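/- **Conventions.** For $z,w\in\mathbb C^n$ write $zw=\sum_k z_kw_k$. Let $J=\begin{pmatrix}0&I_n\\-I_n&0\end{pmatrix}$, $U=\begin{pmatrix}I_n&iI_n\\I_n&-iI_n\end{pmatrix}$, and let $z^{-1/2}$ be the principal value. On the Fock space of $\mathbb C^n$, $\langle f,g\rangle=(2\pi)^{-n}\int f\bar g\,e^{-|z|^2/2}dm(z)$, $e_w(z)=e^{\bar wz/2}$, an operator $A$ has kernel $k_A(z,w)=\langle Ae_w,e_z\rangle$, and $$W_0(A)(z)=2^n(2\pi)^{-n}\int_{\mathbb C^n}k_A(z+w,z-w)\,e^{\frac12(-z\bar z-w\bar w+z\bar w-\bar zw)}\,dm(w).$$ Let $(\mathcal B\varphi)(z)=\pi^{-n/4}\int_{\mathbb R^n}e^{-z^2/4+zx-x^2/2}\varphi(x)\,dx$ be the Bargmann transform. The Weyl symbol of an operator $A$ on $L^2(\mathbb R^n)$ is $W_1(A)(x,y)=W_0(\mathcal BA\mathcal B^{-1})(x+iy)$. For $g\in Sp(n,\mathbb R)$ put $UgU^{-1}=\begin{pmatrix}P(g)&Q(g)\\ \overline{Q(g)}&\overline{P(g)}\end{pmatrix}$;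 the metaplectic operator is $\sigma'(g)=\mathcal B^{-1}\sigma\mathcal B$, where $\sigma$ is the operator with kernel $(\det P)^{-1/2}\exp\frac14\big(z(\bar QP^{-1}z)+2(P^{-1}z)\bar w-\bar w(P^{-1}Q\bar w)\big)$, $P=P(g)$, $Q=Q(g)$. For a symmetric matrix $M$ of size $2n$ let $q_M(x,y)=(x,y)M(x,y)^t$, and let $\mathcal W(q_M)$ be the operator on the Schwartz space given by the classical Weyl quantization in which a symbol $u(p)q^\alpha$ acts by $\varphi\mapsto(i\partial_s)^\alpha\big(u(p+\tfrac s2)\varphi(p+s)\big)|_{s=0}$. Write $\exp(t\,\mathcal W(q_M))$, $t\ge0$, for the strongly continuous semigroup on $L^2(\mathbb R^n)$ whose generator extends $\mathcal W(q_M)$. The Moyal product of polynomials on $\mathbb R^{2n}$ (coordinates $(p,q)$) is $u*v=\sum_{l\ge0}\frac{(-i/2)^l}{l!}P^l(u,v)$, where $P^l$ is the $l$-th power of the Poisson bidifferential operator $P^1(u,v)=\sum_k(\partial_{p_k}u\,\partial_{q_k}v-\partial_{q_k}u\,\partial_{p_k}v)$; $f^{*l}$ are its powers and $\exp_*(f)=\sum_l\frac1{l!}f^{*l}$.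 Below, each function $\det\cosh(sY)$, $\det\cos(sY)$ has an entire square root in $s$ with value $1$ at $s=0$; this is part of the claim. **Theorem.** Let $n\ge0$. 1. Let $X\in sp(n,\mathbb R)$. There are an entire $D$ with $D(0)=1$, $D(s)^2=\det\cosh(\tfrac12sX)$, and a continuous $\delta:\mathbb R\to\mathbb C$ with $\delta(0)=1$, $\delta(t)^2\det P(\exp tX)=1$. If $\det\cosh(\tfrac12X)\ne0$, then there is a sign $\varepsilon\in\{1,-1\}$ such that for all $x,y\in\mathbb R^n$ $$W_1(\sigma'(\exp X))(x,y)=\varepsilon\,\big(\det\cosh(\tfrac12X)\big)^{-1/2}\exp\big(-i(x,y)J\tanh(\tfrac12X)(x,y)^t\big),$$ and $\varepsilon\,(\det\cosh(\frac12X))^{-1/2}=\dfrac{(\det P(\exp X))^{-1/2}}{\delta(1)}\,\dfrac1{D(1)}$. One has $\varepsilon=1$ if $n\le1$, and also if for all $t\in[0,1]$ both $\det\cosh(\frac12tX)\neq0$ and $\det P(\exp tX)\notin(-\infty,0]$. 2. Let $M$ be a complex symmetric $2n\times2n$ matrix with $\operatorname{Re}q_M\le0$ on $\mathbb R^{2n}$.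 Then $\exp(t\mathcal W(q_M))$, $t\ge0$, exists, and there is an entire $D$ with $D(0)=1$, $D(s)^2=\det\cos(sJM)$ such that for all $t\ge0$ with $\det\cos(tJM)\ne0$ $$W_1\big(\exp(t\,\mathcal W(q_M))\big)(x,y)=D(t)^{-1}\exp\big(-(x,y)J\tan(tJM)(x,y)^t\big).$$ In particular, if $M$ is real with $q_M\le0$, then $\det\cos(JM)\ne0$ and $$W_1\big(\exp\mathcal W(q_M)\big)(x,y)=\big(\det\cos(JM)\big)^{-1/2}\exp\big(-(x,y)J\tan(JM)(x,y)^t\big).$$ 3. Let $M$ be a real symmetric $2n\times2n$ matrix, and $\Omega=\{s\in\mathbb C:\det\cosh(sJM)\ne0\}$, which is connected. There is an entire $D$ with $D(0)=1$, $D(s)^2=\det\cosh(sJM)$ such that for all $x,y\in\mathbb R^n$ the function $$F(s)=D(s)^{-1}\exp\big(i(x,y)J\tanh(sJM)(x,y)^t\big)$$ is holomorphic on $\Omega$ and $F^{(l)}(0)=(-iq_M)^{*l}(x,y)$ for every $l\ge0$; that is, $F$ is the analytic continuation of $s\mapsto\exp_*(-isq_M)(x,y)$. If $\det\cosh(sJM)\ne0$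 for all complex $|s|\le1$, then the series $\exp_*(-iq_M)(x,y)$ converges and $$\exp_*(-iq_M)(x,y)=\big(\det\cosh(JM)\big)^{-1/2}\exp\big(i(x,y)J\tanh(JM)(x,y)^t\big).$$ -/

import Mathlib

open MeasureTheory Matrix Complex

open scoped SchwartzMap

noncomputable section

namespace Metaplectic

/-- Points of `ℝⁿ × ℝⁿ` are indexed by `Fin n ⊕ Fin n`: `Sum.inl` for the first (position)
block, `Sum.inr` for the second (momentum) block. -/
abbrev Idx (n : ℕ) : Type := Fin n ⊕ Fin n

/-- `J = (0 I; -I 0)`. -/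
def stdJ (n : ℕ) : Matrix (Idx n) (Idx n) ℂ := Matrix.fromBlocks 0 1 (-1) 0

/-- A real matrix, regarded as a complex one. -/
def cplx {n : ℕ} (A : Matrix (Idx n) (Idx n) ℝ) : Matrix (Idx n) (Idx n) ℂ :=
  A.map (fun r : ℝ => (r : ℂ))

/-- The vector `(x, y)`, with complex entries. -/
def phaseVec {n : ℕ} (x y : Fin n → ℝ) : Idx n → ℂ := fun i => ((Sum.elim x y i : ℝ) : ℂ)

/-- The value `(x, y) A (x, y)ᵗ`. -/
def qform {n : ℕ} (A : Matrix (Idx n) (Idx n) ℂ) (x y : Fin n → ℝ) : ℂ :=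
  phaseVec x y ⬝ᵥ (A *ᵥ phaseVec x y)

/-! ### Hyperbolic and trigonometric functions of matrices -/

section MatrixFunctions

variable {m : Type*} [Fintype m] [DecidableEq m]

def matCosh (A : Matrix m m ℂ) : Matrix m m ℂ :=
  (2⁻¹ : ℂ) • (NormedSpace.exp A + NormedSpace.exp (-A))

def matSinh (A : Matrix m m ℂ) : Matrix m m ℂ :=
  (2⁻¹ : ℂ) • (NormedSpace.exp A - NormedSpace.exp (-A))

/-- Meaningful when `matCosh A` is invertible. -/
def matTanh (A : Matrix m m ℂ) : Matrix m m ℂ := matSinh A * (matCosh A)⁻¹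

def matCos (A : Matrix m m ℂ) : Matrix m m ℂ :=
  (2⁻¹ : ℂ) • (NormedSpace.exp (I • A) + NormedSpace.exp (-(I • A)))

def matSin (A : Matrix m m ℂ) : Matrix m m ℂ :=
  (2 * I)⁻¹ • (NormedSpace.exp (I • A) - NormedSpace.exp (-(I • A)))

/-- Meaningful when `matCos A` is invertible. -/
def matTan (A : Matrix m m ℂ) : Matrix m m ℂ := matSin A * (matCos A)⁻¹

/-- `D` is the entire square root of the function `s ↦ det (F s)` normalised by `D 0 = 1`. -/
def IsDetRoot (F : ℂ → Matrix m m ℂ) (D : ℂ → ℂ) : Prop :=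
  Differentiable ℂ D ∧ D 0 = 1 ∧ ∀ s, D s ^ 2 = (F s).det

end MatrixFunctions

/-- The principal value of `z ^ (-1/2)`. -/
def powNegHalf (z : ℂ) : ℂ := z ^ (-(1 / 2) : ℂ)

/-! ### The Fock space of `ℂⁿ` (with parameter `1`) -/

/-- `⟨f, g⟩ = ∫ f(z) conj(g(z)) exp(-|z|²/2) (2π)⁻ⁿ dm(z)`. -/
def fockInner {n : ℕ} (f g : (Fin n → ℂ) → ℂ) : ℂ :=
  ∫ z : Fin n → ℂ, f z * star (g z) * exp (-(z ⬝ᵥ star z) / 2) * ((2 * Real.pi : ℂ) ^ n)⁻¹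

/-- The coherent state `e_w(z) = exp(w̄ z / 2)`. -/
def coherent {n : ℕ} (w : Fin n → ℂ) : (Fin n → ℂ) → ℂ := fun z => exp ((star w ⬝ᵥ z) / 2)

/-- The kernel `k_A(z, w) = ⟨A e_w, e_z⟩` of an operator `A` on the Fock space. -/
def fockKernel {n : ℕ} (A : ((Fin n → ℂ) → ℂ) → ((Fin n → ℂ) → ℂ)) (z w : Fin n → ℂ) : ℂ :=
  fockInner (A (coherent w)) (coherent z)

/-- The complex Weyl symbol of an operator on the Fock space,
`W₀(A)(z) = 2ⁿ ∫ k_A(z + w, z - w) exp((-z z̄ - w w̄ + z w̄ - z̄ w)/2) (2π)⁻ⁿ dm(w)`. -/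
def W0 {n : ℕ} (A : ((Fin n → ℂ) → ℂ) → ((Fin n → ℂ) → ℂ)) (z : Fin n → ℂ) : ℂ :=
  2 ^ n * ∫ w : Fin n → ℂ, fockKernel A (z + w) (z - w) *
    exp ((-(z ⬝ᵥ star z) - w ⬝ᵥ star w + z ⬝ᵥ star w - star z ⬝ᵥ w) / 2) *
    ((2 * Real.pi : ℂ) ^ n)⁻¹

/-! ### The Bargmann transform and the Weyl symbol on `L²(ℝⁿ)` -/

/-- `L²(ℝⁿ)`. -/
abbrev L2 (n : ℕ) : Type := Lp ℂ 2 (volume : Measure (EuclideanSpace ℝ (Fin n)))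

/-- The Bargmann transform
`(B φ)(z) = π^(-n/4) ∫ exp(-z²/4 + z x - x²/2) φ(x) dx`. -/
def bargmann {n : ℕ} (φ : L2 n) : (Fin n → ℂ) → ℂ := fun z =>
  ((Real.pi ^ (-(n : ℝ) / 4) : ℝ) : ℂ) * ∫ x : EuclideanSpace ℝ (Fin n),
    exp (-(z ⬝ᵥ z) / 4 + (∑ i, z i * (x i : ℂ)) - (∑ i, (x i : ℂ) ^ 2) / 2) * φ x

open Classical in
/-- The inverse Bargmann transform, from its range (the Fock space) to `L²(ℝⁿ)`. -/
def bargmannInv {n : ℕ} (f : (Fin n → ℂ) → ℂ) : L2 n :=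
  if h : ∃ φ : L2 n, bargmann φ = f then h.choose else 0

/-- The Weyl symbol `W₁(A)(x, y) = W₀(B A B⁻¹)(x + i y)` of an operator on `L²(ℝⁿ)`. -/
def W1 {n : ℕ} (A : L2 n → L2 n) (x y : Fin n → ℝ) : ℂ :=
  W0 (fun f => bargmann (A (bargmannInv f))) (fun i => (x i : ℂ) + I * (y i : ℂ))

/-! ### The metaplectic representation -/

/-- `U = (I iI; I -iI)`. -/
def cayleyU (n : ℕ) : Matrix (Idx n) (Idx n) ℂ := Matrix.fromBlocks 1 (I • 1) 1 (-(I • 1))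

/-- `k = U g U⁻¹ = (P Q; Q̄ P̄)`, the image of `g ∈ Sp(n, ℝ)` in `Sp(n, ℂ) ∩ SU(n, n)`. -/
def toS {n : ℕ} (g : Matrix (Idx n) (Idx n) ℝ) : Matrix (Idx n) (Idx n) ℂ :=
  cayleyU n * cplx g * (cayleyU n)⁻¹

/-- For `k = (P Q; Q̄ P̄)`, the kernel
`b_k(z, w) = (det P)^(-1/2) exp((z(Q̄ P⁻¹ z) + 2 (P⁻¹ z) w̄ - w̄(P⁻¹ Q w̄))/4)`. -/
def metaKernel {n : ℕ} (k : Matrix (Idx n) (Idx n) ℂ) (z w : Fin n → ℂ) : ℂ :=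
  let P := k.toBlocks₁₁
  let Q := k.toBlocks₁₂
  powNegHalf P.det *
    exp ((z ⬝ᵥ ((Q.map star * P⁻¹) *ᵥ z) + 2 * ((P⁻¹ *ᵥ z) ⬝ᵥ star w)
      - star w ⬝ᵥ ((P⁻¹ * Q) *ᵥ star w)) / 4)

/-- The metaplectic operator `σ(k)` on the Fock space: the operator with kernel `b_k`. -/
def metaFock {n : ℕ} (k : Matrix (Idx n) (Idx n) ℂ) (f : (Fin n → ℂ) → ℂ) : (Fin n → ℂ) → ℂ :=
  fun z => ∫ w : Fin n → ℂ, metaKernel k z w * f w * exp (-(w ⬝ᵥ star w) / 2) *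
    ((2 * Real.pi : ℂ) ^ n)⁻¹

/-- The metaplectic operator `σ'(g) = B⁻¹ σ(U g U⁻¹) B` on `L²(ℝⁿ)`. -/
def metaplectic {n : ℕ} (g : Matrix (Idx n) (Idx n) ℝ) (φ : L2 n) : L2 n :=
  bargmannInv (metaFock (toS g) (bargmann φ))

/-! ### Weyl quantization of quadratic forms and exponentials -/

/-- The derivative in the `k`-th coordinate direction. -/
def partialD {n : ℕ} (k : Fin n) (f : EuclideanSpace ℝ (Fin n) → ℂ) :
    EuclideanSpace ℝ (Fin n) → ℂ :=
  fun s => lineDeriv ℝ f s (EuclideanSpace.single k 1)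

/-- The classical Weyl quantization of the quadratic form `q_M(p, q) = (p, q) M (p, q)ᵗ`,
by the rule that the symbol `u(p) q^α` gives
`φ ↦ (i ∂/∂s)^α (u(p + s/2) φ(p + s))` at `s = 0`. -/
def weylQuad {n : ℕ} (M : Matrix (Idx n) (Idx n) ℂ) (φ : EuclideanSpace ℝ (Fin n) → ℂ)
    (p : EuclideanSpace ℝ (Fin n)) : ℂ :=
  ∑ j, ∑ k,
    (M (Sum.inl j) (Sum.inl k) * ((p j : ℂ) * (p k : ℂ)) * φ p
    + (M (Sum.inl j) (Sum.inr k) + M (Sum.inr k) (Sum.inl j)) *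
        (I * partialD k (fun s => ((p j : ℂ) + (s j : ℂ) / 2) * φ (p + s)) 0)
    + M (Sum.inr j) (Sum.inr k) *
        (I ^ 2 * partialD j (partialD k (fun s => φ (p + s))) 0))

/-- `T t = exp(t 𝒲(q_M))`, `t ≥ 0`: `T` is a strongly continuous one-parameter semigroup of
bounded operators on `L²(ℝⁿ)` whose generator extends the operator with Weyl symbol `q_M` on the
Schwartz space. -/
structure IsExpWeyl {n : ℕ} (M : Matrix (Idx n) (Idx n) ℂ) (T : ℝ → (L2 n →L[ℂ] L2 n)) :
    Prop where
  map_zero : T 0 = ContinuousLinearMap.id ℂ (L2 n)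
  map_add : ∀ s t : ℝ, 0 ≤ s → 0 ≤ t → T (s + t) = (T s).comp (T t)
  cont : ∀ f : L2 n, ContinuousOn (fun t => T t f) (Set.Ici 0)
  deriv_zero : ∀ φ : 𝓢(EuclideanSpace ℝ (Fin n), ℂ), ∃ ψ : L2 n,
    (∀ᵐ p, ψ p = weylQuad M φ p) ∧
      HasDerivWithinAt (fun t => T t (φ.toLp 2)) ψ (Set.Ici 0) 0

/-! ### The Moyal product of polynomials and star powers -/

/-- `q_M` as a polynomial in the coordinates `(p, q)` of `ℝ²ⁿ`. -/
def quadPoly {n : ℕ} (M : Matrix (Idx n) (Idx n) ℂ) : MvPolynomial (Idx n) ℂ :=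
  ∑ i, ∑ j, MvPolynomial.C (M i j) * (MvPolynomial.X i * MvPolynomial.X j)

/-- The iterated partial derivative `∂^l u / ∂x_{a 0} ⋯ ∂x_{a (l-1)}`. -/
def iterPartial {n l : ℕ} (a : Fin l → Idx n) (u : MvPolynomial (Idx n) ℂ) :
    MvPolynomial (Idx n) ℂ :=
  (List.ofFn a).foldr (fun i f => MvPolynomial.pderiv i f) u

/-- `P^l(u, v) = ∑ Λ^{a₁b₁} ⋯ Λ^{a_l b_l} ∂^l_{a₁…a_l} u ∂^l_{b₁…b_l} v`, where
`P^1(u, v) = ∑ₖ (∂u/∂p_k ∂v/∂q_k - ∂u/∂q_k ∂v/∂p_k)`, that is, `Λ = J`. -/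
def moyalP {n : ℕ} (l : ℕ) (u v : MvPolynomial (Idx n) ℂ) : MvPolynomial (Idx n) ℂ :=
  ∑ a : Fin l → Idx n, ∑ b : Fin l → Idx n,
    MvPolynomial.C (∏ r, stdJ n (a r) (b r)) * (iterPartial a u * iterPartial b v)

/-- The Moyal product `u ∗ v = ∑_l (t^l / l!) P^l(u, v)` at `t = -i/2`; the terms with `l` above
the degree of `u` vanish. -/
def moyal {n : ℕ} (u v : MvPolynomial (Idx n) ℂ) : MvPolynomial (Idx n) ℂ :=
  ∑ l ∈ Finset.range (u.totalDegree + 1),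
    MvPolynomial.C ((-I / 2) ^ l / (Nat.factorial l : ℂ)) * moyalP l u v

/-- The star powers `f^{∗l}`. -/
def starPow {n : ℕ} (f : MvPolynomial (Idx n) ℂ) : ℕ → MvPolynomial (Idx n) ℂ
  | 0 => 1
  | l + 1 => moyal f (starPow f l)

end Metaplectic

end

open Metaplectic

noncomputable section

namespace Metaplectic

set_option linter.unusedSectionVars false

/-! Every operator in the theorem sends a coherent state `e_w` to a Gaussian. Its kernel is `c * exp
(expK P Q R z w)` for a complex symplectic matrix k = (P Q; R S), and the statement is a calculation
with such kernels followed by a determination of signs.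

For Re q_M ≤ 0 the complexified Hamiltonian flow exp(-2itJM), conjugated by U, expands the form |a|²
- |b|² (`isExpSp_kflow`). Expansion makes P and P + R invertible, makes RP⁻¹ and P⁻¹Q symmetric
contractions, and makes all Gaussian integrals converge. A coherent state evolves under 𝒲(q_M) as an
explicit Gaussian whose matrix solves a Riccati equation (`hasDerivWithinAt_gpath`). Its Bargmann
transform is the kernel attached to the flow, with amplitude satisfying c² det P = 1
(`bargmann_gpath`, `pathC_sq`). The Weyl integral of this kernel is Gaussian (`weyl_integral`). Its
exponent is ½ ẑJ(k-1)(k+1)⁻¹ẑ with ẑ = (z, z̄), a Cayley transform that becomes -(x,y) J tan(tJM)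
(x,y)ᵗ (`weyl_phase`). Its coefficient has square 4ⁿ/det(k+1) = 1/det cos(tJM) (`weylCoef_sq`).

The sign of the coefficient remains. The spectrum of a Hamiltonian matrix is invariant under z ↦ -z,
so det cos(sJM) has an entire square root D (`exists_isDetRoot`). If Re q_M < 0 away from 0, then
det cos(tJM) has no zero for t ≥ 0, and continuity from t = 0 yields D(t)⁻¹. A general M is the
limit of the strictly dissipative M - |e|·1 (`weylCoef_flow`, `tendsto_detRoot`).

The semigroup is constructed on the span of the coherent states, which is dense because the Bargmann
transform is injective. It is contractive because Re⟨φ, 𝒲(q_M)φ⟩ ≤ 0, and duality with the flow of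
the conjugate of M gives its generator on all Schwartz functions (`isExpWeyl_weylExp`). Conversely,
the evolution equation determines any such semigroup on coherent states (`semigroup_apply_eq`).

The metaplectic case is M = -(i/2)JX at t = 1, where Re q_M = 0. The operator σ'(exp X) has the same
kernel up to the choice of (det P)^(-1/2), which is compared with the continuous choice δ. For n = 1
the sign is 1 because Gaussian integrals in two real variables have positive real part.

For the star exponential, left Moyal multiplication by -i q_M is a differential operator of order
two with coefficients independent of s. The function F solves ∂F/∂s = (-i q_M) ∗ F with F(0) = 1
(`fderiv_starExp_time`), so its derivatives at 0 are the star powers, and its Taylor series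
converges on every disc free of zeros of det cosh(sJM). -/

/-! ### Gaussian integrals with complex symmetric matrices -/

section Gaussian

variable {ι : Type*} [Fintype ι] [DecidableEq ι]

/-- A real vector, regarded as a complex one. -/
def cvec (x : ι → ℝ) : ι → ℂ := fun i => (x i : ℂ)

/-- A real matrix, regarded as a complex one. -/
def cmat (A : Matrix ι ι ℝ) : Matrix ι ι ℂ := A.map (fun r : ℝ => (r : ℂ))

/-- Complex symmetric matrices with positive definite real part. -/
structure GPos (H : Matrix ι ι ℂ) : Prop where
  symm : H.IsSymm
  pos : ∀ x : ι → ℝ, x ≠ 0 → 0 < (cvec x ⬝ᵥ (H *ᵥ cvec x)).re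

/-- The Gaussian integral of `exp (-(x H x) / 2)`. -/
def gint (H : Matrix ι ι ℂ) : ℂ := ∫ x : ι → ℝ, Complex.exp (-(cvec x ⬝ᵥ (H *ᵥ cvec x)) / 2)

lemma cvec_mulVec (A : Matrix ι ι ℝ) (x : ι → ℝ) : cmat A *ᵥ cvec x = cvec (A *ᵥ x) := by
  ext i; simp [cvec, cmat, mulVec, dotProduct]

lemma cvec_dot (x y : ι → ℝ) : cvec x ⬝ᵥ cvec y = ((x ⬝ᵥ y : ℝ) : ℂ) := by
  simp [cvec, dotProduct]

lemma re_quad (H : Matrix ι ι ℂ) (x : ι → ℝ) :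
    (cvec x ⬝ᵥ (H *ᵥ cvec x)).re = x ⬝ᵥ (H.map Complex.re *ᵥ x) := by
  simp [cvec, mulVec, dotProduct]

lemma cmat_mul (A B : Matrix ι ι ℝ) : cmat (A * B) = cmat A * cmat B := by
  simp only [cmat]
  exact Matrix.map_mul (f := Complex.ofRealHom)

lemma cmat_transpose (A : Matrix ι ι ℝ) : (cmat A)ᵀ = cmat Aᵀ := rfl

lemma cmat_det (A : Matrix ι ι ℝ) : (cmat A).det = (A.det : ℂ) := by
  exact (RingHom.map_det Complex.ofRealHom A).symm

lemma exists_orthogonal_diagonalization {A : Matrix ι ι ℝ} (hA : A.IsHermitian) :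
    ∃ O : Matrix ι ι ℝ, Oᵀ * O = 1 ∧ A = O * diagonal hA.eigenvalues * Oᵀ := by
  refine ⟨hA.eigenvectorUnitary, ?_, ?_⟩
  · have := Unitary.coe_star_mul_self hA.eigenvectorUnitary
    rwa [star_eq_conjTranspose, conjTranspose_eq_transpose_of_trivial] at this
  · have := hA.spectral_theorem
    rw [Unitary.conjStarAlgAut_apply] at this
    rwa [star_eq_conjTranspose, conjTranspose_eq_transpose_of_trivial] at this

/-- Two real quadratic forms, one of them positive definite, are simultaneously diagonalisable: a
real congruence turns Re H into the identity, and an orthogonal one then diagonalises Im H. The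
entries found are `d i = 1 + iλ` with λ real. -/
lemma GPos.exists_diagonalization {H : Matrix ι ι ℂ} (hH : GPos H) :
    ∃ (B : Matrix ι ι ℝ) (d : ι → ℂ), B.det ≠ 0 ∧ (∀ i, 0 < (d i).re) ∧
      H = (cmat B)ᵀ * diagonal d * cmat B := by
  have hr : (H.map Complex.re).IsHermitian := by
    ext i j; simpa using congrArg Complex.re (congrFun (congrFun hH.symm i) j)
  have hp : (H.map Complex.re).PosDef :=
    Matrix.PosDef.of_dotProduct_mulVec_pos hr fun x hx => by
      simpa [re_quad] using hH.pos x hx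
  obtain ⟨O, hO, hA⟩ := exists_orthogonal_diagonalization hr
  have hev : ∀ i, 0 < hr.eigenvalues i := hp.eigenvalues_pos
  set s : ι → ℝ := fun i => Real.sqrt (hr.eigenvalues i)
  have hss : ∀ i, s i * s i = hr.eigenvalues i := fun i => Real.mul_self_sqrt (hev i).le
  have hs0 : ∀ i, s i ≠ 0 := fun i => (Real.sqrt_pos.2 (hev i)).ne'
  -- `C` is a square root of Re H in the sense CᵀC = Re H, and `C'` is its inverse.
  set C : Matrix ι ι ℝ := diagonal s * Oᵀ
  set C' : Matrix ι ι ℝ := O * diagonal (fun i => (s i)⁻¹)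
  have hCC' : C * C' = 1 := by
    simp only [C, C']
    rw [Matrix.mul_assoc, ← Matrix.mul_assoc Oᵀ, hO, Matrix.one_mul, diagonal_mul_diagonal]
    simp [hs0]
  have hC'C : C' * C = 1 := mul_eq_one_comm.1 hCC'
  have hCC : Cᵀ * C = H.map Complex.re := by
    rw [hA]
    simp only [C, transpose_mul, transpose_transpose, diagonal_transpose]
    rw [Matrix.mul_assoc, ← Matrix.mul_assoc (diagonal s), diagonal_mul_diagonal,
      ← Matrix.mul_assoc]
    simp [hss]
  have hK : (C'ᵀ * H.map Complex.im * C').IsHermitian := by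
    have : (H.map Complex.im)ᵀ = H.map Complex.im := by
      ext i j; simpa using congrArg Complex.im (congrFun (congrFun hH.symm i) j)
    rw [IsHermitian, conjTranspose_eq_transpose_of_trivial, transpose_mul, transpose_mul C'ᵀ, this,
      transpose_transpose, Matrix.mul_assoc]
  obtain ⟨O', hO', hK'⟩ := exists_orthogonal_diagonalization hK
  have hO'' : O' * O'ᵀ = 1 := mul_eq_one_comm.1 hO'
  refine ⟨O'ᵀ * C, fun i => 1 + I * hK.eigenvalues i, ?_, ?_, ?_⟩
  · rw [det_mul]
    refine mul_ne_zero (fun h => ?_) (fun h => ?_)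
    · have := congrArg det hO'; rw [det_mul, h] at this; simp at this
    · have := congrArg det hCC'; rw [det_mul, h] at this; simp at this
  · intro i; simp
  · have h1 : (O'ᵀ * C)ᵀ * (O'ᵀ * C) = H.map Complex.re := by
      rw [transpose_mul, transpose_transpose, Matrix.mul_assoc, ← Matrix.mul_assoc O', hO'',
        Matrix.one_mul, hCC]
    have h2 : (O'ᵀ * C)ᵀ * diagonal hK.eigenvalues * (O'ᵀ * C) = H.map Complex.im := by
      calc _ = Cᵀ * (O' * diagonal hK.eigenvalues * O'ᵀ) * C := by
            simp only [transpose_mul, transpose_transpose, Matrix.mul_assoc]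
        _ = (C' * C)ᵀ * H.map Complex.im * (C' * C) := by
            rw [← hK', transpose_mul C' C]; simp only [Matrix.mul_assoc]
        _ = _ := by rw [hC'C]; simp
    have hd : diagonal (fun i => 1 + I * (hK.eigenvalues i : ℂ)) =
        1 + I • cmat (diagonal hK.eigenvalues) := by
      ext i j
      by_cases h : i = j
      · subst h; simp [cmat]
      · simp [cmat, h]
    rw [hd, Matrix.mul_add, Matrix.add_mul, Matrix.mul_one, Matrix.mul_smul, Matrix.smul_mul,
      cmat_transpose, ← cmat_mul, ← cmat_mul, ← cmat_mul, h1, h2]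
    ext i j
    simp [cmat, mul_comm I, Complex.re_add_im]

/-- Linear change of variables. -/
lemma integral_comp_mulVec {B : Matrix ι ι ℝ} (hB : B.det ≠ 0) (f : (ι → ℝ) → ℂ) :
    ∫ x, f (B *ᵥ x) = ((|B.det|⁻¹ : ℝ) : ℂ) * ∫ x, f x := by
  have h := Real.map_matrix_volume_pi_eq_smul_volume_pi hB
  let e : (ι → ℝ) ≃L[ℝ] (ι → ℝ) :=
    (LinearEquiv.ofIsUnitDet (f := toLin' B) (v := Pi.basisFun ℝ ι) (v' := Pi.basisFun ℝ ι)
      (by simpa [LinearMap.toMatrix_eq_toMatrix'] using hB)).toContinuousLinearEquiv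
  have he : ∀ x, e x = B *ᵥ x := fun x => by simp [e]
  have h2 := e.toHomeomorph.measurableEmbedding.integral_map (μ := volume) f
  have h3 : (e.toHomeomorph : (ι → ℝ) → (ι → ℝ)) = toLin' B := by
    ext x i; simp [he]
  rw [h3, h] at h2
  simp only [toLin'_apply] at h2
  rw [← h2, integral_smul_measure, ENNReal.toReal_ofReal (abs_nonneg _), abs_inv]
  simp

lemma integrable_comp_mulVec {B : Matrix ι ι ℝ} (hB : B.det ≠ 0) {f : (ι → ℝ) → ℂ}
    (hf : Integrable f) : Integrable (fun x => f (B *ᵥ x)) := by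
  have h := Real.map_matrix_volume_pi_eq_smul_volume_pi hB
  have h2 : Integrable f (Measure.map (toLin' B) volume) := by
    rw [h]; exact hf.smul_measure (by simp)
  exact h2.comp_measurable (by
    apply Continuous.measurable; exact LinearMap.continuous_on_pi _)

/-- Writing the linear term as `l = H w` lets the substitution y = Bx split the exponent into
one-variable Gaussians. -/
lemma GPos.gaussian_aux {H : Matrix ι ι ℂ} {B : Matrix ι ι ℝ} {d : ι → ℂ}
    (h : H = (cmat B)ᵀ * diagonal d * cmat B) (l w : ι → ℂ) (hw : H *ᵥ w = l) (x : ι → ℝ) :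
    -(cvec x ⬝ᵥ (H *ᵥ cvec x)) / 2 + l ⬝ᵥ cvec x =
      -∑ i, d i / 2 * ((B *ᵥ x) i : ℂ) ^ 2 +
        ∑ i, (d i * (cmat B *ᵥ w) i) * ((B *ᵥ x) i : ℂ) := by
  have h0 : ∀ u v : ι → ℂ, u ⬝ᵥ (H *ᵥ v) = ∑ i, d i * (cmat B *ᵥ u) i * (cmat B *ᵥ v) i := by
    intro u v
    rw [h, ← mulVec_mulVec, ← mulVec_mulVec, mulVec_transpose, dotProduct_comm u,
      ← dotProduct_mulVec, dotProduct]
    exact Finset.sum_congr rfl fun i _ => by rw [mulVec_diagonal]; ring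
  have hl : l ⬝ᵥ cvec x = cvec x ⬝ᵥ (H *ᵥ w) := by rw [hw, dotProduct_comm]
  rw [hl, h0, h0, cvec_mulVec, neg_div, Finset.sum_div]
  congr 1
  · congr 1; exact Finset.sum_congr rfl fun i _ => by simp only [cvec]; ring
  · exact Finset.sum_congr rfl fun i _ => by simp only [cvec]; ring

lemma GPos.det_ne_zero {H : Matrix ι ι ℂ} (hH : GPos H) : H.det ≠ 0 := by
  obtain ⟨B, d, hB, hd, h⟩ := hH.exists_diagonalization
  rw [h, det_mul, det_mul, det_transpose, cmat_det, det_diagonal]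
  have : ∏ i, d i ≠ 0 := Finset.prod_ne_zero_iff.2 fun i _ h0 => by
    have := hd i; simp [h0] at this
  have hB' : (B.det : ℂ) ≠ 0 := by exact_mod_cast hB
  positivity

lemma GPos.exists_mulVec_eq {H : Matrix ι ι ℂ} (hH : GPos H) (l : ι → ℂ) : ∃ w, H *ᵥ w = l := by
  refine ⟨H⁻¹ *ᵥ l, ?_⟩
  rw [mulVec_mulVec, Matrix.mul_nonsing_inv _ (isUnit_iff_ne_zero.2 hH.det_ne_zero), one_mulVec]

lemma GPos.integrable {H : Matrix ι ι ℂ} (hH : GPos H) (l : ι → ℂ) :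
    Integrable (fun x : ι → ℝ => Complex.exp (-(cvec x ⬝ᵥ (H *ᵥ cvec x)) / 2 + l ⬝ᵥ cvec x)) := by
  obtain ⟨w, hw⟩ := hH.exists_mulVec_eq l
  obtain ⟨B, d, hB, hd, h⟩ := hH.exists_diagonalization
  simp_rw [GPos.gaussian_aux h l w hw]
  exact integrable_comp_mulVec hB (f := fun y => Complex.exp (-∑ i, d i / 2 * (y i : ℂ) ^ 2 +
        ∑ i, (d i * (cmat B *ᵥ w) i) * (y i : ℂ)))
    (GaussianFourier.integrable_cexp_neg_sum_mul_add (fun i => by simpa using hd i) _)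

/-- The factor `exp (l·w/2)` is the completed square for a complex shift w. It comes from the
one-variable formulas after diagonalisation, so no contour is moved. The amplitude is the case l =
0, and no branch of (det H)^(-1/2) has to be chosen. -/
lemma GPos.integral_eq {H : Matrix ι ι ℂ} (hH : GPos H) {l w : ι → ℂ} (hw : H *ᵥ w = l) :
    ∫ x : ι → ℝ, Complex.exp (-(cvec x ⬝ᵥ (H *ᵥ cvec x)) / 2 + l ⬝ᵥ cvec x) =
      gint H * Complex.exp (l ⬝ᵥ w / 2) := by
  obtain ⟨B, d, hB, hd, h⟩ := hH.exists_diagonalization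
  have key : ∀ l w : ι → ℂ, H *ᵥ w = l →
      ∫ x : ι → ℝ, Complex.exp (-(cvec x ⬝ᵥ (H *ᵥ cvec x)) / 2 + l ⬝ᵥ cvec x) =
      ((|B.det|⁻¹ : ℝ) : ℂ) * (∏ i, (Real.pi / (d i / 2)) ^ (1 / 2 : ℂ)) *
        Complex.exp (l ⬝ᵥ w / 2) := by
    intro l w hw
    simp_rw [GPos.gaussian_aux h l w hw]
    rw [integral_comp_mulVec hB (f := fun y => Complex.exp (-∑ i, d i / 2 * (y i : ℂ) ^ 2 +
        ∑ i, (d i * (cmat B *ᵥ w) i) * (y i : ℂ))),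
      GaussianFourier.integral_cexp_neg_sum_mul_add (fun i => by simpa using hd i),
      Finset.prod_mul_distrib, ← Complex.exp_sum, mul_assoc]
    congr 3
    have h0 : l ⬝ᵥ w = ∑ i, d i * (cmat B *ᵥ w) i * (cmat B *ᵥ w) i := by
      rw [← hw, h, ← mulVec_mulVec, ← mulVec_mulVec, mulVec_transpose, ← dotProduct_mulVec,
        dotProduct]
      exact Finset.sum_congr rfl fun i _ => by rw [mulVec_diagonal]
    rw [h0, Finset.sum_div]
    refine Finset.sum_congr rfl fun i _ => ?_
    have : d i ≠ 0 := fun h0 => by have := hd i; simp [h0] at this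
    field_simp
    ring
  have h0 := key 0 0 (by simp)
  simp only [zero_dotProduct, add_zero, zero_div, Complex.exp_zero, mul_one] at h0
  rw [key l w hw, gint, h0]

lemma gint_eq_prod {H : Matrix ι ι ℂ} {B : Matrix ι ι ℝ} {d : ι → ℂ} (hB : B.det ≠ 0)
    (hd : ∀ i, 0 < (d i).re) (h : H = (cmat B)ᵀ * diagonal d * cmat B) :
    gint H = ((|B.det|⁻¹ : ℝ) : ℂ) * (∏ i, (Real.pi / (d i / 2)) ^ (1 / 2 : ℂ)) := by
  have := GPos.gaussian_aux h 0 0 (by simp)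
  simp only [zero_dotProduct, add_zero, mulVec_zero, Pi.zero_apply, mul_zero, zero_mul,
    Finset.sum_const_zero] at this
  simp_rw [gint, this]
  rw [integral_comp_mulVec hB (f := fun y => Complex.exp (-∑ i, d i / 2 * (y i : ℂ) ^ 2))]
  have h2 := GaussianFourier.integral_cexp_neg_sum_mul_add
    (b := fun i => d i / 2) (fun i => by simpa using hd i) 0
  simp only [Pi.zero_apply, zero_mul, Finset.sum_const_zero, add_zero] at h2
  rw [h2]; simp

/-- Squaring removes every choice of branch. The sign of `gint` is recovered elsewhere by continuity
in H. -/
lemma GPos.gint_sq {H : Matrix ι ι ℂ} (hH : GPos H) :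
    gint H ^ 2 * H.det = (2 * Real.pi) ^ Fintype.card ι := by
  obtain ⟨B, d, hB, hd, h⟩ := hH.exists_diagonalization
  have h1 := gint_eq_prod hB hd h
  have hd0 : ∀ i, d i ≠ 0 := fun i h0 => by have := hd i; simp [h0] at this
  have hB' : (B.det : ℂ) ≠ 0 := by exact_mod_cast hB
  have h3 : (((|B.det|⁻¹ : ℝ) : ℂ)) ^ 2 = ((B.det : ℂ) ^ 2)⁻¹ := by
    rw [← ofReal_pow, inv_pow, sq_abs]; simp
  have h4 : (∏ i, (Real.pi / (d i / 2)) ^ (1 / 2 : ℂ)) ^ 2 * ∏ i, d i =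
      (2 * Real.pi : ℂ) ^ Fintype.card ι := by
    rw [← Finset.prod_pow, ← Finset.prod_mul_distrib, ← Finset.card_univ, ← Finset.prod_const]
    refine Finset.prod_congr rfl fun i _ => ?_
    rw [← cpow_nat_mul]
    have := hd0 i
    simp
    field_simp
  rw [h1, h, det_mul, det_mul, det_transpose, cmat_det, det_diagonal, mul_pow, h3, ← h4]
  field_simp

lemma GPos.exists_bound {H : Matrix ι ι ℂ} (hH : GPos H) :
    ∃ c : ℝ, 0 < c ∧ ∀ x : ι → ℝ, c * ∑ i, x i ^ 2 ≤ (cvec x ⬝ᵥ (H *ᵥ cvec x)).re := by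
  have hr : (H.map Complex.re).IsHermitian := by
    ext i j; simpa using congrArg Complex.re (congrFun (congrFun hH.symm i) j)
  have hp : (H.map Complex.re).PosDef :=
    Matrix.PosDef.of_dotProduct_mulVec_pos hr fun x hx => by
      simpa [re_quad] using hH.pos x hx
  obtain ⟨O, hO, hA⟩ := exists_orthogonal_diagonalization hr
  have hev : ∀ i, 0 < hr.eigenvalues i := hp.eigenvalues_pos
  obtain ⟨c, hc, hcl⟩ : ∃ c : ℝ, 0 < c ∧ ∀ i, c ≤ hr.eigenvalues i := by
    rcases isEmpty_or_nonempty ι with h | h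
    · exact ⟨1, one_pos, fun i => h.elim i⟩
    · obtain ⟨i, hi⟩ := Finite.exists_min hr.eigenvalues
      exact ⟨_, hev i, hi⟩
  refine ⟨c, hc, fun x => ?_⟩
  have h1 : ∑ i, x i ^ 2 = ∑ i, (Oᵀ *ᵥ x) i ^ 2 := by
    have : (Oᵀ *ᵥ x) ⬝ᵥ (Oᵀ *ᵥ x) = x ⬝ᵥ x := by
      rw [mulVec_transpose, ← dotProduct_mulVec, ← mulVec_transpose, mulVec_mulVec,
        mul_eq_one_comm.1 hO, one_mulVec]
    simpa [dotProduct, sq] using this.symm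
  rw [re_quad, hA, ← mulVec_mulVec, ← mulVec_mulVec, dotProduct_mulVec, ← mulVec_transpose, h1,
    dotProduct, Finset.mul_sum]
  refine Finset.sum_le_sum fun i _ => ?_
  rw [mulVec_diagonal]
  nlinarith [hcl i, sq_nonneg ((Oᵀ *ᵥ x) i)]

lemma norm_quad_le (H : Matrix ι ι ℂ) (x : ι → ℝ) :
    ‖cvec x ⬝ᵥ (H *ᵥ cvec x)‖ ≤ (∑ i, ∑ j, ‖H i j‖) * ∑ i, x i ^ 2 := by
  have h1 : ∀ i, |x i| ≤ Real.sqrt (∑ i, x i ^ 2) := fun i => by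
    rw [← Real.sqrt_sq_eq_abs]
    exact Real.sqrt_le_sqrt
      (Finset.single_le_sum (f := fun i => x i ^ 2) (fun i _ => sq_nonneg _) (Finset.mem_univ i))
  have h2 : 0 ≤ ∑ i, x i ^ 2 := Finset.sum_nonneg fun i _ => sq_nonneg _
  calc ‖cvec x ⬝ᵥ (H *ᵥ cvec x)‖ = ‖∑ i, ∑ j, (x i : ℂ) * (H i j * x j)‖ := by
        simp [dotProduct, mulVec, cvec, Finset.mul_sum]
    _ ≤ ∑ i, ∑ j, ‖(x i : ℂ) * (H i j * x j)‖ :=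
        (norm_sum_le _ _).trans (Finset.sum_le_sum fun i _ => norm_sum_le _ _)
    _ ≤ ∑ i, ∑ j, ‖H i j‖ * ∑ i, x i ^ 2 := by
        refine Finset.sum_le_sum fun i _ => Finset.sum_le_sum fun j _ => ?_
        rw [norm_mul, norm_mul, Complex.norm_real, Complex.norm_real, Real.norm_eq_abs,
          Real.norm_eq_abs]
        calc |x i| * (‖H i j‖ * |x j|) = ‖H i j‖ * (|x i| * |x j|) := by ring
          _ ≤ ‖H i j‖ * (Real.sqrt (∑ i, x i ^ 2) * Real.sqrt (∑ i, x i ^ 2)) := by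
              gcongr <;> exact h1 _
          _ = _ := by rw [Real.mul_self_sqrt h2]
    _ = _ := by simp only [← Finset.sum_mul]

/-- Coercivity is an open condition: for matrices near H the real part of the form stays above
c|x|²/2, so the single Gaussian exp(-c|x|²/4) dominates all the integrands. -/
lemma GPos.tendsto_gint {α : Type*} {l : Filter α} [l.IsCountablyGenerated]
    {F : α → Matrix ι ι ℂ} {H : Matrix ι ι ℂ} (hH : GPos H) (hF : Filter.Tendsto F l (nhds H)) :
    Filter.Tendsto (fun a => gint (F a)) l (nhds (gint H)) := by
  obtain ⟨c, hc, hb⟩ := hH.exists_bound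
  have hint : Integrable (fun x : ι → ℝ => Real.exp (-(c / 4) * ∑ i, x i ^ 2)) := by
    have := (GaussianFourier.integrable_cexp_neg_mul_sum_add (ι := ι) (b := (c / 4 : ℝ))
      (by simpa using hc) 0).norm
    refine this.congr (Filter.Eventually.of_forall fun x => ?_)
    simp only [Complex.norm_exp, Pi.zero_apply, zero_mul, Finset.sum_const_zero, add_zero]
    congr 1
    rw [← ofReal_neg, re_ofReal_mul]
    congr 1
    simp [← ofReal_pow]
  refine tendsto_integral_filter_of_dominated_convergence _ ?_ ?_ hint ?_
  · exact Filter.Eventually.of_forall fun a => by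
      refine Continuous.aestronglyMeasurable ?_
      unfold cvec; simp only [dotProduct, mulVec]; fun_prop
  · have hd : Filter.Tendsto (fun a => ∑ i, ∑ j, ‖(F a - H) i j‖) l (nhds 0) := by
      have h0 : Continuous fun K : Matrix ι ι ℂ => ∑ i, ∑ j, ‖(K - H) i j‖ := by
        simp only [Matrix.sub_apply]; fun_prop
      have h1 := (h0.tendsto H).comp hF
      simp only [sub_self, Matrix.zero_apply, norm_zero, Finset.sum_const_zero] at h1
      exact h1
    filter_upwards [hd.eventually (gt_mem_nhds (half_pos hc))] with a ha
    refine Filter.Eventually.of_forall fun x => ?_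
    rw [Complex.norm_exp]
    refine Real.exp_le_exp.2 ?_
    have h1 := norm_quad_le (F a - H) x
    have h2 := (Complex.abs_re_le_norm _).trans h1
    have h3 := hb x
    have h4 : 0 ≤ ∑ i, x i ^ 2 := Finset.sum_nonneg fun i _ => sq_nonneg _
    rw [sub_mulVec, dotProduct_sub, Complex.sub_re, abs_le] at h2
    have h5 := mul_le_mul_of_nonneg_right ha.le h4
    have h6 : (-(cvec x ⬝ᵥ F a *ᵥ cvec x) / 2).re = -(cvec x ⬝ᵥ F a *ᵥ cvec x).re / 2 := by
      simp
    rw [h6]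
    nlinarith [h2.1]
  · refine Filter.Eventually.of_forall fun x => ?_
    have h0 : Continuous fun K : Matrix ι ι ℂ => Complex.exp (-(cvec x ⬝ᵥ (K *ᵥ cvec x)) / 2) := by
      simp only [dotProduct, mulVec]; fun_prop
    exact (h0.tendsto H).comp hF

lemma gpos_smul_one {a : ℝ} (ha : 0 < a) : GPos ((a : ℂ) • (1 : Matrix ι ι ℂ)) := by
  refine ⟨by simp [Matrix.IsSymm], fun x hx => ?_⟩
  rw [smul_mulVec, one_mulVec, dotProduct_smul, cvec_dot, smul_eq_mul, ← ofReal_mul, ofReal_re]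
  have h0 : 0 ≤ x ⬝ᵥ x := Finset.sum_nonneg fun i _ => mul_self_nonneg _
  have : x ⬝ᵥ x ≠ 0 := by simpa using hx
  positivity

/-- A base value for the continuity arguments that fix signs. The even dimension avoids a fractional
power. -/
lemma gint_smul_one {a : ℝ} (ha : 0 < a) (n : ℕ) (hn : Fintype.card ι = 2 * n) :
    gint ((a : ℂ) • (1 : Matrix ι ι ℂ)) = (2 * Real.pi / a : ℂ) ^ n := by
  have h := GaussianFourier.integral_cexp_neg_mul_sum_add (ι := ι) (b := (a / 2 : ℝ))
      (by simpa using ha) 0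
  simp only [Pi.zero_apply, zero_mul, Finset.sum_const_zero, add_zero, ne_eq, OfNat.ofNat_ne_zero,
    not_false_eq_true, zero_pow, zero_div, Complex.exp_zero, mul_one] at h
  have h1 : ((Fintype.card ι : ℂ) / 2) = (n : ℂ) := by rw [hn]; push_cast; ring
  rw [h1, cpow_natCast] at h
  have ha' : (a : ℂ) ≠ 0 := by exact_mod_cast ha.ne'
  rw [gint, show (2 * Real.pi / a : ℂ) = Real.pi / ((a / 2 : ℝ) : ℂ) by push_cast; field_simp, ← h]
  refine integral_congr_ae (Filter.Eventually.of_forall fun x => ?_)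
  simp only
  congr 1
  rw [smul_mulVec, one_mulVec, dotProduct_smul, smul_eq_mul]
  simp only [dotProduct, cvec]
  push_cast
  rw [Finset.mul_sum, Finset.mul_sum, ← Finset.sum_neg_distrib, Finset.sum_div]
  exact Finset.sum_congr rfl fun i _ => by ring

end Gaussian

/-! ### Determinants of matrix exponentials and their entire square roots -/

section DetRoot

variable {m : Type*} [Fintype m] [DecidableEq m]

lemma card_roots_charpoly (A : Matrix m m ℂ) :
    Multiset.card A.charpoly.roots = Fintype.card m := by
  rw [← (IsAlgClosed.splits A.charpoly).natDegree_eq_card_roots, A.charpoly_natDegree_eq_dim]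

lemma det_sub_smul_one (A : Matrix m m ℂ) (a : ℂ) :
    (A - a • (1 : Matrix m m ℂ)).det = (A.charpoly.roots.map fun z => z - a).prod := by
  have h1 : A.charpoly.eval a = (A.charpoly.roots.map fun z => a - z).prod :=
    (IsAlgClosed.splits A.charpoly).eval_eq_prod_roots_of_monic A.charpoly_monic a
  have h2 : A.charpoly.eval a = (a • (1 : Matrix m m ℂ) - A).det := by
    rw [Matrix.eval_charpoly, smul_one_eq_diagonal]; rfl
  rw [← neg_sub, det_neg, ← h2, h1, ← card_roots_charpoly A,
    ← Multiset.card_map (fun z => a - z), ← Multiset.prod_map_neg, Multiset.map_map]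
  simp

/-- Both sides are multiplicative in p, so splitting p into linear factors reduces the claim to the
characteristic polynomial. -/
lemma det_aeval_eq_prod_roots (A : Matrix m m ℂ) (p : Polynomial ℂ) :
    (Polynomial.aeval A p).det = (A.charpoly.roots.map fun z => p.eval z).prod := by
  have key : ∀ s : Multiset ℂ,
      (Polynomial.aeval A (s.map fun a => Polynomial.X - Polynomial.C a).prod).det =
      (A.charpoly.roots.map fun z =>
        ((s.map fun a => Polynomial.X - Polynomial.C a).prod).eval z).prod := by
    intro s
    induction s using Multiset.induction_on with
    | empty => simp
    | cons a s ih =>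
      simp only [Multiset.map_cons, Multiset.prod_cons, map_mul, det_mul, Polynomial.eval_mul,
        Multiset.prod_map_mul]
      rw [ih]
      congr 1
      simp only [map_sub, Polynomial.aeval_X, Polynomial.aeval_C, Polynomial.eval_sub,
        Polynomial.eval_X, Polynomial.eval_C]
      rw [← det_sub_smul_one, Algebra.algebraMap_eq_smul_one]
  rw [(IsAlgClosed.splits p).eq_prod_roots]
  simp only [map_mul, det_mul, Polynomial.eval_mul, Multiset.prod_map_mul, key,
    Polynomial.aeval_C, Polynomial.eval_C, Multiset.map_const', Multiset.prod_replicate,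
    card_roots_charpoly]
  rw [Algebra.algebraMap_eq_smul_one, det_smul, det_one, mul_one]

open scoped Matrix.Norms.Operator in
lemma hasSum_matrix_exp (A : Matrix m m ℂ) :
    HasSum (fun k : ℕ => ((k.factorial : ℂ))⁻¹ • A ^ k) (NormedSpace.exp A) :=
  NormedSpace.exp_series_hasSum_exp' (𝕂 := ℂ) A

open scoped Matrix.Norms.Operator in
lemma continuous_matrix_exp : Continuous (NormedSpace.exp : Matrix m m ℂ → Matrix m m ℂ) :=
  NormedSpace.exp_continuous

/-- The truncated exponential series are polynomials in A, for which the determinant is a product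
over the eigenvalues; both sides pass to the limit. -/
lemma det_exp_combination (A : Matrix m m ℂ) (a b s u : ℂ) :
    (a • NormedSpace.exp (s • A) + b • NormedSpace.exp (u • A)).det =
      (A.charpoly.roots.map fun z => a * Complex.exp (s * z) + b * Complex.exp (u * z)).prod := by
  let p : ℕ → Polynomial ℂ := fun N => ∑ k ∈ Finset.range N,
    Polynomial.monomial k ((k.factorial : ℂ)⁻¹ * (a * s ^ k + b * u ^ k))
  have h1 : Filter.Tendsto (fun N => (Polynomial.aeval A (p N)).det) Filter.atTop
      (nhds (a • NormedSpace.exp (s • A) + b • NormedSpace.exp (u • A)).det) := by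
    have hd : Continuous (fun B : Matrix m m ℂ => B.det) := continuous_id.matrix_det
    refine (hd.tendsto _).comp ?_
    have := (((hasSum_matrix_exp (s • A)).const_smul a).add
      ((hasSum_matrix_exp (u • A)).const_smul b)).tendsto_sum_nat
    refine this.congr fun N => ?_
    simp only [p, map_sum]
    refine Finset.sum_congr rfl fun k _ => ?_
    rw [Polynomial.aeval_monomial, Algebra.algebraMap_eq_smul_one, smul_mul_assoc, one_mul,
      smul_pow, smul_pow]
    module
  have h2 : Filter.Tendsto (fun N => (A.charpoly.roots.map fun z => (p N).eval z).prod) Filter.atTop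
      (nhds (A.charpoly.roots.map
        fun z => a * Complex.exp (s * z) + b * Complex.exp (u * z)).prod) := by
    refine tendsto_multiset_prod _ fun z _ => ?_
    have he : ∀ w : ℂ, HasSum (fun k : ℕ => ((k.factorial : ℂ))⁻¹ • w ^ k) (Complex.exp w) := by
      intro w
      rw [Complex.exp_eq_exp_ℂ]
      exact NormedSpace.exp_series_hasSum_exp' (𝕂 := ℂ) w
    have := (((he (s * z)).mul_left a).add ((he (u * z)).mul_left b)).tendsto_sum_nat
    refine this.congr fun N => ?_
    simp only [p, Polynomial.eval_finsetSum, Polynomial.eval_monomial]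
    refine Finset.sum_congr rfl fun k _ => ?_
    simp only [smul_eq_mul]
    ring
  refine tendsto_nhds_unique h1 (h2.congr fun N => ?_)
  rw [det_aeval_eq_prod_roots]

lemma det_matCosh_smul (A : Matrix m m ℂ) (s : ℂ) :
    (matCosh (s • A)).det = (A.charpoly.roots.map fun z => Complex.cosh (s * z)).prod := by
  rw [matCosh, smul_add, ← neg_smul, det_exp_combination]
  congr 1
  refine Multiset.map_congr rfl fun z _ => ?_
  rw [Complex.cosh]; ring_nf

lemma det_exp_smul (A : Matrix m m ℂ) (s : ℂ) :
    (NormedSpace.exp (s • A)).det = (A.charpoly.roots.map fun z => Complex.exp (s * z)).prod := by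
  have := det_exp_combination A 1 0 s 0
  simpa using this

/-- A multiset of complex numbers of even cardinality that is invariant under negation is a
multiset of pairs `(z, -z)`. -/
lemma exists_multiset_half : ∀ (s : Multiset ℂ), s.map (fun z => -z) = s →
    Even (Multiset.card s) → ∃ r : Multiset ℂ, s = r + r.map fun z => -z := by
  intro s
  induction hN : Multiset.card s using Nat.strong_induction_on generalizing s with
  | _ N ih =>
    intro hs he
    by_cases h0 : ∃ a ∈ s, a ≠ 0
    · obtain ⟨a, ha, ha0⟩ := h0
      obtain ⟨t, rfl⟩ := Multiset.exists_cons_of_mem ha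
      have h1 : -a ∈ t := by
        have : -a ∈ a ::ₘ t := by
          rw [← hs]; exact Multiset.mem_map_of_mem _ ha
        rcases Multiset.mem_cons.1 this with h | h
        · exact absurd h (by simpa [neg_eq_iff_add_eq_zero, ← two_mul] using ha0)
        · exact h
      obtain ⟨u, rfl⟩ := Multiset.exists_cons_of_mem h1
      have h2 : u.map (fun z => -z) = u := by
        simp only [Multiset.map_cons, neg_neg] at hs
        rw [Multiset.cons_swap] at hs
        simpa using hs
      simp only [Multiset.card_cons] at hN
      obtain ⟨r, hr⟩ := ih (Multiset.card u) (by omega) u rfl h2 (by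
        rw [← hN] at he; simpa [Nat.even_add_one, parity_simps] using he)
      refine ⟨a ::ₘ r, ?_⟩
      rw [Multiset.map_cons, Multiset.cons_add, Multiset.add_cons, ← hr]
    -- Only zeros remain. Zero is its own negative, so an even number of zeros splits into two equal
    -- halves.
    · push Not at h0
      obtain ⟨k, hk⟩ := he
      have : s = Multiset.replicate (k + k) 0 := by
        rw [Multiset.eq_replicate]
        exact ⟨by omega, h0⟩
      exact ⟨Multiset.replicate k 0, by rw [this, Multiset.map_replicate, neg_zero,
        Multiset.replicate_add]⟩

lemma stdJ_mul_self (n : ℕ) : stdJ n * stdJ n = -1 := by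
  simp [stdJ, fromBlocks_multiply, ← fromBlocks_one, fromBlocks_neg]

lemma stdJ_transpose (n : ℕ) : (stdJ n)ᵀ = -stdJ n := by
  simp [stdJ, fromBlocks_transpose, fromBlocks_neg]

/-- Conjugation by J takes -Y to Yᵀ, so Y and -Y have the same characteristic polynomial. The size
2n is even, so det(-A) = det A. -/
lemma roots_charpoly_neg {n : ℕ} {Y : Matrix (Idx n) (Idx n) ℂ} (hY : (stdJ n * Y).IsSymm) :
    Y.charpoly.roots.map (fun z => -z) = Y.charpoly.roots := by
  have h1 : Y.charpoly.comp (-Polynomial.X) = (-Y).charpoly := by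
    have h2 := RingHom.map_det (Polynomial.compRingHom (-Polynomial.X : Polynomial ℂ)) Y.charmatrix
    have h3 : (Polynomial.compRingHom (-Polynomial.X : Polynomial ℂ)).mapMatrix Y.charmatrix =
        -(-Y).charmatrix := by
      ext i j
      by_cases hij : i = j
      · subst hij
        simp [charmatrix_apply_eq]
        ring_nf
      · simp [charmatrix_apply_ne _ _ _ hij]
    rw [h3, det_neg] at h2
    have h4 : (-1 : Polynomial ℂ) ^ Fintype.card (Idx n) = 1 := by
      rw [Fintype.card_sum]
      exact Even.neg_one_pow ⟨_, rfl⟩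
    rw [h4, one_mul] at h2
    exact h2
  have h5 : (-Y).charpoly = Y.charpoly := by
    let u : (Matrix (Idx n) (Idx n) ℂ)ˣ :=
      ⟨stdJ n, -stdJ n, by simp [stdJ_mul_self], by simp [stdJ_mul_self]⟩
    have h6 := Matrix.charpoly_units_conj u (-Y)
    have h7 : (u : Matrix (Idx n) (Idx n) ℂ) * (-Y) * (↑u⁻¹ : Matrix (Idx n) (Idx n) ℂ) = Yᵀ := by
      have h8 : Yᵀ * -stdJ n = stdJ n * Y := by
        rw [← stdJ_transpose, ← transpose_mul]; exact hY
      change stdJ n * -Y * -stdJ n = Yᵀ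
      rw [Matrix.mul_neg, Matrix.mul_neg, Matrix.neg_mul, neg_neg, ← h8, Matrix.mul_assoc,
        Matrix.neg_mul, stdJ_mul_self]
      simp
    rw [← Matrix.coe_units_inv, h7, Matrix.charpoly_transpose] at h6
    exact h6.symm
  rw [← Polynomial.roots_comp_neg_X, h1, h5]

lemma exists_roots_half {n : ℕ} {Y : Matrix (Idx n) (Idx n) ℂ} (hY : (stdJ n * Y).IsSymm) :
    ∃ r : Multiset ℂ, Y.charpoly.roots = r + r.map fun z => -z :=
  exists_multiset_half _ (roots_charpoly_neg hY) (by
    rw [card_roots_charpoly, Fintype.card_sum]; exact ⟨_, rfl⟩)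

lemma det_exp_hamiltonian {n : ℕ} {Y : Matrix (Idx n) (Idx n) ℂ} (hY : (stdJ n * Y).IsSymm)
    (s : ℂ) : (NormedSpace.exp (s • Y)).det = 1 := by
  obtain ⟨r, hr⟩ := exists_roots_half hY
  rw [det_exp_smul, hr, Multiset.map_add, Multiset.prod_add, Multiset.map_map,
    ← Multiset.prod_map_mul]
  simp [← Complex.exp_add]

lemma countable_cosh_zero (a : ℂ) : {s : ℂ | Complex.cosh (s * a) = 0}.Countable := by
  by_cases ha : a = 0
  · simp [ha]
  · refine (Set.countable_range fun k : ℤ => (2 * (k : ℂ) + 1) * Real.pi / 2 / (a * I)).mono ?_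
    intro s hs
    rw [Set.mem_ofPred_eq, ← Complex.cos_mul_I, Complex.cos_eq_zero_iff] at hs
    obtain ⟨k, hk⟩ := hs
    refine ⟨k, ?_⟩
    simp only
    rw [← hk]
    have := I_ne_zero
    field_simp

/-- The eigenvalues z and -z contribute the same factor cosh(sz), so the product over one member of
each pair is an entire square root. -/
lemma exists_isDetRoot {n : ℕ} {Y : Matrix (Idx n) (Idx n) ℂ} (hY : (stdJ n * Y).IsSymm) :
    ∃ D : ℂ → ℂ, IsDetRoot (fun s => matCosh (s • Y)) D := by
  obtain ⟨r, hr⟩ := exists_roots_half hY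
  refine ⟨fun s => (r.map fun z => Complex.cosh (s * z)).prod, ?_, by simp, fun s => ?_⟩
  · clear hr
    induction r using Multiset.induction_on with
    | empty => simp
    | cons a r ih =>
      simp only [Multiset.map_cons, Multiset.prod_cons]
      exact (Complex.differentiable_cosh.comp (differentiable_id.mul_const a)).mul ih
  · simp only
    rw [det_matCosh_smul, hr, Multiset.map_add, Multiset.prod_add, Multiset.map_map, sq]
    simp

lemma countable_det_matCosh_zero (Y : Matrix m m ℂ) :
    {s : ℂ | (matCosh (s • Y)).det = 0}.Countable := by
  have : {s : ℂ | (matCosh (s • Y)).det = 0} ⊆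
      ⋃ a ∈ Y.charpoly.roots.toFinset, {s : ℂ | Complex.cosh (s * a) = 0} := by
    intro s hs
    rw [Set.mem_ofPred_eq, det_matCosh_smul, Multiset.prod_eq_zero_iff] at hs
    obtain ⟨a, ha, ha'⟩ := Multiset.mem_map.1 hs
    simp only [Set.mem_iUnion]
    exact ⟨a, Multiset.mem_toFinset.2 ha, ha'⟩
  exact (Set.Countable.biUnion (Finset.countable_toSet _)
    fun a _ => countable_cosh_zero a).mono this

/-- Removing a countable set from the plane leaves a path connected set. Its paths carry the branch
of the square root from 0 to any admissible point. -/
lemma isPathConnected_det_matCosh_ne_zero (Y : Matrix m m ℂ) :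
    IsPathConnected {s : ℂ | (matCosh (s • Y)).det ≠ 0} :=
  (countable_det_matCosh_zero Y).isPathConnected_compl_of_one_lt_rank (by simp)

lemma matCosh_zero : matCosh (0 : Matrix m m ℂ) = 1 := by
  rw [matCosh, neg_zero, NormedSpace.exp_zero, ← two_smul ℂ, smul_smul]; norm_num

lemma continuous_matCosh : Continuous (matCosh : Matrix m m ℂ → Matrix m m ℂ) := by
  have h : Continuous fun A : Matrix m m ℂ => NormedSpace.exp A + NormedSpace.exp (-A) :=
    (continuous_matrix_exp (m := m)).add ((continuous_matrix_exp (m := m)).comp continuous_neg)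
  exact h.const_smul (2⁻¹ : ℂ)

/-- If `h² - 1` is small along a connected set, the branch `h` with `h = 1` somewhere stays near
`1`. -/
lemma re_pos_of_sq {h : unitInterval → ℂ} (hc : Continuous h) (h0 : h 0 = 1)
    (hs : ∀ u, ‖h u ^ 2 - 1‖ < 1) (u : unitInterval) : 0 < (h u).re := by
  by_contra hu
  have hpre : IsPreconnected (Set.univ : Set unitInterval) := isPreconnected_univ
  obtain ⟨v, -, hv⟩ := hpre.intermediate_value (Set.mem_univ u) (Set.mem_univ 0)
    (Complex.continuous_re.comp hc).continuousOn (show (0 : ℝ) ∈ _ from ⟨not_lt.1 hu, by simp [h0]⟩)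
  have h1 : (h v ^ 2 - 1).re ≤ -1 := by
    simp only [Function.comp] at hv
    simp [sq, hv]; nlinarith [sq_nonneg (h v).im]
  have h2 := (abs_le.1 (Complex.abs_re_le_norm (h v ^ 2 - 1))).1
  linarith [hs v]

/-- The normalised root depends continuously on the matrix away from the zeros. Along a compact path
from 0 to t that avoids the zeros for Y0, the ratio (D a / D0)² stays within distance 1 of 1 once Y
a is close to Y0. The ratio D a / D0 starts at 1 and therefore cannot cross the imaginary axis. -/
lemma tendsto_detRoot {α : Type*} {l : Filter α} {Y : α → Matrix m m ℂ} {Y0 : Matrix m m ℂ}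
    (hY : Filter.Tendsto Y l (nhds Y0)) {D : α → ℂ → ℂ} {D0 : ℂ → ℂ}
    (h : ∀ a, IsDetRoot (fun s => matCosh (s • Y a)) (D a))
    (h0 : IsDetRoot (fun s => matCosh (s • Y0)) D0) {t : ℂ} (ht : (matCosh (t • Y0)).det ≠ 0) :
    Filter.Tendsto (fun a => D a t) l (nhds (D0 t)) := by
  obtain ⟨γ, hγ⟩ := (isPathConnected_det_matCosh_ne_zero Y0).joinedIn 0
    (by simp [matCosh_zero]) t ht
  obtain ⟨G, hG, hcont⟩ : ∃ G : Matrix m m ℂ → unitInterval → ℂ,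
      (∀ Z u, G Z u = (matCosh (γ u • Z)).det) ∧
        Continuous fun q : Matrix m m ℂ × unitInterval => G q.1 q.2 :=
    ⟨_, fun _ _ => rfl, (continuous_matCosh.comp
      ((γ.continuous.comp continuous_snd).smul continuous_fst)).matrix_det⟩
  have hG0 : ∀ u, G Y0 u ≠ 0 := fun u => by rw [hG]; exact hγ u
  have hne : ∀ u, D0 (γ u) ≠ 0 := fun u h1 => hG0 u (by
    have := h0.2.2 (γ u); rw [h1] at this; rw [hG]; simpa using this.symm)
  have hev : ∀ᶠ Z in nhds Y0, ∀ u ∈ (Set.univ : Set unitInterval), ‖G Z u / G Y0 u - 1‖ < 1 := by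
    refine isCompact_univ.eventually_forall_of_forall_eventually
      (P := fun Z u => ‖G Z u / G Y0 u - 1‖ < 1) fun u _ => ?_
    have hc : ContinuousAt (fun q : Matrix m m ℂ × unitInterval =>
        ‖G q.1 q.2 / G Y0 q.2 - 1‖) (Y0, u) := by
      have h2 : Continuous fun q : Matrix m m ℂ × unitInterval => G Y0 q.2 :=
        hcont.comp (continuous_const.prodMk continuous_snd)
      exact ((hcont.continuousAt.div h2.continuousAt (hG0 u)).sub continuousAt_const).norm
    exact hc.eventually (gt_mem_nhds (by simp [div_self (hG0 u)]))
  have hsq : ∀ a u, (D a (γ u) / D0 (γ u)) ^ 2 =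
      G (Y a) u / G Y0 u := fun a u => by
    rw [div_pow, (h a).2.2, h0.2.2, hG, hG]
  have hre : ∀ᶠ a in l, 0 < (D a t / D0 t).re := by
    filter_upwards [hY.eventually hev] with a ha
    have := re_pos_of_sq (h := fun u => D a (γ u) / D0 (γ u))
      (((h a).1.continuous.comp γ.continuous).div (h0.1.continuous.comp γ.continuous) hne)
      (by simp [(h a).2.1, h0.2.1]) (fun u => by rw [hsq]; exact ha u trivial) 1
    simpa using this
  have hD0t : D0 t ≠ 0 := by simpa using hne 1
  have hlim : Filter.Tendsto (fun a => (D a t / D0 t) ^ 2 - 1) l (nhds 0) := by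
    have h1 : Filter.Tendsto (fun a => (matCosh (t • Y a)).det) l
        (nhds (matCosh (t • Y0)).det) :=
      ((continuous_matCosh.comp (continuous_const_smul t)).matrix_det.tendsto Y0).comp hY
    have h2 := (h1.div_const (matCosh (t • Y0)).det).sub_const 1
    rw [div_self ht, sub_self] at h2
    refine h2.congr fun a => ?_
    have := hsq a 1
    simp only [hG, Path.target] at this
    rw [this]
  have hlim2 : Filter.Tendsto (fun a => D a t / D0 t - 1) l (nhds 0) := by
    refine squeeze_zero_norm' ?_ (tendsto_zero_iff_norm_tendsto_zero.1 hlim)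
    filter_upwards [hre] with a ha
    -- For a ratio h with positive real part, |h + 1| ≥ 1, so |h - 1| ≤ |h² - 1|.
    have h1 : (D a t / D0 t) ^ 2 - 1 = (D a t / D0 t - 1) * (D a t / D0 t + 1) := by ring
    rw [h1, norm_mul]
    have h2 : 1 ≤ ‖D a t / D0 t + 1‖ := by
      refine le_trans ?_ (Complex.abs_re_le_norm _)
      rw [Complex.add_re, Complex.one_re]
      exact le_trans (by linarith) (le_abs_self _)
    nlinarith [norm_nonneg (D a t / D0 t - 1)]
  have hlim3 := (hlim2.add_const 1).mul_const (D0 t)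
  simp only [sub_add_cancel, zero_add, one_mul] at hlim3
  exact hlim3.congr fun a => div_mul_cancel₀ _ hD0t

end DetRoot

/-! ### The Hamiltonian flow and expanding symplectic matrices -/

section Flow

variable {n : ℕ}

/-- The squared Euclidean norm of a complex vector. -/
def nsq (a : Fin n → ℂ) : ℝ := ∑ j, ‖a j‖ ^ 2

/-- The indefinite form `|a|² - |b|²` on `ℂⁿ × ℂⁿ`. -/
def hnorm (v : Idx n → ℂ) : ℝ := ∑ j, ‖v (Sum.inl j)‖ ^ 2 - ∑ j, ‖v (Sum.inr j)‖ ^ 2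

lemma hnorm_elim (a b : Fin n → ℂ) : hnorm (Sum.elim a b) = nsq a - nsq b := rfl

lemma nsq_nonneg (a : Fin n → ℂ) : 0 ≤ nsq a := Finset.sum_nonneg fun _ _ => by positivity

lemma nsq_zero : nsq (0 : Fin n → ℂ) = 0 := by simp [nsq]

lemma nsq_neg (a : Fin n → ℂ) : nsq (-a) = nsq a := by simp [nsq]

lemma nsq_star (a : Fin n → ℂ) : nsq (star a) = nsq a := by simp [nsq]

lemma nsq_eq_zero {a : Fin n → ℂ} (h : nsq a ≤ 0) : a = 0 := by
  ext j
  have h1 := (Finset.sum_eq_zero_iff_of_nonneg (fun j _ => by positivity)).1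
    (le_antisymm h (nsq_nonneg a)) j (Finset.mem_univ j)
  simpa using h1

/-- Symplectic matrices that expand the form `|a|² - |b|²`. -/
structure IsExpSp (k : Matrix (Idx n) (Idx n) ℂ) : Prop where
  symp : kᵀ * stdJ n * k = stdJ n
  expand : ∀ v, hnorm v ≤ hnorm (k *ᵥ v)

/-- The complexified Hamiltonian flow `exp (-2 i t J M)`. -/
def flow (M : Matrix (Idx n) (Idx n) ℂ) (t : ℝ) : Matrix (Idx n) (Idx n) ℂ :=
  NormedSpace.exp ((t : ℂ) • ((-(2 * I)) • (stdJ n * M)))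

/-- The flow in the coordinates `(x + i y, x - i y)`. -/
def kflow (M : Matrix (Idx n) (Idx n) ℂ) (t : ℝ) : Matrix (Idx n) (Idx n) ℂ :=
  cayleyU n * flow M t * (cayleyU n)⁻¹

lemma cayleyU_mul_aux (n : ℕ) : cayleyU n *
    ((2⁻¹ : ℂ) • Matrix.fromBlocks 1 1 (-(I • 1)) (I • 1)) = 1 := by
  rw [cayleyU, Matrix.mul_smul, fromBlocks_multiply, ← fromBlocks_one, fromBlocks_smul]
  congr 1 <;>
  · ext i j
    simp only [Matrix.smul_apply, Matrix.add_apply, Matrix.neg_apply, Matrix.zero_apply,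
      Matrix.mul_one, Matrix.mul_neg, Matrix.mul_smul, smul_eq_mul, ← mul_assoc, I_mul_I]
    first | ring1 | (ring_nf; rw [I_sq]; ring1)

lemma cayleyU_inv (n : ℕ) : (cayleyU n)⁻¹ =
    (2⁻¹ : ℂ) • Matrix.fromBlocks 1 1 (-(I • 1)) (I • 1) :=
  Matrix.inv_eq_right_inv (cayleyU_mul_aux n)

lemma cayleyU_mul_inv (n : ℕ) : cayleyU n * (cayleyU n)⁻¹ = 1 := by
  rw [cayleyU_inv, cayleyU_mul_aux]

lemma cayleyU_inv_mul (n : ℕ) : (cayleyU n)⁻¹ * cayleyU n = 1 :=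
  mul_eq_one_comm.1 (cayleyU_mul_inv n)

lemma cayleyU_symp (n : ℕ) : (cayleyU n)ᵀ * stdJ n * cayleyU n = (-(2 * I)) • stdJ n := by
  rw [cayleyU, stdJ, fromBlocks_transpose, fromBlocks_multiply, fromBlocks_multiply,
    fromBlocks_smul]
  congr 1 <;>
  · ext i j
    simp [Matrix.one_apply]
    try split_ifs <;> ring

lemma symm_transpose_mul_stdJ {M : Matrix (Idx n) (Idx n) ℂ} (hM : M.IsSymm) :
    (stdJ n * M)ᵀ = stdJ n * (stdJ n * M) * stdJ n := by
  rw [← Matrix.mul_assoc, stdJ_mul_self, transpose_mul, hM, stdJ_transpose]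
  simp

lemma stdJ_mul_stdJ_mul_symm {M : Matrix (Idx n) (Idx n) ℂ} (hM : M.IsSymm) :
    (stdJ n * (stdJ n * M)).IsSymm := by
  rw [← Matrix.mul_assoc, stdJ_mul_self, Matrix.IsSymm, transpose_mul, hM]
  simp

/-- Since JYJ⁻¹ = -Yᵀ, conjugating exp Y by J gives exp(-Yᵀ), the inverse of its transpose. -/
lemma flow_symp {M : Matrix (Idx n) (Idx n) ℂ} (hM : M.IsSymm) (t : ℝ) :
    (flow M t)ᵀ * stdJ n * flow M t = stdJ n := by
  set Y := (t : ℂ) • ((-(2 * I)) • (stdJ n * M)) with hY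
  let u : (Matrix (Idx n) (Idx n) ℂ)ˣ :=
    ⟨stdJ n, -stdJ n, by simp [stdJ_mul_self], by simp [stdJ_mul_self]⟩
  have h1 : Yᵀ = stdJ n * Y * stdJ n := by
    rw [hY, transpose_smul, transpose_smul, symm_transpose_mul_stdJ hM]
    simp only [Matrix.mul_smul, Matrix.smul_mul]
  have h2 : stdJ n * NormedSpace.exp Y * -stdJ n = NormedSpace.exp (-Yᵀ) := by
    have h3 := Matrix.exp_units_conj u Y
    have h4 : (u : Matrix (Idx n) (Idx n) ℂ) * Y * (↑u⁻¹ : Matrix (Idx n) (Idx n) ℂ) = -Yᵀ := by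
      change stdJ n * Y * -stdJ n = _
      rw [h1, Matrix.mul_neg]
    rw [h4] at h3
    exact h3.symm
  have h4 : stdJ n * NormedSpace.exp Y = NormedSpace.exp (-Yᵀ) * stdJ n := by
    rw [← h2, Matrix.mul_assoc, Matrix.neg_mul, stdJ_mul_self]; simp
  have h5 : NormedSpace.exp Yᵀ * NormedSpace.exp (-Yᵀ) = 1 := by
    rw [← Matrix.exp_add_of_commute _ _ (Commute.refl Yᵀ).neg_right]; simp
  rw [flow, ← hY, Matrix.mul_assoc, h4, ← Matrix.exp_transpose, ← Matrix.mul_assoc, h5,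
    Matrix.one_mul]

/-- U is symplectic up to the scalar -2i, which cancels under conjugation. -/
lemma kflow_symp {M : Matrix (Idx n) (Idx n) ℂ} (hM : M.IsSymm) (t : ℝ) :
    (kflow M t)ᵀ * stdJ n * kflow M t = stdJ n := by
  have h1 := cayleyU_symp n
  have h2 := flow_symp hM t
  have h3 : ((cayleyU n)⁻¹)ᵀ * ((-(2 * I)) • stdJ n) * (cayleyU n)⁻¹ = stdJ n := by
    rw [← h1]
    calc _ = (cayleyU n * (cayleyU n)⁻¹)ᵀ * stdJ n * (cayleyU n * (cayleyU n)⁻¹) := by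
          rw [transpose_mul]; simp only [Matrix.mul_assoc]
      _ = _ := by rw [cayleyU_mul_inv]; simp
  calc (kflow M t)ᵀ * stdJ n * kflow M t
      = ((cayleyU n)⁻¹)ᵀ * ((flow M t)ᵀ * ((cayleyU n)ᵀ * stdJ n * cayleyU n) * flow M t)
        * (cayleyU n)⁻¹ := by
        rw [kflow, transpose_mul, transpose_mul]; simp only [Matrix.mul_assoc]
    _ = _ := by rw [h1, Matrix.mul_smul, Matrix.smul_mul, h2, h3]

lemma hnorm_cayleyU (v : Idx n → ℂ) :
    hnorm (cayleyU n *ᵥ v) = (2 * I * (star v ⬝ᵥ (stdJ n *ᵥ v))).re := by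
  have hv : v = Sum.elim (fun j => v (Sum.inl j)) (fun j => v (Sum.inr j)) := by
    ext (j | j) <;> rfl
  rw [hv]
  generalize (fun j => v (Sum.inl j)) = x
  generalize (fun j => v (Sum.inr j)) = y
  rw [cayleyU, stdJ, fromBlocks_mulVec, fromBlocks_mulVec, hnorm_elim]
  simp only [dotProduct, Fintype.sum_sum_type, nsq, Function.comp_def, Sum.elim_inl, Sum.elim_inr,
    Pi.star_apply, ← Finset.sum_sub_distrib, ← Finset.sum_add_distrib, Finset.mul_sum,
    Complex.re_sum]
  refine Finset.sum_congr rfl fun j _ => ?_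
  rw [← Complex.normSq_eq_norm_sq, ← Complex.normSq_eq_norm_sq]
  simp only [neg_mulVec, smul_mulVec, one_mulVec, zero_mulVec, Pi.add_apply, Pi.neg_apply,
    Pi.smul_apply, smul_eq_mul, Complex.normSq_apply, Pi.zero_apply]
  simp
  ring

open scoped Matrix.Norms.Operator in
lemma hasDerivAt_flow (M : Matrix (Idx n) (Idx n) ℂ) (t : ℝ) :
    HasDerivAt (flow M) ((-(2 * I)) • (stdJ n * M) * flow M t) t := by
  have h := hasDerivAt_exp_smul_const' (𝕂 := ℂ) ((-(2 * I)) • (stdJ n * M)) (t : ℂ)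
  exact h.scomp_of_eq t Complex.ofRealCLM.hasDerivAt rfl |>.congr_deriv (by
    simp only [ofRealCLM_apply, ofReal_one, one_smul]; rfl)

lemma hasDerivAt_flow_mulVec (M : Matrix (Idx n) (Idx n) ℂ) (v : Idx n → ℂ) (t : ℝ) :
    HasDerivAt (fun t => flow M t *ᵥ v)
      ((-(2 * I)) • (stdJ n *ᵥ (M *ᵥ (flow M t *ᵥ v)))) t := by
  open scoped Matrix.Norms.Operator in
  have h := hasDerivAt_flow M t
  open scoped Matrix.Norms.Operator in
  let L : Matrix (Idx n) (Idx n) ℂ →L[ℝ] (Idx n → ℂ) :=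
    LinearMap.toContinuousLinearMap
      { toFun := fun A => A *ᵥ v
        map_add' := fun A B => add_mulVec A B v
        map_smul' := fun c A => smul_mulVec c A v }
  have h2 := L.hasFDerivAt.comp_hasDerivAt t h
  refine h2.congr_deriv ?_
  change (((-(2 * I)) • (stdJ n * M)) * flow M t) *ᵥ v = _
  rw [← mulVec_mulVec, smul_mulVec, ← mulVec_mulVec]

/-- The cross terms between real and imaginary parts cancel by the symmetry of M. A sign condition
on real phase space thus extends to complex vectors. -/
lemma re_hermitian_quad {M : Matrix (Idx n) (Idx n) ℂ} (hM : M.IsSymm) (v : Idx n → ℂ) :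
    (star v ⬝ᵥ (M *ᵥ v)).re =
      (qform M (fun j => (v (Sum.inl j)).re) (fun j => (v (Sum.inr j)).re)).re +
      (qform M (fun j => (v (Sum.inl j)).im) (fun j => (v (Sum.inr j)).im)).re := by
  have h1 : phaseVec (fun j => (v (Sum.inl j)).re) (fun j => (v (Sum.inr j)).re) =
      fun i => ((v i).re : ℂ) := by ext (j | j) <;> rfl
  have h2 : phaseVec (fun j => (v (Sum.inl j)).im) (fun j => (v (Sum.inr j)).im) =
      fun i => ((v i).im : ℂ) := by ext (j | j) <;> rfl
  rw [qform, qform, h1, h2]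
  set a : Idx n → ℂ := fun i => ((v i).re : ℂ)
  set b : Idx n → ℂ := fun i => ((v i).im : ℂ)
  have hv : v = a + I • b := by ext i; simp [a, b, mul_comm I, Complex.re_add_im]
  have hv' : star v = a - I • b := by
    rw [hv]; ext i; simp [a, b, sub_eq_add_neg]
  have hc : b ⬝ᵥ (M *ᵥ a) = a ⬝ᵥ (M *ᵥ b) := by
    rw [dotProduct_mulVec, ← mulVec_transpose, hM, dotProduct_comm]
  rw [hv', hv]
  simp only [mulVec_add, mulVec_smul, sub_dotProduct, dotProduct_add, smul_dotProduct,
    dotProduct_smul, smul_eq_mul, hc]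
  rw [← Complex.add_re]
  congr 1
  ring_nf
  rw [I_sq]
  ring

/-- The J of the indefinite form cancels the J of the Hamiltonian vector field, leaving the
Hermitian form of M. Hence Re q_M ≤ 0 is exactly what makes the flow expand |a|² - |b|². -/
lemma hasDerivAt_hnorm_flow (M : Matrix (Idx n) (Idx n) ℂ) (v : Idx n → ℂ)
    (t : ℝ) : HasDerivAt (fun t => hnorm (cayleyU n *ᵥ (flow M t *ᵥ v)))
      (-8 * (star (flow M t *ᵥ v) ⬝ᵥ (M *ᵥ (flow M t *ᵥ v))).re) t := by
  simp_rw [hnorm_cayleyU]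
  set z := flow M t *ᵥ v with hz
  have h := hasDerivAt_flow_mulVec M v t
  rw [← hz] at h
  have h' := hasDerivAt_pi.1 h
  have hd : HasDerivAt (fun t => star (flow M t *ᵥ v) ⬝ᵥ (stdJ n *ᵥ (flow M t *ᵥ v)))
      (star ((-(2 * I)) • (stdJ n *ᵥ (M *ᵥ z))) ⬝ᵥ (stdJ n *ᵥ z) +
        star z ⬝ᵥ (stdJ n *ᵥ ((-(2 * I)) • (stdJ n *ᵥ (M *ᵥ z))))) t := by
    simp only [dotProduct, mulVec, ← Finset.sum_add_distrib]
    refine HasDerivAt.fun_sum fun i _ => ?_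
    refine HasDerivAt.mul (h' i).star ?_
    refine HasDerivAt.fun_sum fun j _ => ?_
    exact (h' j).const_mul _
  have hd2 := (Complex.reCLM.hasFDerivAt.comp_hasDerivAt t (hd.const_mul (2 * I)))
  refine hd2.congr_deriv ?_
  have e1 : ∀ z : Idx n → ℂ, star ((-(2 * I)) • (stdJ n *ᵥ (M *ᵥ z))) ⬝ᵥ (stdJ n *ᵥ z) =
      (2 * I) * star (star z ⬝ᵥ (M *ᵥ z)) := by
    intro z
    have hJ : (stdJ n)ᴴ = -stdJ n := by
      simp [stdJ, fromBlocks_conjTranspose, fromBlocks_neg]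
    rw [star_smul, smul_dotProduct, star_mulVec, ← dotProduct_mulVec, mulVec_mulVec, hJ,
      Matrix.neg_mul, stdJ_mul_self, neg_neg, one_mulVec, ← star_dotProduct_star, star_star,
      dotProduct_comm]
    simp
  have e2 : ∀ z : Idx n → ℂ, star z ⬝ᵥ (stdJ n *ᵥ ((-(2 * I)) • (stdJ n *ᵥ (M *ᵥ z)))) =
      (2 * I) * (star z ⬝ᵥ (M *ᵥ z)) := by
    intro z
    rw [mulVec_smul, mulVec_mulVec, stdJ_mul_self, neg_mulVec, one_mulVec, dotProduct_smul,
      dotProduct_neg, smul_eq_mul]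
    ring
  rw [e1, e2]
  generalize star z ⬝ᵥ (M *ᵥ z) = q
  simp
  ring

lemma kflow_mulVec (M : Matrix (Idx n) (Idx n) ℂ) (t : ℝ) (v : Idx n → ℂ) :
    kflow M t *ᵥ v = cayleyU n *ᵥ (flow M t *ᵥ ((cayleyU n)⁻¹ *ᵥ v)) := by
  rw [kflow, mulVec_mulVec, mulVec_mulVec, Matrix.mul_assoc]

lemma flow_zero (M : Matrix (Idx n) (Idx n) ℂ) : flow M 0 = 1 := by simp [flow]

lemma kflow_zero (M : Matrix (Idx n) (Idx n) ℂ) : kflow M 0 = 1 := by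
  rw [kflow, flow_zero, Matrix.mul_one, cayleyU_mul_inv]

lemma isExpSp_kflow {M : Matrix (Idx n) (Idx n) ℂ} (hM : M.IsSymm)
    (hq : ∀ x y : Fin n → ℝ, (qform M x y).re ≤ 0) {t : ℝ} (ht : 0 ≤ t) : IsExpSp (kflow M t) := by
  refine ⟨kflow_symp hM t, fun v => ?_⟩
  have hmono : Monotone fun t => hnorm (cayleyU n *ᵥ (flow M t *ᵥ ((cayleyU n)⁻¹ *ᵥ v))) := by
    refine monotone_of_deriv_nonneg
      (fun s => (hasDerivAt_hnorm_flow M ((cayleyU n)⁻¹ *ᵥ v) s).differentiableAt) fun s => ?_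
    rw [(hasDerivAt_hnorm_flow M _ s).deriv, re_hermitian_quad hM]
    linarith [hq (fun j => ((flow M s *ᵥ ((cayleyU n)⁻¹ *ᵥ v)) (Sum.inl j)).re)
      (fun j => ((flow M s *ᵥ ((cayleyU n)⁻¹ *ᵥ v)) (Sum.inr j)).re),
      hq (fun j => ((flow M s *ᵥ ((cayleyU n)⁻¹ *ᵥ v)) (Sum.inl j)).im)
      (fun j => ((flow M s *ᵥ ((cayleyU n)⁻¹ *ᵥ v)) (Sum.inr j)).im)]
  have h := hmono ht
  simp only [flow_zero, one_mulVec] at h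
  rwa [mulVec_mulVec, cayleyU_mul_inv, one_mulVec, ← kflow_mulVec] at h

/-- For strictly dissipative `M` the flow at positive times has no eigenvalue `-1`. -/
lemma det_flow_add_one_ne_zero {M : Matrix (Idx n) (Idx n) ℂ} (hM : M.IsSymm)
    (hq : ∀ x y : Fin n → ℝ, (x ≠ 0 ∨ y ≠ 0) → (qform M x y).re < 0) {t : ℝ} (ht : 0 < t) :
    (flow M t + 1).det ≠ 0 := by
  intro hdet
  obtain ⟨v, hv, hv0⟩ := Matrix.exists_mulVec_eq_zero_iff.2 hdet
  have hle : ∀ x y : Fin n → ℝ, (qform M x y).re ≤ 0 := fun x y => by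
    by_cases h : x ≠ 0 ∨ y ≠ 0
    · exact (hq x y h).le
    · push Not at h
      have : phaseVec x y = 0 := by rw [h.1, h.2]; ext (j | j) <;> simp [phaseVec]
      simp [qform, this]
  have hinj : ∀ s, flow M s *ᵥ v ≠ 0 := fun s h => hv (by
    have h1 : IsUnit (flow M s) := Matrix.isUnit_exp _
    have h2 := (Matrix.mulVec_injective_iff_isUnit.2 h1) (h.trans (mulVec_zero _).symm)
    exact h2)
  have hneg : ∀ w : Idx n → ℂ, w ≠ 0 → (star w ⬝ᵥ (M *ᵥ w)).re < 0 := by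
    intro w hw
    rw [re_hermitian_quad hM]
    by_cases h1 : (fun j => (w (Sum.inl j)).re) ≠ 0 ∨ (fun j => (w (Sum.inr j)).re) ≠ 0
    · linarith [hq _ _ h1, hle (fun j => (w (Sum.inl j)).im) (fun j => (w (Sum.inr j)).im)]
    · have h2 : (fun j => (w (Sum.inl j)).im) ≠ 0 ∨ (fun j => (w (Sum.inr j)).im) ≠ 0 := by
        by_contra h2
        push Not at h1 h2
        refine hw (funext fun i => ?_)
        rcases i with j | j
        · exact Complex.ext (congrFun h1.1 j) (congrFun h2.1 j)
        · exact Complex.ext (congrFun h1.2 j) (congrFun h2.2 j)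
      linarith [hq _ _ h2, hle (fun j => (w (Sum.inl j)).re) (fun j => (w (Sum.inr j)).re)]
  -- The form `hnorm` is even, so a vector with flow image -v would have the same value at times 0
  -- and t, against strict growth.
  have hmono : StrictMono fun t => hnorm (cayleyU n *ᵥ (flow M t *ᵥ v)) := by
    refine strictMono_of_deriv_pos fun s => ?_
    rw [(hasDerivAt_hnorm_flow M _ s).deriv]
    linarith [hneg _ (hinj s)]
  have h := hmono ht
  have h3 : flow M t *ᵥ v = -v := by
    rw [add_mulVec, one_mulVec] at hv0
    exact eq_neg_of_add_eq_zero_left hv0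
  simp only [flow_zero, one_mulVec, h3, mulVec_neg] at h
  have h4 : ∀ w : Idx n → ℂ, hnorm (-w) = hnorm w := fun w => by simp [hnorm]
  rw [h4] at h
  exact lt_irrefl _ h

end Flow

/-! ### Block identities and estimates for expanding symplectic matrices -/

section Blocks

variable {n : ℕ} {P Q R S : Matrix (Fin n) (Fin n) ℂ}

namespace IsExpSp

lemma rel₁ (h : IsExpSp (fromBlocks P Q R S)) : Pᵀ * R = Rᵀ * P := by
  have h1 := h.symp
  rw [stdJ, fromBlocks_transpose, fromBlocks_multiply, fromBlocks_multiply] at h1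
  have := (fromBlocks_inj.1 h1).1
  simp only [Matrix.mul_zero, Matrix.mul_neg, Matrix.mul_one, zero_add, add_zero,
    Matrix.neg_mul] at this
  exact eq_of_sub_eq_zero (by rw [← this]; abel)

lemma rel₂ (h : IsExpSp (fromBlocks P Q R S)) : Pᵀ * S - Rᵀ * Q = 1 := by
  have h1 := h.symp
  rw [stdJ, fromBlocks_transpose, fromBlocks_multiply, fromBlocks_multiply] at h1
  have := (fromBlocks_inj.1 h1).2.1
  simp only [Matrix.mul_zero, Matrix.mul_neg, Matrix.mul_one, zero_add, add_zero,
    Matrix.neg_mul] at this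
  rw [← this]; abel

lemma rel₃ (h : IsExpSp (fromBlocks P Q R S)) : Qᵀ * S = Sᵀ * Q := by
  have h1 := h.symp
  rw [stdJ, fromBlocks_transpose, fromBlocks_multiply, fromBlocks_multiply] at h1
  have := (fromBlocks_inj.1 h1).2.2.2
  simp only [Matrix.mul_zero, Matrix.mul_neg, Matrix.mul_one, zero_add, add_zero,
    Matrix.neg_mul] at this
  exact eq_of_sub_eq_zero (by rw [← this]; abel)

lemma nsq_le (h : IsExpSp (fromBlocks P Q R S)) (a b : Fin n → ℂ) :
    nsq a - nsq b ≤ nsq (P *ᵥ a + Q *ᵥ b) - nsq (R *ᵥ a + S *ᵥ b) := by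
  have h1 := h.expand (Sum.elim a b)
  rw [fromBlocks_mulVec, hnorm_elim] at h1
  exact h1

/-- Expansion at (v, 0) with Pv = 0 would give |v|² ≤ -|Rv|². -/
lemma det_ne_zero (h : IsExpSp (fromBlocks P Q R S)) : P.det ≠ 0 := by
  intro hd
  obtain ⟨v, hv, hv0⟩ := Matrix.exists_mulVec_eq_zero_iff.2 hd
  have h1 := h.nsq_le v 0
  rw [hv0, mulVec_zero, mulVec_zero, add_zero, add_zero, nsq_zero] at h1
  exact hv (nsq_eq_zero (by linarith [nsq_nonneg (R *ᵥ v)]))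

/-- If Pv = -Rv, the two terms of the expanded form cancel and |v|² ≤ 0. -/
lemma det_add_ne_zero (h : IsExpSp (fromBlocks P Q R S)) : (P + R).det ≠ 0 := by
  intro hd
  obtain ⟨v, hv, hv0⟩ := Matrix.exists_mulVec_eq_zero_iff.2 hd
  have h1 := h.nsq_le v 0
  rw [add_mulVec] at hv0
  rw [eq_neg_of_add_eq_zero_left hv0, mulVec_zero, mulVec_zero, add_zero, add_zero, nsq_zero,
    nsq_neg] at h1
  exact hv (nsq_eq_zero (by linarith))

lemma inv_mul (h : IsExpSp (fromBlocks P Q R S)) : P⁻¹ * P = 1 :=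
  Matrix.nonsing_inv_mul _ (isUnit_iff_ne_zero.2 h.det_ne_zero)

lemma mul_inv (h : IsExpSp (fromBlocks P Q R S)) : P * P⁻¹ = 1 :=
  Matrix.mul_nonsing_inv _ (isUnit_iff_ne_zero.2 h.det_ne_zero)

lemma add_inv_mul (h : IsExpSp (fromBlocks P Q R S)) : (P + R)⁻¹ * (P + R) = 1 :=
  Matrix.nonsing_inv_mul _ (isUnit_iff_ne_zero.2 h.det_add_ne_zero)

lemma add_mul_inv (h : IsExpSp (fromBlocks P Q R S)) : (P + R) * (P + R)⁻¹ = 1 :=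
  Matrix.mul_nonsing_inv _ (isUnit_iff_ne_zero.2 h.det_add_ne_zero)

lemma tinv_mul (h : IsExpSp (fromBlocks P Q R S)) : P⁻¹ᵀ * Pᵀ = 1 := by
  rw [← transpose_mul, h.mul_inv, transpose_one]

lemma symm_RP (h : IsExpSp (fromBlocks P Q R S)) : (R * P⁻¹)ᵀ = R * P⁻¹ := by
  calc (R * P⁻¹)ᵀ = P⁻¹ᵀ * (Rᵀ * P) * P⁻¹ := by
        rw [transpose_mul]; simp only [Matrix.mul_assoc]; rw [h.mul_inv, Matrix.mul_one]
    _ = (P⁻¹ᵀ * Pᵀ) * R * P⁻¹ := by rw [← h.rel₁]; simp only [Matrix.mul_assoc]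
    _ = _ := by rw [h.tinv_mul, Matrix.one_mul]

/-- The symplectic relations identify the Schur complement of P, which eliminates S from the kernel
formulas. -/
lemma schur (h : IsExpSp (fromBlocks P Q R S)) : S - R * P⁻¹ * Q = P⁻¹ᵀ := by
  calc S - R * P⁻¹ * Q = (P⁻¹ᵀ * Pᵀ) * S - (R * P⁻¹)ᵀ * Q := by
        rw [h.symm_RP, h.tinv_mul, Matrix.one_mul]
    _ = P⁻¹ᵀ * (Pᵀ * S - Rᵀ * Q) := by
        rw [transpose_mul, Matrix.mul_sub]; simp only [Matrix.mul_assoc]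
    _ = _ := by rw [h.rel₂, Matrix.mul_one]

lemma S_eq (h : IsExpSp (fromBlocks P Q R S)) : S = P⁻¹ᵀ + R * P⁻¹ * Q := by
  rw [← h.schur]; abel

lemma symm_PQ (h : IsExpSp (fromBlocks P Q R S)) : (P⁻¹ * Q)ᵀ = P⁻¹ * Q := by
  have h1 := h.rel₃
  rw [h.S_eq, transpose_add, transpose_mul (R * P⁻¹), h.symm_RP, transpose_transpose,
    Matrix.mul_add, Matrix.add_mul] at h1
  rw [transpose_mul]
  have h2 : Qᵀ * (R * P⁻¹ * Q) = Qᵀ * (R * P⁻¹) * Q := by simp only [Matrix.mul_assoc]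
  rw [h2] at h1
  exact add_right_cancel h1

lemma nsq_RP_le (h : IsExpSp (fromBlocks P Q R S)) (v : Fin n → ℂ) :
    nsq ((R * P⁻¹) *ᵥ v) ≤ nsq v := by
  have h1 := h.nsq_le (P⁻¹ *ᵥ v) 0
  rw [mulVec_mulVec, h.mul_inv, one_mulVec, mulVec_zero, mulVec_zero, add_zero, add_zero,
    nsq_zero, mulVec_mulVec] at h1
  linarith [nsq_nonneg (P⁻¹ *ᵥ v)]

/-- Expansion is applied to (-P⁻¹Qv, v), whose image has first component zero. -/
lemma nsq_PQ_le (h : IsExpSp (fromBlocks P Q R S)) (v : Fin n → ℂ) :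
    nsq ((P⁻¹ * Q) *ᵥ v) ≤ nsq v := by
  have h1 := h.nsq_le (-((P⁻¹ * Q) *ᵥ v)) v
  rw [mulVec_neg _ P, mulVec_mulVec, ← Matrix.mul_assoc, h.mul_inv, Matrix.one_mul,
    neg_add_cancel, nsq_zero, nsq_neg] at h1
  linarith [nsq_nonneg (R *ᵥ -((P⁻¹ * Q) *ᵥ v) + S *ᵥ v)]

lemma symm_A (h : IsExpSp (fromBlocks P Q R S)) : ((P - R) * (P + R)⁻¹).IsSymm := by
  have h1 : (P + R)ᵀ * (P - R) = (P - R)ᵀ * (P + R) := by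
    have := h.rel₁
    simp only [transpose_add, transpose_sub, Matrix.add_mul, Matrix.sub_mul, Matrix.mul_add,
      Matrix.mul_sub, this]
    abel
  have h2 : ((P + R)⁻¹)ᵀ * (P + R)ᵀ = 1 := by
    rw [← transpose_mul, h.add_mul_inv, transpose_one]
  calc ((P - R) * (P + R)⁻¹)ᵀ = ((P + R)⁻¹)ᵀ * ((P - R)ᵀ * (P + R)) * (P + R)⁻¹ := by
        rw [transpose_mul]; simp only [Matrix.mul_assoc]; rw [h.add_mul_inv, Matrix.mul_one]
    _ = (((P + R)⁻¹)ᵀ * (P + R)ᵀ) * (P - R) * (P + R)⁻¹ := by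
        rw [← h1]; simp only [Matrix.mul_assoc]
    _ = _ := by rw [h2, Matrix.one_mul]

/-- With x = (P + R)u real, the real part of the form is |Pu|² - |Ru|², which is at least |u|² by
expansion. This keeps the evolved coherent states square integrable. -/
lemma gpos_A (h : IsExpSp (fromBlocks P Q R S)) : GPos ((P - R) * (P + R)⁻¹) := by
  refine ⟨h.symm_A, fun x hx => ?_⟩
  set u := (P + R)⁻¹ *ᵥ cvec x with hu
  have hx' : cvec x = P *ᵥ u + R *ᵥ u := by
    rw [hu, ← add_mulVec, mulVec_mulVec, h.add_mul_inv, one_mulVec]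
  have h1 := h.nsq_le u 0
  rw [mulVec_zero, mulVec_zero, add_zero, add_zero, nsq_zero, sub_zero] at h1
  have h2 : (cvec x ⬝ᵥ (((P - R) * (P + R)⁻¹) *ᵥ cvec x)).re = nsq (P *ᵥ u) - nsq (R *ᵥ u) := by
    have hs : cvec x = star (cvec x) := by ext i; simp [cvec]
    rw [← mulVec_mulVec, ← hu, hs, hx', sub_mulVec]
    generalize P *ᵥ u = a
    generalize R *ᵥ u = b
    simp only [dotProduct, nsq, Complex.re_sum, ← Finset.sum_sub_distrib]
    refine Finset.sum_congr rfl fun j _ => ?_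
    rw [← Complex.normSq_eq_norm_sq, ← Complex.normSq_eq_norm_sq]
    simp [Complex.normSq_apply]
    ring
  rw [h2]
  refine lt_of_lt_of_le ?_ h1
  by_contra hneg
  have hu0 := nsq_eq_zero (not_lt.1 hneg)
  rw [hu0, mulVec_zero, mulVec_zero, add_zero] at hx'
  exact hx (funext fun i => by simpa [cvec] using congrFun hx' i)

lemma A_add_one (h : IsExpSp (fromBlocks P Q R S)) :
    (P - R) * (P + R)⁻¹ + 1 = (2 : ℂ) • (P * (P + R)⁻¹) := by
  rw [← h.add_mul_inv, ← Matrix.add_mul, ← Matrix.smul_mul]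
  congr 1
  module

lemma gpos_A_add_one (h : IsExpSp (fromBlocks P Q R S)) : GPos ((P - R) * (P + R)⁻¹ + 1) := by
  have h1 := h.gpos_A
  refine ⟨by rw [IsSymm, transpose_add, h1.symm, transpose_one], fun x hx => ?_⟩
  rw [add_mulVec, dotProduct_add, Complex.add_re, one_mulVec, cvec_dot, ofReal_re]
  have h0 : 0 ≤ x ⬝ᵥ x := Finset.sum_nonneg fun i _ => mul_self_nonneg _
  linarith [h1.pos x hx]

lemma A_add_one_mul (h : IsExpSp (fromBlocks P Q R S)) :
    ((P - R) * (P + R)⁻¹ + 1) * ((2⁻¹ : ℂ) • ((P + R) * P⁻¹)) = 1 := by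
  rw [h.A_add_one, Matrix.smul_mul, Matrix.mul_smul, smul_smul, Matrix.mul_assoc,
    ← Matrix.mul_assoc (P + R)⁻¹, h.add_inv_mul, Matrix.one_mul, h.mul_inv]
  norm_num

lemma det_A_add_one (h : IsExpSp (fromBlocks P Q R S)) :
    ((P - R) * (P + R)⁻¹ + 1).det * (P + R).det = 2 ^ n * P.det := by
  rw [h.A_add_one, ← det_mul, Matrix.smul_mul, Matrix.mul_assoc, h.add_inv_mul, Matrix.mul_one,
    det_smul, Fintype.card_fin]

lemma add_inv_mul_add (h : IsExpSp (fromBlocks P Q R S)) :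
    (P + R)⁻¹ * (Q + S) = (P + R)⁻¹ * P⁻¹ᵀ + P⁻¹ * Q := by
  have h1 : Q + S = P⁻¹ᵀ + (P + R) * (P⁻¹ * Q) := by
    conv_lhs => rw [h.S_eq]
    rw [Matrix.add_mul, ← Matrix.mul_assoc P, h.mul_inv, Matrix.one_mul]
    simp only [Matrix.mul_assoc]
    abel
  rw [h1, Matrix.mul_add, ← Matrix.mul_assoc, h.add_inv_mul, Matrix.one_mul]

end IsExpSp

end Blocks

set_option linter.unusedSimpArgs false

/-! ### Gaussian integrals over `ℂⁿ` -/

section ComplexGaussian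

variable {n : ℕ}

/-- The vector `(w, w̄)`. -/
def hat (w : Fin n → ℂ) : Idx n → ℂ := Sum.elim w (star w)

/-- The complex vector `x + i y`. -/
def toC (v : Idx n → ℝ) : Fin n → ℂ := fun j => (v (Sum.inl j) : ℂ) + I * (v (Sum.inr j) : ℂ)

lemma hat_toC (v : Idx n → ℝ) : hat (toC v) = cayleyU n *ᵥ cvec v := by
  have hv : cvec v = Sum.elim (fun j => (v (Sum.inl j) : ℂ)) (fun j => (v (Sum.inr j) : ℂ)) := by
    ext (j | j) <;> rfl
  rw [hv, cayleyU, fromBlocks_mulVec, hat]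
  congr 1
  · ext j
    simp [toC, smul_mulVec, Function.comp_def]
  · ext j
    simp [toC, smul_mulVec, Function.comp_def, neg_mulVec]

lemma toC_ne_zero {v : Idx n → ℝ} (hv : v ≠ 0) : toC v ≠ 0 := by
  intro h
  refine hv (funext fun i => ?_)
  rcases i with j | j
  · simpa [toC] using congrArg Complex.re (congrFun h j)
  · simpa [toC] using congrArg Complex.im (congrFun h j)

lemma integral_pi_complex (f : (Fin n → ℂ) → ℂ) :
    ∫ w : Fin n → ℂ, f w = ∫ v : Idx n → ℝ, f (toC v) := by
  let e1 := MeasurableEquiv.sumPiEquivProdPi (fun _ : Idx n => ℝ)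
  have h1 : MeasurePreserving e1 := volume_measurePreserving_sumPiEquivProdPi _
  let e2 := (MeasurableEquiv.arrowProdEquivProdArrow ℝ ℝ (Fin n)).symm
  have h2 : MeasurePreserving e2 :=
    (volume_measurePreserving_arrowProdEquivProdArrow ℝ ℝ (Fin n)).symm _
  let e3 : (Fin n → ℝ × ℝ) ≃ᵐ (Fin n → ℂ) :=
    MeasurableEquiv.piCongrRight fun _ => Complex.measurableEquivRealProd.symm
  have h3 : MeasurePreserving e3 :=
    volume_preserving_pi fun _ => Complex.volume_preserving_equiv_real_prod.symm
  have h := (h3.comp (h2.comp h1)).integral_comp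
    (((e1.trans e2).trans e3).measurableEmbedding) f
  rw [← h]
  refine integral_congr_ae (Filter.Eventually.of_forall fun v => ?_)
  simp only [Function.comp]
  congr 1
  ext j
  change (⟨v (Sum.inl j), v (Sum.inr j)⟩ : ℂ) = _
  rw [Complex.mk_eq_add_mul_I]
  simp [toC, mul_comm]

/-- Complex symmetric matrices whose quadratic form has positive real part on the vectors
`(w, w̄)`. -/
structure CPos (B : Matrix (Idx n) (Idx n) ℂ) : Prop where
  symm : B.IsSymm
  pos : ∀ w : Fin n → ℂ, w ≠ 0 → 0 < (hat w ⬝ᵥ (B *ᵥ hat w)).re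

lemma conj_quad (B : Matrix (Idx n) (Idx n) ℂ) (v : Idx n → ℝ) :
    cvec v ⬝ᵥ (((cayleyU n)ᵀ * B * cayleyU n) *ᵥ cvec v) = hat (toC v) ⬝ᵥ (B *ᵥ hat (toC v)) := by
  rw [hat_toC, ← mulVec_mulVec, ← mulVec_mulVec, mulVec_transpose, dotProduct_comm (cvec v),
    ← dotProduct_mulVec, dotProduct_comm]

lemma CPos.gpos {B : Matrix (Idx n) (Idx n) ℂ} (hB : CPos B) :
    GPos ((cayleyU n)ᵀ * B * cayleyU n) := by
  refine ⟨?_, fun v hv => ?_⟩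
  · rw [IsSymm, transpose_mul, transpose_mul, transpose_transpose, hB.symm, Matrix.mul_assoc]
  · rw [conj_quad]
    exact hB.pos _ (toC_ne_zero hv)

lemma CPos.integral_eq {B : Matrix (Idx n) (Idx n) ℂ} (hB : CPos B) {l u : Idx n → ℂ}
    (hu : B *ᵥ u = l) :
    ∫ w : Fin n → ℂ, Complex.exp (-(hat w ⬝ᵥ (B *ᵥ hat w)) / 2 + l ⬝ᵥ hat w) =
      gint ((cayleyU n)ᵀ * B * cayleyU n) * Complex.exp (l ⬝ᵥ u / 2) := by
  rw [integral_pi_complex]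
  have h1 := hB.gpos.integral_eq (l := (cayleyU n)ᵀ *ᵥ l) (w := (cayleyU n)⁻¹ *ᵥ u) (by
    rw [mulVec_mulVec, Matrix.mul_assoc, cayleyU_mul_inv, Matrix.mul_one, ← mulVec_mulVec, hu])
  have h2 : ((cayleyU n)ᵀ *ᵥ l) ⬝ᵥ ((cayleyU n)⁻¹ *ᵥ u) = l ⬝ᵥ u := by
    rw [mulVec_transpose, ← dotProduct_mulVec, mulVec_mulVec, cayleyU_mul_inv, one_mulVec]
  rw [h2] at h1
  rw [← h1]
  refine integral_congr_ae (Filter.Eventually.of_forall fun v => ?_)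
  simp only
  rw [conj_quad, hat_toC, mulVec_transpose, ← dotProduct_mulVec]

lemma re_dot_star_self (w : Fin n → ℂ) : (w ⬝ᵥ star w).re = nsq w := by
  simp only [dotProduct, nsq, Complex.re_sum]
  refine Finset.sum_congr rfl fun j _ => ?_
  rw [← Complex.normSq_eq_norm_sq, Complex.normSq_apply]
  simp

lemma nsq_sub (a b : Fin n → ℂ) : nsq (a - b) = nsq a + nsq b - 2 * (star b ⬝ᵥ a).re := by
  simp only [dotProduct, nsq, Complex.re_sum, ← Finset.sum_sub_distrib, ← Finset.sum_add_distrib,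
    Finset.mul_sum]
  refine Finset.sum_congr rfl fun j _ => ?_
  rw [← Complex.normSq_eq_norm_sq, ← Complex.normSq_eq_norm_sq, ← Complex.normSq_eq_norm_sq,
    Complex.normSq_apply, Complex.normSq_apply, Complex.normSq_apply]
  simp
  ring

/-- The matrix of the Gaussian `exp (½ |w|² - ¼ w σ w)`. -/
def repMat (σ : Matrix (Fin n) (Fin n) ℂ) : Matrix (Idx n) (Idx n) ℂ :=
  (2⁻¹ : ℂ) • fromBlocks (-σ) 1 1 0

lemma repMat_quad (σ : Matrix (Fin n) (Fin n) ℂ) (w : Fin n → ℂ) :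
    hat w ⬝ᵥ (repMat σ *ᵥ hat w) = w ⬝ᵥ star w - w ⬝ᵥ (σ *ᵥ w) / 2 := by
  rw [repMat, hat, smul_mulVec, fromBlocks_mulVec, dotProduct_smul, sumElim_dotProduct_sumElim]
  simp only [Sum.elim_comp_inl, Sum.elim_comp_inr, one_mulVec, zero_mulVec, neg_mulVec, add_zero,
    dotProduct_add, dotProduct_neg, smul_eq_mul, dotProduct_comm (star w) w]
  ring

/-- From |σw - w̄|² ≥ 0 and |σw| ≤ |w| follows Re wσw ≤ |w|². Only half of this is subtracted from
|w|², which leaves at least |w|²/2. -/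
lemma cpos_repMat {σ : Matrix (Fin n) (Fin n) ℂ} (hσ : σᵀ = σ)
    (hn : ∀ v, nsq (σ *ᵥ v) ≤ nsq v) : CPos (repMat σ) := by
  refine ⟨by simp [IsSymm, repMat, fromBlocks_transpose, hσ], fun w hw => ?_⟩
  rw [repMat_quad, Complex.sub_re, re_dot_star_self]
  have h1 : (w ⬝ᵥ (σ *ᵥ w) / 2).re = (w ⬝ᵥ (σ *ᵥ w)).re / 2 := by simp
  have h2 := nsq_sub (σ *ᵥ w) (star w)
  rw [star_star, nsq_star] at h2
  have h3 : 0 < nsq w := by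
    by_contra h; exact hw (nsq_eq_zero (not_lt.1 h))
  rw [h1]
  linarith [nsq_nonneg (σ *ᵥ w - star w), hn w]

/-- The matrix exchanging the two blocks. -/
def swapM (n : ℕ) : Matrix (Idx n) (Idx n) ℂ := fromBlocks 0 1 1 0

lemma fromBlocks_sub (A B C D A' B' C' D' : Matrix (Fin n) (Fin n) ℂ) :
    fromBlocks A B C D - fromBlocks A' B' C' D' =
      fromBlocks (A - A') (B - B') (C - C') (D - D') := by
  rw [sub_eq_add_neg, fromBlocks_neg, fromBlocks_add]
  simp only [← sub_eq_add_neg]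

/-- Only this combination of determinants is needed, so neither determinant has to be evaluated. The
second identity also identifies the base point of the deformations as a multiple of 1. -/
lemma det_swap_mul_det_cayleyU : (cayleyU n).det ^ 2 * (swapM n).det = 4 ^ n ∧ (cayleyU n)ᵀ * swapM
    n * cayleyU n = (2 : ℂ) • 1 := by
  have h1 : (cayleyU n)ᵀ * swapM n * cayleyU n = (2 : ℂ) • 1 := by
    rw [cayleyU, swapM, fromBlocks_transpose, fromBlocks_multiply, fromBlocks_multiply,
      ← fromBlocks_one, fromBlocks_smul]
    congr 1 <;>
    · ext i j
      simp [Matrix.one_apply]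
      try split_ifs <;> ring
  refine ⟨?_, h1⟩
  have h2 := congrArg det h1
  rw [det_mul, det_mul, det_transpose, det_smul, det_one, Fintype.card_sum, Fintype.card_fin] at h2
  rw [sq, mul_assoc, mul_comm _ (det _), ← mul_assoc, h2, ← two_mul, pow_mul]
  norm_num

/-- Up to the block swap the matrix is unitriangular, so σ does not affect the determinant. -/
lemma det_repMat (σ : Matrix (Fin n) (Fin n) ℂ) :
    ((cayleyU n)ᵀ * repMat σ * cayleyU n).det = 1 := by
  have h1 : fromBlocks (-σ) 1 1 0 = swapM n * fromBlocks 1 0 (-σ) 1 := by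
    simp [swapM, fromBlocks_multiply]
  have h2 := (det_swap_mul_det_cayleyU (n := n)).1
  rw [det_mul, det_mul, det_transpose, repMat, det_smul, h1, det_mul, det_fromBlocks_zero₁₂,
    Fintype.card_sum, Fintype.card_fin, det_one, mul_one, mul_one]
  have h3 : (2⁻¹ : ℂ) ^ (n + n) * 4 ^ n = 1 := by
    rw [← two_mul, pow_mul, ← mul_pow]; norm_num
  calc _ = (2⁻¹ : ℂ) ^ (n + n) * ((cayleyU n).det ^ 2 * (swapM n).det) := by ring
    _ = 1 := by rw [h2, h3]

/-- The determinant is 1 for every σ, so the square of the integral is constant along sσ, 0 ≤ s ≤ 1.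
Continuity carries the value at σ = 0 to the end. -/
lemma gint_repMat {σ : Matrix (Fin n) (Fin n) ℂ} (hσ : σᵀ = σ)
    (hn : ∀ v, nsq (σ *ᵥ v) ≤ nsq v) :
    gint ((cayleyU n)ᵀ * repMat σ * cayleyU n) = (2 * Real.pi) ^ n := by
  let F : ℝ → Matrix (Idx n) (Idx n) ℂ := fun s =>
    (cayleyU n)ᵀ * repMat ((s : ℂ) • σ) * cayleyU n
  have hF : Continuous F := by
    have h1 : Continuous fun s : ℝ => repMat ((s : ℂ) • σ) := by
      unfold repMat
      refine Continuous.const_smul ?_ (2⁻¹ : ℂ)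
      refine Continuous.matrix_fromBlocks ?_ continuous_const continuous_const continuous_const
      exact (Complex.continuous_ofReal.smul continuous_const).neg
    exact (continuous_const.matrix_mul h1).matrix_mul continuous_const
  have hpos : ∀ s ∈ Set.Icc (0 : ℝ) 1, GPos (F s) := by
    intro s hs
    refine (cpos_repMat (by rw [transpose_smul, hσ]) fun v => ?_).gpos
    have h1 : nsq (((s : ℂ) • σ) *ᵥ v) = s ^ 2 * nsq (σ *ᵥ v) := by
      simp only [nsq, Finset.mul_sum, smul_mulVec, Pi.smul_apply, norm_smul, mul_pow,
        Complex.norm_real, Real.norm_eq_abs, sq_abs]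
    rw [h1]
    have h2 : s ^ 2 ≤ 1 := by nlinarith [hs.1, hs.2]
    nlinarith [hn v, nsq_nonneg (σ *ᵥ v)]
  have hcont : ContinuousOn (fun s => gint (F s)) (Set.Icc 0 1) := fun s hs =>
    ((hpos s hs).tendsto_gint (hF.tendsto s)).mono_left nhdsWithin_le_nhds
  have hsq : ∀ s ∈ Set.Icc (0 : ℝ) 1, gint (F s) ^ 2 = ((2 * Real.pi : ℂ) ^ n) ^ 2 := by
    intro s hs
    have := (hpos s hs).gint_sq
    rw [det_repMat, mul_one, Fintype.card_sum, Fintype.card_fin] at this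
    rw [this, ← pow_mul]; ring_nf
  have hpi : (2 * Real.pi : ℂ) ≠ 0 := by
    have := Real.pi_ne_zero; exact_mod_cast (by positivity : (2 * Real.pi : ℝ) ≠ 0)
  have h0 : gint (F 0) = (2 * Real.pi : ℂ) ^ n := by
    have : F 0 = ((1 : ℝ) : ℂ) • (1 : Matrix (Idx n) (Idx n) ℂ) := by
      simp only [F, repMat, ofReal_zero, zero_smul, neg_zero, Matrix.mul_smul, Matrix.smul_mul]
      change (2⁻¹ : ℂ) • ((cayleyU n)ᵀ * swapM n * cayleyU n) = _
      rw [(det_swap_mul_det_cayleyU (n := n)).2, smul_smul]; norm_num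
    rw [this, gint_smul_one one_pos n (by rw [Fintype.card_sum, Fintype.card_fin]; ring)]
    simp
  have := (isPreconnected_Icc (a := (0 : ℝ)) (b := 1)).eq_of_sq_eq hcont continuousOn_const
    (fun s hs => hsq s hs) (fun _ => pow_ne_zero _ hpi) (Set.left_mem_Icc.2 zero_le_one) h0
  have h1 := this (Set.right_mem_Icc.2 zero_le_one)
  simpa [F] using h1

/-- The reproducing property of the Fock space, for Gaussians. -/
lemma integral_reproducing {σ : Matrix (Fin n) (Fin n) ℂ} (hσ : σᵀ = σ)
    (hn : ∀ v, nsq (σ *ᵥ v) ≤ nsq v) (b z : Fin n → ℂ) :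
    ∫ w : Fin n → ℂ, Complex.exp (w ⬝ᵥ (σ *ᵥ w) / 4 + b ⬝ᵥ w + (z ⬝ᵥ star w) / 2
      - (w ⬝ᵥ star w) / 2) = (2 * Real.pi) ^ n * Complex.exp (z ⬝ᵥ (σ *ᵥ z) / 4 + b ⬝ᵥ z) := by
  have h := (cpos_repMat hσ hn).integral_eq
    (l := Sum.elim b ((2⁻¹ : ℂ) • z)) (u := Sum.elim z ((2 : ℂ) • b + σ *ᵥ z)) (by
      rw [repMat, smul_mulVec, fromBlocks_mulVec]
      ext (j | j)
      · simp [neg_mulVec]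
      · simp)
  rw [gint_repMat hσ hn] at h
  simp_rw [repMat_quad] at h
  convert h using 1
  · refine integral_congr_ae (Filter.Eventually.of_forall fun w => ?_)
    simp only [hat, sumElim_dotProduct_sumElim, smul_dotProduct, smul_eq_mul]
    congr 1
    ring
  · congr 2
    simp only [sumElim_dotProduct_sumElim, smul_dotProduct, dotProduct_smul, dotProduct_add,
      smul_eq_mul, dotProduct_comm z b]
    ring

end ComplexGaussian

/-! ### The Weyl integral of a Gaussian kernel -/

section Weyl

variable {n : ℕ}

/-- The exponent of the kernel attached to `k = (P Q; R S)`. -/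
def expK (P Q R : Matrix (Fin n) (Fin n) ℂ) (z w : Fin n → ℂ) : ℂ :=
  (z ⬝ᵥ ((R * P⁻¹) *ᵥ z) + 2 * ((P⁻¹ *ᵥ z) ⬝ᵥ star w) - star w ⬝ᵥ ((P⁻¹ * Q) *ᵥ star w)) / 4

/-- The matrix of the Gaussian in the Weyl integral. -/
def weylMat (P Q R : Matrix (Fin n) (Fin n) ℂ) : Matrix (Idx n) (Idx n) ℂ :=
  (2⁻¹ : ℂ) • fromBlocks (-(R * P⁻¹)) (1 + P⁻¹ᵀ) (1 + P⁻¹) (P⁻¹ * Q)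

/-- The matrix of the linear term in the Weyl integral. -/
def weylLin (P Q R : Matrix (Fin n) (Fin n) ℂ) : Matrix (Idx n) (Idx n) ℂ :=
  (2⁻¹ : ℂ) • fromBlocks (R * P⁻¹) (P⁻¹ᵀ - 1) (1 - P⁻¹) (P⁻¹ * Q)

/-- The constant term in the Weyl integral. -/
def weylConst (P Q R : Matrix (Fin n) (Fin n) ℂ) : Matrix (Idx n) (Idx n) ℂ :=
  (2⁻¹ : ℂ) • fromBlocks (R * P⁻¹) (P⁻¹ᵀ - 1) (P⁻¹ - 1) (-(P⁻¹ * Q))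

variable {P Q R S : Matrix (Fin n) (Fin n) ℂ}

lemma weyl_exponent (h : IsExpSp (fromBlocks P Q R S)) (z w : Fin n → ℂ) :
    expK P Q R (z + w) (z - w) +
      (-(z ⬝ᵥ star z) - w ⬝ᵥ star w + z ⬝ᵥ star w - star z ⬝ᵥ w) / 2 =
    (-(hat w ⬝ᵥ (weylMat P Q R *ᵥ hat w)) / 2 + (weylLin P Q R *ᵥ hat z) ⬝ᵥ hat w) +
      hat z ⬝ᵥ (weylConst P Q R *ᵥ hat z) / 2 := by
  have c1 : ∀ a b : Fin n → ℂ, a ⬝ᵥ ((R * P⁻¹) *ᵥ b) = b ⬝ᵥ ((R * P⁻¹) *ᵥ a) := fun a b => by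
    conv_lhs => rw [← h.symm_RP, mulVec_transpose, dotProduct_comm, ← dotProduct_mulVec]
  have c2 : ∀ a b : Fin n → ℂ, a ⬝ᵥ ((P⁻¹ * Q) *ᵥ b) = b ⬝ᵥ ((P⁻¹ * Q) *ᵥ a) := fun a b => by
    conv_lhs => rw [← h.symm_PQ, mulVec_transpose, dotProduct_comm, ← dotProduct_mulVec]
  have c3 : ∀ a b : Fin n → ℂ, a ⬝ᵥ (P⁻¹ᵀ *ᵥ b) = b ⬝ᵥ (P⁻¹ *ᵥ a) := fun a b => by
    rw [mulVec_transpose, dotProduct_comm, ← dotProduct_mulVec]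
  rw [expK, weylMat, weylLin, weylConst, hat, hat]
  simp only [smul_mulVec, fromBlocks_mulVec, Sum.elim_comp_inl, Sum.elim_comp_inr,
    dotProduct_smul, smul_dotProduct, sumElim_dotProduct_sumElim, smul_eq_mul,
    add_mulVec, sub_mulVec, neg_mulVec, one_mulVec, dotProduct_add, add_dotProduct, dotProduct_sub,
    sub_dotProduct, dotProduct_neg, star_sub, mulVec_add, mulVec_sub]
  rw [dotProduct_comm ((R * P⁻¹) *ᵥ z) w, dotProduct_comm (P⁻¹ᵀ *ᵥ star z) w,
    dotProduct_comm ((P⁻¹ * Q) *ᵥ star z) (star w), c1 w z, c2 (star w) (star z), c3, c3, c3,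
    dotProduct_comm (P⁻¹ *ᵥ z), dotProduct_comm (P⁻¹ *ᵥ z), dotProduct_comm (P⁻¹ *ᵥ w),
    dotProduct_comm (P⁻¹ *ᵥ w), dotProduct_comm (star w) w, dotProduct_comm (star z) z]
  ring

/-- Locates the stationary point of the Weyl Gaussian without inverting its matrix: if ẑ = (k+1)y,
then (k-1)y solves the equation with right-hand side `weylLin` applied to ẑ. -/
lemma weylMat_mul (h : IsExpSp (fromBlocks P Q R S)) :
    weylMat P Q R * (fromBlocks P Q R S - 1) = weylLin P Q R * (fromBlocks P Q R S + 1) := by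
  have h1 : R * P⁻¹ * P = R := by rw [Matrix.mul_assoc, h.inv_mul, Matrix.mul_one]
  have h2 : P⁻¹ * Q * R = P⁻¹ * (Q * R) := by rw [Matrix.mul_assoc]
  have h3 := h.schur
  rw [weylMat, weylLin, Matrix.smul_mul, Matrix.smul_mul, ← fromBlocks_one, fromBlocks_sub,
    fromBlocks_add, fromBlocks_multiply, fromBlocks_multiply]
  congr 2
  · simp only [Matrix.mul_sub, Matrix.mul_add, Matrix.add_mul, Matrix.sub_mul, Matrix.neg_mul,
      Matrix.mul_one, Matrix.one_mul, sub_zero, add_zero, h1]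
    abel
  · simp only [Matrix.mul_sub, Matrix.mul_add, Matrix.add_mul, Matrix.sub_mul, Matrix.neg_mul,
      Matrix.mul_one, Matrix.one_mul, sub_zero, add_zero]
    have h4 : R * P⁻¹ * Q = S - P⁻¹ᵀ := by rw [← h3]; abel
    rw [h4]
    abel
  · simp only [Matrix.mul_sub, Matrix.mul_add, Matrix.add_mul, Matrix.sub_mul, Matrix.neg_mul,
      Matrix.mul_one, Matrix.one_mul, sub_zero, add_zero, h.inv_mul]
    abel
  · simp only [Matrix.mul_sub, Matrix.mul_add, Matrix.add_mul, Matrix.sub_mul, Matrix.neg_mul,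
      Matrix.mul_one, Matrix.one_mul, sub_zero, add_zero]
    abel

/-- Evaluates the exponent at that stationary point: the linear and constant contributions combine
into ẑJ(k-1)y. -/
lemma weylLin_mul (h : IsExpSp (fromBlocks P Q R S)) :
    (weylLin P Q R)ᵀ * (fromBlocks P Q R S - 1) + weylConst P Q R * (fromBlocks P Q R S + 1) =
      stdJ n * (fromBlocks P Q R S - 1) := by
  have h1 : R * P⁻¹ * P = R := by rw [Matrix.mul_assoc, h.inv_mul, Matrix.mul_one]
  have h3 := h.schur
  have h4 : R * P⁻¹ * Q = S - P⁻¹ᵀ := by rw [← h3]; abel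
  rw [weylLin, weylConst, stdJ, transpose_smul, fromBlocks_transpose, h.symm_RP, h.symm_PQ,
    transpose_sub, transpose_sub, transpose_one, transpose_transpose,
    Matrix.smul_mul, Matrix.smul_mul, ← smul_add, ← fromBlocks_one, fromBlocks_sub,
    fromBlocks_add, fromBlocks_multiply, fromBlocks_multiply, fromBlocks_multiply, fromBlocks_add,
    fromBlocks_smul]
  have hk : ∀ A B : Matrix (Fin n) (Fin n) ℂ, A = (2 : ℂ) • B → (2⁻¹ : ℂ) • A = B := by
    rintro A B rfl; rw [smul_smul]; norm_num
  congr 1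
  · apply hk
    simp only [Matrix.mul_sub, Matrix.mul_add, Matrix.add_mul, Matrix.sub_mul, Matrix.neg_mul,
      Matrix.mul_one, Matrix.one_mul, Matrix.zero_mul, Matrix.mul_zero, sub_zero, add_zero,
      zero_add, h1]
    module
  · apply hk
    simp only [Matrix.mul_sub, Matrix.mul_add, Matrix.add_mul, Matrix.sub_mul, Matrix.neg_mul,
      Matrix.mul_one, Matrix.one_mul, Matrix.zero_mul, Matrix.mul_zero, sub_zero, add_zero,
      zero_add, h4]
    module
  · apply hk
    simp only [Matrix.mul_sub, Matrix.mul_add, Matrix.add_mul, Matrix.sub_mul, Matrix.neg_mul,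
      Matrix.mul_one, Matrix.one_mul, Matrix.zero_mul, Matrix.mul_zero, sub_zero, add_zero,
      zero_add, h.inv_mul]
    module
  · apply hk
    simp only [Matrix.mul_sub, Matrix.mul_add, Matrix.add_mul, Matrix.sub_mul, Matrix.neg_mul,
      Matrix.mul_one, Matrix.one_mul, Matrix.zero_mul, Matrix.mul_zero, sub_zero, add_zero,
      zero_add]
    module

/-- The matrix k + 1 factors as (P 0; R 1) times the block swap times 2 `weylMat`; the rest is
bookkeeping of constants. -/
lemma det_weylMat (h : IsExpSp (fromBlocks P Q R S)) :
    ((cayleyU n)ᵀ * weylMat P Q R * cayleyU n).det * P.det = (fromBlocks P Q R S + 1).det := by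
  have h1 : fromBlocks P 0 R 1 * (swapM n *
      fromBlocks (-(R * P⁻¹)) (1 + P⁻¹ᵀ) (1 + P⁻¹) (P⁻¹ * Q)) = fromBlocks P Q R S + 1 := by
    have h4 : R * (P⁻¹ * Q) = S - P⁻¹ᵀ := by rw [← h.schur, ← Matrix.mul_assoc]; abel
    have h5 : P * (P⁻¹ * Q) = Q := by rw [← Matrix.mul_assoc, h.mul_inv, Matrix.one_mul]
    rw [swapM, ← fromBlocks_one, fromBlocks_add, fromBlocks_multiply, fromBlocks_multiply]
    congr 1
    · simp [Matrix.mul_add, h.mul_inv]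
    · simp [h5]
    · simp [Matrix.mul_add]
    · simp [h4]
  have h2 := congrArg det h1
  rw [det_mul, det_mul, det_fromBlocks_zero₁₂, det_one, mul_one] at h2
  have h3 := (det_swap_mul_det_cayleyU (n := n)).1
  have h4 : (2⁻¹ : ℂ) ^ (n + n) * 4 ^ n = 1 := by
    rw [← two_mul, pow_mul, ← mul_pow]; norm_num
  have h5 : (swapM n).det ^ 2 = 1 := by
    rw [swapM, sq, ← det_mul, fromBlocks_multiply]; simp
  rw [det_mul, det_mul, det_transpose, weylMat, det_smul, Fintype.card_sum, Fintype.card_fin]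
  set τ := (swapM n).det
  set u := (cayleyU n).det
  set b := (fromBlocks (-(R * P⁻¹)) (1 + P⁻¹ᵀ) (1 + P⁻¹) (P⁻¹ * Q)).det
  calc u * ((2⁻¹ : ℂ) ^ (n + n) * b) * u * P.det
      = (2⁻¹ : ℂ) ^ (n + n) * (u ^ 2 * τ) * (P.det * (τ * b)) +
        (2⁻¹ : ℂ) ^ (n + n) * u ^ 2 * P.det * b * (1 - τ ^ 2) := by ring
    _ = _ := by rw [h5, h3, h4, h2]; ring

/-- The matrix k sends (β, -w̄) to (w, α). Expansion of this vector gives |α|² + |β|² ≤ 2|w|², so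
the real part of the form is at least (|α - w̄|² + |β + w|²)/4. If it were not positive, both
squares would vanish and k would map (-w, -w̄) to (w, w̄), making -1 an eigenvalue. -/
lemma cpos_weylMat (h : IsExpSp (fromBlocks P Q R S)) (hd : (fromBlocks P Q R S + 1).det ≠ 0) :
    CPos (weylMat P Q R) := by
  refine ⟨?_, fun w hw => ?_⟩
  · rw [IsSymm, weylMat, transpose_smul, fromBlocks_transpose, transpose_neg, h.symm_RP, h.symm_PQ]
    simp
  · set β := P⁻¹ *ᵥ w + (P⁻¹ * Q) *ᵥ star w with hβ
    set α := (R * P⁻¹) *ᵥ w - P⁻¹ᵀ *ᵥ star w with hα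
    have e1 : hat w ⬝ᵥ (weylMat P Q R *ᵥ hat w) =
        w ⬝ᵥ star w - (w ⬝ᵥ α) / 2 + (star w ⬝ᵥ β) / 2 := by
      rw [weylMat, hat, hα, hβ]
      simp only [smul_mulVec, fromBlocks_mulVec, Sum.elim_comp_inl, Sum.elim_comp_inr,
        dotProduct_smul, sumElim_dotProduct_sumElim, smul_eq_mul,
        add_mulVec, neg_mulVec, one_mulVec, dotProduct_add, dotProduct_sub, dotProduct_neg,
        dotProduct_comm (star w) w]
      ring
    have e2 : P *ᵥ β + Q *ᵥ (-star w) = w := by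
      rw [hβ, mulVec_add, mulVec_mulVec, mulVec_mulVec, ← Matrix.mul_assoc, h.mul_inv,
        Matrix.one_mul, one_mulVec, mulVec_neg, add_neg_cancel_right]
    have e3 : R *ᵥ β + S *ᵥ (-star w) = α := by
      rw [hβ, hα, ← h.schur, mulVec_add, mulVec_mulVec, mulVec_mulVec, mulVec_neg, sub_mulVec,
        ← Matrix.mul_assoc]
      abel
    have h1 := h.nsq_le β (-star w)
    rw [e2, e3, nsq_neg, nsq_star] at h1
    have h2 := nsq_sub α (star w)
    have h3 := nsq_sub β (-w)
    rw [star_star, nsq_star] at h2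
    rw [nsq_neg, star_neg, neg_dotProduct, Complex.neg_re] at h3
    rw [e1, Complex.add_re, Complex.sub_re, re_dot_star_self]
    have h4 : ((w ⬝ᵥ α) / 2).re = (w ⬝ᵥ α).re / 2 := by simp
    have h5 : ((star w ⬝ᵥ β) / 2).re = (star w ⬝ᵥ β).re / 2 := by simp
    rw [h4, h5]
    by_contra hneg
    have h6 := nsq_nonneg (α - star w)
    have h7 := nsq_nonneg (β - -w)
    have h8 : α - star w = 0 := nsq_eq_zero (by linarith)
    have h9 : β - -w = 0 := nsq_eq_zero (by linarith)
    have h10 : (fromBlocks P Q R S + 1) *ᵥ (Sum.elim (-w) (-star w)) = 0 := by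
      rw [add_mulVec, one_mulVec, fromBlocks_mulVec, Sum.elim_comp_inl, Sum.elim_comp_inr,
        ← sub_eq_zero.1 h9, e2, e3, sub_eq_zero.1 h8, sub_eq_zero.1 h9]
      ext (j | j) <;> simp
    refine hd (Matrix.exists_mulVec_eq_zero_iff.1 ⟨_, fun h0 => hw ?_, h10⟩)
    ext j
    simpa using congrFun h0 (Sum.inl j)

/-- The Weyl integral of a Gaussian kernel. -/
lemma weyl_integral (h : IsExpSp (fromBlocks P Q R S)) (hd : (fromBlocks P Q R S + 1).det ≠ 0)
    (c : ℂ) (z : Fin n → ℂ) :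
    2 ^ n * ∫ w : Fin n → ℂ, c * Complex.exp (expK P Q R (z + w) (z - w)) *
      Complex.exp ((-(z ⬝ᵥ star z) - w ⬝ᵥ star w + z ⬝ᵥ star w - star z ⬝ᵥ w) / 2) *
      ((2 * Real.pi : ℂ) ^ n)⁻¹ =
    (2 ^ n * ((2 * Real.pi : ℂ) ^ n)⁻¹ * c * gint ((cayleyU n)ᵀ * weylMat P Q R * cayleyU n)) *
      Complex.exp (hat z ⬝ᵥ (stdJ n *ᵥ ((fromBlocks P Q R S - 1) *ᵥ
        ((fromBlocks P Q R S + 1)⁻¹ *ᵥ hat z))) / 2) := by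
  set k := fromBlocks P Q R S with hk
  set y := (k + 1)⁻¹ *ᵥ hat z with hy
  have hz : (k + 1) *ᵥ y = hat z := by
    rw [hy, mulVec_mulVec, Matrix.mul_nonsing_inv _ (isUnit_iff_ne_zero.2 hd), one_mulVec]
  have h1 : weylMat P Q R *ᵥ ((k - 1) *ᵥ y) = weylLin P Q R *ᵥ hat z := by
    rw [mulVec_mulVec, weylMat_mul h, ← mulVec_mulVec, ← hk, hz]
  have h2 := (cpos_weylMat h hd).integral_eq h1
  have h3 : hat z ⬝ᵥ (stdJ n *ᵥ ((k - 1) *ᵥ y)) =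
      (weylLin P Q R *ᵥ hat z) ⬝ᵥ ((k - 1) *ᵥ y) + hat z ⬝ᵥ (weylConst P Q R *ᵥ hat z) := by
    rw [mulVec_mulVec, ← weylLin_mul h, add_mulVec, dotProduct_add, ← mulVec_mulVec,
      ← mulVec_mulVec, ← hk, hz, dotProduct_mulVec, vecMul_transpose]
  rw [h3, add_div, Complex.exp_add, ← mul_assoc, mul_assoc _ (gint _), mul_assoc _ (gint _ * _),
    ← h2]
  rw [← integral_mul_const, ← integral_const_mul, ← integral_const_mul]
  refine integral_congr_ae (Filter.Eventually.of_forall fun w => ?_)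
  simp only
  have h4 := weyl_exponent h z w
  have h5 : ∀ a b : ℂ, c * Complex.exp a * Complex.exp b = c * Complex.exp (a + b) := fun a b => by
    rw [Complex.exp_add]; ring
  rw [h5, h4, Complex.exp_add]
  ring

end Weyl

/-! ### The Weyl symbol of the quantized flow -/

/-- A logarithm exists by lifting through the covering exp : ℂ → ℂ∖{0}; halving it gives the root.
-/
lemma exists_continuous_sqrt {A : Type*} [TopologicalSpace A] [SimplyConnectedSpace A]
    [LocallyPathConnectedSpace A] {f : A → ℂ} (hf : Continuous f) (hne : ∀ a, f a ≠ 0) {a₀ : A}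
    (h0 : f a₀ = 1) : ∃ g : A → ℂ, Continuous g ∧ g a₀ = 1 ∧ ∀ a, g a ^ 2 = f a := by
  obtain ⟨F, ⟨hF0, hF⟩, -⟩ := Complex.isCoveringMap_exp.existsUnique_continuousMap_lifts
    (⟨fun a => ⟨f a, hne a⟩, hf.subtype_mk _⟩ : C(A, {z : ℂ // z ≠ 0})) a₀ 0
    (Subtype.ext (by simp [h0]))
  refine ⟨fun a => Complex.exp (F a / 2), by fun_prop, by simp [hF0], fun a => ?_⟩
  rw [← Complex.exp_nat_mul]
  have := congrArg Subtype.val (congrFun hF a)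
  simp only [Function.comp] at this
  push_cast
  rw [mul_div_cancel₀ _ two_ne_zero]
  exact this

section WeylFlow

variable {n : ℕ} {M : Matrix (Idx n) (Idx n) ℂ}

lemma matCos_eq_matCosh {m : Type*} [Fintype m] [DecidableEq m] (A : Matrix m m ℂ) :
    matCos A = matCosh (I • A) := rfl

lemma matCos_smul_eq {m : Type*} [Fintype m] [DecidableEq m] (A : Matrix m m ℂ) (s : ℂ) :
    matCos (s • A) = matCosh (s • (I • A)) := by
  rw [matCos_eq_matCosh, smul_comm]

lemma isSymm_stdJ_I (hM : M.IsSymm) : (stdJ n * (I • (stdJ n * M))).IsSymm := by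
  rw [Matrix.mul_smul, IsSymm, transpose_smul, (stdJ_mul_stdJ_mul_symm hM).eq]

lemma exp_mul_exp_smul {m : Type*} [Fintype m] [DecidableEq m] (A : Matrix m m ℂ) (s u : ℂ) :
    NormedSpace.exp (s • A) * NormedSpace.exp (u • A) = NormedSpace.exp ((s + u) • A) := by
  rw [add_smul, Matrix.exp_add_of_commute]
  exact ((Commute.refl A).smul_left s).smul_right u

/-- With θ = tJM this is e^(-2iθ) + 1 = 2 cos θ e^(-iθ). Together with the formula for the
difference it turns the Cayley transform of the flow into -i tan θ. -/
lemma flow_add_one (M : Matrix (Idx n) (Idx n) ℂ) (t : ℝ) :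
    flow M t + 1 = (2 : ℂ) • (matCos ((t : ℂ) • (stdJ n * M)) *
      NormedSpace.exp ((-(I * t)) • (stdJ n * M))) := by
  have h1 : I • ((t : ℂ) • (stdJ n * M)) = (I * t) • (stdJ n * M) := smul_smul _ _ _
  rw [matCos, h1, ← neg_smul, Matrix.smul_mul, smul_smul, Matrix.add_mul, exp_mul_exp_smul,
    exp_mul_exp_smul, flow, smul_smul]
  have h2 : (t : ℂ) * -(2 * I) = -(I * t) + -(I * t) := by ring
  rw [h2, add_neg_cancel, zero_smul, NormedSpace.exp_zero, mul_inv_cancel₀ two_ne_zero, one_smul,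
    add_comm]

lemma flow_sub_one (M : Matrix (Idx n) (Idx n) ℂ) (t : ℝ) :
    flow M t - 1 = (-(2 * I)) • (matSin ((t : ℂ) • (stdJ n * M)) *
      NormedSpace.exp ((-(I * t)) • (stdJ n * M))) := by
  have h1 : I • ((t : ℂ) • (stdJ n * M)) = (I * t) • (stdJ n * M) := smul_smul _ _ _
  rw [matSin, h1, ← neg_smul, Matrix.smul_mul, smul_smul, Matrix.sub_mul, exp_mul_exp_smul,
    exp_mul_exp_smul, flow, smul_smul]
  have h2 : (t : ℂ) * -(2 * I) = -(I * t) + -(I * t) := by ring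
  have h3 : -(2 * I) * (2 * I)⁻¹ = -1 := by
    rw [neg_mul, mul_inv_cancel₀ (by simp)]
  rw [h2, add_neg_cancel, zero_smul, NormedSpace.exp_zero, h3, neg_one_smul, neg_sub]

lemma det_flow_add_one (hM : M.IsSymm) (t : ℝ) :
    (flow M t + 1).det = 4 ^ n * (matCos ((t : ℂ) • (stdJ n * M))).det := by
  rw [flow_add_one, det_smul, det_mul, det_exp_hamiltonian (stdJ_mul_stdJ_mul_symm hM), mul_one,
    Fintype.card_sum, Fintype.card_fin, ← two_mul, pow_mul]
  norm_num

lemma kflow_add_one (M : Matrix (Idx n) (Idx n) ℂ) (t : ℝ) :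
    kflow M t + 1 = cayleyU n * (flow M t + 1) * (cayleyU n)⁻¹ := by
  rw [Matrix.mul_add, Matrix.add_mul, Matrix.mul_one, cayleyU_mul_inv, kflow]

lemma kflow_sub_one (M : Matrix (Idx n) (Idx n) ℂ) (t : ℝ) :
    kflow M t - 1 = cayleyU n * (flow M t - 1) * (cayleyU n)⁻¹ := by
  rw [Matrix.mul_sub, Matrix.sub_mul, Matrix.mul_one, cayleyU_mul_inv, kflow]

lemma det_kflow_add_one (hM : M.IsSymm) (t : ℝ) :
    (kflow M t + 1).det = 4 ^ n * (matCos ((t : ℂ) • (stdJ n * M))).det := by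
  rw [kflow_add_one, det_mul, det_mul, mul_right_comm, ← det_mul, cayleyU_mul_inv, det_one,
    one_mul, det_flow_add_one hM]

lemma hat_phase (x y : Fin n → ℝ) :
    hat (fun i => (x i : ℂ) + I * (y i : ℂ)) = cayleyU n *ᵥ phaseVec x y :=
  hat_toC (Sum.elim x y)

/-- The exponential factors cancel in (k-1)(k+1)⁻¹, leaving -i tan(tJM) conjugated by U. The
relation UᵀJU = -2iJ supplies the other factor, and (-2i)(-i)/2 = -1. -/
lemma weyl_phase (hM : M.IsSymm) {t : ℝ} (hd : (matCos ((t : ℂ) • (stdJ n * M))).det ≠ 0)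
    (x y : Fin n → ℝ) :
    hat (fun i => (x i : ℂ) + I * (y i : ℂ)) ⬝ᵥ (stdJ n *ᵥ ((kflow M t - 1) *ᵥ
      ((kflow M t + 1)⁻¹ *ᵥ hat (fun i => (x i : ℂ) + I * (y i : ℂ))))) / 2 =
    -qform (stdJ n * matTan ((t : ℂ) • (stdJ n * M))) x y := by
  have hE := det_exp_hamiltonian (stdJ_mul_stdJ_mul_symm hM) (-(I * t))
  set E := NormedSpace.exp ((-(I * t)) • (stdJ n * M))
  set Ct := matCos ((t : ℂ) • (stdJ n * M)) with hCt
  have hE1 : E * E⁻¹ = 1 := Matrix.mul_nonsing_inv _ (by rw [hE]; exact isUnit_one)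
  have hC1 : Ct * Ct⁻¹ = 1 := Matrix.mul_nonsing_inv _ (isUnit_iff_ne_zero.2 hd)
  have hA : (flow M t + 1) * ((2⁻¹ : ℂ) • (E⁻¹ * Ct⁻¹)) = Ct * (E * E⁻¹) * Ct⁻¹ := by
    rw [flow_add_one, Matrix.smul_mul, Matrix.mul_smul, smul_smul, mul_inv_cancel₀ two_ne_zero,
      one_smul]
    simp only [Matrix.mul_assoc]; rfl
  have hB : (flow M t - 1) * ((2⁻¹ : ℂ) • (E⁻¹ * Ct⁻¹)) =
      (-I) • (matSin ((t : ℂ) • (stdJ n * M)) * (E * E⁻¹) * Ct⁻¹) := by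
    rw [flow_sub_one, Matrix.smul_mul, Matrix.mul_smul, smul_smul]
    have : -(2 * I) * 2⁻¹ = -I := by ring
    rw [this]
    simp only [Matrix.mul_assoc]; rfl
  have h1 : (kflow M t + 1)⁻¹ = cayleyU n * ((2⁻¹ : ℂ) • (E⁻¹ * Ct⁻¹)) * (cayleyU n)⁻¹ := by
    refine Matrix.inv_eq_right_inv ?_
    calc _ = cayleyU n * ((flow M t + 1) * ((cayleyU n)⁻¹ * cayleyU n) *
          ((2⁻¹ : ℂ) • (E⁻¹ * Ct⁻¹))) * (cayleyU n)⁻¹ := by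
          rw [kflow_add_one]; simp only [Matrix.mul_assoc]
      _ = cayleyU n * (Ct * (E * E⁻¹) * Ct⁻¹) * (cayleyU n)⁻¹ := by
          rw [cayleyU_inv_mul, Matrix.mul_one, hA]
      _ = 1 := by rw [hE1, Matrix.mul_one, hC1, Matrix.mul_one, cayleyU_mul_inv]
  have h2 : (kflow M t - 1) * (kflow M t + 1)⁻¹ =
      cayleyU n * ((-I) • matTan ((t : ℂ) • (stdJ n * M))) * (cayleyU n)⁻¹ := by
    rw [h1, kflow_sub_one]
    calc _ = cayleyU n * ((flow M t - 1) * ((cayleyU n)⁻¹ * cayleyU n) *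
          ((2⁻¹ : ℂ) • (E⁻¹ * Ct⁻¹))) * (cayleyU n)⁻¹ := by simp only [Matrix.mul_assoc]
      _ = cayleyU n * ((-I) • (matSin ((t : ℂ) • (stdJ n * M)) * (E * E⁻¹) * Ct⁻¹)) *
          (cayleyU n)⁻¹ := by
          rw [cayleyU_inv_mul, Matrix.mul_one, hB]
      _ = _ := by rw [hE1, Matrix.mul_one, matTan]
  have h4 (v : Idx n → ℂ) : (kflow M t - 1) *ᵥ ((kflow M t + 1)⁻¹ *ᵥ (cayleyU n *ᵥ v)) =
      cayleyU n *ᵥ (((-I) • matTan ((t : ℂ) • (stdJ n * M))) *ᵥ v) := by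
    rw [mulVec_mulVec _ (kflow M t - 1), h2, mulVec_mulVec, Matrix.mul_assoc, cayleyU_inv_mul,
      Matrix.mul_one, mulVec_mulVec]
  have h5 (a b : Idx n → ℂ) : (cayleyU n *ᵥ a) ⬝ᵥ (stdJ n *ᵥ (cayleyU n *ᵥ b)) =
      -(2 * I) * (a ⬝ᵥ (stdJ n *ᵥ b)) := by
    rw [← vecMul_transpose, ← dotProduct_mulVec, mulVec_mulVec, mulVec_mulVec,
      cayleyU_symp, smul_mulVec, dotProduct_smul, smul_eq_mul]
  rw [hat_phase, h4, h5, qform, smul_mulVec, mulVec_smul, dotProduct_smul, mulVec_mulVec,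
    smul_eq_mul]
  linear_combination (phaseVec x y ⬝ᵥ ((stdJ n * matTan ((t : ℂ) • (stdJ n * M))) *ᵥ
    phaseVec x y)) * I_mul_I

/-- The Weyl coefficient of the Gaussian kernel with constant `c`. -/
def weylCoef (c : ℂ) (k : Matrix (Idx n) (Idx n) ℂ) : ℂ :=
  2 ^ n * ((2 * Real.pi : ℂ) ^ n)⁻¹ * c *
    gint ((cayleyU n)ᵀ * weylMat k.toBlocks₁₁ k.toBlocks₁₂ k.toBlocks₂₁ * cayleyU n)

lemma isExpSp_blocks {k : Matrix (Idx n) (Idx n) ℂ} (h : IsExpSp k) :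
    IsExpSp (fromBlocks k.toBlocks₁₁ k.toBlocks₁₂ k.toBlocks₂₁ k.toBlocks₂₂) := by
  rwa [fromBlocks_toBlocks]

/-- The factor det P of `det_weylMat` is absorbed by c², so only det(k+1) survives. -/
lemma weylCoef_sq {k : Matrix (Idx n) (Idx n) ℂ} (h : IsExpSp k) (hd : (k + 1).det ≠ 0) {c : ℂ}
    (hc : c ^ 2 * k.toBlocks₁₁.det = 1) : weylCoef c k ^ 2 * (k + 1).det = 4 ^ n := by
  have h' := isExpSp_blocks h
  have h1 := det_weylMat h'
  have h2 := (cpos_weylMat h' (by rwa [fromBlocks_toBlocks])).gpos.gint_sq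
  rw [fromBlocks_toBlocks] at h1
  rw [Fintype.card_sum, Fintype.card_fin] at h2
  have hpi : (2 * Real.pi : ℂ) ≠ 0 := by
    exact_mod_cast (by positivity : (2 * Real.pi : ℝ) ≠ 0)
  rw [← h1, weylCoef]
  set G := (cayleyU n)ᵀ * weylMat k.toBlocks₁₁ k.toBlocks₁₂ k.toBlocks₂₁ * cayleyU n
  calc _ = (2 ^ n) ^ 2 * (((2 * Real.pi : ℂ) ^ n)⁻¹) ^ 2 * (c ^ 2 * k.toBlocks₁₁.det) *
        (gint G ^ 2 * G.det) := by ring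
    _ = _ := by
      rw [hc, h2, ← two_mul, mul_comm 2 n, pow_mul (2 * (Real.pi : ℂ)), ← pow_mul, mul_comm n 2,
        pow_mul]
      have : ((2 * Real.pi : ℂ) ^ n) ≠ 0 := pow_ne_zero _ hpi
      field_simp
      norm_num

lemma weylCoef_one : weylCoef 1 (1 : Matrix (Idx n) (Idx n) ℂ) = 1 := by
  have h1 : (1 : Matrix (Idx n) (Idx n) ℂ) = fromBlocks 1 0 0 1 := fromBlocks_one.symm
  have hpi : (Real.pi : ℂ) ≠ 0 := by exact_mod_cast Real.pi_ne_zero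
  have h2 : weylMat (1 : Matrix (Fin n) (Fin n) ℂ) 0 0 = swapM n := by
    simp only [weylMat, swapM, inv_one, transpose_one, Matrix.mul_zero, Matrix.zero_mul, neg_zero,
      fromBlocks_smul, smul_zero]
    congr 1 <;> (rw [← two_smul ℂ, smul_smul]; norm_num)
  rw [weylCoef, h1, toBlocks_fromBlocks₁₁, toBlocks_fromBlocks₁₂, toBlocks_fromBlocks₂₁, h2,
    (det_swap_mul_det_cayleyU (n := n)).2]
  have h3 := gint_smul_one (ι := Idx n) (a := 2) two_pos n
    (by rw [Fintype.card_sum, Fintype.card_fin]; ring)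
  push_cast at h3
  rw [h3, mul_one, mul_assoc, ← inv_pow, ← mul_pow, ← mul_pow]
  have h4 : 2 * ((2 * (Real.pi : ℂ))⁻¹ * (2 * Real.pi / 2)) = 1 := by field_simp
  rw [h4, one_pow]

lemma tendsto_weylCoef {α : Type*} {l : Filter α} [l.IsCountablyGenerated]
    {c : α → ℂ} {k : α → Matrix (Idx n) (Idx n) ℂ} {c0 : ℂ} {k0 : Matrix (Idx n) (Idx n) ℂ}
    (h : IsExpSp k0) (hd : (k0 + 1).det ≠ 0) (hc : Filter.Tendsto c l (nhds c0))
    (hk : Filter.Tendsto k l (nhds k0)) :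
    Filter.Tendsto (fun a => weylCoef (c a) (k a)) l (nhds (weylCoef c0 k0)) := by
  have h' := isExpSp_blocks h
  refine (hc.const_mul _).mul ?_
  refine (cpos_weylMat h' (by rwa [fromBlocks_toBlocks])).gpos.tendsto_gint ?_
  have hblk : Continuous fun k : Matrix (Idx n) (Idx n) ℂ => k.toBlocks₁₁ :=
    continuous_id.matrix_submatrix Sum.inl Sum.inl
  have hblk2 : Continuous fun k : Matrix (Idx n) (Idx n) ℂ => k.toBlocks₁₂ :=
    continuous_id.matrix_submatrix Sum.inl Sum.inr
  have hblk3 : Continuous fun k : Matrix (Idx n) (Idx n) ℂ => k.toBlocks₂₁ :=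
    continuous_id.matrix_submatrix Sum.inr Sum.inl
  have hinv : ContinuousAt (fun k : Matrix (Idx n) (Idx n) ℂ => (k.toBlocks₁₁)⁻¹) k0 := by
    simp only [Matrix.inv_def, Ring.inverse_eq_inv]
    exact (hblk.matrix_det.continuousAt.inv₀ h'.det_ne_zero).smul
      hblk.matrix_adjugate.continuousAt
  have hcont : ContinuousAt (fun k : Matrix (Idx n) (Idx n) ℂ => (cayleyU n)ᵀ *
      weylMat k.toBlocks₁₁ k.toBlocks₁₂ k.toBlocks₂₁ * cayleyU n) k0 := by
    have hfb : Continuous fun q : Matrix (Fin n) (Fin n) ℂ × Matrix (Fin n) (Fin n) ℂ ×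
        Matrix (Fin n) (Fin n) ℂ => (cayleyU n)ᵀ * ((2⁻¹ : ℂ) •
          fromBlocks (-(q.2.2 * q.1)) (1 + q.1ᵀ) (1 + q.1) (q.1 * q.2.1)) * cayleyU n := by
      refine (continuous_const.matrix_mul (Continuous.const_smul ?_ (2⁻¹ : ℂ))).matrix_mul
        continuous_const
      refine Continuous.matrix_fromBlocks ?_ ?_ ?_ ?_
      · exact (continuous_snd.snd.matrix_mul continuous_fst).neg
      · exact continuous_const.add continuous_fst.matrix_transpose
      · exact continuous_const.add continuous_fst
      · exact continuous_fst.matrix_mul continuous_snd.fst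
    exact hfb.continuousAt.comp (f := fun k : Matrix (Idx n) (Idx n) ℂ =>
      ((k.toBlocks₁₁)⁻¹, k.toBlocks₁₂, k.toBlocks₂₁))
      (hinv.prodMk (hblk2.continuousAt.prodMk hblk3.continuousAt))
  exact hcont.tendsto.comp hk

lemma continuous_kflow_param {A : Type*} [TopologicalSpace A]
    {F : A → Matrix (Idx n) (Idx n) ℂ} (hF : Continuous F) {τ : A → ℝ} (hτ : Continuous τ) :
    Continuous fun a => kflow (F a) (τ a) := by
  have h0 : Continuous fun a => stdJ n * F a := continuous_const.matrix_mul hF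
  have h1 : Continuous fun a => ((τ a : ℝ) : ℂ) • ((-(2 * I)) • (stdJ n * F a)) :=
    (Complex.continuous_ofReal.comp hτ).smul (h0.const_smul (-(2 * I)))
  exact (continuous_const.matrix_mul (continuous_matrix_exp.comp h1)).matrix_mul continuous_const

lemma continuous_blocks₁₁ : Continuous fun k : Matrix (Idx n) (Idx n) ℂ => k.toBlocks₁₁ :=
  continuous_id.matrix_submatrix Sum.inl Sum.inl

lemma det_matCos_zero : (matCos ((0 : ℂ) • (stdJ n * M))).det = 1 := by
  rw [matCos_smul_eq, zero_smul, matCosh_zero, det_one]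

lemma weylCoef_sq_flow (hM : M.IsSymm) (hq : ∀ x y : Fin n → ℝ, (qform M x y).re ≤ 0)
    {D : ℂ → ℂ} (hD : IsDetRoot (fun s => matCos (s • (stdJ n * M))) D) {t : ℝ} (ht : 0 ≤ t)
    (hd : (matCos ((t : ℂ) • (stdJ n * M))).det ≠ 0) {c : ℂ}
    (hc : c ^ 2 * (kflow M t).toBlocks₁₁.det = 1) :
    weylCoef c (kflow M t) ^ 2 = ((D t)⁻¹) ^ 2 := by
  have h4 : (4 : ℂ) ^ n ≠ 0 := pow_ne_zero _ (by norm_num)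
  have h1 := det_kflow_add_one hM t
  have h2 := weylCoef_sq (isExpSp_kflow hM hq ht) (by rw [h1]; exact mul_ne_zero h4 hd) hc
  have h3 := hD.2.2 t
  simp only at h3
  rw [h1, ← h3] at h2
  rw [← h3] at hd
  have h5 : D t ≠ 0 := fun h => hd (by rw [h]; simp)
  rw [inv_pow]
  refine eq_inv_of_mul_eq_one_left ?_
  have h6 : (4 : ℂ) ^ n * (weylCoef c (kflow M t) ^ 2 * D t ^ 2) = 4 ^ n * 1 := by
    linear_combination h2
  exact mul_left_cancel₀ h4 h6

/-- Strict dissipativity keeps det cos(tJM) away from 0 for all t ≥ 0. Both sides are then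
continuous with equal squares and agree at t = 0. -/
lemma weylCoef_flow_strict (hM : M.IsSymm)
    (hq : ∀ x y : Fin n → ℝ, (x ≠ 0 ∨ y ≠ 0) → (qform M x y).re < 0)
    (hq' : ∀ x y : Fin n → ℝ, (qform M x y).re ≤ 0)
    {D : ℂ → ℂ} (hD : IsDetRoot (fun s => matCos (s • (stdJ n * M))) D)
    {c : ℝ → ℂ} (hcc : ContinuousOn c (Set.Ici 0)) (hc0 : c 0 = 1)
    (hc : ∀ t, 0 ≤ t → c t ^ 2 * (kflow M t).toBlocks₁₁.det = 1) {t : ℝ} (ht : 0 ≤ t) :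
    weylCoef (c t) (kflow M t) = (D t)⁻¹ := by
  have h4 : (4 : ℂ) ^ n ≠ 0 := pow_ne_zero _ (by norm_num)
  have hd : ∀ t : ℝ, 0 ≤ t → (matCos ((t : ℂ) • (stdJ n * M))).det ≠ 0 := by
    intro t ht
    rcases ht.eq_or_lt with rfl | ht
    · rw [ofReal_zero, det_matCos_zero]; exact one_ne_zero
    · intro h
      refine det_flow_add_one_ne_zero hM hq ht ?_
      rw [det_flow_add_one hM, h, mul_zero]
  have hDne : ∀ t : ℝ, 0 ≤ t → D t ≠ 0 := fun t ht h => hd t ht (by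
    have := hD.2.2 t; rw [h] at this; simpa using this.symm)
  have hk : Continuous fun t => kflow M t := continuous_kflow_param continuous_const continuous_id
  have hcont : ContinuousOn (fun t => weylCoef (c t) (kflow M t)) (Set.Ici 0) := fun s hs =>
    tendsto_weylCoef (isExpSp_kflow hM hq' hs)
      (by rw [det_kflow_add_one hM]; exact mul_ne_zero h4 (hd s hs)) (hcc s hs)
      ((hk.tendsto s).mono_left nhdsWithin_le_nhds)
  have hcontD : ContinuousOn (fun t : ℝ => (D t)⁻¹) (Set.Ici 0) :=
    (hD.1.continuous.comp Complex.continuous_ofReal).continuousOn.inv₀ hDne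
  refine isPreconnected_Ici.eq_of_sq_eq hcont hcontD (fun s hs => ?_) (fun {s} hs => ?_)
    (Set.self_mem_Ici (a := (0 : ℝ))) ?_ ht
  · exact weylCoef_sq_flow hM hq' hD hs (hd s hs) (hc s hs)
  · exact inv_ne_zero (hDne s hs)
  · simp only [ofReal_zero]
    rw [kflow_zero, hc0, weylCoef_one, hD.2.1, inv_one]

/-- Zeros of det cos may separate 0 from t, so continuity in t alone does not fix the sign. The
strictly dissipative M - |e|·1 avoids them, and both sides converge at the fixed time t as e → 0. -/
lemma weylCoef_flow (hM : M.IsSymm) (hq : ∀ x y : Fin n → ℝ, (qform M x y).re ≤ 0)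
    {D : ℂ → ℂ} (hD : IsDetRoot (fun s => matCos (s • (stdJ n * M))) D)
    {c : ℝ → ℂ} (hcc : ContinuousOn c (Set.Ici 0)) (hc0 : c 0 = 1)
    (hc : ∀ t, 0 ≤ t → c t ^ 2 * (kflow M t).toBlocks₁₁.det = 1) {t : ℝ} (ht : 0 ≤ t)
    (hd : (matCos ((t : ℂ) • (stdJ n * M))).det ≠ 0) :
    weylCoef (c t) (kflow M t) = (D t)⁻¹ := by
  have h4 : (4 : ℂ) ^ n ≠ 0 := pow_ne_zero _ (by norm_num)
  let N : ℝ → Matrix (Idx n) (Idx n) ℂ := fun e => M - ((|e| : ℝ) : ℂ) • 1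
  have hN0 : N 0 = M := by simp [N]
  have hNs : ∀ e, (N e).IsSymm := fun e => by
    simp only [N, IsSymm, transpose_sub, transpose_smul, transpose_one, hM.eq]
  have hNq : ∀ e (x y : Fin n → ℝ), (qform (N e) x y).re =
      (qform M x y).re - |e| * (x ⬝ᵥ x + y ⬝ᵥ y) := by
    intro e x y
    have h1 : phaseVec x y ⬝ᵥ phaseVec x y = ((x ⬝ᵥ x + y ⬝ᵥ y : ℝ) : ℂ) := by
      simp [phaseVec, dotProduct]
    simp only [qform, N]
    rw [sub_mulVec, smul_mulVec, one_mulVec, dotProduct_sub, dotProduct_smul, h1, Complex.sub_re,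
      smul_eq_mul, ← ofReal_mul, ofReal_re]
  have hsq : ∀ x : Fin n → ℝ, 0 ≤ x ⬝ᵥ x := fun x => Finset.sum_nonneg fun i _ => mul_self_nonneg _
  have hNle : ∀ e (x y : Fin n → ℝ), (qform (N e) x y).re ≤ 0 := fun e x y => by
    rw [hNq]; nlinarith [hq x y, abs_nonneg e, hsq x, hsq y]
  have hNlt : ∀ e, e ≠ 0 → ∀ x y : Fin n → ℝ, (x ≠ 0 ∨ y ≠ 0) → (qform (N e) x y).re < 0 := by
    intro e he x y hxy
    have h1 : 0 < x ⬝ᵥ x + y ⬝ᵥ y := by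
      rcases hxy with h | h
      · have : x ⬝ᵥ x ≠ 0 := by simpa using h
        linarith [lt_of_le_of_ne (hsq x) this.symm, hsq y]
      · have : y ⬝ᵥ y ≠ 0 := by simpa using h
        linarith [lt_of_le_of_ne (hsq y) this.symm, hsq x]
    rw [hNq]; nlinarith [hq x y, abs_pos.2 he]
  have hNc : Continuous N :=
    continuous_const.sub ((Complex.continuous_ofReal.comp continuous_abs).smul continuous_const)
  have hkc : Continuous fun p : ℝ × ℝ => kflow (N p.1) |p.2| :=
    continuous_kflow_param (hNc.comp continuous_fst) (continuous_abs.comp continuous_snd)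
  -- The amplitude must vary continuously in e and time together. The absolute values keep the flow
  -- expanding on the whole plane of pairs, which is simply connected.
  obtain ⟨g, hgc, hg0, hg⟩ := exists_continuous_sqrt
    (f := fun p : ℝ × ℝ => (kflow (N p.1) |p.2|).toBlocks₁₁.det)
    (continuous_blocks₁₁.comp hkc).matrix_det
    (fun p => (isExpSp_blocks (isExpSp_kflow (hNs p.1) (hNle p.1) (abs_nonneg p.2))).det_ne_zero)
    (a₀ := (0, 0)) (by
      simp only [abs_zero, kflow_zero]
      rw [← fromBlocks_one, toBlocks_fromBlocks₁₁, det_one])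
  have hgne : ∀ p, g p ≠ 0 := fun p h => by
    have h1 := hg p
    rw [h] at h1
    exact (isExpSp_blocks (isExpSp_kflow (hNs p.1) (hNle p.1) (abs_nonneg p.2))).det_ne_zero
      (by rw [← h1]; simp)
  have hcg : ∀ e s : ℝ, 0 ≤ s → ((g (e, s))⁻¹) ^ 2 * (kflow (N e) s).toBlocks₁₁.det = 1 := by
    intro e s hs
    have h1 := hg (e, s)
    simp only [abs_of_nonneg hs] at h1
    rw [← h1, inv_pow, inv_mul_cancel₀ (pow_ne_zero _ (hgne _))]
  have hgz : ∀ e, g (e, 0) = 1 := by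
    have hsq1 : ∀ e, g (e, 0) ^ 2 = 1 := fun e => by
      rw [hg]
      simp only [abs_zero, kflow_zero]
      rw [← fromBlocks_one, toBlocks_fromBlocks₁₁, det_one]
    intro e
    exact isPreconnected_univ.eq_of_sq_eq (f := fun e => g (e, 0)) (g := fun _ => 1)
      (hgc.comp (continuous_id.prodMk continuous_const)).continuousOn continuousOn_const
      (fun e _ => by simp [hsq1]) (fun _ => one_ne_zero) (Set.mem_univ 0) hg0 (Set.mem_univ e)
  -- On the line e = 0 the inverse of this root and the given amplitude have equal squares and the
  -- same initial value.
  have hgt : (g (0, t))⁻¹ = c t := by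
    have hcne : ∀ s, 0 ≤ s → c s ≠ 0 := fun s hs h => by
      have := hc s hs; rw [h] at this; simp at this
    refine isPreconnected_Ici.eq_of_sq_eq (f := fun s => (g (0, s))⁻¹) (g := c)
      ((hgc.comp (continuous_const.prodMk continuous_id)).inv₀ fun s => hgne _).continuousOn hcc
      (fun s hs => ?_) (fun {s} hs => hcne s hs) (Set.self_mem_Ici (a := (0 : ℝ)))
      (by simp [hg0, hc0]) ht
    have h1 := hcg 0 s hs
    rw [hN0] at h1
    have h2 := hc s hs
    have h3 : (kflow M s).toBlocks₁₁.det ≠ 0 := fun h => by rw [h] at h2; simp at h2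
    exact mul_right_cancel₀ h3 (h1.trans h2.symm)
  choose Dε hDε using fun e => exists_isDetRoot (isSymm_stdJ_I (hNs e))
  have hDε' : ∀ e, IsDetRoot (fun s => matCos (s • (stdJ n * N e))) (Dε e) := fun e => by
    simp_rw [matCos_smul_eq]; exact hDε e
  have hstrict : ∀ e, e ≠ 0 → weylCoef ((g (e, t))⁻¹) (kflow (N e) t) = (Dε e t)⁻¹ := by
    intro e he
    exact weylCoef_flow_strict (hNs e) (hNlt e he) (hNle e) (hDε' e)
      (c := fun s => (g (e, s))⁻¹)
      ((hgc.comp (continuous_const.prodMk continuous_id)).inv₀ fun s => hgne _).continuousOn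
      (by simp [hgz]) (fun s hs => hcg e s hs) ht
  have hlim1 : Filter.Tendsto (fun e => weylCoef ((g (e, t))⁻¹) (kflow (N e) t))
      (nhdsWithin 0 {0}ᶜ) (nhds (weylCoef (c t) (kflow M t))) := by
    refine tendsto_weylCoef (isExpSp_kflow hM hq ht)
      (by rw [det_kflow_add_one hM]; exact mul_ne_zero h4 hd) ?_ ?_
    · rw [← hgt]
      exact (((hgc.comp (continuous_id.prodMk continuous_const)).inv₀
        fun s => hgne _).tendsto 0).mono_left nhdsWithin_le_nhds
    · have h1 : Continuous fun e => kflow (N e) t := continuous_kflow_param hNc continuous_const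
      have h2 := h1.tendsto 0
      rw [hN0] at h2
      exact h2.mono_left nhdsWithin_le_nhds
  have hlim2 : Filter.Tendsto (fun e => (Dε e t)⁻¹) (nhdsWithin 0 {0}ᶜ) (nhds (D t)⁻¹) := by
    have h1 : D (t : ℂ) ≠ 0 := fun h => hd (by
      have := hD.2.2 t; rw [h] at this; simpa using this.symm)
    refine Filter.Tendsto.inv₀ ?_ h1
    have h2 : Continuous fun e => I • (stdJ n * N e) :=
      (continuous_const.matrix_mul hNc).const_smul I
    have h3 := h2.tendsto 0
    rw [hN0] at h3
    refine tendsto_detRoot (h3.mono_left nhdsWithin_le_nhds) hDε ?_ ?_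
    · simp_rw [← matCos_smul_eq]; exact hD
    · rw [← matCos_smul_eq]; exact hd
  refine tendsto_nhds_unique hlim1 (hlim2.congr' ?_)
  filter_upwards [self_mem_nhdsWithin] with e he
  exact (hstrict e he).symm

end WeylFlow

/-! ### Gaussian Schwartz functions -/

section GaussianSchwartz

variable {n : ℕ}

/-- `ℝⁿ` with its Euclidean norm. -/
abbrev Euc (n : ℕ) : Type := EuclideanSpace ℝ (Fin n)

/-- The exponent `-(x A x) / 2 + b x + e`. -/
def gaussExp (A : Matrix (Fin n) (Fin n) ℂ) (b : Fin n → ℂ) (e : ℂ) (x : Euc n) : ℂ :=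
  -(cvec x.ofLp ⬝ᵥ (A *ᵥ cvec x.ofLp)) / 2 + b ⬝ᵥ cvec x.ofLp + e

lemma hasTemperateGrowth_coord (i : Fin n) :
    Function.HasTemperateGrowth fun x : Euc n => (x i : ℂ) :=
  (Complex.ofRealCLM.comp (EuclideanSpace.proj (𝕜 := ℝ) i)).hasTemperateGrowth

lemma hasTemperateGrowth_gaussExp (A : Matrix (Fin n) (Fin n) ℂ) (b : Fin n → ℂ) (e : ℂ) :
    Function.HasTemperateGrowth (gaussExp A b e) := by
  have h := hasTemperateGrowth_coord (n := n)
  unfold gaussExp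
  simp only [dotProduct, mulVec, cvec, neg_div, Finset.sum_div]
  refine Function.HasTemperateGrowth.fun_add (Function.HasTemperateGrowth.fun_add
    (Function.HasTemperateGrowth.fun_neg (Function.HasTemperateGrowth.sum fun i _ => ?_))
    (Function.HasTemperateGrowth.sum fun i _ => ?_)) (.const _)
  · simp only [div_eq_mul_inv]
    exact ((h i).fun_mul (Function.HasTemperateGrowth.sum fun j _ =>
      (Function.HasTemperateGrowth.const (A i j)).fun_mul (h j))).fun_mul (.const _)
  · exact (Function.HasTemperateGrowth.const (b i)).fun_mul (h i)

/-- Feeds the bound for derivatives of a composition, which then carries the decaying factor |exp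
g|. -/
lemma norm_iteratedFDeriv_cexp_le (i : ℕ) (z : ℂ) :
    ‖iteratedFDeriv ℝ i Complex.exp z‖ ≤ ‖Complex.exp z‖ := by
  induction i with
  | zero => rw [norm_iteratedFDeriv_zero]
  | succ i ih =>
    rw [← norm_iteratedFDeriv_fderiv]
    have h1 : fderiv ℝ Complex.exp = (ContinuousLinearMap.mul ℝ ℂ) ∘ Complex.exp := by
      ext1 z
      refine ((Complex.hasDerivAt_exp z).hasFDerivAt.restrictScalars ℝ).fderiv.trans ?_
      ext
      simp [mul_comm]
    rw [h1]
    refine ((ContinuousLinearMap.mul ℝ ℂ).norm_iteratedFDeriv_comp_left (N := i)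
      Complex.contDiff_exp.contDiffAt le_rfl).trans ?_
    calc _ ≤ 1 * ‖iteratedFDeriv ℝ i Complex.exp z‖ := by
          gcongr; exact ContinuousLinearMap.opNorm_mul_le ℝ ℂ
      _ ≤ _ := by rwa [one_mul]

lemma sum_sq_eq_norm (x : Euc n) : ∑ i, x i ^ 2 = ‖x‖ ^ 2 := by
  rw [EuclideanSpace.norm_sq_eq]; simp

lemma norm_dot_cvec_le (b : Fin n → ℂ) (x : Euc n) :
    ‖b ⬝ᵥ cvec x.ofLp‖ ≤ (∑ i, ‖b i‖) * ‖x‖ := by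
  rw [dotProduct, Finset.sum_mul]
  refine (norm_sum_le _ _).trans (Finset.sum_le_sum fun i _ => ?_)
  rw [norm_mul, cvec, Complex.norm_real]
  gcongr
  exact PiLp.norm_apply_le x i

lemma re_gaussExp_le {A : Matrix (Fin n) (Fin n) ℂ} {c : ℝ}
    (hc : ∀ x : Fin n → ℝ, c * ∑ i, x i ^ 2 ≤ (cvec x ⬝ᵥ (A *ᵥ cvec x)).re) (b : Fin n → ℂ) (e : ℂ)
    (x : Euc n) :
    (gaussExp A b e x).re ≤ -(c / 2) * ‖x‖ ^ 2 + (∑ i, ‖b i‖) * ‖x‖ + ‖e‖ := by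
  have h1 := hc x.ofLp
  rw [sum_sq_eq_norm] at h1
  have h2 := (Complex.re_le_norm _).trans (norm_dot_cvec_le b x)
  have h3 := Complex.re_le_norm e
  have h4 : (gaussExp A b e x).re = -(cvec x.ofLp ⬝ᵥ (A *ᵥ cvec x.ofLp)).re / 2 +
      (b ⬝ᵥ cvec x.ofLp).re + e.re := by
    rw [gaussExp]; simp
  rw [h4]; linarith

/-- After (1 + r)^N ≤ e^(Nr), completing the square in the exponent gives the constant. -/
lemma one_add_pow_mul_exp_le {c : ℝ} (hc : 0 < c) (N : ℕ) (B r : ℝ) (hr : 0 ≤ r) :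
    (1 + r) ^ N * Real.exp (-c * r ^ 2 + B * r) ≤ Real.exp ((N + B) ^ 2 / (4 * c)) := by
  have h1 : (1 + r) ^ N ≤ Real.exp (N * r) := by
    rw [Real.exp_nat_mul]
    exact pow_le_pow_left₀ (by linarith) (by linarith [Real.add_one_le_exp r]) N
  calc _ ≤ Real.exp (N * r) * Real.exp (-c * r ^ 2 + B * r) := by gcongr
    _ = Real.exp (N * r + (-c * r ^ 2 + B * r)) := (Real.exp_add _ _).symm
    _ ≤ _ := by
      refine Real.exp_le_exp.2 ?_
      rw [le_div_iff₀ (by positivity)]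
      nlinarith [sq_nonneg (2 * c * r - (N + B))]

/-- The Gaussian Schwartz function with exponent `gaussExp A b e`. -/
def gaussS {A : Matrix (Fin n) (Fin n) ℂ} (hA : GPos A) (b : Fin n → ℂ) (e : ℂ) :
    𝓢(Euc n, ℂ) where
  toFun x := Complex.exp (gaussExp A b e x)
  smooth' := ContDiff.comp (g := Complex.exp) Complex.contDiff_exp
    (hasTemperateGrowth_gaussExp A b e).1
  decay' k m := by
    have hcexp : ContDiff ℝ ⊤ Complex.exp := Complex.contDiff_exp
    obtain ⟨c, hc, hb⟩ := hA.exists_bound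
    have hT := hasTemperateGrowth_gaussExp A b e
    obtain ⟨p, C, hC, hCb⟩ := hT.norm_iteratedFDeriv_le_uniform m
    refine ⟨m.factorial * (C + 1) ^ m * Real.exp ‖e‖ *
      Real.exp (((k + p * m : ℕ) + ∑ i, ‖b i‖) ^ 2 / (4 * (c / 2))), fun x => ?_⟩
    have h1 : ‖iteratedFDeriv ℝ m (Complex.exp ∘ gaussExp A b e) x‖ ≤
        m.factorial * ‖Complex.exp (gaussExp A b e x)‖ * ((C + 1) * (1 + ‖x‖) ^ p) ^ m := by
      refine norm_iteratedFDeriv_comp_le (N := m) (hcexp.of_le le_top)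
        (hT.1.of_le (by exact_mod_cast le_top)) le_rfl x
        (fun i _ => norm_iteratedFDeriv_cexp_le i _) fun i hi1 him => ?_
      -- Using `C + 1` in place of `C` makes the base at least 1, hence at most its i-th power for i
      -- ≥ 1.
      have h2 : 1 ≤ (C + 1) * (1 + ‖x‖) ^ p := by
        have : 1 ≤ (1 + ‖x‖) ^ p := one_le_pow₀ (by linarith [norm_nonneg x])
        nlinarith
      calc _ ≤ C * (1 + ‖x‖) ^ p := hCb i him x
        _ ≤ (C + 1) * (1 + ‖x‖) ^ p := by gcongr; linarith
        _ ≤ _ := le_self_pow₀ h2 (by omega)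
    have h3 : ‖Complex.exp (gaussExp A b e x)‖ ≤
        Real.exp ‖e‖ * Real.exp (-(c / 2) * ‖x‖ ^ 2 + (∑ i, ‖b i‖) * ‖x‖) := by
      rw [Complex.norm_exp, ← Real.exp_add]
      exact Real.exp_le_exp.2 ((re_gaussExp_le hb b e x).trans (le_of_eq (by ring)))
    have h4 := one_add_pow_mul_exp_le (half_pos hc) (k + p * m) (∑ i, ‖b i‖) ‖x‖ (norm_nonneg x)
    calc _ ≤ (1 + ‖x‖) ^ k * (m.factorial * (Real.exp ‖e‖ * Real.exp (-(c / 2) * ‖x‖ ^ 2 +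
          (∑ i, ‖b i‖) * ‖x‖)) * ((C + 1) * (1 + ‖x‖) ^ p) ^ m) := by
          refine mul_le_mul (pow_le_pow_left₀ (norm_nonneg x) (by linarith) k) (h1.trans ?_)
            (norm_nonneg _) (by positivity)
          gcongr
      _ = m.factorial * (C + 1) ^ m * Real.exp ‖e‖ * ((1 + ‖x‖) ^ (k + p * m) *
          Real.exp (-(c / 2) * ‖x‖ ^ 2 + (∑ i, ‖b i‖) * ‖x‖)) := by
          rw [mul_pow, pow_add, pow_mul]; ring
      _ ≤ _ := by gcongr

lemma gaussS_apply {A : Matrix (Fin n) (Fin n) ℂ} (hA : GPos A) (b : Fin n → ℂ) (e : ℂ)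
    (x : Euc n) : gaussS hA b e x = Complex.exp (gaussExp A b e x) := rfl

lemma norm_toLp_sq (f : 𝓢(Euc n, ℂ)) : ‖f.toLp 2‖ ^ 2 = ∫ x, ‖f x‖ ^ 2 := by
  have h := SchwartzMap.inner_toL2_toL2_eq f f
  rw [inner_self_eq_norm_sq_to_K] at h
  have h2 : (∫ x, inner ℂ (f x) (f x)) = ((∫ x, ‖f x‖ ^ 2 : ℝ) : ℂ) := by
    rw [← integral_complex_ofReal]
    congr 1 with x
    rw [inner_self_eq_norm_sq_to_K]
    norm_cast
  rw [h2] at h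
  have h3 : ((‖f.toLp 2‖ ^ 2 : ℝ) : ℂ) = ((∫ x, ‖f x‖ ^ 2 : ℝ) : ℂ) := by
    rw [← h]; push_cast; rfl
  exact Complex.ofReal_injective h3

lemma integrable_norm_sq (f : 𝓢(Euc n, ℂ)) : Integrable fun x => ‖f x‖ ^ 2 :=
  (memLp_two_iff_integrable_sq_norm f.continuous.aestronglyMeasurable).1 (f.memLp 2)

/-- Differentiation in `L²` of a family of Schwartz functions with dominated derivative. -/
lemma hasDerivWithinAt_toLp {S : Set ℝ} (hS : Convex ℝ S) {t₀ : ℝ} (ht₀ : t₀ ∈ S)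
    {f : ℝ → 𝓢(Euc n, ℂ)} {f' : ℝ → Euc n → ℂ} {g B : 𝓢(Euc n, ℂ)} {ε : ℝ} (hε : 0 < ε)
    (hf : ∀ t ∈ S, ∀ x, HasDerivWithinAt (fun t => f t x) (f' t x) S t)
    (hB : ∀ t ∈ S, |t - t₀| < ε → ∀ x, ‖f' t x‖ ≤ ‖B x‖) (hg : ∀ x, g x = f' t₀ x) :
    HasDerivWithinAt (fun t => (f t).toLp 2 (volume : Measure (Euc n))) (g.toLp 2) S t₀ := by
  rw [hasDerivWithinAt_iff_tendsto_slope, tendsto_iff_norm_sub_tendsto_zero]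
  let h : ℝ → 𝓢(Euc n, ℂ) := fun t => (t - t₀)⁻¹ • (f t - f t₀) - g
  have hh : ∀ t, slope (fun t => (f t).toLp 2 (volume : Measure (Euc n))) t₀ t -
      g.toLp 2 (volume : Measure (Euc n)) = (h t).toLp 2 (volume : Measure (Euc n)) := fun t => rfl
  simp_rw [hh]
  suffices H : Filter.Tendsto (fun t => ‖(h t).toLp 2 (volume : Measure (Euc n))‖ ^ 2)
      (nhdsWithin t₀ (S \ {t₀})) (nhds 0) by
    have := H.sqrt
    simpa [Real.sqrt_sq (norm_nonneg _)] using this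
  simp_rw [norm_toLp_sq]
  have hgB : ∀ x, ‖g x‖ ≤ ‖B x‖ := fun x => by
    rw [hg]; exact hB t₀ ht₀ (by simpa using hε) x
  have hlim : ∫ _ : Euc n, (0 : ℝ) = 0 := by simp
  rw [← hlim]
  -- The mean value inequality bounds the difference quotient by |B|, and |g| ≤ |B| as well; hence
  -- the factor (1 + 1)² = 4.
  refine tendsto_integral_filter_of_dominated_convergence (fun x => 4 * ‖B x‖ ^ 2) ?_ ?_ ?_ ?_
  · exact Filter.Eventually.of_forall fun t =>
      ((h t).continuous.norm.pow 2).aestronglyMeasurable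
  · have hball : ∀ᶠ t in nhdsWithin t₀ (S \ {t₀}), |t - t₀| < ε :=
      nhdsWithin_le_nhds (Metric.ball_mem_nhds t₀ hε)
    filter_upwards [hball, self_mem_nhdsWithin] with t ht hts
    refine Filter.Eventually.of_forall fun x => ?_
    rw [Real.norm_eq_abs, abs_of_nonneg (by positivity)]
    have hmv : ‖f t x - f t₀ x‖ ≤ ‖B x‖ * ‖t - t₀‖ := by
      have hconv : Convex ℝ (S ∩ Metric.ball t₀ ε) := hS.inter (convex_ball _ _)
      refine hconv.norm_image_sub_le_of_norm_hasDerivWithin_le (f := fun t => f t x)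
        (f' := fun t => f' t x) (fun s hs => (hf s hs.1 x).mono Set.inter_subset_left)
        (fun s hs => hB s hs.1 (by simpa [Real.dist_eq] using hs.2) x)
        ⟨ht₀, Metric.mem_ball_self hε⟩ ⟨hts.1, by simpa [Real.dist_eq] using ht⟩
    have hne : t - t₀ ≠ 0 := sub_ne_zero.2 hts.2
    have h1 : ‖h t x‖ ≤ 2 * ‖B x‖ := by
      change ‖(t - t₀)⁻¹ • (f t x - f t₀ x) - g x‖ ≤ _
      refine (norm_sub_le _ _).trans ?_
      rw [norm_smul, norm_inv]
      have : ‖t - t₀‖⁻¹ * ‖f t x - f t₀ x‖ ≤ ‖B x‖ := by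
        rw [inv_mul_le_iff₀ (norm_pos_iff.2 hne)]; linarith
      linarith [hgB x]
    nlinarith [norm_nonneg (h t x)]
  · exact (integrable_norm_sq B).const_mul 4
  · refine Filter.Eventually.of_forall fun x => ?_
    have h1 := hasDerivWithinAt_iff_tendsto_slope.1 (hf t₀ ht₀ x)
    rw [← hg, tendsto_iff_norm_sub_tendsto_zero] at h1
    have := h1.pow 2
    simpa using! this

/-- Differentiation in `L²` of a family of Gaussians. -/
lemma hasDerivWithinAt_gauss {S : Set ℝ} (hS : Convex ℝ S) {t₀ : ℝ} (ht₀ : t₀ ∈ S)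
    {A A' : ℝ → Matrix (Fin n) (Fin n) ℂ} {b b' : ℝ → Fin n → ℂ} {e e' : ℝ → ℂ}
    (hA : ∀ t, GPos (A t))
    (dA : ∀ t ∈ S, ∀ i j, HasDerivWithinAt (fun t => A t i j) (A' t i j) S t)
    (db : ∀ t ∈ S, ∀ i, HasDerivWithinAt (fun t => b t i) (b' t i) S t)
    (de : ∀ t ∈ S, HasDerivWithinAt e (e' t) S t)
    (cA : ContinuousWithinAt A' S t₀) (cb : ContinuousWithinAt b' S t₀)
    (ce : ContinuousWithinAt e' S t₀) {g : 𝓢(Euc n, ℂ)}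
    (hg : ∀ x, g x = gaussExp (A' t₀) (b' t₀) (e' t₀) x * gaussS (hA t₀) (b t₀) (e t₀) x) :
    HasDerivWithinAt (fun t => (gaussS (hA t) (b t) (e t)).toLp 2 (volume : Measure (Euc n)))
      (g.toLp 2) S t₀ := by
  obtain ⟨c, hc, hb⟩ := (hA t₀).exists_bound
  have cA0 : ContinuousWithinAt A S t₀ := continuousWithinAt_pi.2 fun i =>
    continuousWithinAt_pi.2 fun j => (dA t₀ ht₀ i j).continuousWithinAt
  have cb0 : ContinuousWithinAt b S t₀ := continuousWithinAt_pi.2 fun i =>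
    (db t₀ ht₀ i).continuousWithinAt
  have ce0 := (de t₀ ht₀).continuousWithinAt
  let K : ℝ → ℝ := fun t => (∑ i, ∑ j, ‖A' t i j‖) + (∑ i, ‖b' t i‖) + ‖e' t‖ +
    (∑ i, ‖b t i‖) + ‖e t‖
  have hK : ContinuousWithinAt K S t₀ := by
    have e1 : ∀ i j, ContinuousWithinAt (fun t => A' t i j) S t₀ := fun i j =>
      continuousWithinAt_pi.1 (continuousWithinAt_pi.1 cA i) j
    have e2 : ∀ i, ContinuousWithinAt (fun t => b' t i) S t₀ := continuousWithinAt_pi.1 cb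
    have e3 : ∀ i, ContinuousWithinAt (fun t => b t i) S t₀ := continuousWithinAt_pi.1 cb0
    have s1 : ContinuousWithinAt (fun t => ∑ i, ∑ j, ‖A' t i j‖) S t₀ :=
      tendsto_finsetSum _ fun i _ => tendsto_finsetSum _ fun j _ => (e1 i j).norm
    have s2 : ContinuousWithinAt (fun t => ∑ i, ‖b' t i‖) S t₀ :=
      tendsto_finsetSum _ fun i _ => (e2 i).norm
    have s3 : ContinuousWithinAt (fun t => ∑ i, ‖b t i‖) S t₀ :=
      tendsto_finsetSum _ fun i _ => (e3 i).norm
    exact (((s1.add s2).add ce.norm).add s3).add ce0.norm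
  let d : ℝ → ℝ := fun t => ∑ i, ∑ j, ‖(A t - A t₀) i j‖
  have hd : Filter.Tendsto d (nhdsWithin t₀ S) (nhds 0) := by
    have h0 : (0 : ℝ) = ∑ i : Fin n, ∑ j : Fin n, ‖(A t₀ - A t₀) i j‖ := by simp
    rw [h0]
    exact tendsto_finsetSum _ fun i _ => tendsto_finsetSum _ fun j _ =>
      (((continuousWithinAt_pi.1 (continuousWithinAt_pi.1 cA0 i) j).sub
        continuousWithinAt_const).norm)
  have hev : ∀ᶠ t in nhdsWithin t₀ S, K t < K t₀ + 1 ∧ d t < c / 2 :=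
    (hK.eventually_lt_const (lt_add_one _)).and (hd.eventually_lt_const (half_pos hc))
  obtain ⟨ε, hε, hball⟩ := Metric.mem_nhdsWithin_iff.1 hev
  set L := K t₀ + 1 with hL
  have hL0 : 0 < L := by
    have : 0 ≤ K t₀ := by positivity
    linarith
  -- Near t₀ the coercivity constant stays above c/2, so the Gaussians decay like exp(-c|x|²/4) up
  -- to linear terms. Half of this rate absorbs the quadratic prefactor and the linear terms, and
  -- exp(-c|x|²/8) remains.
  let B : 𝓢(Euc n, ℂ) := ((L * Real.exp L * Real.exp ((2 + L) ^ 2 / (4 * (c / 8))) : ℝ) : ℂ) •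
    gaussS (gpos_smul_one (ι := Fin n) (a := c / 4) (by positivity)) 0 0
  have hBx : ∀ x, ‖B x‖ = L * Real.exp L * Real.exp ((2 + L) ^ 2 / (4 * (c / 8))) *
      Real.exp (-(c / 8) * ‖x‖ ^ 2) := by
    intro x
    change ‖(_ : ℂ) * gaussS _ 0 0 x‖ = _
    rw [norm_mul, Complex.norm_real, Real.norm_of_nonneg (by positivity), gaussS_apply,
      Complex.norm_exp, gaussExp, smul_mulVec, one_mulVec, dotProduct_smul, cvec_dot,
      zero_dotProduct, add_zero, add_zero, smul_eq_mul, ← ofReal_mul]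
    congr 2
    have : x.ofLp ⬝ᵥ x.ofLp = ‖x‖ ^ 2 := by
      rw [← sum_sq_eq_norm]; exact Finset.sum_congr rfl fun i _ => (sq _).symm
    rw [this, ← ofReal_neg, ← ofReal_ofNat, ← ofReal_div, ofReal_re]
    ring
  refine hasDerivWithinAt_toLp hS ht₀ (B := B) hε
    (f' := fun t x => gaussExp (A' t) (b' t) (e' t) x * gaussS (hA t) (b t) (e t) x)
    (fun t ht x => ?_) (fun t ht htε x => ?_) hg
  · have h1 : HasDerivWithinAt (fun t => gaussExp (A t) (b t) (e t) x)
        (gaussExp (A' t) (b' t) (e' t) x) S t := by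
      unfold gaussExp
      simp only [dotProduct, mulVec]
      refine ((HasDerivWithinAt.fun_sum fun i _ => ?_).fun_neg.div_const 2).add
        (HasDerivWithinAt.fun_sum fun i _ => (db t ht i).mul_const _) |>.add (de t ht)
      exact (HasDerivWithinAt.fun_sum fun j _ => (dA t ht i j).mul_const _).const_mul _
    simp only [gaussS_apply]
    rw [mul_comm]
    exact h1.cexp
  · obtain ⟨hKt, hdt⟩ := hball ⟨by simpa [Real.dist_eq] using htε, ht⟩
    have p1 : 0 ≤ ∑ i, ∑ j, ‖A' t i j‖ := by positivity
    have p2 : 0 ≤ ∑ i, ‖b' t i‖ := by positivity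
    have p3 : 0 ≤ ∑ i, ‖b t i‖ := by positivity
    have hr := norm_nonneg x
    have hq1 : ‖gaussExp (A' t) (b' t) (e' t) x‖ ≤ L * (1 + ‖x‖) ^ 2 := by
      have q1 := norm_quad_le (A' t) x.ofLp
      rw [sum_sq_eq_norm] at q1
      have q2 := norm_dot_cvec_le (b' t) x
      rw [gaussExp]
      refine (norm_add₃_le).trans ?_
      rw [norm_div, norm_neg, Complex.norm_ofNat]
      have q3 := norm_nonneg (e' t)
      have q4 := norm_nonneg (e t)
      have : L * (1 + ‖x‖) ^ 2 ≥ ((∑ i, ∑ j, ‖A' t i j‖) + (∑ i, ‖b' t i‖) + ‖e' t‖) *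
          (1 + ‖x‖) ^ 2 := by
        gcongr
        simp only [K] at hKt
        linarith
      nlinarith [mul_nonneg p1 hr, mul_nonneg p2 hr, mul_nonneg q3 hr,
        mul_nonneg p2 (sq_nonneg ‖x‖), mul_nonneg q3 (sq_nonneg ‖x‖), mul_nonneg p1 (sq_nonneg ‖x‖)]
    have hq2 : ‖gaussS (hA t) (b t) (e t) x‖ ≤
        Real.exp L * Real.exp (-(c / 4) * ‖x‖ ^ 2 + L * ‖x‖) := by
      have hb2 : ∀ x : Fin n → ℝ, c / 2 * ∑ i, x i ^ 2 ≤ (cvec x ⬝ᵥ (A t *ᵥ cvec x)).re := by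
        intro x
        have q1 := hb x
        have q2 := norm_quad_le (A t - A t₀) x
        have q3 := Complex.abs_re_le_norm (cvec x ⬝ᵥ ((A t - A t₀) *ᵥ cvec x))
        have q4 : (cvec x ⬝ᵥ ((A t - A t₀) *ᵥ cvec x)).re = (cvec x ⬝ᵥ (A t *ᵥ cvec x)).re -
            (cvec x ⬝ᵥ (A t₀ *ᵥ cvec x)).re := by
          rw [sub_mulVec, dotProduct_sub, Complex.sub_re]
        have q5 : (0 : ℝ) ≤ ∑ i, x i ^ 2 := by positivity
        have q6 : d t * ∑ i, x i ^ 2 ≤ c / 2 * ∑ i, x i ^ 2 := by gcongr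
        rw [q4] at q3
        have q7 := neg_abs_le ((cvec x ⬝ᵥ (A t *ᵥ cvec x)).re - (cvec x ⬝ᵥ (A t₀ *ᵥ cvec x)).re)
        simp only [d] at q6
        linarith
      rw [gaussS_apply, Complex.norm_exp, ← Real.exp_add]
      refine Real.exp_le_exp.2 ((re_gaussExp_le hb2 (b t) (e t) x).trans ?_)
      have q3 := norm_nonneg (e' t)
      have q4 := norm_nonneg (e t)
      have q8 : (∑ i, ‖b t i‖) * ‖x‖ ≤ L * ‖x‖ := by
        gcongr
        simp only [K] at hKt
        linarith
      simp only [K] at hKt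
      linarith
    have h4 := one_add_pow_mul_exp_le (c := c / 8) (by positivity) 2 L ‖x‖ hr
    rw [norm_mul, hBx]
    calc _ ≤ (L * (1 + ‖x‖) ^ 2) * (Real.exp L * Real.exp (-(c / 4) * ‖x‖ ^ 2 + L * ‖x‖)) :=
          mul_le_mul hq1 hq2 (norm_nonneg _) (by positivity)
      _ = L * Real.exp L * ((1 + ‖x‖) ^ 2 * Real.exp (-(c / 8) * ‖x‖ ^ 2 + L * ‖x‖)) *
          Real.exp (-(c / 8) * ‖x‖ ^ 2) := by
          have : -(c / 4) * ‖x‖ ^ 2 + L * ‖x‖ =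
            (-(c / 8) * ‖x‖ ^ 2 + L * ‖x‖) + -(c / 8) * ‖x‖ ^ 2 := by ring
          rw [this, Real.exp_add (-(c / 8) * ‖x‖ ^ 2 + L * ‖x‖)]; ring
      _ ≤ _ := by
          push_cast at h4
          gcongr

end GaussianSchwartz

/-! ### Weyl quantization on the Schwartz space -/

section SchwartzOperators

open scoped LineDeriv

variable {n : ℕ}

/-- The position operators `x_j` and the momentum operators `i ∂_k`. -/
def phaseOp : Idx n → 𝓢(Euc n, ℂ) →L[ℂ] 𝓢(Euc n, ℂ)
  | Sum.inl j => SchwartzMap.smulLeftCLM ℂ fun x : Euc n => (x j : ℂ)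
  | Sum.inr k => I • LineDeriv.lineDerivOpCLM ℂ 𝓢(Euc n, ℂ) (EuclideanSpace.single k (1 : ℝ))

lemma phaseOp_inl (j : Fin n) (φ : 𝓢(Euc n, ℂ)) (x : Euc n) :
    phaseOp (Sum.inl j) φ x = (x j : ℂ) * φ x :=
  SchwartzMap.smulLeftCLM_apply_apply (hasTemperateGrowth_coord j) φ x

lemma phaseOp_inr (k : Fin n) (φ : 𝓢(Euc n, ℂ)) (x : Euc n) :
    phaseOp (Sum.inr k) φ x = I * lineDeriv ℝ φ x (EuclideanSpace.single k 1) := by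
  rw [← SchwartzMap.lineDerivOp_apply]; rfl

lemma inner_toLp (f g : 𝓢(Euc n, ℂ)) :
    inner ℂ (f.toLp 2 (volume : Measure (Euc n))) (g.toLp 2) = ∫ x, inner ℂ (f x) (g x) :=
  SchwartzMap.inner_toL2_toL2_eq f g

lemma hasLineDerivAt_schwartz (φ : 𝓢(Euc n, ℂ)) (x v : Euc n) :
    HasLineDerivAt ℝ φ (lineDeriv ℝ φ x v) x v :=
  (φ.differentiableAt.lineDifferentiableAt).hasLineDerivAt

/-- The Weyl quantization of `q_M` as an operator on the Schwartz space. -/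
def weylS (M : Matrix (Idx n) (Idx n) ℂ) (φ : 𝓢(Euc n, ℂ)) : 𝓢(Euc n, ℂ) :=
  ∑ a, ∑ b, M a b • phaseOp a (phaseOp b φ)

lemma sum_apply' {α : Type*} (s : Finset α) (f : α → 𝓢(Euc n, ℂ)) (x : Euc n) :
    (∑ a ∈ s, f a) x = ∑ a ∈ s, f a x := by
  classical
  induction s using Finset.induction_on with
  | empty => simp
  | insert a s ha ih =>
    rw [Finset.sum_insert ha, Finset.sum_insert ha, ← ih]; rfl

lemma weylS_apply (M : Matrix (Idx n) (Idx n) ℂ) (φ : 𝓢(Euc n, ℂ)) (x : Euc n) :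
    weylS M φ x = ∑ a, ∑ b, M a b * phaseOp a (phaseOp b φ) x := by
  rw [weylS, sum_apply']
  refine Finset.sum_congr rfl fun a _ => ?_
  rw [sum_apply']
  rfl

lemma weylS_add (M : Matrix (Idx n) (Idx n) ℂ) (φ ψ : 𝓢(Euc n, ℂ)) :
    weylS M (φ + ψ) = weylS M φ + weylS M ψ := by
  simp only [weylS, map_add, smul_add, Finset.sum_add_distrib]

lemma weylS_smul (M : Matrix (Idx n) (Idx n) ℂ) (c : ℂ) (φ : 𝓢(Euc n, ℂ)) :
    weylS M (c • φ) = c • weylS M φ := by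
  simp only [weylS, map_smul, Finset.smul_sum, smul_comm c]

lemma hasDerivAt_coord (p : Euc n) (j k : Fin n) :
    HasDerivAt (fun t : ℝ => (((p + t • EuclideanSpace.single k (1 : ℝ)) j : ℝ) : ℂ))
      (if j = k then 1 else 0) 0 := by
  have h1 : HasDerivAt (fun t : ℝ => p j + t * (if j = k then (1 : ℝ) else 0))
      (1 * (if j = k then (1 : ℝ) else 0)) 0 :=
    ((hasDerivAt_id (0 : ℝ)).mul_const _).const_add _
  have h2 := h1.ofReal_comp
  rw [one_mul] at h2
  have h3 : (fun t : ℝ => (((p + t • EuclideanSpace.single k (1 : ℝ)) j : ℝ) : ℂ)) =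
      fun t : ℝ => ((p j + t * (if j = k then (1 : ℝ) else 0) : ℝ) : ℂ) := by
    ext t
    simp
  rw [h3]
  exact h2.congr_deriv (by split_ifs <;> simp)

/-- The midpoint p + s/2 produces the symmetrised product ½(x_j·i∂_k + i∂_k·x_j). For symmetric M
this is the sum of the two orderings in `weylS`. -/
lemma weylQuad_eq_weylS {M : Matrix (Idx n) (Idx n) ℂ} (hM : M.IsSymm) (φ : 𝓢(Euc n, ℂ))
    (p : Euc n) : weylQuad M φ p = weylS M φ p := by
  have hlin : ∀ (ψ : 𝓢(Euc n, ℂ)) (k : Fin n),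
      partialD k (fun s => ψ (p + s)) = fun s => lineDeriv ℝ ψ (p + s) (EuclideanSpace.single k 1)
      := by
    intro ψ k
    ext s
    simp only [partialD, lineDeriv, add_assoc]
  have hmm : ∀ j k : Fin n, I ^ 2 * partialD j (partialD k (fun s => φ (p + s))) 0 =
      phaseOp (Sum.inr j) (phaseOp (Sum.inr k) φ) p := by
    intro j k
    have h1 : partialD k (fun s => φ (p + s)) = fun s =>
        (∂_{EuclideanSpace.single k (1 : ℝ)} φ : 𝓢(Euc n, ℂ)) (p + s) := by
      rw [hlin]
      ext s
      rw [SchwartzMap.lineDerivOp_apply]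
    have h2 : phaseOp (Sum.inr k) φ = I • (∂_{EuclideanSpace.single k (1 : ℝ)} φ) := rfl
    rw [h1, hlin, h2, map_smul, _root_.smul_apply, phaseOp_inr]
    simp only [smul_eq_mul, add_zero]
    ring
  have hpm : ∀ j k : Fin n, I * partialD k (fun s => ((p j : ℂ) + (s j : ℂ) / 2) * φ (p + s)) 0 =
      2⁻¹ * (phaseOp (Sum.inl j) (phaseOp (Sum.inr k) φ) p +
        phaseOp (Sum.inr k) (phaseOp (Sum.inl j) φ) p) := by
    intro j k
    have hφ : HasDerivAt (fun t : ℝ => φ (p + t • EuclideanSpace.single k (1 : ℝ)))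
      (lineDeriv ℝ φ p (EuclideanSpace.single k 1)) 0 := hasLineDerivAt_schwartz φ p _
    have e1 : lineDeriv ℝ (phaseOp (Sum.inl j) φ) p (EuclideanSpace.single k 1) =
        (if j = k then 1 else 0) * φ p + p j * lineDeriv ℝ φ p (EuclideanSpace.single k 1) := by
      have := ((hasDerivAt_coord p j k).mul hφ).deriv
      simp only [zero_smul, add_zero] at this
      rw [← this, lineDeriv]
      congr 1
      ext t
      rw [phaseOp_inl]; rfl
    have e2 : partialD k (fun s => ((p j : ℂ) + (s j : ℂ) / 2) * φ (p + s)) 0 =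
        ((if j = k then 1 else 0) / 2) * φ p +
          p j * lineDeriv ℝ φ p (EuclideanSpace.single k 1) := by
      have := ((((hasDerivAt_coord 0 j k).div_const 2).const_add (p j : ℂ)).mul hφ).deriv
      simp only [zero_smul, add_zero, zero_add] at this
      rw [partialD, lineDeriv]
      simp only [zero_add]
      refine this.trans ?_
      simp
    rw [e2, phaseOp_inl, phaseOp_inr, phaseOp_inr, e1]
    ring
  rw [weylQuad, weylS_apply]
  simp only [Fintype.sum_sum_type, Finset.sum_add_distrib]
  have hswap : ∑ j : Fin n, ∑ k : Fin n, M (Sum.inr j) (Sum.inl k) *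
        phaseOp (Sum.inr j) (phaseOp (Sum.inl k) φ) p =
      ∑ j : Fin n, ∑ k : Fin n, M (Sum.inr k) (Sum.inl j) *
        phaseOp (Sum.inr k) (phaseOp (Sum.inl j) φ) p := Finset.sum_comm
  rw [hswap, add_assoc, add_assoc]
  congr 1
  · refine Finset.sum_congr rfl fun j _ => Finset.sum_congr rfl fun k _ => ?_
    rw [phaseOp_inl, phaseOp_inl]; ring
  rw [← add_assoc]
  congr 1
  · simp only [← Finset.sum_add_distrib]
    refine Finset.sum_congr rfl fun j _ => Finset.sum_congr rfl fun k _ => ?_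
    rw [hpm, hM.apply (Sum.inl j) (Sum.inr k)]
    ring
  · refine Finset.sum_congr rfl fun j _ => Finset.sum_congr rfl fun k _ => ?_
    rw [hmm]

/-- For i∂_k this is integration by parts: the sign it produces is undone by the conjugation of i.
-/
lemma inner_phaseOp (a : Idx n) (φ ψ : 𝓢(Euc n, ℂ)) :
    inner ℂ ((phaseOp a φ).toLp 2 (volume : Measure (Euc n))) (ψ.toLp 2) =
      inner ℂ (φ.toLp 2 (volume : Measure (Euc n))) ((phaseOp a ψ).toLp 2) := by
  rw [inner_toLp, inner_toLp]
  rcases a with j | k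
  · congr 1 with x
    rw [phaseOp_inl, phaseOp_inl]
    simp only [RCLike.inner_apply, map_mul, Complex.conj_ofReal]
    ring
  · let L : ℂ →L[ℝ] ℂ →L[ℝ] ℂ := (ContinuousLinearMap.mul ℝ ℂ).comp
      Complex.conjCLE.toContinuousLinearMap
    have h := SchwartzMap.integral_bilinear_lineDerivOp_right_eq_neg_left (μ := volume) φ ψ L
      (EuclideanSpace.single k (1 : ℝ))
    have h1 : ∀ x, inner ℂ (phaseOp (Sum.inr k) φ x) (ψ x) =
        -I * L ((∂_{EuclideanSpace.single k (1 : ℝ)} φ : 𝓢(Euc n, ℂ)) x) (ψ x) := by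
      intro x
      rw [phaseOp_inr]
      simp [L, RCLike.inner_apply]
      rw [SchwartzMap.lineDerivOp_apply]
      ring
    have h2 : ∀ x, inner ℂ (φ x) (phaseOp (Sum.inr k) ψ x) =
        I * L (φ x) ((∂_{EuclideanSpace.single k (1 : ℝ)} ψ : 𝓢(Euc n, ℂ)) x) := by
      intro x
      rw [phaseOp_inr]
      simp [L, RCLike.inner_apply]
      rw [SchwartzMap.lineDerivOp_apply]
      ring
    simp_rw [h1, h2]
    rw [integral_const_mul, integral_const_mul, h]
    ring

lemma toLp_sum {α : Type*} (s : Finset α) (f : α → 𝓢(Euc n, ℂ)) :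
    (∑ a ∈ s, f a).toLp 2 (volume : Measure (Euc n)) =
      ∑ a ∈ s, (f a).toLp 2 (volume : Measure (Euc n)) :=
  map_sum (SchwartzMap.toLpCLM ℂ ℂ 2 (volume : Measure (Euc n))) f s

lemma toLp_smul (c : ℂ) (f : 𝓢(Euc n, ℂ)) :
    (c • f).toLp 2 (volume : Measure (Euc n)) = c • f.toLp 2 (volume : Measure (Euc n)) :=
  map_smul (SchwartzMap.toLpCLM ℂ ℂ 2 (volume : Measure (Euc n))) c f

lemma toLp_weylS (M : Matrix (Idx n) (Idx n) ℂ) (φ : 𝓢(Euc n, ℂ)) :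
    (weylS M φ).toLp 2 (volume : Measure (Euc n)) =
      ∑ a, ∑ b, M a b • (phaseOp a (phaseOp b φ)).toLp 2 (volume : Measure (Euc n)) := by
  simp only [weylS, toLp_sum, toLp_smul]

/-- Passing to the adjoint reverses the order of the two factors, which the symmetry of M absorbs;
only the conjugation of the coefficients remains. -/
lemma inner_weylS {M : Matrix (Idx n) (Idx n) ℂ} (hM : M.IsSymm) (φ ψ : 𝓢(Euc n, ℂ)) :
    inner ℂ ((weylS M φ).toLp 2 (volume : Measure (Euc n))) (ψ.toLp 2) =
      inner ℂ (φ.toLp 2 (volume : Measure (Euc n))) ((weylS (M.map star) ψ).toLp 2) := by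
  simp only [toLp_weylS, sum_inner, inner_sum, inner_smul_left, inner_smul_right]
  rw [Finset.sum_comm]
  refine Finset.sum_congr rfl fun a _ => Finset.sum_congr rfl fun b _ => ?_
  rw [inner_phaseOp, inner_phaseOp, hM.apply a b]
  rfl

lemma integrable_inner_schwartz (f g : 𝓢(Euc n, ℂ)) :
    Integrable fun x => inner ℂ (f x) (g x) := by
  refine (L2.integrable_inner (𝕜 := ℂ) (f.toLp 2 (volume : Measure (Euc n)))
    (g.toLp 2 (volume : Measure (Euc n)))).congr ?_
  filter_upwards [f.coeFn_toLp 2 (volume : Measure (Euc n)),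
    g.coeFn_toLp 2 (volume : Measure (Euc n))] with x h1 h2
  rw [h1, h2]

/-- Moving one factor across the inner product turns ⟨φ, 𝒲(q_M)φ⟩ into the integral of the Hermitian
form of M at the vector of the functions x_jφ and i∂_kφ. No ordering correction appears. -/
lemma re_inner_weylS_le {M : Matrix (Idx n) (Idx n) ℂ} (hM : M.IsSymm)
    (hq : ∀ x y : Fin n → ℝ, (qform M x y).re ≤ 0) (φ : 𝓢(Euc n, ℂ)) :
    (inner ℂ (φ.toLp 2 (volume : Measure (Euc n))) ((weylS M φ).toLp 2)).re ≤ 0 := by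
  have h1 : inner ℂ (φ.toLp 2 (volume : Measure (Euc n))) ((weylS M φ).toLp 2) =
      ∫ x, star (fun a => phaseOp a φ x) ⬝ᵥ (M *ᵥ fun a => phaseOp a φ x) := by
    have h0 : ∀ a b, inner ℂ (φ.toLp 2 (volume : Measure (Euc n)))
        ((phaseOp a (phaseOp b φ)).toLp 2) = ∫ x, inner ℂ (phaseOp a φ x) (phaseOp b φ x) :=
      fun a b => by rw [← inner_phaseOp, inner_toLp]
    simp only [toLp_weylS, inner_sum, inner_smul_right, h0]
    simp only [dotProduct, mulVec, Finset.mul_sum]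
    have hint : ∀ a b, Integrable fun x => star (phaseOp a φ x) * (M a b * phaseOp b φ x) := by
      intro a b
      have h2 : Integrable fun x => inner ℂ (phaseOp a φ x) (phaseOp b φ x) :=
        integrable_inner_schwartz _ _
      refine (h2.const_mul (M a b)).congr (Filter.Eventually.of_forall fun x => ?_)
      simp only [RCLike.inner_apply]
      simp
      ring
    refine Eq.trans ?_ (integral_finsetSum _ fun a _ =>
      integrable_finsetSum _ fun b _ => hint a b).symm
    refine Finset.sum_congr rfl fun a _ => ?_
    refine Eq.trans ?_ (integral_finsetSum _ fun b _ => hint a b).symm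
    refine Finset.sum_congr rfl fun b _ => ?_
    rw [← integral_const_mul]
    congr 1 with x
    simp only [RCLike.inner_apply]
    simp
    ring
  rw [h1]
  by_cases hi : Integrable fun x => star (fun a => phaseOp a φ x) ⬝ᵥ (M *ᵥ fun a => phaseOp a φ x)
  · have h2 := integral_re hi
    simp only [RCLike.re_eq_complex_re] at h2
    rw [← h2]
    refine integral_nonpos fun x => ?_
    rw [re_hermitian_quad hM]
    exact add_nonpos (hq _ _) (hq _ _)
  -- A non-integrable integrand has integral 0 by convention, which satisfies the bound too.
  · rw [integral_undef hi]; simp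

/-- The symbol of the position and momentum operators acting on a Gaussian. -/
def gaussPhase (A : Matrix (Fin n) (Fin n) ℂ) (b : Fin n → ℂ) (x : Euc n) : Idx n → ℂ :=
  Sum.elim (cvec x.ofLp) (I • (b - A *ᵥ cvec x.ofLp))

lemma hasDerivAt_mulVec_line (A : Matrix (Fin n) (Fin n) ℂ) (x : Euc n) (j k : Fin n) :
    HasDerivAt (fun t : ℝ => (A *ᵥ cvec (x + t • EuclideanSpace.single k (1 : ℝ)).ofLp) j)
      (A j k) 0 := by
  simp only [mulVec, dotProduct]
  refine (HasDerivAt.fun_sum fun i _ => (hasDerivAt_coord x i k).const_mul (A j i)).congr_deriv ?_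
  simp

lemma hasDerivAt_gaussExp_line {A : Matrix (Fin n) (Fin n) ℂ} (hA : A.IsSymm) (b : Fin n → ℂ)
    (e : ℂ) (x : Euc n) (k : Fin n) :
    HasDerivAt (fun t : ℝ => gaussExp A b e (x + t • EuclideanSpace.single k (1 : ℝ)))
      ((b - A *ᵥ cvec x.ofLp) k) 0 := by
  unfold gaussExp
  simp only [dotProduct]
  have h1 := HasDerivAt.fun_sum (u := Finset.univ) fun i _ =>
    (hasDerivAt_coord x i k).fun_mul (hasDerivAt_mulVec_line A x i k)
  have h2 := HasDerivAt.fun_sum (u := Finset.univ) fun i _ => (hasDerivAt_coord x i k).const_mul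
    (b i)
  refine (((h1.fun_neg.div_const 2).fun_add h2).add_const e).congr_deriv ?_
  simp only [zero_smul, add_zero, ite_mul, one_mul, zero_mul, Finset.sum_add_distrib,
    Finset.sum_ite_eq', Finset.mem_univ, if_true, mul_ite, mul_one, mul_zero, Pi.sub_apply]
  have h3 : ∑ i, (x i : ℂ) * A i k = (A *ᵥ cvec x.ofLp) k := by
    simp only [mulVec, dotProduct]
    exact Finset.sum_congr rfl fun i _ => by rw [hA.apply k i, mul_comm]; rfl
  rw [h3]
  ring

lemma phaseOp_gaussS {A : Matrix (Fin n) (Fin n) ℂ} (hA : GPos A) (b : Fin n → ℂ) (e : ℂ)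
    (a : Idx n) (x : Euc n) :
    phaseOp a (gaussS hA b e) x = gaussPhase A b x a * gaussS hA b e x := by
  rcases a with j | k
  · rw [phaseOp_inl]; rfl
  · rw [phaseOp_inr]
    have h := (hasDerivAt_gaussExp_line hA.symm b e x k).cexp.deriv
    simp only [zero_smul, add_zero] at h
    have h1 : lineDeriv ℝ (gaussS hA b e) x (EuclideanSpace.single k 1) =
        Complex.exp (gaussExp A b e x) * (b - A *ᵥ cvec x.ofLp) k := h
    rw [h1, gaussS_apply, gaussPhase]
    simp only [Sum.elim_inr, Pi.smul_apply, smul_eq_mul]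
    ring

/-- The action of `i ∂_k` on `gaussPhase`. -/
def gaussPhaseD (A : Matrix (Fin n) (Fin n) ℂ) : Matrix (Idx n) (Idx n) ℂ :=
  fromBlocks 0 0 (I • 1) A

lemma phaseOp_phaseOp_gaussS {A : Matrix (Fin n) (Fin n) ℂ} (hA : GPos A) (b : Fin n → ℂ) (e : ℂ)
    (a c : Idx n) (x : Euc n) :
    phaseOp a (phaseOp c (gaussS hA b e)) x =
      (gaussPhase A b x a * gaussPhase A b x c + gaussPhaseD A a c) * gaussS hA b e x := by
  rcases a with j | k
  · rw [phaseOp_inl, phaseOp_gaussS]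
    have : gaussPhaseD A (Sum.inl j) c = 0 := by rcases c with c | c <;> rfl
    rw [this]
    simp only [gaussPhase, Sum.elim_inl, cvec]
    ring
  · have hg := (hasDerivAt_gaussExp_line hA.symm b e x k).cexp
    have hz : ∃ d, HasDerivAt (fun t : ℝ => gaussPhase A b (x + t • EuclideanSpace.single k
      (1 : ℝ)) c)
        d 0 ∧ I * d = gaussPhaseD A (Sum.inr k) c := by
      rcases c with j | j
      · refine ⟨_, hasDerivAt_coord x j k, ?_⟩
        simp [gaussPhaseD, Matrix.one_apply, eq_comm]
      · refine ⟨_, ((hasDerivAt_const (0 : ℝ) (b j)).sub (hasDerivAt_mulVec_line A x j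
          k)).const_mul I, ?_⟩
        simp only [gaussPhaseD, fromBlocks_apply₂₂]
        rw [hA.symm.apply k j]
        linear_combination (-A k j) * I_mul_I
    obtain ⟨d, hd, hd2⟩ := hz
    rw [phaseOp_inr]
    have h := (hd.mul hg).deriv
    simp only [zero_smul, add_zero] at h
    have h1 : lineDeriv ℝ (phaseOp c (gaussS hA b e)) x (EuclideanSpace.single k 1) =
        d * Complex.exp (gaussExp A b e x) + gaussPhase A b x c *
          (Complex.exp (gaussExp A b e x) * (b - A *ᵥ cvec x.ofLp) k) := by
      rw [← h, lineDeriv]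
      congr 1
      ext t
      exact phaseOp_gaussS hA b e c _
    rw [h1, gaussS_apply, ← hd2]
    simp only [gaussPhase, Sum.elim_inr, Pi.smul_apply, smul_eq_mul]
    ring

lemma weylS_gaussS (M : Matrix (Idx n) (Idx n) ℂ) {A : Matrix (Fin n) (Fin n) ℂ} (hA : GPos A)
    (b : Fin n → ℂ) (e : ℂ) (x : Euc n) :
    weylS M (gaussS hA b e) x = (gaussPhase A b x ⬝ᵥ (M *ᵥ gaussPhase A b x) +
      (M * (gaussPhaseD A)ᵀ).trace) * gaussS hA b e x := by
  simp only [weylS_apply, phaseOp_phaseOp_gaussS, trace, diag, mul_apply, dotProduct, mulVec,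
    transpose_apply, add_mul, mul_add, Finset.sum_add_distrib, Finset.sum_mul, Finset.mul_sum]
  congr 1 <;>
  exact Finset.sum_congr rfl fun a _ => Finset.sum_congr rfl fun c _ => by ring

lemma trace_fromBlocks' (A B C D : Matrix (Fin n) (Fin n) ℂ) :
    (fromBlocks A B C D).trace = A.trace + D.trace := by
  simp [trace, Fintype.sum_sum_type]

/-- The three coefficients are the right-hand sides of the evolution equations for the Gaussian: a
Riccati equation for A, a linear one for b, and a quadrature for e. -/
lemma weylS_gaussS' {M₁₁ M₁₂ M₂₂ : Matrix (Fin n) (Fin n) ℂ} (h22 : M₂₂.IsSymm)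
    {A : Matrix (Fin n) (Fin n) ℂ} (hA : GPos A)
    (b : Fin n → ℂ) (e : ℂ) (x : Euc n) :
    weylS (fromBlocks M₁₁ M₁₂ M₁₂ᵀ M₂₂) (gaussS hA b e) x =
      gaussExp ((-2 : ℂ) • (M₁₁ - I • (M₁₂ * A) - I • (A * M₁₂ᵀ) - A * M₂₂ * A))
        ((2 * I) • ((M₁₂ - I • (A * M₂₂)) *ᵥ b))
        (-(b ⬝ᵥ (M₂₂ *ᵥ b)) + I * M₁₂.trace + (M₂₂ * A).trace) x * gaussS hA b e x := by
  rw [weylS_gaussS]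
  congr 1
  have h1 : (fromBlocks M₁₁ M₁₂ M₁₂ᵀ M₂₂ * (gaussPhaseD A)ᵀ).trace =
      I * M₁₂.trace + (M₂₂ * A).trace := by
    rw [gaussPhaseD, fromBlocks_transpose, fromBlocks_multiply, hA.symm.eq, trace_fromBlocks']
    simp only [transpose_zero, Matrix.mul_zero, add_zero, trace_zero, zero_add, transpose_smul,
      transpose_one,
      Matrix.mul_smul, Matrix.mul_one, trace_add, trace_smul, trace_transpose, smul_eq_mul]
  rw [h1]
  set v := cvec x.ofLp with hv
  have s1 : ∀ (B : Matrix (Fin n) (Fin n) ℂ) (p q : Fin n → ℂ), p ⬝ᵥ (B *ᵥ q) = q ⬝ᵥ (Bᵀ *ᵥ p) := by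
    intro B p q
    rw [mulVec_transpose, dotProduct_comm q, dotProduct_mulVec]
  have h2 : gaussPhase A b x ⬝ᵥ (fromBlocks M₁₁ M₁₂ M₁₂ᵀ M₂₂ *ᵥ gaussPhase A b x) =
      v ⬝ᵥ (M₁₁ *ᵥ v) + 2 * I * (v ⬝ᵥ (M₁₂ *ᵥ (b - A *ᵥ v))) -
        (b - A *ᵥ v) ⬝ᵥ (M₂₂ *ᵥ (b - A *ᵥ v)) := by
    rw [gaussPhase, fromBlocks_mulVec, sumElim_dotProduct_sumElim]
    simp only [Sum.elim_comp_inl, Sum.elim_comp_inr, mulVec_smul, dotProduct_add, smul_dotProduct,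
      dotProduct_smul, smul_eq_mul]
    rw [s1 M₁₂ᵀ, transpose_transpose]
    linear_combination ((b - A *ᵥ v) ⬝ᵥ (M₂₂ *ᵥ (b - A *ᵥ v))) * I_mul_I
  rw [h2, gaussExp, ← hv]
  have h3 : (A *ᵥ v) ⬝ᵥ (M₂₂ *ᵥ (A *ᵥ v)) = v ⬝ᵥ ((A * M₂₂ * A) *ᵥ v) := by
    rw [dotProduct_comm, s1, hA.symm.eq, mulVec_mulVec, mulVec_mulVec, dotProduct_comm]
  have h4 : (A *ᵥ v) ⬝ᵥ (M₂₂ *ᵥ b) = v ⬝ᵥ ((A * M₂₂) *ᵥ b) := by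
    rw [dotProduct_comm, s1, hA.symm.eq, mulVec_mulVec]
  have h5 : b ⬝ᵥ (M₂₂ *ᵥ (A *ᵥ v)) = v ⬝ᵥ ((A * M₂₂) *ᵥ b) := by
    rw [s1, h22.eq, h4]
  have h6 : v ⬝ᵥ ((A * M₁₂ᵀ) *ᵥ v) = v ⬝ᵥ ((M₁₂ * A) *ᵥ v) := by
    rw [s1, transpose_mul, transpose_transpose, hA.symm.eq]
  have h7 : ((2 * I) • ((M₁₂ - I • (A * M₂₂)) *ᵥ b)) ⬝ᵥ v =
      2 * I * (v ⬝ᵥ (M₁₂ *ᵥ b)) + 2 * (v ⬝ᵥ ((A * M₂₂) *ᵥ b)) := by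
    rw [dotProduct_comm, dotProduct_smul, sub_mulVec, smul_mulVec, dotProduct_sub, dotProduct_smul,
      smul_eq_mul, smul_eq_mul]
    linear_combination (-2 * (v ⬝ᵥ ((A * M₂₂) *ᵥ b))) * I_mul_I
  rw [h7]
  simp only [mulVec_sub, sub_mulVec, smul_mulVec, dotProduct_sub, sub_dotProduct, dotProduct_smul,
    smul_eq_mul, h3, h4, h5, h6]
  rw [mulVec_mulVec]
  ring

end SchwartzOperators

/-! ### The Gaussian path of the Hamiltonian flow -/

/-- Jacobi's formula for the derivative of a determinant. -/
lemma hasDerivAt_det {𝕜 : Type*} [NontriviallyNormedField 𝕜] [NormedAlgebra 𝕜 ℂ] {m : Type*}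
    [Fintype m] [DecidableEq m] {F : 𝕜 → Matrix m m ℂ} {F' : Matrix m m ℂ} {t : 𝕜}
    (h : ∀ i j, HasDerivAt (fun t => F t i j) (F' i j) t) :
    HasDerivAt (fun t => (F t).det) (((F t).adjugate * F').trace) t := by
  have h1 : ((F t).adjugate * F').trace = ∑ i, ((F t).updateCol i (fun j => F' j i)).det := by
    refine Finset.sum_congr rfl fun i _ => ?_
    rw [← cramer_apply, cramer_eq_adjugate_mulVec]; rfl
  rw [h1]
  simp only [det_apply]
  rw [Finset.sum_comm]
  refine HasDerivAt.fun_sum fun σ _ => ?_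
  rw [← Finset.smul_sum]
  refine HasDerivAt.fun_const_smul _ ?_
  refine (HasDerivAt.fun_finsetProd (u := Finset.univ) fun i _ => h (σ i) i).congr_deriv ?_
  refine Finset.sum_congr rfl fun i _ => ?_
  rw [← Finset.mul_prod_erase Finset.univ _ (Finset.mem_univ i), smul_eq_mul, mul_comm]
  congr 1
  · simp
  · refine Finset.prod_congr rfl fun j hj => ?_
    rw [updateCol_ne (Finset.ne_of_mem_erase hj)]

section Path

open scoped Matrix.Norms.Operator

variable {n : ℕ} {M : Matrix (Idx n) (Idx n) ℂ}

lemma hasDerivAt_entry {𝕜 : Type*} [NontriviallyNormedField 𝕜] [NormedAlgebra 𝕜 ℂ] {m l : Type*}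
    [Fintype m] [Fintype l] {F : 𝕜 → Matrix m l ℂ} {F' : Matrix m l ℂ} {t : 𝕜}
    (h : HasDerivAt F F' t) (i : m) (j : l) : HasDerivAt (fun t => F t i j) (F' i j) t :=
  (⟨Matrix.entryLinearMap 𝕜 ℂ i j, continuous_id.matrix_elem i j⟩ :
    Matrix m l ℂ →L[𝕜] ℂ).hasFDerivAt.comp_hasDerivAt t h

lemma hasDerivAt_matrix_inv {𝕜 : Type*} [NontriviallyNormedField 𝕜] [NormedAlgebra 𝕜 ℂ] {m : Type*}
    [Fintype m] [DecidableEq m] {F : 𝕜 → Matrix m m ℂ} {F' : Matrix m m ℂ} {t : 𝕜}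
    (h : HasDerivAt F F' t) (hd : (F t).det ≠ 0) :
    HasDerivAt (fun t => (F t)⁻¹) (-((F t)⁻¹ * F' * (F t)⁻¹)) t := by
  have hu : IsUnit (F t) := (isUnit_iff_isUnit_det _).2 (isUnit_iff_ne_zero.2 hd)
  have h1 := hasFDerivAt_ringInverse (𝕜 := 𝕜) hu.unit
  have h2 := HasFDerivAt.comp_hasDerivAt_of_eq t h1 h hu.unit_spec.symm
  simp only [nonsing_inv_eq_ringInverse]
  refine h2.congr_deriv ?_
  have h3 : ((hu.unit⁻¹ : (Matrix m m ℂ)ˣ) : Matrix m m ℂ) = Ring.inverse (F t) := by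
    rw [← Ring.inverse_unit, hu.unit_spec]
  rw [h3]
  rfl

/-- The blocks of the flow applied to the vacuum. -/
def pathX (M : Matrix (Idx n) (Idx n) ℂ) (t : ℝ) : Matrix (Fin n) (Fin n) ℂ :=
  (kflow M t).toBlocks₁₁ + (kflow M t).toBlocks₂₁

/-- A block of the flow applied to the vacuum, see `pathX`. -/
def pathY (M : Matrix (Idx n) (Idx n) ℂ) (t : ℝ) : Matrix (Fin n) (Fin n) ℂ :=
  (-I) • ((kflow M t).toBlocks₁₁ - (kflow M t).toBlocks₂₁)

/-- A block of the flow applied to the vacuum, see `pathX`. -/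
def pathX' (M : Matrix (Idx n) (Idx n) ℂ) (t : ℝ) : Matrix (Fin n) (Fin n) ℂ :=
  (kflow M t).toBlocks₁₂ + (kflow M t).toBlocks₂₂

/-- A block of the flow applied to the vacuum, see `pathX`. -/
def pathY' (M : Matrix (Idx n) (Idx n) ℂ) (t : ℝ) : Matrix (Fin n) (Fin n) ℂ :=
  (-I) • ((kflow M t).toBlocks₁₂ - (kflow M t).toBlocks₂₂)

/-- The matrix of the Gaussian evolving from the vacuum. -/
def pathA (M : Matrix (Idx n) (Idx n) ℂ) (t : ℝ) : Matrix (Fin n) (Fin n) ℂ :=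
  ((kflow M t).toBlocks₁₁ - (kflow M t).toBlocks₂₁) * (pathX M t)⁻¹

lemma path_blocks (t : ℝ) :
    fromBlocks (pathX M t) (pathX' M t) (pathY M t) (pathY' M t) =
      flow M t * ((2 : ℂ) • (cayleyU n)⁻¹) := by
  have h1 : ((2 : ℂ) • (cayleyU n)⁻¹) * kflow M t = flow M t * ((2 : ℂ) • (cayleyU n)⁻¹) := by
    rw [kflow, Matrix.smul_mul, Matrix.mul_smul, ← Matrix.mul_assoc, ← Matrix.mul_assoc,
      cayleyU_inv_mul, Matrix.one_mul]
  rw [← h1, cayleyU_inv, smul_smul, mul_inv_cancel₀ two_ne_zero, one_smul]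
  conv_rhs => rw [← fromBlocks_toBlocks (kflow M t), fromBlocks_multiply]
  simp only [Matrix.one_mul, Matrix.neg_mul, Matrix.smul_mul]
  congr 1
  · rw [pathY]; module
  · rw [pathY']; module

lemma hasDerivAt_path (t : ℝ) :
    HasDerivAt (fun t => fromBlocks (pathX M t) (pathX' M t) (pathY M t) (pathY' M t))
      ((-(2 * I)) • (stdJ n * M) * fromBlocks (pathX M t) (pathX' M t) (pathY M t) (pathY' M t))
      t := by
  simp_rw [path_blocks]
  rw [← Matrix.mul_assoc]
  exact (hasDerivAt_flow M t).mul_const _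

lemma hasDerivAt_path_blocks {M₁₁ M₁₂ M₂₂ : Matrix (Fin n) (Fin n) ℂ}
    (hM : M = fromBlocks M₁₁ M₁₂ M₁₂ᵀ M₂₂) (t : ℝ) :
    HasDerivAt (pathX M) ((-(2 * I)) • (M₁₂ᵀ * pathX M t + M₂₂ * pathY M t)) t ∧
    HasDerivAt (pathY M) ((2 * I) • (M₁₁ * pathX M t + M₁₂ * pathY M t)) t ∧
    HasDerivAt (pathX' M) ((-(2 * I)) • (M₁₂ᵀ * pathX' M t + M₂₂ * pathY' M t)) t := by
  have h := hasDerivAt_path (M := M) t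
  have h1 : (-(2 * I)) • (stdJ n * M) *
      fromBlocks (pathX M t) (pathX' M t) (pathY M t) (pathY' M t) =
      fromBlocks ((-(2 * I)) • (M₁₂ᵀ * pathX M t + M₂₂ * pathY M t))
        ((-(2 * I)) • (M₁₂ᵀ * pathX' M t + M₂₂ * pathY' M t))
        ((2 * I) • (M₁₁ * pathX M t + M₁₂ * pathY M t))
        ((2 * I) • (M₁₁ * pathX' M t + M₁₂ * pathY' M t)) := by
    generalize pathX M t = a
    generalize pathX' M t = b
    generalize pathY M t = c
    generalize pathY' M t = d
    rw [hM, stdJ, fromBlocks_multiply, Matrix.smul_mul, fromBlocks_multiply, fromBlocks_smul]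
    simp only [Matrix.zero_mul, Matrix.one_mul, Matrix.neg_mul, zero_add, add_zero]
    congr 1 <;> module
  rw [h1] at h
  let L₁₁ : Matrix (Idx n) (Idx n) ℂ →L[ℝ] Matrix (Fin n) (Fin n) ℂ :=
    LinearMap.toContinuousLinearMap
      { toFun := toBlocks₁₁, map_add' := fun A B => rfl, map_smul' := fun c A => rfl }
  let L₁₂ : Matrix (Idx n) (Idx n) ℂ →L[ℝ] Matrix (Fin n) (Fin n) ℂ :=
    LinearMap.toContinuousLinearMap
      { toFun := toBlocks₁₂, map_add' := fun A B => rfl, map_smul' := fun c A => rfl }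
  let L₂₁ : Matrix (Idx n) (Idx n) ℂ →L[ℝ] Matrix (Fin n) (Fin n) ℂ :=
    LinearMap.toContinuousLinearMap
      { toFun := toBlocks₂₁, map_add' := fun A B => rfl, map_smul' := fun c A => rfl }
  exact ⟨L₁₁.hasFDerivAt.comp_hasDerivAt t h, L₂₁.hasFDerivAt.comp_hasDerivAt t h,
    L₁₂.hasFDerivAt.comp_hasDerivAt t h⟩

lemma pathA_eq (t : ℝ) : pathA M t = I • (pathY M t * (pathX M t)⁻¹) := by
  rw [pathA, pathY, Matrix.smul_mul, smul_smul]
  have : I * -I = 1 := by linear_combination -I_mul_I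
  rw [this, one_smul]

lemma pathY_mul_inv (t : ℝ) : pathY M t * (pathX M t)⁻¹ = (-I) • pathA M t := by
  rw [pathA_eq, smul_smul]
  have : -I * I = 1 := by linear_combination -I_mul_I
  rw [this, one_smul]

/-- Nonnegativity data needed along the flow. -/
lemma isExpSp_path (hM : M.IsSymm) (hq : ∀ x y : Fin n → ℝ, (qform M x y).re ≤ 0) {t : ℝ}
    (ht : 0 ≤ t) : IsExpSp (fromBlocks (kflow M t).toBlocks₁₁ (kflow M t).toBlocks₁₂
      (kflow M t).toBlocks₂₁ (kflow M t).toBlocks₂₂) :=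
  isExpSp_blocks (isExpSp_kflow hM hq ht)

lemma pathX_deriv_mul_inv {M₁₂ M₂₂ : Matrix (Fin n) (Fin n) ℂ} {t : ℝ} (hd : (pathX M t).det ≠ 0) :
    ((-(2 * I)) • (M₁₂ᵀ * pathX M t + M₂₂ * pathY M t)) * (pathX M t)⁻¹ =
      (-(2 * I)) • M₁₂ᵀ - (2 : ℂ) • (M₂₂ * pathA M t) := by
  rw [Matrix.smul_mul, Matrix.add_mul, Matrix.mul_assoc, Matrix.mul_assoc, pathY_mul_inv,
    Matrix.mul_nonsing_inv _ (isUnit_iff_ne_zero.2 hd), Matrix.mul_one, Matrix.mul_smul, smul_add,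
    smul_smul]
  have : -(2 * I) * -I = -2 := by linear_combination 2 * I_mul_I
  rw [this]
  module

/-- The quotient A = iYX⁻¹ of a solution (X, Y) of the linear system solves the Riccati equation. -/
lemma hasDerivAt_pathA {M₁₁ M₁₂ M₂₂ : Matrix (Fin n) (Fin n) ℂ}
    (hM : M = fromBlocks M₁₁ M₁₂ M₁₂ᵀ M₂₂) {t : ℝ} (hd : (pathX M t).det ≠ 0) :
    HasDerivAt (pathA M) ((-2 : ℂ) • (M₁₁ - I • (M₁₂ * pathA M t) - I • (pathA M t * M₁₂ᵀ) -
      pathA M t * M₂₂ * pathA M t)) t := by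
  obtain ⟨h1, h2, -⟩ := hasDerivAt_path_blocks hM t
  have h3 := (h2.mul (hasDerivAt_matrix_inv h1 hd)).const_smul I
  have h4 : pathA M = I • (pathY M * fun t => (pathX M t)⁻¹) := funext pathA_eq
  rw [h4]
  refine h3.congr_deriv ?_
  rw [← h4]
  have h5 : pathY M t * -((pathX M t)⁻¹ * ((-(2 * I)) • (M₁₂ᵀ * pathX M t + M₂₂ * pathY M t)) *
      (pathX M t)⁻¹) = -((pathY M t * (pathX M t)⁻¹) *
      (((-(2 * I)) • (M₁₂ᵀ * pathX M t + M₂₂ * pathY M t)) * (pathX M t)⁻¹)) := by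
    rw [Matrix.mul_neg]; simp only [Matrix.mul_assoc]
  rw [h5, pathX_deriv_mul_inv hd, pathY_mul_inv, Matrix.smul_mul, Matrix.add_mul,
    Matrix.mul_assoc M₁₂, pathY_mul_inv, Matrix.mul_assoc M₁₁,
    Matrix.mul_nonsing_inv _ (isUnit_iff_ne_zero.2 hd), Matrix.mul_one]
  simp only [Matrix.mul_smul, Matrix.smul_mul, Matrix.mul_sub, smul_add, smul_sub, smul_neg,
    smul_smul, ← Matrix.mul_assoc]
  have e1 : I * (2 * I) = -2 := by linear_combination 2 * I_mul_I
  have e2 : I * (2 * I * -I) = 2 * I := by linear_combination (-2 * I) * I_mul_I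
  simp only [e1, e2]
  match_scalars <;> ring_nf <;> simp [I_pow_three]

/-- The linear term of the Gaussian path. -/
def pathB (M : Matrix (Idx n) (Idx n) ℂ) (v : Fin n → ℂ) (t : ℝ) : Fin n → ℂ :=
  ((pathX M t)⁻¹)ᵀ *ᵥ v

lemma hasDerivAt_inv_pathX {M₁₁ M₁₂ M₂₂ : Matrix (Fin n) (Fin n) ℂ}
    (hM : M = fromBlocks M₁₁ M₁₂ M₁₂ᵀ M₂₂) {t : ℝ} (hd : (pathX M t).det ≠ 0) :
    HasDerivAt (fun t => (pathX M t)⁻¹) ((pathX M t)⁻¹ * ((2 * I) • M₁₂ᵀ +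
      (2 : ℂ) • (M₂₂ * pathA M t))) t := by
  obtain ⟨h1, -, -⟩ := hasDerivAt_path_blocks hM t
  refine (hasDerivAt_matrix_inv h1 hd).congr_deriv ?_
  rw [Matrix.mul_assoc, pathX_deriv_mul_inv hd, ← Matrix.mul_neg]
  congr 1
  module

lemma hasDerivAt_pathB {M₁₁ M₁₂ M₂₂ : Matrix (Fin n) (Fin n) ℂ}
    (hM : M = fromBlocks M₁₁ M₁₂ M₁₂ᵀ M₂₂) (h22 : M₂₂.IsSymm) {t : ℝ}
    (hd : (pathX M t).det ≠ 0) (hA : (pathA M t).IsSymm) (v : Fin n → ℂ) (i : Fin n) :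
    HasDerivAt (fun t => pathB M v t i)
      (((2 * I) • ((M₁₂ - I • (pathA M t * M₂₂)) *ᵥ pathB M v t)) i) t := by
  have h := hasDerivAt_inv_pathX hM hd
  have h1 : (2 * I) • ((M₁₂ - I • (pathA M t * M₂₂)) *ᵥ pathB M v t) =
      ((pathX M t)⁻¹ * ((2 * I) • M₁₂ᵀ + (2 : ℂ) • (M₂₂ * pathA M t)))ᵀ *ᵥ v := by
    rw [transpose_mul, ← mulVec_mulVec, pathB, ← smul_mulVec]
    congr 1
    rw [transpose_add, transpose_smul, transpose_smul, transpose_transpose, transpose_mul, hA.eq,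
      h22.eq, smul_sub, smul_smul]
    have : 2 * I * I = -2 := by linear_combination 2 * I_mul_I
    rw [this]
    module
  rw [h1]
  simp only [pathB, mulVec, dotProduct, transpose_apply]
  exact HasDerivAt.fun_sum fun j _ => (hasDerivAt_entry h j i).mul_const _

/-- This is the Schur complement of X in the moving frame. It collapses the derivative of the
constant term to one expression quadratic in `pathB`. -/
lemma pathY'_sub (hM : M.IsSymm) (hq : ∀ x y : Fin n → ℝ, (qform M x y).re ≤ 0) {t : ℝ}
    (ht : 0 ≤ t) :
    pathY' M t - pathY M t * (pathX M t)⁻¹ * pathX' M t = (2 * I) • ((pathX M t)⁻¹)ᵀ := by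
  have h := isExpSp_path hM hq ht
  have hA : (pathA M t).IsSymm := h.symm_A
  have hX : (pathX M t)⁻¹ * pathX M t = 1 := h.add_inv_mul
  have hXt : (pathX M t)⁻¹ᵀ * (pathX M t)ᵀ = 1 := by
    rw [← transpose_mul, Matrix.mul_nonsing_inv (pathX M t) (isUnit_iff_ne_zero.2
      h.det_add_ne_zero),
      transpose_one]
  have hAX : pathA M t * pathX M t = (kflow M t).toBlocks₁₁ - (kflow M t).toBlocks₂₁ := by
    rw [pathA, Matrix.mul_assoc, hX, Matrix.mul_one]
  have h2 : (pathX M t)ᵀ * (((kflow M t).toBlocks₁₂ - (kflow M t).toBlocks₂₂) -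
      pathA M t * pathX' M t) = (-2 : ℂ) • 1 := by
    have h3 : (pathX M t)ᵀ * (pathA M t * pathX' M t) =
        ((kflow M t).toBlocks₁₁ - (kflow M t).toBlocks₂₁)ᵀ * pathX' M t := by
      rw [← hAX, transpose_mul, hA.eq, Matrix.mul_assoc]
    rw [Matrix.mul_sub, h3, pathX, pathX', ← h.rel₂]
    simp only [transpose_add, transpose_sub, Matrix.add_mul, Matrix.sub_mul, Matrix.mul_add,
      Matrix.mul_sub]
    module
  have h4 : ((kflow M t).toBlocks₁₂ - (kflow M t).toBlocks₂₂) - pathA M t * pathX' M t =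
      (-2 : ℂ) • ((pathX M t)⁻¹)ᵀ := by
    calc _ = (pathX M t)⁻¹ᵀ * ((pathX M t)ᵀ * (((kflow M t).toBlocks₁₂ -
          (kflow M t).toBlocks₂₂) - pathA M t * pathX' M t)) := by
          rw [← Matrix.mul_assoc, hXt, Matrix.one_mul]
      _ = _ := by rw [h2, Matrix.mul_smul, Matrix.mul_one]
  rw [pathY_mul_inv, pathY', Matrix.smul_mul, ← smul_sub, h4, smul_smul]
  congr 1
  ring

lemma hasDerivAt_pathE {M₁₁ M₁₂ M₂₂ : Matrix (Fin n) (Fin n) ℂ}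
    (hM : M = fromBlocks M₁₁ M₁₂ M₁₂ᵀ M₂₂) (hs : M.IsSymm)
    (hq : ∀ x y : Fin n → ℝ, (qform M x y).re ≤ 0) {t : ℝ} (ht : 0 ≤ t) (v : Fin n → ℂ) :
    HasDerivAt (fun t => -(v ⬝ᵥ (((pathX M t)⁻¹ * pathX' M t) *ᵥ v)) / 4)
      (-(pathB M v t ⬝ᵥ (M₂₂ *ᵥ pathB M v t))) t := by
  have h := isExpSp_path hs hq ht
  have hd : (pathX M t).det ≠ 0 := h.det_add_ne_zero
  obtain ⟨-, -, h3⟩ := hasDerivAt_path_blocks hM t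
  have h4 := (hasDerivAt_inv_pathX hM hd).mul h3
  have h5 : (pathX M t)⁻¹ * ((2 * I) • M₁₂ᵀ + (2 : ℂ) • (M₂₂ * pathA M t)) * pathX' M t +
      (pathX M t)⁻¹ * ((-(2 * I)) • (M₁₂ᵀ * pathX' M t + M₂₂ * pathY' M t)) =
      (4 : ℂ) • ((pathX M t)⁻¹ * M₂₂ * ((pathX M t)⁻¹)ᵀ) := by
    have h6 := pathY'_sub hs hq ht
    have h7 : ((pathX M t)⁻¹)ᵀ = (-(I / 2)) • (pathY' M t - ((-I) • pathA M t) * pathX' M t) := by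
      rw [← pathY_mul_inv, h6, smul_smul]
      have : -(I / 2) * (2 * I) = 1 := by linear_combination -I_mul_I
      rw [this, one_smul]
    rw [h7]
    simp only [Matrix.mul_add, Matrix.add_mul, Matrix.mul_sub, Matrix.mul_smul, Matrix.smul_mul,
      smul_add, smul_sub, smul_smul, ← Matrix.mul_assoc]
    match_scalars <;> ring_nf <;> simp
  have h8 := (h4.congr_deriv h5)
  have h9 : HasDerivAt (fun t => v ⬝ᵥ (((pathX M t)⁻¹ * pathX' M t) *ᵥ v))
      (v ⬝ᵥ (((4 : ℂ) • ((pathX M t)⁻¹ * M₂₂ * ((pathX M t)⁻¹)ᵀ)) *ᵥ v)) t := by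
    simp only [dotProduct, mulVec]
    exact HasDerivAt.fun_sum fun i _ => (HasDerivAt.fun_sum fun j _ =>
      (hasDerivAt_entry h8 i j).mul_const _).const_mul _
  refine (h9.fun_neg.div_const 4).congr_deriv ?_
  rw [smul_mulVec, dotProduct_smul, ← mulVec_mulVec, ← mulVec_mulVec, dotProduct_mulVec,
    ← mulVec_transpose, ← pathB, smul_eq_mul]
  ring

end Path

/-- Symmetric matrices with a quadratic form of nonpositive real part. -/
structure Dissipative {n : ℕ} (M : Matrix (Idx n) (Idx n) ℂ) : Prop where
  symm : M.IsSymm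
  re_nonpos : ∀ x y : Fin n → ℝ, (qform M x y).re ≤ 0

/-! ### Evolution of coherent states under a dissipative quadratic symbol -/

section GaussPath

variable {n : ℕ} {M : Matrix (Idx n) (Idx n) ℂ}

lemma Dissipative.isExpSp (h : Dissipative M) {t : ℝ} (ht : 0 ≤ t) :
    IsExpSp (fromBlocks (kflow M t).toBlocks₁₁ (kflow M t).toBlocks₁₂
      (kflow M t).toBlocks₂₁ (kflow M t).toBlocks₂₂) :=
  isExpSp_path h.symm h.re_nonpos ht

lemma Dissipative.det_pathX_ne_zero (h : Dissipative M) {t : ℝ} (ht : 0 ≤ t) :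
    (pathX M t).det ≠ 0 := (h.isExpSp ht).det_add_ne_zero

lemma Dissipative.gpos_pathA (h : Dissipative M) {t : ℝ} (ht : 0 ≤ t) : GPos (pathA M t) :=
  (h.isExpSp ht).gpos_A

lemma eq_fromBlocks_symm (hM : M.IsSymm) :
    M = fromBlocks M.toBlocks₁₁ M.toBlocks₁₂ (M.toBlocks₁₂)ᵀ M.toBlocks₂₂ := by
  have h : (M.toBlocks₁₂)ᵀ = M.toBlocks₂₁ := by
    ext i j; exact hM.apply (Sum.inr i) (Sum.inl j)
  rw [h, fromBlocks_toBlocks]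

lemma toBlocks₂₂_isSymm (hM : M.IsSymm) : (M.toBlocks₂₂).IsSymm := by
  ext i j; exact hM.apply (Sum.inr i) (Sum.inr j)

open scoped Matrix.Norms.Operator in
lemma hasDerivAt_pathA_entry (h : Dissipative M) {t : ℝ} (ht : 0 ≤ t) (i j : Fin n) :
    HasDerivAt (fun t => pathA M t i j) (((-2 : ℂ) • (M.toBlocks₁₁ -
      I • (M.toBlocks₁₂ * pathA M t) - I • (pathA M t * (M.toBlocks₁₂)ᵀ) -
      pathA M t * M.toBlocks₂₂ * pathA M t)) i j) t :=
  hasDerivAt_entry (hasDerivAt_pathA (eq_fromBlocks_symm h.symm) (h.det_pathX_ne_zero ht)) i j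

lemma continuous_pathA_abs (h : Dissipative M) : Continuous fun t => pathA M |t| :=
  continuous_pi fun i => continuous_pi fun j => continuous_iff_continuousAt.2 fun t =>
    (ContinuousAt.comp (g := fun t => pathA M t i j)
      (hasDerivAt_pathA_entry h (abs_nonneg t) i j).continuousAt continuous_abs.continuousAt)

lemma continuous_pathB_abs (h : Dissipative M) (v : Fin n → ℂ) :
    Continuous fun t => pathB M v |t| :=
  continuous_pi fun i => continuous_iff_continuousAt.2 fun t =>
    (ContinuousAt.comp (g := fun t => pathB M v t i)
      (hasDerivAt_pathB (eq_fromBlocks_symm h.symm) (toBlocks₂₂_isSymm h.symm)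
        (h.det_pathX_ne_zero (abs_nonneg t)) (h.gpos_pathA (abs_nonneg t)).symm v i).continuousAt
      continuous_abs.continuousAt)

/-- The logarithmic derivative of the amplitude of the Gaussian path. -/
def pathLog (M : Matrix (Idx n) (Idx n) ℂ) (t : ℝ) : ℂ :=
  I * M.toBlocks₁₂.trace + (M.toBlocks₂₂ * pathA M |t|).trace

/-- The logarithm of the amplitude of the Gaussian path. -/
def pathEta (M : Matrix (Idx n) (Idx n) ℂ) (t : ℝ) : ℂ := ∫ s in (0 : ℝ)..t, pathLog M s

lemma continuous_pathLog (h : Dissipative M) : Continuous (pathLog M) :=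
  continuous_const.add (continuous_const.matrix_mul (continuous_pathA_abs h)).matrix_trace

lemma hasDerivAt_pathEta (h : Dissipative M) (t : ℝ) :
    HasDerivAt (pathEta M) (pathLog M t) t :=
  intervalIntegral.integral_hasDerivAt_right ((continuous_pathLog h).intervalIntegrable _ _)
    ((continuous_pathLog h).stronglyMeasurableAtFilter _ _) (continuous_pathLog h).continuousAt

open scoped Matrix.Norms.Operator in
-- By Jacobi's formula the logarithmic derivative of det X is -2 `pathLog`, so the product is
-- constant; its value at t = 0 is 1.
lemma pathEta_sq_mul_det (h : Dissipative M) {t : ℝ} (ht : 0 ≤ t) :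
    Complex.exp (pathEta M t) ^ 2 * (pathX M t).det = 1 := by
  have hd : ∀ s, 0 ≤ s → HasDerivAt (fun s => Complex.exp (2 * pathEta M s) * (pathX M s).det) 0 s
    := by
    intro s hs
    have hX := h.det_pathX_ne_zero hs
    have h1 := (hasDerivAt_path_blocks (eq_fromBlocks_symm h.symm) s).1
    have h2 := hasDerivAt_det fun i j => hasDerivAt_entry h1 i j
    have h3 := ((hasDerivAt_pathEta h s).const_mul (2 : ℂ)).cexp.fun_mul h2
    refine h3.congr_deriv ?_
    have h4 : (pathX M s).adjugate = (pathX M s).det • (pathX M s)⁻¹ := by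
      rw [Matrix.inv_def, smul_smul, Ring.inverse_eq_inv', mul_inv_cancel₀ hX, one_smul]
    rw [h4, Matrix.smul_mul, trace_smul, trace_mul_comm, pathX_deriv_mul_inv hX, trace_sub,
      trace_smul, trace_smul, trace_transpose, pathLog, abs_of_nonneg hs]
    simp only [smul_eq_mul]
    ring
  have hconst : Complex.exp (2 * pathEta M t) * (pathX M t).det =
      Complex.exp (2 * pathEta M 0) * (pathX M 0).det := by
    have h1 := (convex_Ici (0 : ℝ)).norm_image_sub_le_of_norm_hasDerivWithin_le (C := 0)
      (fun s hs => (hd s hs).hasDerivWithinAt) (fun s _ => by simp) (Set.self_mem_Ici)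
      (Set.mem_Ici.2 ht)
    rw [zero_mul] at h1
    exact sub_eq_zero.1 (norm_le_zero_iff.1 h1)
  rw [← Complex.exp_nat_mul]
  push_cast
  rw [hconst, pathEta, intervalIntegral.integral_same, pathX, kflow_zero, ← fromBlocks_one,
    toBlocks_fromBlocks₁₁, toBlocks_fromBlocks₂₁]
  simp

/-- The evolution of a coherent state. -/
def gpath (h : Dissipative M) (w : Fin n → ℂ) (t : ℝ) : 𝓢(Euc n, ℂ) :=
  gaussS (h.gpos_pathA (abs_nonneg t)) (pathB M (star w) |t|)
    (((-(n : ℝ) / 4 * Real.log Real.pi : ℝ) : ℂ) + pathEta M t -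
      (star w ⬝ᵥ (((pathX M |t|)⁻¹ * pathX' M |t|) *ᵥ star w)) / 4)

lemma hasDerivWithinAt_abs_comp {E : Type*} [NormedAddCommGroup E] [NormedSpace ℝ E] {f : ℝ → E}
    {f' : E} {t : ℝ} (ht : 0 ≤ t) (h : HasDerivAt f f' t) :
    HasDerivWithinAt (fun t => f |t|) f' (Set.Ici 0) t :=
  h.hasDerivWithinAt.congr (fun s hs => by rw [abs_of_nonneg hs]) (by rw [abs_of_nonneg ht])

/-- The evolved coherent states solve the Schrödinger equation. -/
lemma hasDerivWithinAt_gpath (h : Dissipative M) (w : Fin n → ℂ) {t : ℝ} (ht : 0 ≤ t) :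
    HasDerivWithinAt (fun t => (gpath h w t).toLp 2 (volume : Measure (Euc n)))
      ((weylS M (gpath h w t)).toLp 2) (Set.Ici 0) t := by
  have hM := eq_fromBlocks_symm h.symm
  have h22 := toBlocks₂₂_isSymm h.symm
  have cA := continuous_pathA_abs h
  have cB := continuous_pathB_abs h (star w)
  unfold gpath
  refine hasDerivWithinAt_gauss (convex_Ici 0) ht
    (A := fun t => pathA M |t|)
    (A' := fun t => (-2 : ℂ) • (M.toBlocks₁₁ - I • (M.toBlocks₁₂ * pathA M |t|) -
      I • (pathA M |t| * (M.toBlocks₁₂)ᵀ) - pathA M |t| * M.toBlocks₂₂ * pathA M |t|))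
    (b := fun t => pathB M (star w) |t|)
    (b' := fun t => (2 * I) • ((M.toBlocks₁₂ - I • (pathA M |t| * M.toBlocks₂₂)) *ᵥ
      pathB M (star w) |t|))
    (e := fun t => ((-(n : ℝ) / 4 * Real.log Real.pi : ℝ) : ℂ) + pathEta M t -
      (star w ⬝ᵥ (((pathX M |t|)⁻¹ * pathX' M |t|) *ᵥ star w)) / 4)
    (e' := fun t => -(pathB M (star w) |t| ⬝ᵥ (M.toBlocks₂₂ *ᵥ pathB M (star w) |t|)) +
      pathLog M t) (fun t => h.gpos_pathA (abs_nonneg t)) ?_ ?_ ?_ ?_ ?_ ?_ ?_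
  · intro s hs i j
    rw [abs_of_nonneg hs]
    exact hasDerivWithinAt_abs_comp hs (hasDerivAt_pathA_entry h hs i j)
  · intro s hs i
    rw [abs_of_nonneg hs]
    exact hasDerivWithinAt_abs_comp hs (hasDerivAt_pathB hM h22 (h.det_pathX_ne_zero hs)
      (h.gpos_pathA hs).symm (star w) i)
  · intro s hs
    have h1 := hasDerivWithinAt_abs_comp hs (hasDerivAt_pathE hM h.symm h.re_nonpos hs (star w))
    have h2 := ((hasDerivAt_pathEta h s).const_add
      ((-(n : ℝ) / 4 * Real.log Real.pi : ℝ) : ℂ)).hasDerivWithinAt (s := Set.Ici 0)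
    have h3 := h2.fun_add h1
    rw [add_comm (pathLog M s)] at h3
    simp only [abs_of_nonneg (show (0 : ℝ) ≤ s from hs)]
    refine h3.congr (fun x _ => by ring) (by rw [abs_of_nonneg (show (0 : ℝ) ≤ s from hs)]; ring)
  · refine Continuous.continuousWithinAt ?_
    have c1 : Continuous fun t => M.toBlocks₁₂ * pathA M |t| := continuous_const.matrix_mul cA
    have c2 : Continuous fun t => pathA M |t| * (M.toBlocks₁₂)ᵀ := cA.matrix_mul continuous_const
    have c3 : Continuous fun t => pathA M |t| * M.toBlocks₂₂ * pathA M |t| :=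
      (cA.matrix_mul continuous_const).matrix_mul cA
    exact (((continuous_const.sub (c1.const_smul I)).sub (c2.const_smul I)).sub c3).const_smul
      (-2 : ℂ)
  · refine Continuous.continuousWithinAt ?_
    have c1 : Continuous fun t => pathA M |t| * M.toBlocks₂₂ := cA.matrix_mul continuous_const
    exact ((continuous_const.sub (c1.const_smul I)).matrix_mulVec cB).const_smul (2 * I)
  · exact (((cB.dotProduct (continuous_const.matrix_mulVec cB)).neg).add
      (continuous_pathLog h)).continuousWithinAt
  · intro x
    have h1 := weylS_gaussS' (M₁₁ := M.toBlocks₁₁) (M₁₂ := M.toBlocks₁₂) h22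
      (h.gpos_pathA (abs_nonneg t)) (pathB M (star w) |t|)
      (((-(n : ℝ) / 4 * Real.log Real.pi : ℝ) : ℂ) + pathEta M t -
      (star w ⬝ᵥ (((pathX M |t|)⁻¹ * pathX' M |t|) *ᵥ star w)) / 4) x
    rw [← hM, add_assoc] at h1
    exact h1

lemma gpath_zero (h : Dissipative M) (w : Fin n → ℂ) (x : Euc n) :
    gpath h w 0 x = Complex.exp (((-(n : ℝ) / 4 * Real.log Real.pi : ℝ) : ℂ) +
      (-(cvec x.ofLp ⬝ᵥ cvec x.ofLp) / 2 + star w ⬝ᵥ cvec x.ofLp - star w ⬝ᵥ star w / 4)) := by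
  have hk : kflow M 0 = fromBlocks 1 0 0 1 := by rw [kflow_zero, fromBlocks_one]
  have hX : pathX M 0 = 1 := by
    rw [pathX, hk, toBlocks_fromBlocks₁₁, toBlocks_fromBlocks₂₁, add_zero]
  have hX' : pathX' M 0 = 1 := by
    rw [pathX', hk, toBlocks_fromBlocks₁₂, toBlocks_fromBlocks₂₂, zero_add]
  have hA : pathA M 0 = 1 := by
    rw [pathA, hX, hk, toBlocks_fromBlocks₁₁, toBlocks_fromBlocks₂₁, sub_zero, inv_one,
      Matrix.mul_one]
  rw [gpath, gaussS_apply]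
  congr 1
  rw [gaussExp, abs_zero, hA, hX', hX, pathB, hX, pathEta, intervalIntegral.integral_same]
  simp only [inv_one, transpose_one, one_mulVec, Matrix.mul_one, add_zero]
  ring

end GaussPath

/-! ### The Bargmann transform -/

section Bargmann

variable {n : ℕ} {M : Matrix (Idx n) (Idx n) ℂ}

lemma dissipative_zero : Dissipative (0 : Matrix (Idx n) (Idx n) ℂ) :=
  ⟨by simp [Matrix.IsSymm], fun x y => by simp [qform]⟩

/-- The normalised coherent states in `L²(ℝⁿ)`. -/
def coherentS (w : Fin n → ℂ) : 𝓢(Euc n, ℂ) := gpath dissipative_zero w 0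

lemma gpath_zero_eq (h : Dissipative M) (w : Fin n → ℂ) : gpath h w 0 = coherentS w := by
  ext x
  rw [coherentS, gpath_zero, gpath_zero]

lemma exp_log_pi (n : ℕ) : Complex.exp ((-(n : ℝ) / 4 * Real.log Real.pi : ℝ) : ℂ) =
    ((Real.pi ^ (-(n : ℝ) / 4) : ℝ) : ℂ) := by
  rw [Real.rpow_def_of_pos Real.pi_pos, mul_comm, ofReal_exp]

lemma star_coherentS (z : Fin n → ℂ) (x : Euc n) :
    (starRingEnd ℂ) (coherentS z x) = ((Real.pi ^ (-(n : ℝ) / 4) : ℝ) : ℂ) *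
      Complex.exp (-(z ⬝ᵥ z) / 4 + (∑ i, z i * (x i : ℂ)) - (∑ i, (x i : ℂ) ^ 2) / 2) := by
  rw [coherentS, gpath_zero, ← Complex.exp_conj, ← exp_log_pi, ← Complex.exp_add]
  congr 1
  simp only [map_add, map_sub, map_neg, map_div₀, conj_ofReal, dotProduct, cvec, map_sum, map_mul,
    Pi.star_apply, RCLike.star_def, RingHomCompTriple.comp_apply, RingHom.id_apply, map_ofNat]
  simp only [← pow_two]
  ring

lemma inner_coherentS (z : Fin n → ℂ) (φ : L2 n) :
    inner ℂ ((coherentS z).toLp 2 (volume : Measure (Euc n))) φ = bargmann φ z := by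
  rw [L2.inner_def, bargmann, ← integral_const_mul]
  refine integral_congr_ae ?_
  filter_upwards [(coherentS z).coeFn_toLp 2 (volume : Measure (Euc n))] with x hx
  rw [hx, RCLike.inner_apply, star_coherentS]
  ring

/-- The Bargmann transform is injective. -/
lemma eq_zero_of_bargmann (ψ : L2 n) (h : ∀ z, bargmann ψ z = 0) : ψ = 0 := by
  set g : Euc n → ℂ := fun x => (starRingEnd ℂ) (coherentS 0 x) * ψ x with hg
  have hgi : Integrable g :=
    (((coherentS (n := n) 0).memLp 2 volume).star).integrable_mul (Lp.memLp ψ)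
  have hF : ∀ ξ : Euc n, FourierTransform.fourier g ξ = 0 := by
    intro ξ
    -- At the imaginary point z = -2πiξ the Bargmann transform is, up to a nonvanishing factor, the
    -- Fourier transform of ψ times a Gaussian.
    have h1 := h fun i => -2 * Real.pi * I * (ξ i : ℂ)
    set z : Fin n → ℂ := fun i => -2 * Real.pi * I * (ξ i : ℂ) with hz
    rw [← inner_coherentS, L2.inner_def] at h1
    rw [Real.fourier_eq']
    have h2 : (∫ v : Euc n, Complex.exp (((-2 * Real.pi * inner ℝ v ξ : ℝ) : ℂ) * I) • g v) =
        Complex.exp (z ⬝ᵥ z / 4) * ∫ a : Euc n, inner ℂ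
          ((coherentS z).toLp 2 (volume : Measure (Euc n)) a) (ψ a) := by
      rw [← integral_const_mul]
      refine integral_congr_ae ?_
      filter_upwards [(coherentS z).coeFn_toLp 2 (volume : Measure (Euc n))] with x hx
      rw [hx, RCLike.inner_apply, star_coherentS, hg]
      simp only [smul_eq_mul]
      rw [star_coherentS, mul_comm (ψ x), ← mul_assoc, ← mul_assoc, ← mul_assoc,
        mul_comm (Complex.exp _), mul_assoc _ (Complex.exp _) (Complex.exp _), ← Complex.exp_add,
        mul_comm (Complex.exp (z ⬝ᵥ z / 4)), mul_assoc _ (Complex.exp _) (Complex.exp _),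
        ← Complex.exp_add]
      congr 3
      have h3 : ((-2 * Real.pi * inner ℝ x ξ : ℝ) : ℂ) * I = ∑ i, z i * (x i : ℂ) := by
        rw [PiLp.inner_apply]
        push_cast
        rw [Finset.mul_sum, Finset.sum_mul]
        refine Finset.sum_congr rfl fun i _ => ?_
        simp only [hz, RCLike.inner_apply, conj_trivial]
        push_cast
        ring
      rw [h3]
      simp only [zero_dotProduct, Pi.zero_apply, zero_mul, Finset.sum_const_zero]
      ring
    rw [h2, h1, mul_zero]
  -- The integrable function g has zero Fourier transform. A test function F is the Fourier
  -- transform of a Schwartz function, and exchanging the transform between the two factors shows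
  -- that g integrates to 0 against F.
  have hae : ∀ᵐ x, g x = 0 := by
    refine ae_eq_zero_of_integral_contDiff_smul_eq_zero hgi.locallyIntegrable ?_
    intro f hf hfc
    have hfc' : HasCompactSupport fun x => (f x : ℂ) := hfc.comp_left (g := Complex.ofReal) rfl
    set F : 𝓢(Euc n, ℂ) := hfc'.toSchwartzMap (Complex.ofRealCLM.contDiff.comp hf) with hFdef
    have h1 := VectorFourier.integral_fourierIntegral_smul_eq_flip (L := innerₗ (Euc n))
      (μ := (volume : Measure (Euc n))) (ν := (volume : Measure (Euc n)))
      Real.continuous_fourierChar continuous_inner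
      ((FourierTransform.fourierInv F : 𝓢(Euc n, ℂ)).integrable (μ := volume)) hgi
    rw [flip_innerₗ] at h1
    have h2 : ∀ ξ, VectorFourier.fourierIntegral Real.fourierChar volume (innerₗ (Euc n)) g ξ = 0 :=
      hF
    have h3 : ∀ ξ, VectorFourier.fourierIntegral Real.fourierChar volume (innerₗ (Euc n))
        (FourierTransform.fourierInv F : 𝓢(Euc n, ℂ)) ξ = F ξ := by
      intro ξ
      have := congrArg (fun G : 𝓢(Euc n, ℂ) => G ξ)
        (FourierTransform.fourier_fourierInv_eq (F := 𝓢(Euc n, ℂ)) F)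
      exact this
    simp only [h2, h3, smul_zero, integral_zero] at h1
    rw [← h1]
    refine integral_congr_ae (Filter.Eventually.of_forall fun x => ?_)
    simp only [hFdef]
    rfl
  rw [Lp.eq_zero_iff_ae_eq_zero]
  filter_upwards [hae] with x hx
  have h4 : (starRingEnd ℂ) (coherentS (0 : Fin n → ℂ) x) ≠ 0 := by
    rw [star_coherentS]
    exact mul_ne_zero (by exact_mod_cast (Real.rpow_pos_of_pos Real.pi_pos _).ne')
      (Complex.exp_ne_zero _)
  exact (mul_eq_zero.1 hx).resolve_left h4

lemma bargmann_injective : Function.Injective (bargmann (n := n)) := by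
  intro φ ψ h
  refine sub_eq_zero.1 (eq_zero_of_bargmann _ fun z => ?_)
  rw [← inner_coherentS, inner_sub_right, inner_coherentS, inner_coherentS, h, sub_self]

lemma bargmannInv_bargmann (φ : L2 n) : bargmannInv (bargmann φ) = φ := by
  have h : ∃ ψ : L2 n, bargmann ψ = bargmann φ := ⟨φ, rfl⟩
  rw [bargmannInv, dif_pos h]
  exact bargmann_injective h.choose_spec

/-- Coherent states span a dense subspace. -/
lemma topologicalClosure_span_coherentS : (Submodule.span ℂ
    (Set.range fun w => (coherentS w).toLp 2 (volume : Measure (Euc n)))).topologicalClosure = ⊤ :=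
    by
  rw [Submodule.topologicalClosure_eq_top_iff, Submodule.eq_bot_iff]
  intro ψ hψ
  refine eq_zero_of_bargmann ψ fun z => ?_
  rw [← inner_coherentS]
  exact hψ _ (Submodule.subset_span ⟨z, rfl⟩)

lemma ext_inner_coherentS {φ ψ : L2 n} (h : ∀ z,
    inner ℂ ((coherentS z).toLp 2 (volume : Measure (Euc n))) φ =
      inner ℂ ((coherentS z).toLp 2 (volume : Measure (Euc n))) ψ) : φ = ψ :=
  bargmann_injective (funext fun z => by rw [← inner_coherentS, ← inner_coherentS, h])

lemma integral_comp_ofLp (f : (Fin n → ℝ) → ℂ) : ∫ x : Euc n, f x.ofLp = ∫ x, f x := by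
  rw [← (PiLp.volume_preserving_toLp (Fin n)).integral_comp
    (MeasurableEquiv.toLp 2 (Fin n → ℝ)).measurableEmbedding]

lemma cvec_ofLp_sum (x : Euc n) : ∑ i, (x i : ℂ) ^ 2 = cvec x.ofLp ⬝ᵥ cvec x.ofLp := by
  simp only [dotProduct, cvec, pow_two]

/-- The Bargmann transform of a Gaussian. -/
lemma bargmann_gaussS {A : Matrix (Fin n) (Fin n) ℂ} (hA : GPos A) (hA1 : GPos (A + 1))
    {b z u : Fin n → ℂ} (e : ℂ) (hu : (A + 1) *ᵥ u = z + b) :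
    bargmann ((gaussS hA b e).toLp 2 (volume : Measure (Euc n))) z =
      Complex.exp ((-(n : ℝ) / 4 * Real.log Real.pi : ℝ) : ℂ) * gint (A + 1) *
        Complex.exp (-(z ⬝ᵥ z) / 4 + (z + b) ⬝ᵥ u / 2 + e) := by
  rw [bargmann, ← exp_log_pi, mul_assoc]
  congr 1
  have h1 := hA1.integral_eq hu
  rw [add_assoc, add_comm ((z + b) ⬝ᵥ u / 2), ← add_assoc, Complex.exp_add, ← mul_assoc,
    mul_right_comm, ← h1, mul_comm, ← integral_const_mul, ← integral_comp_ofLp]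
  refine integral_congr_ae ?_
  filter_upwards [(gaussS hA b e).coeFn_toLp 2 (volume : Measure (Euc n))] with x hx
  rw [hx, gaussS_apply, ← Complex.exp_add, ← Complex.exp_add, gaussExp, cvec_ofLp_sum, add_mulVec,
    one_mulVec, dotProduct_add, add_dotProduct]
  congr 1
  simp only [dotProduct, cvec]
  ring

end Bargmann

/-! ### Gaussian kernels of operators -/

section Kernels

variable {n : ℕ} {M : Matrix (Idx n) (Idx n) ℂ}

/-- The amplitude of the kernel of the evolution. -/
def pathC (M : Matrix (Idx n) (Idx n) ℂ) (t : ℝ) : ℂ :=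
  Complex.exp ((-(n : ℝ) / 2 * Real.log Real.pi : ℝ) : ℂ) * Complex.exp (pathEta M t) *
    gint (pathA M |t| + 1)

lemma Dissipative.gpos_pathA_add_one (h : Dissipative M) {t : ℝ} (ht : 0 ≤ t) :
    GPos (pathA M t + 1) := (h.isExpSp ht).gpos_A_add_one

lemma continuous_pathC (h : Dissipative M) : Continuous (pathC M) := by
  have h1 : Continuous (pathEta M) :=
    continuous_iff_continuousAt.2 fun t => (hasDerivAt_pathEta h t).continuousAt
  refine (continuous_const.mul (Complex.continuous_exp.comp h1)).mul ?_
  exact continuous_iff_continuousAt.2 fun t =>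
    GPos.tendsto_gint (h.gpos_pathA_add_one (abs_nonneg t))
      (((continuous_pathA_abs h).add continuous_const).tendsto t)

/-- The normalisations of `gint (A + 1)`, of det(A + 1) and of exp `pathEta` are multiplied
together; det X cancels and det P is left. -/
lemma pathC_sq (h : Dissipative M) {t : ℝ} (ht : 0 ≤ t) :
    pathC M t ^ 2 * (kflow M t).toBlocks₁₁.det = 1 := by
  have h1 := (h.gpos_pathA_add_one ht).gint_sq
  have h2 : (pathA M t + 1).det * (pathX M t).det = 2 ^ n * (kflow M t).toBlocks₁₁.det :=
    (h.isExpSp ht).det_A_add_one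
  have h3 := pathEta_sq_mul_det h ht
  have hX := h.det_pathX_ne_zero ht
  have h4 : Complex.exp ((-(n : ℝ) / 2 * Real.log Real.pi : ℝ) : ℂ) ^ 2 * Real.pi ^ n = 1 := by
    rw [← ofReal_exp, ← ofReal_pow, ← ofReal_pow, ← ofReal_mul, ← Real.exp_nat_mul,
      ← Real.rpow_natCast Real.pi, Real.rpow_def_of_pos Real.pi_pos, ← Real.exp_add]
    have : ((2 : ℕ) : ℝ) * (-(n : ℝ) / 2 * Real.log Real.pi) + Real.log Real.pi * n = 0 := by
      push_cast; ring
    rw [this, Real.exp_zero, ofReal_one]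
  have h2n : (2 : ℂ) ^ n ≠ 0 := pow_ne_zero _ two_ne_zero
  rw [Fintype.card_fin, mul_pow] at h1
  rw [pathC, abs_of_nonneg ht]
  refine mul_left_cancel₀ h2n ?_
  calc _ = Complex.exp ((-(n : ℝ) / 2 * Real.log Real.pi : ℝ) : ℂ) ^ 2 *
        (gint (pathA M t + 1) ^ 2 * (pathA M t + 1).det) *
        (Complex.exp (pathEta M t) ^ 2 * (pathX M t).det) := by
        linear_combination (-(Complex.exp ((-(n : ℝ) / 2 * Real.log Real.pi : ℝ) : ℂ) ^ 2 *
          Complex.exp (pathEta M t) ^ 2 * gint (pathA M t + 1) ^ 2)) * h2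
    _ = _ := by rw [h1, h3]; linear_combination (2 : ℂ) ^ n * h4

lemma pathA_zero : pathA M 0 = 1 := by
  rw [pathA, pathX, kflow_zero, ← fromBlocks_one, toBlocks_fromBlocks₁₁, toBlocks_fromBlocks₂₁,
    sub_zero, add_zero, inv_one, Matrix.mul_one]

lemma pathC_zero : pathC M 0 = 1 := by
  have hpi : (Real.pi : ℂ) ≠ 0 := by exact_mod_cast Real.pi_ne_zero
  have h := GaussianFourier.integral_cexp_neg_mul_sum_add (ι := Fin n) (b := 1) (by simp) 0
  simp only [Pi.zero_apply, zero_mul, Finset.sum_const_zero, add_zero, ne_eq, OfNat.ofNat_ne_zero,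
    not_false_eq_true, zero_pow, zero_div, Complex.exp_zero, mul_one, Fintype.card_fin,
    div_one] at h
  have h1 : gint (pathA M 0 + 1) = (Real.pi : ℂ) ^ ((n : ℂ) / 2) := by
    rw [← h, gint]
    refine integral_congr_ae (Filter.Eventually.of_forall fun x => ?_)
    simp only
    rw [pathA_zero, add_mulVec, one_mulVec, dotProduct_add]
    congr 1
    simp only [dotProduct, cvec, ← pow_two]
    ring
  rw [pathC, abs_zero, h1, pathEta, intervalIntegral.integral_same, Complex.exp_zero, mul_one,
    cpow_def_of_ne_zero hpi, ← ofReal_log Real.pi_pos.le, ← Complex.exp_add]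
  rw [← Complex.exp_zero]
  congr 1
  push_cast
  ring

/-- The Bargmann transform of the evolved coherent states. -/
lemma bargmann_gpath (h : Dissipative M) (w z : Fin n → ℂ) {t : ℝ} (ht : 0 ≤ t) :
    bargmann ((gpath h w t).toLp 2 (volume : Measure (Euc n))) z = pathC M t *
      Complex.exp (expK (kflow M t).toBlocks₁₁ (kflow M t).toBlocks₁₂ (kflow M t).toBlocks₂₁ z w)
      := by
  have hs := h.isExpSp ht
  set P := (kflow M t).toBlocks₁₁ with hP
  set Q := (kflow M t).toBlocks₁₂ with hQ
  set R := (kflow M t).toBlocks₂₁ with hR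
  set S := (kflow M t).toBlocks₂₂ with hS
  have hX : pathX M |t| = P + R := by rw [abs_of_nonneg ht, pathX]
  have hX' : pathX' M |t| = Q + S := by rw [abs_of_nonneg ht, pathX']
  have hA : pathA M |t| = (P - R) * (P + R)⁻¹ := by rw [abs_of_nonneg ht, pathA, pathX]
  set b := pathB M (star w) |t| with hb
  have hb' : b = ((P + R)⁻¹)ᵀ *ᵥ star w := by rw [hb, pathB, hX]
  -- The matrix ½(P + R)P⁻¹ is the inverse of A + 1.
  have hu : (pathA M |t| + 1) *ᵥ (((2⁻¹ : ℂ) • ((P + R) * P⁻¹)) *ᵥ (z + b)) = z + b := by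
    rw [hA, mulVec_mulVec, hs.A_add_one_mul, one_mulVec]
  rw [gpath, bargmann_gaussS _ (h.gpos_pathA_add_one (abs_nonneg t)) _ hu, pathC]
  have h2 : ((-(n : ℝ) / 2 * Real.log Real.pi : ℝ) : ℂ) =
      ((-(n : ℝ) / 4 * Real.log Real.pi : ℝ) : ℂ) + ((-(n : ℝ) / 4 * Real.log Real.pi : ℝ) : ℂ) :=
      by
    push_cast; ring
  have h3 : -(z ⬝ᵥ z) / 4 + (z + b) ⬝ᵥ (((2⁻¹ : ℂ) • ((P + R) * P⁻¹)) *ᵥ (z + b)) / 2 -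
      (star w ⬝ᵥ (((pathX M |t|)⁻¹ * pathX' M |t|) *ᵥ star w)) / 4 = expK P Q R z w := by
    have hσ : (P + R) * P⁻¹ = 1 + R * P⁻¹ := by rw [Matrix.add_mul, hs.mul_inv]
    have hsym : ((P + R) * P⁻¹)ᵀ = (P + R) * P⁻¹ := by
      rw [hσ, transpose_add, hs.symm_RP, transpose_one]
    have e1 : ∀ v, b ⬝ᵥ (((P + R) * P⁻¹) *ᵥ v) = (P⁻¹ *ᵥ v) ⬝ᵥ star w := by
      intro v
      rw [hb', mulVec_transpose, ← dotProduct_mulVec, mulVec_mulVec, ← Matrix.mul_assoc,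
        hs.add_inv_mul, Matrix.one_mul, dotProduct_comm]
    have e2 : z ⬝ᵥ (((P + R) * P⁻¹) *ᵥ b) = (P⁻¹ *ᵥ z) ⬝ᵥ star w := by
      rw [← e1 z, dotProduct_mulVec, ← mulVec_transpose, hsym, dotProduct_comm]
    have e3 : b ⬝ᵥ (((P + R) * P⁻¹) *ᵥ b) = star w ⬝ᵥ (((P + R)⁻¹ * P⁻¹ᵀ) *ᵥ star w) := by
      rw [e1 b, hb', mulVec_mulVec, dotProduct_comm, dotProduct_mulVec, ← mulVec_transpose,
        transpose_mul, transpose_transpose, dotProduct_comm]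
    rw [hX, hX', hs.add_inv_mul_add, smul_mulVec, dotProduct_smul, smul_eq_mul, mulVec_add,
      add_dotProduct, dotProduct_add, dotProduct_add, e1 z, e2, e3, expK, hσ, add_mulVec,
      one_mulVec,
      dotProduct_add, add_mulVec, dotProduct_add]
    ring
  rw [← h3, h2]
  simp only [Complex.exp_add, Complex.exp_sub]
  ring

lemma expK_one (z w : Fin n → ℂ) : expK 1 0 0 z w = (star w ⬝ᵥ z) / 2 := by
  rw [expK]
  simp only [inv_one, Matrix.zero_mul, zero_mulVec, dotProduct_zero, one_mulVec, Matrix.mul_zero,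
    zero_add, sub_zero]
  rw [dotProduct_comm]
  ring

/-- The case M = 0, t = 0 of the transform of the evolved states. -/
lemma bargmann_coherentS (w : Fin n → ℂ) :
    bargmann ((coherentS w).toLp 2 (volume : Measure (Euc n))) = coherent w := by
  funext z
  rw [coherentS, bargmann_gpath dissipative_zero w z le_rfl, pathC_zero, kflow_zero, ←
    fromBlocks_one,
    toBlocks_fromBlocks₁₁, toBlocks_fromBlocks₁₂, toBlocks_fromBlocks₂₁, expK_one, one_mul,
    coherent]

lemma star_coherent (z v : Fin n → ℂ) : star (coherent z v) = Complex.exp ((z ⬝ᵥ star v) / 2) := by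
  rw [coherent, RCLike.star_def, ← Complex.exp_conj]
  congr 1
  rw [map_div₀, ← RCLike.star_def, ← star_dotProduct_star, star_star]
  simp only [star_ofNat]
  rw [dotProduct_comm]

/-- As a function of v the kernel is a holomorphic Gaussian with contraction RP⁻¹, so pairing with a
coherent state evaluates it at z. -/
lemma fockInner_gaussian {k : Matrix (Idx n) (Idx n) ℂ} (h : IsExpSp k) (c : ℂ) (z w : Fin n → ℂ) :
    fockInner (fun v => c * Complex.exp (expK k.toBlocks₁₁ k.toBlocks₁₂ k.toBlocks₂₁ v w))
      (coherent z) = c * Complex.exp (expK k.toBlocks₁₁ k.toBlocks₁₂ k.toBlocks₂₁ z w) := by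
  have hs := isExpSp_blocks h
  have h1 := integral_reproducing hs.symm_RP hs.nsq_RP_le
    ((2⁻¹ : ℂ) • (k.toBlocks₁₁⁻¹ᵀ *ᵥ star w)) z
  have hb : ∀ v : Fin n → ℂ, ((2⁻¹ : ℂ) • (k.toBlocks₁₁⁻¹ᵀ *ᵥ star w)) ⬝ᵥ v =
      (k.toBlocks₁₁⁻¹ *ᵥ v) ⬝ᵥ star w / 2 := by
    intro v
    rw [smul_dotProduct, mulVec_transpose, ← dotProduct_mulVec, dotProduct_comm, smul_eq_mul]
    ring
  simp only [hb] at h1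
  have hpi : ((2 * Real.pi : ℂ) ^ n) ≠ 0 :=
    pow_ne_zero _ (by exact_mod_cast (by positivity : (2 * Real.pi : ℝ) ≠ 0))
  rw [fockInner]
  have h2 : ∀ v : Fin n → ℂ, expK k.toBlocks₁₁ k.toBlocks₁₂ k.toBlocks₂₁ v w =
      v ⬝ᵥ ((k.toBlocks₂₁ * k.toBlocks₁₁⁻¹) *ᵥ v) / 4 + (k.toBlocks₁₁⁻¹ *ᵥ v) ⬝ᵥ star w / 2 +
      -(star w ⬝ᵥ ((k.toBlocks₁₁⁻¹ * k.toBlocks₁₂) *ᵥ star w)) / 4 := by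
    intro v; rw [expK]; ring
  rw [h2 z, Complex.exp_add, ← mul_assoc, mul_right_comm]
  have h3 := congrArg (fun t => c * Complex.exp (-(star w ⬝ᵥ ((k.toBlocks₁₁⁻¹ * k.toBlocks₁₂) *ᵥ
    star w)) / 4) * ((2 * Real.pi : ℂ) ^ n)⁻¹ * t) h1
  rw [← mul_assoc _ ((2 * (Real.pi : ℂ)) ^ n), mul_assoc _ _ ((2 * (Real.pi : ℂ)) ^ n),
    inv_mul_cancel₀ hpi, mul_one] at h3
  rw [← h3, ← integral_const_mul]
  refine integral_congr_ae (Filter.Eventually.of_forall fun v => ?_)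
  simp only
  rw [star_coherent, h2 v]
  have h5 : ∀ a b d e p : ℂ, c * Complex.exp a * Complex.exp b * Complex.exp d * p =
      c * Complex.exp e * p * Complex.exp (a + b + d - e) := fun a b d e p => by
    rw [sub_eq_add_neg, Complex.exp_add, Complex.exp_add, Complex.exp_add, Complex.exp_neg]
    field_simp
  rw [h5 _ _ _ (-(star w ⬝ᵥ ((k.toBlocks₁₁⁻¹ * k.toBlocks₁₂) *ᵥ star w)) / 4)]
  congr 2
  ring

/-- The complex Weyl symbol of an operator with Gaussian kernel. -/
lemma W0_gaussian {A : ((Fin n → ℂ) → ℂ) → ((Fin n → ℂ) → ℂ)} {c : ℂ}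
    {k : Matrix (Idx n) (Idx n) ℂ} (h : IsExpSp k) (hd : (k + 1).det ≠ 0)
    (hA : ∀ w, A (coherent w) =
      fun z => c * Complex.exp (expK k.toBlocks₁₁ k.toBlocks₁₂ k.toBlocks₂₁ z w)) (z : Fin n → ℂ) :
    W0 A z = weylCoef c k * Complex.exp (hat z ⬝ᵥ (stdJ n *ᵥ ((k - 1) *ᵥ
      ((k + 1)⁻¹ *ᵥ hat z))) / 2) := by
  have h1 := weyl_integral (isExpSp_blocks h) (by rwa [fromBlocks_toBlocks]) c z
  rw [fromBlocks_toBlocks] at h1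
  rw [weylCoef, ← h1, W0]
  simp only [fockKernel, hA, fockInner_gaussian h]

/-- Apart from the Gaussian weight and the coherent state, the integrand is antiholomorphic in the
integration variable. Its complex conjugate is a reproducing integral with σ = -conj(P⁻¹Q),
evaluated at w. -/
lemma metaFock_coherent {k : Matrix (Idx n) (Idx n) ℂ} (h : IsExpSp k)
    (hk : k.toBlocks₂₁ = k.toBlocks₁₂.map star) (w : Fin n → ℂ) :
    metaFock k (coherent w) = fun z => powNegHalf k.toBlocks₁₁.det *
      Complex.exp (expK k.toBlocks₁₁ k.toBlocks₁₂ k.toBlocks₂₁ z w) := by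
  funext z
  have hs := isExpSp_blocks h
  rw [metaFock]
  simp only [metaKernel]
  rw [← hk]
  set P := k.toBlocks₁₁
  set Q := k.toBlocks₁₂
  set σ : Matrix (Fin n) (Fin n) ℂ := -((P⁻¹ * Q).map star) with hσ
  have hmv : ∀ v, σ *ᵥ v = -star ((P⁻¹ * Q) *ᵥ star v) := by
    intro v
    rw [hσ, neg_mulVec]
    congr 1
    ext i
    simp [mulVec, dotProduct]
  have hσs : σᵀ = σ := by
    rw [hσ, transpose_neg, ← transpose_map, hs.symm_PQ]
  have h1 := integral_reproducing hσs (fun v => by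
    rw [hmv, nsq_neg, nsq_star]; exact (hs.nsq_PQ_le _).trans (nsq_star v).le)
    ((2⁻¹ : ℂ) • star (P⁻¹ *ᵥ z)) w
  have h2 := congrArg (starRingEnd ℂ) h1
  rw [← integral_conj] at h2
  have hpi : ((2 * Real.pi : ℂ) ^ n) ≠ 0 :=
    pow_ne_zero _ (by exact_mod_cast (by positivity : (2 * Real.pi : ℝ) ≠ 0))
  have hc : ∀ a b : Fin n → ℂ, (starRingEnd ℂ) (a ⬝ᵥ b) = star a ⬝ᵥ star b := fun a b => by
    rw [← RCLike.star_def, star_dotProduct_star, dotProduct_comm]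
  have hh : (starRingEnd ℂ) (2⁻¹ : ℂ) = 2⁻¹ := by rw [map_inv₀, map_ofNat]
  simp only [← Complex.exp_conj, map_add, map_sub, map_neg, map_div₀, map_mul, hc, hmv, star_star,
    dotProduct_neg, smul_dotProduct, smul_eq_mul, map_ofNat, hh,
    conj_ofReal, map_pow] at h2
  have h3 := congrArg (fun t => powNegHalf P.det * Complex.exp
    (z ⬝ᵥ ((k.toBlocks₂₁ * P⁻¹) *ᵥ z) / 4) *
    ((2 * Real.pi : ℂ) ^ n)⁻¹ * t) h2
  rw [← mul_assoc _ ((2 * (Real.pi : ℂ)) ^ n), mul_assoc _ _ ((2 * (Real.pi : ℂ)) ^ n),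
    inv_mul_cancel₀ hpi, mul_one, mul_assoc (powNegHalf _) (Complex.exp _) (Complex.exp _), ←
    Complex.exp_add,
    ← integral_const_mul] at h3
  have h4 : expK P Q k.toBlocks₂₁ z w = z ⬝ᵥ ((k.toBlocks₂₁ * P⁻¹) *ᵥ z) / 4 +
      (-(star w ⬝ᵥ ((P⁻¹ * Q) *ᵥ star w)) / 4 + 2⁻¹ * ((P⁻¹ *ᵥ z) ⬝ᵥ star w)) := by
    rw [expK]; ring
  rw [h4, ← h3]
  refine integral_congr_ae (Filter.Eventually.of_forall fun v => ?_)
  simp only [coherent]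
  have h5 : ∀ p a b d e q : ℂ, p * Complex.exp a * Complex.exp b * Complex.exp d * q =
      p * Complex.exp e * q * Complex.exp (a + b + d - e) := fun p a b d e q => by
    rw [sub_eq_add_neg, Complex.exp_add, Complex.exp_add, Complex.exp_add, Complex.exp_neg]
    field_simp
  rw [h5 _ _ _ _ (z ⬝ᵥ ((k.toBlocks₂₁ * P⁻¹) *ᵥ z) / 4)]
  congr 2
  rw [dotProduct_comm (star v) v]
  ring

end Kernels

/-! ### Strongly continuous semigroups -/

section AbstractSemigroup

variable {E : Type*} [NormedAddCommGroup E] [NormedSpace ℂ E] [CompleteSpace E]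

lemma exists_opNorm_bound {T : ℝ → (E →L[ℂ] E)} (hc : ∀ f : E, ContinuousOn (fun t => T t f)
    (Set.Ici 0))
    (a : ℝ) : ∃ C, ∀ s ∈ Set.Icc 0 a, ‖T s‖ ≤ C := by
  obtain ⟨C, hC⟩ := banach_steinhaus (g := fun s : Set.Icc (0 : ℝ) a => T s) fun x => by
    obtain ⟨C, hC⟩ := isCompact_Icc.exists_bound_of_continuousOn
      ((hc x).mono (Set.Icc_subset_Ici_self : Set.Icc 0 a ⊆ _))
    exact ⟨C, fun i => hC i i.2⟩
  exact ⟨C, fun s hs => hC ⟨s, hs⟩⟩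

/-- A differentiable solution of the evolution equation is given by the semigroup. -/
lemma semigroup_apply_eq {T : ℝ → (E →L[ℂ] E)} (h0 : T 0 = ContinuousLinearMap.id ℂ E)
    (hadd : ∀ s t : ℝ, 0 ≤ s → 0 ≤ t → T (s + t) = (T s).comp (T t))
    (hc : ∀ f : E, ContinuousOn (fun t => T t f) (Set.Ici 0)) {u u' : ℝ → E}
    (hu : ∀ s, 0 ≤ s → HasDerivWithinAt u (u' s) (Set.Ici 0) s)
    (hT : ∀ s, 0 ≤ s → HasDerivWithinAt (fun r => T r (u s)) (u' s) (Set.Ici 0) 0) {t : ℝ}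
    (ht : 0 ≤ t) : T t (u 0) = u t := by
  obtain ⟨C, hC⟩ := exists_opNorm_bound hc t
  -- The function s ↦ T(t - s)u(s) interpolates between the two sides; it is shown to be continuous
  -- with zero right derivative, hence constant.
  have hcont : ContinuousOn (fun s => T (t - s) (u s)) (Set.Icc 0 t) := by
    intro s hs
    have h1 : Filter.Tendsto (fun x => T (t - x) (u x - u s)) (nhdsWithin s (Set.Icc 0 t)) (nhds 0)
      := by
      have h2 : Filter.Tendsto (fun x => C * ‖u x - u s‖) (nhdsWithin s (Set.Icc 0 t)) (nhds 0) :=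
        by
        have h3 : Filter.Tendsto u (nhdsWithin s (Set.Icc 0 t)) (nhds (u s)) :=
          ((hu s hs.1).continuousWithinAt.mono Set.Icc_subset_Ici_self)
        have := (tendsto_iff_norm_sub_tendsto_zero.1 h3).const_mul C
        rwa [mul_zero] at this
      refine squeeze_zero_norm' ?_ h2
      filter_upwards [self_mem_nhdsWithin] with x hx
      exact (T (t - x)).le_of_opNorm_le (hC _ ⟨by linarith [hx.2], by linarith [hx.1]⟩) _
    have h4 : Filter.Tendsto (fun x => T (t - x) (u s)) (nhdsWithin s (Set.Icc 0 t))
        (nhds (T (t - s) (u s))) := by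
      have h5 : ContinuousOn (fun x => T (t - x) (u s)) (Set.Icc 0 t) :=
        (hc (u s)).comp (by fun_prop) fun x hx => by simpa using hx.2
      exact h5 s hs
    have h6 := h1.add h4
    rw [zero_add] at h6
    refine h6.congr fun x => ?_
    rw [map_sub, sub_add_cancel]
  have hder : ∀ s ∈ Set.Ico 0 t, HasDerivWithinAt (fun s => T (t - s) (u s)) 0 (Set.Ici s) s := by
    intro s hs
    have h1 : HasDerivWithinAt u (u' s) (Set.Ici s) s := (hu s hs.1).mono
      (Set.Ici_subset_Ici.2 hs.1)
    have h2 : HasDerivWithinAt (fun x => T (x - s) (u s)) (u' s) (Set.Ici s) s := by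
      have h3 := hT s hs.1
      rw [← sub_self s] at h3
      have h4 := HasDerivWithinAt.scomp (h := fun x => x - s) (t' := Set.Ici 0) s
        (by simpa using h3) ((hasDerivAt_id s).sub_const s).hasDerivWithinAt
        (fun x hx => by simpa using hx : Set.MapsTo (fun x => x - s) (Set.Ici s) (Set.Ici 0))
      rw [one_smul] at h4
      exact h4
    have h5 := (h1.sub h2)
    rw [sub_self, hasDerivWithinAt_iff_isLittleO] at h5
    rw [hasDerivWithinAt_iff_isLittleO]
    simp only [smul_zero, sub_zero] at h5 ⊢
    refine Asymptotics.IsBigO.trans_isLittleO (Asymptotics.IsBigO.of_bound C ?_) h5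
    have h6 : Set.Icc s t ∈ nhdsWithin s (Set.Ici s) := Icc_mem_nhdsGE hs.2
    filter_upwards [h6] with x hx
    -- Factoring T(t - s) puts the whole increment under the uniformly bounded T(t - x). What is
    -- left is the difference of u(x) and T(x - s)u(s), which agree to first order at x = s.
    have h7 : T (t - s) (u s) = T (t - x) (T (x - s) (u s)) := by
      rw [← ContinuousLinearMap.comp_apply, ← hadd _ _ (by linarith [hx.2]) (by linarith [hx.1]),
        sub_add_sub_cancel]
    rw [h7, ← map_sub]
    have h8 : (u - fun x => T (x - s) (u s)) x - (u - fun x => T (x - s) (u s)) s =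
        u x - T (x - s) (u s) := by
      simp [h0]
    rw [h8]
    exact (T (t - x)).le_of_opNorm_le (hC _ ⟨by linarith [hx.2], by linarith [hx.1, hs.1]⟩) _
  have h9 := constant_of_has_deriv_right_zero hcont hder t (Set.right_mem_Icc.2 ht)
  simp only [sub_self, sub_zero, h0, ContinuousLinearMap.id_apply] at h9
  exact h9.symm

end AbstractSemigroup

/-! ### Uniqueness on coherent states and duality with the conjugate symbol -/

section WeylSemigroup

variable {n : ℕ} {M : Matrix (Idx n) (Idx n) ℂ}

lemma weylQuad_ae_eq (h : Dissipative M) (φ : 𝓢(Euc n, ℂ)) {ψ : L2 n}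
    (hψ : ∀ᵐ p, ψ p = weylQuad M φ p) : ψ = (weylS M φ).toLp 2 (volume : Measure (Euc n)) := by
  refine Lp.ext ?_
  filter_upwards [hψ, (weylS M φ).coeFn_toLp 2 (volume : Measure (Euc n))] with p h1 h2
  rw [h1, h2, weylQuad_eq_weylS h.symm]

/-- The semigroup acts on coherent states by the Gaussian path. -/
lemma IsExpWeyl.apply_coherentS (h : Dissipative M) {T : ℝ → (L2 n →L[ℂ] L2 n)} (hT : IsExpWeyl M T)
    (w : Fin n → ℂ) {t : ℝ} (ht : 0 ≤ t) : T t ((coherentS w).toLp 2) = (gpath h w t).toLp 2 := by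
  rw [← gpath_zero_eq h w]
  refine semigroup_apply_eq (u := fun t => (gpath h w t).toLp 2)
    (u' := fun t => (weylS M (gpath h w t)).toLp 2) hT.map_zero hT.map_add hT.cont
    (fun s hs => hasDerivWithinAt_gpath h w hs) (fun s _ => ?_) ht
  obtain ⟨ψ, h1, h2⟩ := hT.deriv_zero (gpath h w s)
  rwa [weylQuad_ae_eq h _ h1] at h2

lemma Dissipative.conj (h : Dissipative M) : Dissipative (M.map star) := by
  refine ⟨?_, fun x y => ?_⟩
  · rw [Matrix.IsSymm, ← transpose_map, h.symm.eq]
  · have h1 : qform (M.map star) x y = (starRingEnd ℂ) (qform M x y) := by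
      simp only [qform, dotProduct, mulVec, map_sum, map_mul, phaseVec, conj_ofReal, map_apply,
        RCLike.star_def]
    rw [h1, conj_re]
    exact h.re_nonpos x y

lemma map_star_map_star (M : Matrix (Idx n) (Idx n) ℂ) : (M.map star).map star = M := by
  ext; simp

/-- Duality between the flows of `M` and of its conjugate. -/
lemma inner_gpath_conj (h : Dissipative M) (z w : Fin n → ℂ) {s t : ℝ} (hs : 0 ≤ s) (ht : 0 ≤ t) :
    inner ℂ ((gpath h.conj z s).toLp 2 (volume : Measure (Euc n))) ((gpath h w t).toLp 2) =
      inner ℂ ((coherentS z).toLp 2 (volume : Measure (Euc n))) ((gpath h w (s + t)).toLp 2) := by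
  -- Running one flow backwards while the other runs forwards gives a constant pairing, because the
  -- formal adjoint of the generator belongs to the conjugate symbol.
  set f : ℝ → ℂ := fun r => inner ℂ ((gpath h.conj z (s + t - r)).toLp 2 (volume : Measure (Euc n)))
    ((gpath h w r).toLp 2) with hf
  have hd : ∀ r ∈ Set.Icc 0 (s + t), HasDerivWithinAt f 0 (Set.Icc 0 (s + t)) r := by
    intro r hr
    have h1 : HasDerivWithinAt (fun r => (gpath h w r).toLp 2 (volume : Measure (Euc n)))
      ((weylS M (gpath h w r)).toLp 2) (Set.Icc 0 (s + t)) r :=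
      (hasDerivWithinAt_gpath h w hr.1).mono Set.Icc_subset_Ici_self
    have h2 := HasDerivWithinAt.scomp (h := fun r => s + t - r) (h' := -1) (s := Set.Icc 0 (s + t))
      r
      (hasDerivWithinAt_gpath h.conj z (t := s + t - r) (by linarith [hr.2]))
      ((hasDerivAt_id r).const_sub (s + t)).hasDerivWithinAt
      (fun x hx => by simpa using hx.2)
    have h3 := HasDerivWithinAt.inner ℂ h2 h1
    refine h3.congr_deriv ?_
    rw [neg_one_smul, inner_neg_left, inner_weylS h.conj.symm, map_star_map_star,
      Function.comp_apply,
      add_neg_cancel]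
  have hconst : ∀ a ∈ Set.Icc 0 (s + t), f a = f (s + t) := by
    intro a ha
    have h1 := (convex_Icc (0 : ℝ) (s + t)).norm_image_sub_le_of_norm_hasDerivWithin_le (C := 0)
      hd (fun s _ => by simp) (Set.right_mem_Icc.2 (by positivity)) ha
    rw [zero_mul] at h1
    exact sub_eq_zero.1 (norm_le_zero_iff.1 h1)
  have h1 := hconst t ⟨ht, by linarith⟩
  simp only [hf, add_sub_cancel_right, sub_self] at h1
  rw [h1, gpath_zero_eq]

end WeylSemigroup

/-! ### Existence of the Weyl semigroup -/

section Existence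

variable {n : ℕ} {M : Matrix (Idx n) (Idx n) ℂ}

lemma weylS_sum {α : Type*} (M : Matrix (Idx n) (Idx n) ℂ) (s : Finset α) (f : α → 𝓢(Euc n, ℂ)) :
    weylS M (∑ a ∈ s, f a) = ∑ a ∈ s, weylS M (f a) := by
  classical
  induction s using Finset.induction_on with
  | empty =>
    have := weylS_smul M 0 (0 : 𝓢(Euc n, ℂ))
    rwa [zero_smul, zero_smul] at this
  | insert a s ha ih => rw [Finset.sum_insert ha, Finset.sum_insert ha, weylS_add, ih]

/-- The evolution on combinations of coherent states. -/
def pathL (h : Dissipative M) (t : ℝ) : ((Fin n → ℂ) →₀ ℂ) →ₗ[ℂ] L2 n :=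
  Finsupp.linearCombination ℂ fun w => (gpath h w t).toLp 2 (volume : Measure (Euc n))

lemma pathL_single (h : Dissipative M) (t : ℝ) (w : Fin n → ℂ) :
    pathL h t (Finsupp.single w 1) = (gpath h w t).toLp 2 (volume : Measure (Euc n)) := by
  rw [pathL, Finsupp.linearCombination_single, one_smul]

lemma pathL_apply (h : Dissipative M) (t : ℝ) (F : (Fin n → ℂ) →₀ ℂ) :
    pathL h t F = ∑ w ∈ F.support, F w • (gpath h w t).toLp 2 (volume : Measure (Euc n)) := by
  rw [pathL, Finsupp.linearCombination_apply, Finsupp.sum]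

lemma pathL_apply' (h : Dissipative M) (t : ℝ) (F : (Fin n → ℂ) →₀ ℂ) :
    pathL h t F = (∑ w ∈ F.support, F w • gpath h w t).toLp 2 (volume : Measure (Euc n)) := by
  rw [pathL_apply, toLp_sum]
  simp only [toLp_smul]

lemma hasDerivWithinAt_pathL (h : Dissipative M) (F : (Fin n → ℂ) →₀ ℂ) {t : ℝ} (ht : 0 ≤ t) :
    HasDerivWithinAt (fun t => pathL h t F)
      ((weylS M (∑ w ∈ F.support, F w • gpath h w t)).toLp 2) (Set.Ici 0) t := by
  simp only [pathL_apply]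
  rw [weylS_sum, toLp_sum]
  simp only [weylS_smul, toLp_smul]
  exact HasDerivWithinAt.fun_sum fun w _ => (hasDerivWithinAt_gpath h w ht).const_smul (F w)

lemma norm_le_of_re_inner_deriv_nonpos {E : Type*} [NormedAddCommGroup E] [InnerProductSpace ℂ E]
    {f f' : ℝ → E} (hd : ∀ s, 0 ≤ s → HasDerivWithinAt f (f' s) (Set.Ici 0) s)
    (hf : ∀ s, 0 ≤ s → (inner ℂ (f s) (f' s)).re ≤ 0) {t : ℝ} (ht : 0 ≤ t) : ‖f t‖ ≤ ‖f 0‖ := by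
  have hd' : ∀ s, 0 ≤ s → HasDerivWithinAt (fun t => (inner ℂ (f t) (f t)).re)
      (2 * (inner ℂ (f s) (f' s)).re) (Set.Ici 0) s := by
    intro s hs
    have h2 := Complex.reCLM.hasFDerivAt.comp_hasDerivWithinAt s
      (HasDerivWithinAt.inner ℂ (hd s hs) (hd s hs))
    refine h2.congr_deriv ?_
    rw [Complex.reCLM_apply, Complex.add_re, ← inner_conj_symm (f' s) (f s), conj_re]
    ring
  have hanti : AntitoneOn (fun t => (inner ℂ (f t) (f t)).re) (Set.Ici 0) := by
    refine antitoneOn_of_hasDerivWithinAt_nonpos (convex_Ici 0)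
      (fun s hs => (hd' s hs).continuousWithinAt)
      (fun s hs => (hd' s (interior_subset hs)).mono interior_subset) fun s hs => ?_
    linarith [hf s (interior_subset hs)]
  have h1 := hanti (Set.self_mem_Ici) (Set.mem_Ici.2 ht) ht
  simp only [inner_self_eq_norm_sq_to_K] at h1
  norm_cast at h1
  exact (pow_le_pow_iff_left₀ (norm_nonneg _) (norm_nonneg _) two_ne_zero).1 h1

/-- The estimate compares with the vector `pathL h 0 F` and not with the coefficients F. It
therefore also shows that the evolution is well defined on the span of the coherent states. -/
lemma norm_pathL_le (h : Dissipative M) (F : (Fin n → ℂ) →₀ ℂ) {t : ℝ} (ht : 0 ≤ t) :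
    ‖pathL h t F‖ ≤ ‖pathL h 0 F‖ := by
  refine norm_le_of_re_inner_deriv_nonpos (f := fun t => pathL h t F)
    (fun s hs => hasDerivWithinAt_pathL h F hs) (fun s _ => ?_) ht
  rw [pathL_apply']
  exact re_inner_weylS_le h.symm h.re_nonpos _

lemma denseRange_pathL_zero (h : Dissipative M) : DenseRange (pathL h 0) := by
  have h1 := topologicalClosure_span_coherentS (n := n)
  rw [DenseRange, dense_iff_closure_eq, ← LinearMap.coe_range, pathL,
    Finsupp.range_linearCombination,
    ← Submodule.topologicalClosure_coe]
  simp only [gpath_zero_eq]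
  rw [h1, Submodule.top_coe]

/-- The semigroup generated by `𝒲(q_M)`. -/
def weylExp (h : Dissipative M) (t : ℝ) : L2 n →L[ℂ] L2 n :=
  LinearMap.extendOfNorm (pathL h |t|) (pathL h 0)

lemma weylExp_pathL (h : Dissipative M) (t : ℝ) (F : (Fin n → ℂ) →₀ ℂ) :
    weylExp h t (pathL h 0 F) = pathL h |t| F :=
  LinearMap.extendOfNorm_eq (denseRange_pathL_zero h)
    ⟨1, fun F => by rw [one_mul]; exact norm_pathL_le h F (abs_nonneg t)⟩ F

lemma weylExp_coherentS (h : Dissipative M) (w : Fin n → ℂ) {t : ℝ} (ht : 0 ≤ t) :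
    weylExp h t ((coherentS w).toLp 2) = (gpath h w t).toLp 2 := by
  have h1 := weylExp_pathL h t (Finsupp.single w 1)
  rwa [pathL_single, pathL_single, gpath_zero_eq, abs_of_nonneg ht] at h1

lemma norm_weylExp_le (h : Dissipative M) (t : ℝ) (f : L2 n) : ‖weylExp h t f‖ ≤ ‖f‖ := by
  refine (denseRange_pathL_zero h).induction_on (p := fun f => ‖weylExp h t f‖ ≤ ‖f‖) f
    (isClosed_le (weylExp h t).continuous.norm continuous_norm) fun F => ?_
  rw [weylExp_pathL]
  exact norm_pathL_le h F (abs_nonneg t)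

lemma ext_coherentS {A B : L2 n →L[ℂ] L2 n}
    (h : ∀ w, A ((coherentS w).toLp 2) = B ((coherentS w).toLp 2)) : A = B :=
  ContinuousLinearMap.ext_on (s := Set.range fun w =>
    (coherentS w).toLp 2 (volume : Measure (Euc n)))
    ((Submodule.dense_iff_topologicalClosure_eq_top).2 topologicalClosure_span_coherentS)
    (by rintro _ ⟨w, rfl⟩; exact h w)

/-- By density the duality for coherent states extends to all φ. It replaces an adjoint semigroup.
-/
lemma inner_weylExp (h : Dissipative M) (z : Fin n → ℂ) (φ : L2 n) {t : ℝ} (ht : 0 ≤ t) :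
    inner ℂ ((coherentS z).toLp 2 (volume : Measure (Euc n))) (weylExp h t φ) =
      inner ℂ ((gpath h.conj z t).toLp 2 (volume : Measure (Euc n))) φ := by
  have h1 : (innerSL ℂ ((coherentS z).toLp 2 (volume : Measure (Euc n)))).comp (weylExp h t) =
      innerSL ℂ ((gpath h.conj z t).toLp 2 (volume : Measure (Euc n))) := by
    refine ContinuousLinearMap.ext_on (s := Set.range fun w =>
      (coherentS w).toLp 2 (volume : Measure (Euc n)))
      ((Submodule.dense_iff_topologicalClosure_eq_top).2 topologicalClosure_span_coherentS) ?_
    rintro _ ⟨w, rfl⟩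
    simp only [ContinuousLinearMap.comp_apply, innerSL_apply_apply]
    rw [weylExp_coherentS h w ht, ← gpath_zero_eq h w, inner_gpath_conj h z w ht le_rfl, add_zero]
  exact congrArg (fun A => A φ) h1

lemma weylExp_zero (h : Dissipative M) : weylExp h 0 = ContinuousLinearMap.id ℂ (L2 n) :=
  ext_coherentS fun w => by
    rw [weylExp_coherentS h w le_rfl, gpath_zero_eq, ContinuousLinearMap.id_apply]

/-- An evolved coherent state need not be a combination of coherent states, so the composition is
tested weakly: the outer operator is moved to the left factor of the inner product. -/
lemma weylExp_add (h : Dissipative M) {s t : ℝ} (hs : 0 ≤ s) (ht : 0 ≤ t) :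
    weylExp h (s + t) = (weylExp h s).comp (weylExp h t) := by
  refine ext_coherentS fun w => ext_inner_coherentS fun z => ?_
  rw [ContinuousLinearMap.comp_apply, inner_weylExp h z _ hs, weylExp_coherentS h w ht,
    inner_gpath_conj h z w hs ht, weylExp_coherentS h w (add_nonneg hs ht)]

lemma continuous_weylExp (h : Dissipative M) (f : L2 n) : Continuous fun t => weylExp h t f := by
  rw [← continuousOn_univ]
  refine continuousOn_of_uniform_approx_of_continuousOn fun u hu => ?_
  obtain ⟨ε, hε, hu⟩ := Metric.mem_uniformity_dist.1 hu
  obtain ⟨F, hF⟩ := (denseRange_pathL_zero h).exists_dist_lt f hε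
  refine ⟨fun t => weylExp h t (pathL h 0 F), ?_, fun t _ => hu ?_⟩
  · simp only [weylExp_pathL]
    have h1 : ContinuousOn (fun t => pathL h t F) (Set.Ici 0) := fun s hs =>
      (hasDerivWithinAt_pathL h F hs).continuousWithinAt
    exact h1.comp continuous_abs.continuousOn fun t _ => abs_nonneg t
  · rw [dist_eq_norm, ← map_sub]
    exact (norm_weylExp_le h t _).trans_lt (by rwa [← dist_eq_norm])

/-- A general Schwartz function is not a finite combination of coherent states, so differentiation
is done weakly. Paired with a coherent state, the evolution falls on the conjugate path, whose
derivative returns 𝒲(q_M) to φ. Integration in time gives an identity in L². -/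
lemma weylExp_sub_eq_integral (h : Dissipative M) (φ : 𝓢(Euc n, ℂ)) {t : ℝ} (ht : 0 ≤ t) :
    weylExp h t (φ.toLp 2) - φ.toLp 2 (volume : Measure (Euc n)) =
      ∫ s in (0 : ℝ)..t, weylExp h s ((weylS M φ).toLp 2 (volume : Measure (Euc n))) := by
  refine ext_inner_coherentS fun z => ?_
  have hc := continuous_weylExp h ((weylS M φ).toLp 2 (volume : Measure (Euc n)))
  have h1 := (innerSL ℂ ((coherentS z).toLp 2 (volume : Measure
    (Euc n)))).intervalIntegral_comp_comm
    (hc.intervalIntegrable (μ := volume) 0 t)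
  simp only [innerSL_apply_apply] at h1
  rw [← h1]
  have hd : ∀ s, 0 ≤ s → HasDerivWithinAt (fun s => inner ℂ
      ((gpath h.conj z s).toLp 2 (volume : Measure (Euc n))) (φ.toLp 2 (volume : Measure (Euc n))))
      (inner ℂ ((coherentS z).toLp 2 (volume : Measure (Euc n)))
        (weylExp h s ((weylS M φ).toLp 2))) (Set.Ici 0) s := by
    intro s hs
    have h2 := HasDerivWithinAt.inner ℂ (hasDerivWithinAt_gpath h.conj z hs)
      (hasDerivWithinAt_const s (Set.Ici 0) (φ.toLp 2 (volume : Measure (Euc n))))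
    refine h2.congr_deriv ?_
    rw [inner_zero_right, zero_add, inner_weylS h.conj.symm, map_star_map_star, inner_weylExp h z _
      hs]
  have h3 := intervalIntegral.integral_eq_sub_of_hasDeriv_right_of_le ht
    (f := fun s => inner ℂ
      ((gpath h.conj z s).toLp 2 (volume : Measure (Euc n))) (φ.toLp 2 (volume : Measure (Euc n))))
    (fun s hs => (hd s hs.1).continuousWithinAt.mono Set.Icc_subset_Ici_self)
    (fun s hs => (hd s hs.1.le).mono (Set.Ioi_subset_Ici hs.1.le))
    ((continuous_const.inner hc).intervalIntegrable 0 t)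
  rw [h3, gpath_zero_eq, inner_sub_right, inner_weylExp h z _ ht]

lemma isExpWeyl_weylExp (h : Dissipative M) : IsExpWeyl M (weylExp h) where
  map_zero := weylExp_zero h
  map_add s t hs ht := weylExp_add h hs ht
  cont f := (continuous_weylExp h f).continuousOn
  deriv_zero φ := by
    refine ⟨(weylS M φ).toLp 2, ?_, ?_⟩
    · filter_upwards [(weylS M φ).coeFn_toLp 2 (volume : Measure (Euc n))] with p hp
      rw [hp, weylQuad_eq_weylS h.symm]
    · have hc := continuous_weylExp h ((weylS M φ).toLp 2 (volume : Measure (Euc n)))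
      have h1 := (intervalIntegral.integral_hasDerivAt_right (hc.intervalIntegrable 0 0)
        (hc.stronglyMeasurableAtFilter volume _) hc.continuousAt).hasDerivWithinAt (s := Set.Ici 0)
      rw [weylExp_zero, ContinuousLinearMap.id_apply] at h1
      refine (h1.add_const (φ.toLp 2 (volume : Measure (Euc n)))).congr (fun s hs => ?_) ?_
      · rw [← weylExp_sub_eq_integral h φ hs, sub_add_cancel]
      · rw [intervalIntegral.integral_same, zero_add, weylExp_zero, ContinuousLinearMap.id_apply]

end Existence

/-! ### Weyl symbols of Weyl semigroups -/

section WeylSymbol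

variable {n : ℕ}

lemma bargmannInv_coherent (w : Fin n → ℂ) :
    bargmannInv (coherent w) = (coherentS w).toLp 2 (volume : Measure (Euc n)) := by
  rw [← bargmann_coherentS, bargmannInv_bargmann]

lemma W1_gaussian {A : L2 n → L2 n} {c : ℂ} {k : Matrix (Idx n) (Idx n) ℂ} (h : IsExpSp k)
    (hd : (k + 1).det ≠ 0) (hA : ∀ w, bargmann (A ((coherentS w).toLp 2)) =
      fun z => c * Complex.exp (expK k.toBlocks₁₁ k.toBlocks₁₂ k.toBlocks₂₁ z w)) (x y : Fin n → ℝ)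
      :
    W1 A x y = weylCoef c k * Complex.exp (hat (fun i => (x i : ℂ) + I * (y i : ℂ)) ⬝ᵥ
      (stdJ n *ᵥ ((k - 1) *ᵥ ((k + 1)⁻¹ *ᵥ hat (fun i => (x i : ℂ) + I * (y i : ℂ))))) / 2) :=
  W0_gaussian h hd (fun w => by rw [bargmannInv_coherent, hA]) _

lemma exists_isDetRoot_matCos {M : Matrix (Idx n) (Idx n) ℂ} (hM : M.IsSymm) :
    ∃ D : ℂ → ℂ, IsDetRoot (fun s => matCos (s • (stdJ n * M))) D := by
  simp only [matCos_smul_eq]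
  exact exists_isDetRoot (isSymm_stdJ_I hM)

lemma det_kflow_add_one_ne_zero {M : Matrix (Idx n) (Idx n) ℂ} (hM : M.IsSymm) {t : ℝ}
    (hd : (matCos ((t : ℂ) • (stdJ n * M))).det ≠ 0) : (kflow M t + 1).det ≠ 0 := by
  rw [det_kflow_add_one hM]
  exact mul_ne_zero (pow_ne_zero _ (by norm_num)) hd

lemma IsExpWeyl.W1_eq {M : Matrix (Idx n) (Idx n) ℂ} (h : Dissipative M) {D : ℂ → ℂ}
    (hD : IsDetRoot (fun s => matCos (s • (stdJ n * M))) D) {T : ℝ → (L2 n →L[ℂ] L2 n)}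
    (hT : IsExpWeyl M T) {t : ℝ} (ht : 0 ≤ t)
    (hd : (matCos ((t : ℂ) • (stdJ n * M))).det ≠ 0) (x y : Fin n → ℝ) :
    W1 (T t) x y = (D t)⁻¹ *
      Complex.exp (-qform (stdJ n * matTan ((t : ℂ) • (stdJ n * M))) x y) := by
  rw [W1_gaussian (isExpSp_kflow h.symm h.re_nonpos ht) (det_kflow_add_one_ne_zero h.symm hd)
    (c := pathC M t) (fun w => funext fun z => by
      rw [hT.apply_coherentS h w ht, bargmann_gpath h w z ht]),
    weylCoef_flow h.symm h.re_nonpos hD (continuous_pathC h).continuousOn pathC_zero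
      (fun t ht => pathC_sq h ht) ht hd, weyl_phase h.symm hd]

lemma powNegHalf_sq (z : ℂ) : powNegHalf z ^ 2 = z⁻¹ := by
  rw [powNegHalf, ← cpow_nat_mul]
  norm_num [cpow_neg_one]

lemma powNegHalf_ne_zero {z : ℂ} (hz : z ≠ 0) : powNegHalf z ≠ 0 := by
  intro h
  have h1 := powNegHalf_sq z
  rw [h, zero_pow two_ne_zero] at h1
  exact inv_ne_zero hz h1.symm

lemma powNegHalf_one : powNegHalf 1 = 1 := one_cpow _

lemma continuousAt_powNegHalf {z : ℂ} (hz : z ∈ slitPlane) : ContinuousAt powNegHalf z :=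
  continuousAt_cpow_const hz

/-- Inverse square roots along a path avoiding the negative half-line are principal. -/
lemma eq_powNegHalf_of_sq {d f : ℝ → ℂ} {a : ℝ} (ha : 0 ≤ a) (hd : ContinuousOn d (Set.Icc 0 a))
    (hf : ContinuousOn f (Set.Icc 0 a)) (hs : ∀ t ∈ Set.Icc 0 a, d t ^ 2 * f t = 1)
    (h0 : d 0 = 1) (hslit : ∀ t ∈ Set.Icc 0 a, f t ∈ slitPlane) : d a = powNegHalf (f a) := by
  have h00 : (0 : ℝ) ∈ Set.Icc 0 a := Set.left_mem_Icc.2 ha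
  have hne : ∀ t ∈ Set.Icc 0 a, f t ≠ 0 := fun t ht => slitPlane_ne_zero (hslit t ht)
  refine isPreconnected_Icc.eq_of_sq_eq hd (g := fun t => powNegHalf (f t)) (fun t ht =>
    (continuousAt_powNegHalf (hslit t ht)).comp_continuousWithinAt (hf t ht)) (fun t ht => ?_)
    (fun {t} ht => powNegHalf_ne_zero (hne t ht)) h00 ?_ (Set.right_mem_Icc.2 ha)
  · simp only [Pi.pow_apply]
    rw [powNegHalf_sq, eq_inv_of_mul_eq_one_left (hs t ht)]
  · have := hs 0 h00
    rw [h0, one_pow, one_mul] at this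
    rw [h0, this, powNegHalf_one]

lemma powNegHalf_eq_inv_detRoot {F : ℂ → Matrix (Idx n) (Idx n) ℂ} {D : ℂ → ℂ} (hD : IsDetRoot F D)
    (hslit : ∀ t : ℝ, t ∈ Set.Icc 0 1 → (F t).det ∈ slitPlane) :
    powNegHalf (F 1).det = (D 1)⁻¹ := by
  have hc : ContinuousOn (fun t : ℝ => D t) (Set.Icc 0 1) :=
    (hD.1.continuous.comp continuous_ofReal).continuousOn
  have hne : ∀ t : ℝ, t ∈ Set.Icc 0 1 → D t ≠ 0 := by
    intro t ht h0
    have := slitPlane_ne_zero (hslit t ht)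
    rw [← hD.2.2, h0] at this
    simp at this
  have h1 := eq_powNegHalf_of_sq (d := fun t : ℝ => (D t)⁻¹) (f := fun t : ℝ => (F t).det)
    zero_le_one (hc.inv₀ hne) (by simp only [← hD.2.2]; exact hc.pow 2) (fun t ht => by
      rw [← hD.2.2, inv_pow, inv_mul_cancel₀ (pow_ne_zero _ (hne t ht))])
    (by simp [hD.2.1]) hslit
  simpa using h1.symm

lemma cplx_isSymm {M : Matrix (Idx n) (Idx n) ℝ} (hM : M.IsSymm) : (cplx M).IsSymm := by
  rw [Matrix.IsSymm, cplx, ← transpose_map, hM.eq]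

lemma cplx_map_star (M : Matrix (Idx n) (Idx n) ℝ) : (cplx M).map star = cplx M := by
  ext; simp [cplx]

lemma star_quad {m : Type*} [Fintype m] (A : Matrix m m ℂ) (u : m → ℂ) :
    star (star u ⬝ᵥ (A *ᵥ u)) = star u ⬝ᵥ (Aᴴ *ᵥ u) := by
  rw [← star_dotProduct, star_mulVec, ← dotProduct_mulVec]

open scoped ComplexOrder in
/-- The eigenvalues of `J M` are imaginary for semidefinite real `M`. -/
lemma re_eq_zero_of_mem_roots {M : Matrix (Idx n) (Idx n) ℝ} (hM : M.IsSymm)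
    (hq : ∀ x y : Fin n → ℝ, (qform (cplx M) x y).re ≤ 0) {z : ℂ}
    (hz : z ∈ (stdJ n * cplx M).charpoly.roots) : z.re = 0 := by
  have hMs := cplx_isSymm hM
  have hherm : (cplx M)ᴴ = cplx M := by
    rw [conjTranspose, hMs.eq, cplx_map_star]
  have hev : (z • (1 : Matrix (Idx n) (Idx n) ℂ) - stdJ n * cplx M).det = 0 := by
    have h1 := (Polynomial.mem_roots'.1 hz).2
    rw [Polynomial.IsRoot.def, eval_charpoly] at h1
    rwa [smul_one_eq_diagonal]
  obtain ⟨v, hv, hv0⟩ := Matrix.exists_mulVec_eq_zero_iff.2 hev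
  rw [sub_mulVec, smul_mulVec, one_mulVec, sub_eq_zero] at hv0
  have h1 : cplx M *ᵥ v = -(z • (stdJ n *ᵥ v)) := by
    have h2 := congrArg (fun u => stdJ n *ᵥ u) hv0
    rw [mulVec_smul, mulVec_mulVec, ← Matrix.mul_assoc, stdJ_mul_self, neg_one_mul,
      neg_mulVec] at h2
    rw [h2, neg_neg]
  have hpsd : (-cplx M).PosSemidef := by
    refine PosSemidef.of_dotProduct_mulVec_nonneg (by rw [IsHermitian, conjTranspose_neg, hherm])
      fun u => ?_
    rw [neg_mulVec, dotProduct_neg, Complex.le_def]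
    constructor
    · rw [Complex.neg_re, re_hermitian_quad hMs, Complex.zero_re]
      have := hq (fun j => (u (Sum.inl j)).re) (fun j => (u (Sum.inr j)).re)
      have := hq (fun j => (u (Sum.inl j)).im) (fun j => (u (Sum.inr j)).im)
      linarith
    · have h3 := congrArg Complex.im (star_quad (cplx M) u)
      rw [hherm, RCLike.star_def, conj_im] at h3
      rw [Complex.zero_im, Complex.neg_im]
      linarith
  have hm : (starRingEnd ℂ) (star v ⬝ᵥ (cplx M *ᵥ v)) = star v ⬝ᵥ (cplx M *ᵥ v) := by
    have := star_quad (cplx M) v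
    rwa [hherm] at this
  have hc : (starRingEnd ℂ) (star v ⬝ᵥ (stdJ n *ᵥ v)) = -(star v ⬝ᵥ (stdJ n *ᵥ v)) := by
    have hJ : (stdJ n)ᴴ = -stdJ n := by
      have : (stdJ n).map star = stdJ n := by
        ext (i | i) (j | j) <;> simp [stdJ, one_apply, apply_ite]
      rw [conjTranspose, stdJ_transpose]
      ext i j
      have h := congrFun (congrFun this i) j
      rw [map_apply] at h
      rw [map_apply, neg_apply, star_neg, h]
    have := star_quad (stdJ n) v
    rwa [hJ, neg_mulVec, dotProduct_neg] at this
  have hmc : star v ⬝ᵥ (cplx M *ᵥ v) = -(z * (star v ⬝ᵥ (stdJ n *ᵥ v))) := by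
    rw [h1, dotProduct_neg, dotProduct_smul, smul_eq_mul]
  -- If v*Mv = 0, semidefiniteness forces Mv = 0 and z = 0. Otherwise v*Mv is real and v*Jv is
  -- imaginary, both nonzero, which forces z̄ = -z.
  by_cases h0 : star v ⬝ᵥ (cplx M *ᵥ v) = 0
  · have h3 : cplx M *ᵥ v = 0 := by
      have := (hpsd.dotProduct_mulVec_zero_iff v).1 (by rw [neg_mulVec, dotProduct_neg, h0,
        neg_zero])
      rwa [neg_mulVec, neg_eq_zero] at this
    rw [← mulVec_mulVec, h3, mulVec_zero] at hv0
    rw [(smul_eq_zero.1 hv0).resolve_right hv, Complex.zero_re]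
  · have hc0 : star v ⬝ᵥ (stdJ n *ᵥ v) ≠ 0 := fun h => h0 (by rw [hmc, h, mul_zero, neg_zero])
    have h3 := congrArg (starRingEnd ℂ) hmc
    rw [hm, hmc, map_neg, map_mul, hc] at h3
    have h4 : (starRingEnd ℂ) z = -z := by
      refine mul_right_cancel₀ hc0 ?_
      linear_combination -h3
    have h5 := congrArg Complex.re h4
    rw [conj_re, Complex.neg_re] at h5
    linarith

lemma prod_mem_slitPlane {s : Multiset ℂ} (h : ∀ a ∈ s, ∃ r : ℝ, 0 < r ∧ a = r) :
    s.prod ∈ slitPlane := by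
  obtain ⟨r, hr, hs⟩ := Multiset.prod_induction (fun a : ℂ => ∃ r : ℝ, 0 < r ∧ a = r) s
    (by rintro _ _ ⟨a, ha, rfl⟩ ⟨b, hb, rfl⟩; exact ⟨a * b, mul_pos ha hb, by push_cast; rfl⟩)
    ⟨1, one_pos, by simp⟩ h
  rw [hs]
  exact Complex.ofReal_mem_slitPlane.2 hr

/-- The eigenvalues of JM are imaginary, so each factor is the cosine of an imaginary number, a
positive real. Hence the principal branch is the right one at all real times. -/
lemma det_matCos_mem_slitPlane {M : Matrix (Idx n) (Idx n) ℝ} (hM : M.IsSymm)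
    (hq : ∀ x y : Fin n → ℝ, (qform (cplx M) x y).re ≤ 0) (t : ℝ) :
    (matCos ((t : ℂ) • (stdJ n * cplx M))).det ∈ slitPlane := by
  rw [matCos_eq_matCosh, smul_smul, det_matCosh_smul]
  refine prod_mem_slitPlane fun a ha => ?_
  obtain ⟨z, hz, rfl⟩ := Multiset.mem_map.1 ha
  have h1 := re_eq_zero_of_mem_roots hM hq hz
  refine ⟨Real.cosh (-(t * z.im)), Real.cosh_pos _, ?_⟩
  rw [ofReal_cosh]
  congr 1
  apply Complex.ext <;> simp [h1]

end WeylSymbol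

/-! ### The Moyal product by a quadratic polynomial -/

section MoyalPolynomial

variable {n : ℕ}

open MvPolynomial in
/-- The derivative of a polynomial in the direction `v`. -/
def dirD (v : Idx n → ℂ) (p : MvPolynomial (Idx n) ℂ) : MvPolynomial (Idx n) ℂ :=
  ∑ b, C (v b) * pderiv b p

lemma hasDerivAt_eval_line (p : MvPolynomial (Idx n) ℂ) (ζ v : Idx n → ℂ) (t : ℂ) :
    HasDerivAt (fun t : ℂ => MvPolynomial.eval (ζ + t • v) p)
      (MvPolynomial.eval (ζ + t • v) (dirD v p)) t := by
  induction p using MvPolynomial.induction_on with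
  | C a =>
    simp only [dirD, MvPolynomial.pderiv_C, mul_zero, Finset.sum_const_zero, map_zero,
      MvPolynomial.eval_C]
    exact hasDerivAt_const _ _
  | add p q hp hq =>
    simp only [dirD, map_add, mul_add, Finset.sum_add_distrib] at hp hq ⊢
    exact hp.add hq
  | mul_X p i hp =>
    have h1 : HasDerivAt (fun t : ℂ => (ζ + t • v) i) (v i) t := by
      simpa using ((hasDerivAt_id t).mul_const (v i)).const_add (ζ i)
    have h2 := hp.fun_mul h1
    simp only [map_mul, MvPolynomial.eval_X]
    refine h2.congr_deriv ?_
    simp only [dirD, Derivation.leibniz, MvPolynomial.pderiv_X, smul_eq_mul, mul_add,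
      Finset.sum_add_distrib, map_add, map_sum, map_mul, MvPolynomial.eval_C, MvPolynomial.eval_X,
      Pi.single_apply, mul_ite, mul_one, mul_zero, Finset.sum_ite_eq, Finset.mem_univ, if_true]
    rw [add_comm, mul_comm (v i), Finset.sum_mul]
    congr 1
    exact Finset.sum_congr rfl fun b _ => by ring

lemma isHomogeneous_quadPoly (M : Matrix (Idx n) (Idx n) ℂ) : (quadPoly M).IsHomogeneous 2 := by
  refine MvPolynomial.IsHomogeneous.sum _ _ _ fun i _ => MvPolynomial.IsHomogeneous.sum _ _ _
    fun j _ => ?_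
  have h := (MvPolynomial.isHomogeneous_C (Idx n) (M i j)).mul
    ((MvPolynomial.isHomogeneous_X ℂ i).mul (MvPolynomial.isHomogeneous_X ℂ j))
  rwa [zero_add] at h

lemma moyalP_zero (u v : MvPolynomial (Idx n) ℂ) : moyalP 0 u v = u * v := by
  simp [moyalP, iterPartial]

lemma moyalP_one (u v : MvPolynomial (Idx n) ℂ) :
    moyalP 1 u v = ∑ a, MvPolynomial.pderiv a u * dirD (stdJ n a) v := by
  rw [moyalP, ← (Equiv.funUnique (Fin 1) (Idx n)).symm.sum_comp]
  refine Finset.sum_congr rfl fun a _ => ?_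
  rw [← (Equiv.funUnique (Fin 1) (Idx n)).symm.sum_comp, dirD, Finset.mul_sum]
  refine Finset.sum_congr rfl fun b _ => ?_
  simp only [iterPartial, Equiv.funUnique_symm_apply, uniqueElim_const, Finset.univ_unique,
    Finset.prod_singleton, List.ofFn_succ, List.ofFn_zero, List.foldr_cons, List.foldr_nil]
  ring

lemma moyalP_two (u v : MvPolynomial (Idx n) ℂ) :
    moyalP 2 u v = ∑ a, ∑ b, MvPolynomial.pderiv a (MvPolynomial.pderiv b u) *
      dirD (stdJ n a) (dirD (stdJ n b) v) := by
  rw [moyalP, ← (finTwoArrowEquiv (Idx n)).symm.sum_comp, Fintype.sum_prod_type]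
  refine Finset.sum_congr rfl fun a _ => Finset.sum_congr rfl fun b _ => ?_
  rw [← (finTwoArrowEquiv (Idx n)).symm.sum_comp, Fintype.sum_prod_type, dirD, Finset.mul_sum]
  refine Finset.sum_congr rfl fun c _ => ?_
  rw [dirD, map_sum, Finset.mul_sum, Finset.mul_sum]
  refine Finset.sum_congr rfl fun d _ => ?_
  simp only [iterPartial, finTwoArrowEquiv_symm_apply, Fin.prod_univ_two, List.ofFn_succ,
    List.ofFn_zero, List.foldr_cons, List.foldr_nil, Derivation.leibniz, MvPolynomial.pderiv_C,
    smul_eq_mul, mul_zero, add_zero, map_mul, Matrix.cons_val_zero, Fin.succ_zero_eq_one,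
    Matrix.cons_val_one]
  ring

/-- The defining sum runs to the total degree, which is 2 unless f = 0. For f = 0 it stops at l = 0,
and the extra terms vanish. -/
lemma moyal_quad {f : MvPolynomial (Idx n) ℂ} (hf : f.IsHomogeneous 2) (v : MvPolynomial (Idx n) ℂ)
    :
    moyal f v = f * v + MvPolynomial.C (-I / 2) * moyalP 1 f v +
      MvPolynomial.C (-1 / 8) * moyalP 2 f v := by
  by_cases h0 : f = 0
  · have h1 : moyalP 1 f v = 0 := by rw [moyalP_one, h0]; simp
    have h2 : moyalP 2 f v = 0 := by rw [moyalP_two, h0]; simp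
    rw [h1, h2, moyal, h0, MvPolynomial.totalDegree_zero, zero_add, Finset.sum_range_one,
      moyalP_zero]
    simp
  · rw [moyal, hf.totalDegree h0, Finset.sum_range_succ, Finset.sum_range_succ,
      Finset.sum_range_one,
      moyalP_zero]
    congr 2
    · simp
    · simp
    · congr 1
      simp only [Nat.factorial, div_pow, neg_sq, I_sq]
      norm_num

lemma pderiv_quadPoly {M : Matrix (Idx n) (Idx n) ℂ} (hM : M.IsSymm) (a : Idx n) :
    MvPolynomial.pderiv a (quadPoly M) = MvPolynomial.C 2 * ∑ j, MvPolynomial.C (M a j) *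
    MvPolynomial.X j := by
  simp only [quadPoly, map_sum, Derivation.leibniz, MvPolynomial.pderiv_C, MvPolynomial.pderiv_X,
    smul_eq_mul, mul_zero, add_zero, Pi.single_apply, mul_ite, mul_one, mul_add,
    Finset.sum_add_distrib, Finset.sum_ite_eq', Finset.mem_univ, if_true]
  rw [Finset.sum_comm]
  simp only [Finset.sum_ite_eq', Finset.mem_univ, if_true]
  rw [show (MvPolynomial.C 2 : MvPolynomial (Idx n) ℂ) = 2 from map_ofNat _ 2, two_mul]
  congr 1
  exact Finset.sum_congr rfl fun i _ => by rw [hM.apply]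

lemma pderiv_pderiv_quadPoly {M : Matrix (Idx n) (Idx n) ℂ} (hM : M.IsSymm) (a b : Idx n) :
    MvPolynomial.pderiv a (MvPolynomial.pderiv b (quadPoly M)) = MvPolynomial.C (2 * M a b) := by
  rw [pderiv_quadPoly hM]
  simp only [Derivation.leibniz, map_sum, MvPolynomial.pderiv_C, MvPolynomial.pderiv_X, smul_eq_mul,
    mul_zero, add_zero, Pi.single_apply, mul_ite, mul_one, Finset.sum_ite_eq',
    Finset.mem_univ, if_true]
  rw [map_mul, hM.apply]

lemma eval_quadPoly (M : Matrix (Idx n) (Idx n) ℂ) (ζ : Idx n → ℂ) :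
    MvPolynomial.eval ζ (quadPoly M) = ζ ⬝ᵥ (M *ᵥ ζ) := by
  simp only [quadPoly, map_sum, map_mul, MvPolynomial.eval_C, MvPolynomial.eval_X, dotProduct,
    mulVec,
    Finset.mul_sum]
  exact Finset.sum_congr rfl fun i _ => Finset.sum_congr rfl fun j _ => by ring

/-- Left Moyal multiplication by `-i q_M` as a differential operator. -/
lemma eval_moyal_quadPoly {M : Matrix (Idx n) (Idx n) ℂ} (hM : M.IsSymm) (ζ : Idx n → ℂ)
    (p : MvPolynomial (Idx n) ℂ) :
    MvPolynomial.eval ζ (moyal (MvPolynomial.C (-I) * quadPoly M) p) =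
      -I * (ζ ⬝ᵥ (M *ᵥ ζ)) * MvPolynomial.eval ζ p -
      ∑ a, (M *ᵥ ζ) a * MvPolynomial.eval ζ (dirD (stdJ n a) p) +
      I / 4 * ∑ a, ∑ b, M a b * MvPolynomial.eval ζ (dirD (stdJ n a) (dirD (stdJ n b) p)) := by
  have hf : (MvPolynomial.C (-I) * quadPoly M).IsHomogeneous 2 := by
    have h := (MvPolynomial.isHomogeneous_C (Idx n) (-I)).mul (isHomogeneous_quadPoly M)
    rwa [zero_add] at h
  rw [moyal_quad hf, moyalP_one, moyalP_two]
  simp only [MvPolynomial.pderiv_C_mul, pderiv_pderiv_quadPoly hM]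
  simp only [pderiv_quadPoly hM, map_add, map_mul, MvPolynomial.eval_C,
    map_sum, MvPolynomial.eval_X, eval_quadPoly]
  rw [sub_eq_add_neg, Finset.mul_sum, Finset.mul_sum, Finset.mul_sum, ← Finset.sum_neg_distrib]
  congr 1
  · congr 1
    refine Finset.sum_congr rfl fun a _ => ?_
    rw [mulVec, dotProduct]
    linear_combination ((∑ j, M a j * ζ j) * MvPolynomial.eval ζ (dirD (stdJ n a) p)) * I_mul_I
  · refine Finset.sum_congr rfl fun a _ => ?_
    rw [Finset.mul_sum, Finset.mul_sum]
    exact Finset.sum_congr rfl fun b _ => by ring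

end MoyalPolynomial

/-! ### Evolution equations with time-independent coefficients -/

section Evolution

variable {n : ℕ} {H : ℂ × (Idx n → ℂ) → ℂ} {U : Set (ℂ × (Idx n → ℂ))}

lemma analyticOnNhd_fderiv_apply (hH : AnalyticOnNhd ℂ H U) (u : ℂ × (Idx n → ℂ)) :
    AnalyticOnNhd ℂ (fun p => fderiv ℂ H p u) U :=
  (ContinuousLinearMap.apply ℂ ℂ u).comp_analyticOnNhd hH.fderiv

lemma fderiv_fderiv_apply_comm (hH : AnalyticOnNhd ℂ H U) {p : ℂ × (Idx n → ℂ)} (hp : p ∈ U)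
    (u v : ℂ × (Idx n → ℂ)) :
    fderiv ℂ (fun q => fderiv ℂ H q u) p v = fderiv ℂ (fun q => fderiv ℂ H q v) p u := by
  have h1 : ∀ u v, fderiv ℂ (fun q => fderiv ℂ H q u) p v = fderiv ℂ (fderiv ℂ H) p v u := by
    intro u v
    have h2 := (ContinuousLinearMap.apply ℂ ℂ u).hasFDerivAt.comp p
      (hH.fderiv p hp).differentiableAt.hasFDerivAt
    exact congrArg (fun A => A v) h2.fderiv
  rw [h1, h1]
  exact ((hH p hp).contDiffAt (n := 2)).isSymmSndFDerivAt
    minSmoothness_of_isRCLikeNormedField.le v u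

/-- The direction of the Hamiltonian vector field of a coordinate. -/
def symDir (a : Idx n) : ℂ × (Idx n → ℂ) := (0, stdJ n a)

/-- Left Moyal multiplication by `-i q_M`, on functions of time and phase space. -/
def moyalOp (M : Matrix (Idx n) (Idx n) ℂ) (H : ℂ × (Idx n → ℂ) → ℂ) (p : ℂ × (Idx n → ℂ)) : ℂ :=
  -I * (p.2 ⬝ᵥ (M *ᵥ p.2)) * H p - ∑ a, (M *ᵥ p.2) a * fderiv ℂ H p (symDir a) +
    I / 4 * ∑ a, ∑ b, M a b * fderiv ℂ (fun q => fderiv ℂ H q (symDir b)) p (symDir a)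

lemma hasDerivAt_time {G : ℂ × (Idx n → ℂ) → ℂ} {p : ℂ × (Idx n → ℂ)}
    (hG : DifferentiableAt ℂ G p) :
    HasDerivAt (fun s => G (s, p.2)) (fderiv ℂ G p (1, 0)) p.1 :=
  HasFDerivAt.comp_hasDerivAt (f := fun s => (s, p.2)) p.1 hG.hasFDerivAt
    ((hasDerivAt_id p.1).prodMk (hasDerivAt_const p.1 p.2))

/-- The coefficients of the operator do not involve time and mixed derivatives commute, so the
operator commutes with the time derivative. All time derivatives of a solution thus solve the same
equation. -/
lemma hasDerivAt_moyalOp_time (M : Matrix (Idx n) (Idx n) ℂ) (hU : IsOpen U)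
    (hH : AnalyticOnNhd ℂ H U) {p : ℂ × (Idx n → ℂ)} (hp : p ∈ U) :
    HasDerivAt (fun s => moyalOp M H (s, p.2)) (moyalOp M (fun q => fderiv ℂ H q (1, 0)) p) p.1 :=
    by
  have h1 := hasDerivAt_time (hH p hp).differentiableAt
  have h2 : ∀ a, HasDerivAt (fun s => fderiv ℂ H (s, p.2) (symDir a))
      (fderiv ℂ (fun q => fderiv ℂ H q (1, 0)) p (symDir a)) p.1 := fun a => by
    have := hasDerivAt_time (analyticOnNhd_fderiv_apply hH (symDir a) p hp).differentiableAt
    rwa [fderiv_fderiv_apply_comm hH hp] at this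
  have h3 : ∀ a b, HasDerivAt
      (fun s => fderiv ℂ (fun q => fderiv ℂ H q (symDir b)) (s, p.2) (symDir a))
      (fderiv ℂ (fun q => fderiv ℂ (fun q => fderiv ℂ H q (1, 0)) q (symDir b)) p (symDir a)) p.1
      := by
    intro a b
    have hb := analyticOnNhd_fderiv_apply hH (symDir b)
    have := hasDerivAt_time (analyticOnNhd_fderiv_apply hb (symDir a) p hp).differentiableAt
    rw [fderiv_fderiv_apply_comm hb hp] at this
    have h4 : (fun q => fderiv ℂ (fun q => fderiv ℂ H q (symDir b)) q (1, 0)) =ᶠ[nhds p]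
        fun q => fderiv ℂ (fun q => fderiv ℂ H q (1, 0)) q (symDir b) := by
      filter_upwards [hU.mem_nhds hp] with q hq using fderiv_fderiv_apply_comm hH hq _ _
    rwa [h4.fderiv_eq] at this
  unfold moyalOp
  refine ((h1.const_mul (-I * (p.2 ⬝ᵥ (M *ᵥ p.2)))).fun_sub (HasDerivAt.fun_sum fun a _ =>
    (h2 a).const_mul ((M *ᵥ p.2) a))).fun_add (HasDerivAt.const_mul (I / 4)
      (HasDerivAt.fun_sum fun a _ => HasDerivAt.fun_sum fun b _ => (h3 a b).const_mul (M a b)))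

/-- Iterated time derivatives. -/
def timeIter (H : ℂ × (Idx n → ℂ) → ℂ) : ℕ → ℂ × (Idx n → ℂ) → ℂ
  | 0 => H
  | l + 1 => fun p => fderiv ℂ (timeIter H l) p (1, 0)

lemma analyticOnNhd_timeIter (hH : AnalyticOnNhd ℂ H U) (l : ℕ) :
    AnalyticOnNhd ℂ (timeIter H l) U := by
  induction l with
  | zero => exact hH
  | succ l ih => exact analyticOnNhd_fderiv_apply ih (1, 0)

lemma eventually_time_mem (hU : IsOpen U) {p : ℂ × (Idx n → ℂ)} (hp : p ∈ U) :
    ∀ᶠ s in nhds p.1, (s, p.2) ∈ U := by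
  have hc : Continuous fun s : ℂ => (s, p.2) := by fun_prop
  exact (hU.preimage hc).mem_nhds hp

lemma fderiv_timeIter {M : Matrix (Idx n) (Idx n) ℂ} (hU : IsOpen U) (hH : AnalyticOnNhd ℂ H U)
    (hL : ∀ p ∈ U, fderiv ℂ H p (1, 0) = moyalOp M H p) (l : ℕ) :
    ∀ p ∈ U, fderiv ℂ (timeIter H l) p (1, 0) = moyalOp M (timeIter H l) p := by
  induction l with
  | zero => exact hL
  | succ l ih =>
    intro p hp
    have h1 := hasDerivAt_time (analyticOnNhd_timeIter hH (l + 1) p hp).differentiableAt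
    have h2 := hasDerivAt_moyalOp_time M hU (analyticOnNhd_timeIter hH l) hp
    refine h1.unique (h2.congr_of_eventuallyEq ?_)
    filter_upwards [eventually_time_mem hU hp] with s hs using ih _ hs

lemma iteratedDeriv_eq_timeIter (hU : IsOpen U) (hH : AnalyticOnNhd ℂ H U) (l : ℕ) :
    ∀ p ∈ U, iteratedDeriv l (fun s => H (s, p.2)) p.1 = timeIter H l p := by
  induction l with
  | zero => intro p _; rw [iteratedDeriv_zero]; rfl
  | succ l ih =>
    intro p hp
    have h1 := hasDerivAt_time (analyticOnNhd_timeIter hH l p hp).differentiableAt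
    rw [iteratedDeriv_succ]
    refine (h1.congr_of_eventuallyEq ?_).deriv
    filter_upwards [eventually_time_mem hU hp] with s hs using ih (s, p.2) hs

lemma fderiv_symDir_eq_eval {G : ℂ × (Idx n → ℂ) → ℂ} {s : ℂ} {p : MvPolynomial (Idx n) ℂ}
    (hG : ∀ ζ, G (s, ζ) = MvPolynomial.eval ζ p) {ζ : Idx n → ℂ} (hd : DifferentiableAt ℂ G (s, ζ))
    (a : Idx n) : fderiv ℂ G (s, ζ) (symDir a) = MvPolynomial.eval ζ (dirD (stdJ n a) p) := by
  have h1 : HasDerivAt (fun t : ℂ => G ((s, ζ) + t • symDir a)) (fderiv ℂ G (s, ζ) (symDir a)) 0 :=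
    hd.hasFDerivAt.hasLineDerivAt (symDir a)
  have h2 := hasDerivAt_eval_line p ζ (stdJ n a) 0
  rw [zero_smul, add_zero] at h2
  refine h1.unique (h2.congr_of_eventuallyEq (Filter.Eventually.of_forall fun t => ?_))
  simp only
  rw [← hG, symDir, Prod.smul_mk, Prod.mk_add_mk, smul_zero, add_zero]

/-- Star powers as iterated derivatives of a solution of the evolution equation. -/
lemma timeIter_eq_eval_starPow {M : Matrix (Idx n) (Idx n) ℂ} (hM : M.IsSymm) (hU : IsOpen U)
    (hH : AnalyticOnNhd ℂ H U) (hL : ∀ p ∈ U, fderiv ℂ H p (1, 0) = moyalOp M H p)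
    (h0 : ∀ ζ, (0, ζ) ∈ U) (h1 : ∀ ζ, H (0, ζ) = 1) (l : ℕ) :
    ∀ ζ, timeIter H l (0, ζ) =
      MvPolynomial.eval ζ (starPow (MvPolynomial.C (-I) * quadPoly M) l) := by
  induction l with
  | zero => intro ζ; rw [starPow, map_one]; exact h1 ζ
  | succ l ih =>
    intro ζ
    have hA := analyticOnNhd_timeIter hH l
    have hd : ∀ b ζ, fderiv ℂ (timeIter H l) (0, ζ) (symDir b) = MvPolynomial.eval ζ
      (dirD (stdJ n b)
        (starPow (MvPolynomial.C (-I) * quadPoly M) l)) := fun b ζ =>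
      fderiv_symDir_eq_eval ih (hA _ (h0 ζ)).differentiableAt b
    have hd2 : ∀ a b, fderiv ℂ (fun q => fderiv ℂ (timeIter H l) q (symDir b)) (0, ζ) (symDir a) =
        MvPolynomial.eval ζ (dirD (stdJ n a) (dirD (stdJ n b)
          (starPow (MvPolynomial.C (-I) * quadPoly M) l))) := fun a b =>
      fderiv_symDir_eq_eval (hd b)
        (analyticOnNhd_fderiv_apply hA (symDir b) _ (h0 ζ)).differentiableAt a
    refine (fderiv_timeIter hU hH hL l _ (h0 ζ)).trans ?_
    rw [starPow, eval_moyal_quadPoly hM, moyalOp]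
    simp only [hd, hd2, ih]

end Evolution

/-! ### The analytic solution of the star-exponential equation -/

section Tanh

open scoped Matrix.Norms.Operator

variable {n : ℕ} {Y M : Matrix (Idx n) (Idx n) ℂ} {s : ℂ}

lemma commute_exp_smul {m : Type*} [Fintype m] [DecidableEq m] (Y : Matrix m m ℂ) (s : ℂ) :
    Commute Y (NormedSpace.exp (s • Y)) := ((Commute.refl Y).smul_right s).exp_right

lemma commute_matCosh {m : Type*} [Fintype m] [DecidableEq m] (Y : Matrix m m ℂ) (s : ℂ) :
    Commute Y (matCosh (s • Y)) := by
  rw [matCosh, ← neg_smul]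
  exact ((commute_exp_smul Y s).add_right (commute_exp_smul Y (-s))).smul_right _

lemma commute_matSinh {m : Type*} [Fintype m] [DecidableEq m] (Y : Matrix m m ℂ) (s : ℂ) :
    Commute Y (matSinh (s • Y)) := by
  rw [matSinh, ← neg_smul]
  exact ((commute_exp_smul Y s).sub_right (commute_exp_smul Y (-s))).smul_right _

lemma commute_matSinh_matCosh {m : Type*} [Fintype m] [DecidableEq m] (A : Matrix m m ℂ) :
    Commute (matSinh A) (matCosh A) := by
  have h : Commute (NormedSpace.exp A) (NormedSpace.exp (-A)) :=
    ((Commute.refl A).neg_right).exp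
  rw [matSinh, matCosh]
  refine Commute.smul_left (Commute.smul_right ?_ _) _
  exact Commute.sub_left ((Commute.refl _).add_right h) (h.symm.add_right (Commute.refl _))

lemma hasDerivAt_matCosh (Y : Matrix (Idx n) (Idx n) ℂ) (s : ℂ) :
    HasDerivAt (fun s : ℂ => matCosh (s • Y)) (matSinh (s • Y) * Y) s := by
  have h1 := hasDerivAt_exp_smul_const Y s
  have h2 := hasDerivAt_exp_smul_const (-Y) s
  simp only [smul_neg] at h2
  refine ((h1.fun_add h2).const_smul (2⁻¹ : ℂ)).congr_deriv ?_
  rw [matSinh, Matrix.smul_mul, Matrix.sub_mul, Matrix.mul_neg, sub_eq_add_neg]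
  rfl

lemma hasDerivAt_matSinh (Y : Matrix (Idx n) (Idx n) ℂ) (s : ℂ) :
    HasDerivAt (fun s : ℂ => matSinh (s • Y)) (matCosh (s • Y) * Y) s := by
  have h1 := hasDerivAt_exp_smul_const Y s
  have h2 := hasDerivAt_exp_smul_const (-Y) s
  simp only [smul_neg] at h2
  refine ((h1.fun_sub h2).const_smul (2⁻¹ : ℂ)).congr_deriv ?_
  rw [matCosh, Matrix.smul_mul, Matrix.add_mul, Matrix.mul_neg, sub_neg_eq_add]
  rfl

lemma matCosh_mul_inv (hs : (matCosh (s • Y)).det ≠ 0) :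
    matCosh (s • Y) * (matCosh (s • Y))⁻¹ = 1 :=
  Matrix.mul_nonsing_inv _ (isUnit_iff_ne_zero.2 hs)

lemma matCosh_inv_mul (hs : (matCosh (s • Y)).det ≠ 0) :
    (matCosh (s • Y))⁻¹ * matCosh (s • Y) = 1 :=
  Matrix.nonsing_inv_mul _ (isUnit_iff_ne_zero.2 hs)

lemma matTanh_eq_inv_mul (hs : (matCosh (s • Y)).det ≠ 0) :
    matTanh (s • Y) = (matCosh (s • Y))⁻¹ * matSinh (s • Y) := by
  have h := commute_matSinh_matCosh (s • Y)
  calc matTanh (s • Y) = ((matCosh (s • Y))⁻¹ * matCosh (s • Y)) * matSinh (s • Y) *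
        (matCosh (s • Y))⁻¹ := by rw [matCosh_inv_mul hs, Matrix.one_mul, matTanh]
    _ = (matCosh (s • Y))⁻¹ * matSinh (s • Y) * (matCosh (s • Y) * (matCosh (s • Y))⁻¹) := by
        rw [Matrix.mul_assoc (matCosh (s • Y))⁻¹, ← h.eq]; simp only [Matrix.mul_assoc]
    _ = _ := by rw [matCosh_mul_inv hs, Matrix.mul_one]

lemma commute_matTanh (hs : (matCosh (s • Y)).det ≠ 0) : Commute Y (matTanh (s • Y)) := by
  have hC := commute_matCosh Y s
  have hS := commute_matSinh Y s
  have hCi : Y * (matCosh (s • Y))⁻¹ = (matCosh (s • Y))⁻¹ * Y := by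
    calc Y * (matCosh (s • Y))⁻¹ = (matCosh (s • Y))⁻¹ * (matCosh (s • Y) * Y) *
      (matCosh (s • Y))⁻¹ := by
          rw [← Matrix.mul_assoc, matCosh_inv_mul hs, Matrix.one_mul]
      _ = (matCosh (s • Y))⁻¹ * Y * (matCosh (s • Y) * (matCosh (s • Y))⁻¹) := by
          rw [← hC.eq]; simp only [Matrix.mul_assoc]
      _ = _ := by rw [matCosh_mul_inv hs, Matrix.mul_one]
  rw [Commute, SemiconjBy, matTanh, ← Matrix.mul_assoc, hS.eq, Matrix.mul_assoc, hCi,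
    Matrix.mul_assoc]

lemma hasDerivAt_matTanh (hs : (matCosh (s • Y)).det ≠ 0) :
    HasDerivAt (fun s : ℂ => matTanh (s • Y))
      (Y - matTanh (s • Y) * Y * matTanh (s • Y)) s := by
  have h1 := (hasDerivAt_matSinh Y s).fun_mul (hasDerivAt_matrix_inv (hasDerivAt_matCosh Y s) hs)
  refine h1.congr_deriv ?_
  have hC := commute_matCosh Y s
  have hS := commute_matSinh Y s
  rw [← hC.eq, ← hS.eq, Matrix.mul_assoc, matCosh_mul_inv hs, Matrix.mul_one, Matrix.mul_neg,
    ← sub_eq_add_neg]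
  simp only [matTanh, Matrix.mul_assoc]

lemma detRoot_ne_zero {F : ℂ → Matrix (Idx n) (Idx n) ℂ} {D : ℂ → ℂ} (hD : IsDetRoot F D) {s : ℂ}
    (hs : (F s).det ≠ 0) : D s ≠ 0 := fun h0 => hs (by rw [← hD.2.2, h0, zero_pow two_ne_zero])

/-- D² = det cosh(sY) is differentiated in two ways, the second by Jacobi's formula, and 2D is
cancelled. -/
lemma hasDerivAt_detRoot {D : ℂ → ℂ} (hD : IsDetRoot (fun s => matCosh (s • Y)) D)
    (hs : (matCosh (s • Y)).det ≠ 0) :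
    HasDerivAt D (D s * ((matTanh (s • Y) * Y).trace / 2)) s := by
  have hne := detRoot_ne_zero hD hs
  have h1 := (hD.1 s).hasDerivAt
  have h2 := h1.fun_pow 2
  simp only [hD.2.2] at h2
  have h3 := hasDerivAt_det fun i j => hasDerivAt_entry (hasDerivAt_matCosh Y s) i j
  have h4 := h2.unique h3
  have h5 : (matCosh (s • Y)).adjugate = (matCosh (s • Y)).det • (matCosh (s • Y))⁻¹ := by
    rw [Matrix.inv_def, smul_smul, Ring.inverse_eq_inv', mul_inv_cancel₀ hs, one_smul]
  have hD2 : D s ^ 2 = (matCosh (s • Y)).det := hD.2.2 s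
  rw [h5, Matrix.smul_mul, trace_smul, ← Matrix.mul_assoc, ← matTanh_eq_inv_mul hs, smul_eq_mul,
    ← hD2] at h4
  refine h1.congr_deriv ?_
  have h6 : (2 * D s) * deriv D s = (2 * D s) * (D s * ((matTanh (s • Y) * Y).trace / 2)) := by
    norm_num at h4
    linear_combination h4
  exact mul_left_cancel₀ (mul_ne_zero two_ne_zero hne) h6

lemma transpose_exp_mul_stdJ (hY : (stdJ n * Y).IsSymm) :
    (NormedSpace.exp Y)ᵀ * stdJ n = stdJ n * NormedSpace.exp (-Y) := by
  have hJ : (stdJ n) * (-stdJ n) = 1 := by rw [Matrix.mul_neg, stdJ_mul_self, neg_neg]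
  have hJi : (stdJ n)⁻¹ = -stdJ n := Matrix.inv_eq_right_inv hJ
  have hY' : Yᵀ = stdJ n * (-Y) * (stdJ n)⁻¹ := by
    have h1 := hY.eq
    rw [transpose_mul, stdJ_transpose, Matrix.mul_neg] at h1
    rw [hJi, Matrix.mul_neg, Matrix.mul_neg, Matrix.neg_mul, neg_neg, ← h1, Matrix.neg_mul,
      Matrix.mul_assoc, stdJ_mul_self, Matrix.mul_neg, neg_neg, Matrix.mul_one]
  rw [← Matrix.exp_transpose, hY', Matrix.exp_conj _ _
    (IsUnit.of_mul_eq_one _ hJ), Matrix.mul_assoc, hJi, Matrix.neg_mul,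
    stdJ_mul_self, neg_neg, Matrix.mul_one]

lemma isSymm_stdJ_mul_smul (hY : (stdJ n * Y).IsSymm) (s : ℂ) : (stdJ n * (s • Y)).IsSymm := by
  rw [Matrix.mul_smul, IsSymm, transpose_smul, hY.eq]

/-- Transposition across J replaces Y by -Y; cosh is even and sinh odd, so tanh(sY) is again
Hamiltonian. -/
lemma matTanh_transpose_mul_stdJ (hY : (stdJ n * Y).IsSymm) (hs : (matCosh (s • Y)).det ≠ 0) :
    (matTanh (s • Y))ᵀ * stdJ n = -(stdJ n * matTanh (s • Y)) := by
  have h1 := transpose_exp_mul_stdJ (isSymm_stdJ_mul_smul hY s)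
  have h2 := transpose_exp_mul_stdJ (isSymm_stdJ_mul_smul hY (-s))
  rw [neg_smul, neg_neg] at h2
  have hC : (matCosh (s • Y))ᵀ * stdJ n = stdJ n * matCosh (s • Y) := by
    rw [matCosh, transpose_smul, transpose_add, Matrix.smul_mul, Matrix.add_mul, h1, h2,
      Matrix.mul_smul, Matrix.mul_add, add_comm]
  have hS : (matSinh (s • Y))ᵀ * stdJ n = -(stdJ n * matSinh (s • Y)) := by
    rw [matSinh, transpose_smul, transpose_sub, Matrix.smul_mul, Matrix.sub_mul, h1, h2,
      Matrix.mul_smul, Matrix.mul_sub]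
    module
  have hCi : ((matCosh (s • Y))⁻¹)ᵀ * stdJ n = stdJ n * (matCosh (s • Y))⁻¹ := by
    calc ((matCosh (s • Y))⁻¹)ᵀ * stdJ n = ((matCosh (s • Y))⁻¹)ᵀ *
          (stdJ n * matCosh (s • Y)) * (matCosh (s • Y))⁻¹ := by
          rw [Matrix.mul_assoc, Matrix.mul_assoc, matCosh_mul_inv hs, Matrix.mul_one]
      _ = (matCosh (s • Y) * (matCosh (s • Y))⁻¹)ᵀ * stdJ n * (matCosh (s • Y))⁻¹ := by
          rw [← hC, transpose_mul]; simp only [Matrix.mul_assoc]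
      _ = _ := by rw [matCosh_mul_inv hs, transpose_one, Matrix.one_mul]
  rw [matTanh_eq_inv_mul hs, transpose_mul, ← matTanh_eq_inv_mul hs, Matrix.mul_assoc, hCi,
    ← Matrix.mul_assoc, hS, Matrix.neg_mul, Matrix.mul_assoc, matTanh]

lemma isSymm_stdJ_mul_matTanh (hY : (stdJ n * Y).IsSymm) (hs : (matCosh (s • Y)).det ≠ 0) :
    (stdJ n * matTanh (s • Y)).IsSymm := by
  rw [IsSymm, transpose_mul, stdJ_transpose, Matrix.mul_neg, matTanh_transpose_mul_stdJ hY hs,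
    neg_neg]

end Tanh

/-! ### The evolution equation satisfied by the closed formula -/

section StarExp

variable {n : ℕ} {M : Matrix (Idx n) (Idx n) ℂ} {D : ℂ → ℂ}

/-- The candidate for the star exponential, with complex phase-space variables. -/
def starExp (M : Matrix (Idx n) (Idx n) ℂ) (D : ℂ → ℂ) (p : ℂ × (Idx n → ℂ)) : ℂ :=
  (D p.1)⁻¹ * Complex.exp (I * (p.2 ⬝ᵥ ((stdJ n * matTanh (p.1 • (stdJ n * M))) *ᵥ p.2)))

/-- The domain of the star exponential. -/
def starDom (M : Matrix (Idx n) (Idx n) ℂ) : Set (ℂ × (Idx n → ℂ)) :=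
  {p | (matCosh (p.1 • (stdJ n * M))).det ≠ 0}

lemma isOpen_det_matCosh (Y : Matrix (Idx n) (Idx n) ℂ) :
    IsOpen {s : ℂ | (matCosh (s • Y)).det ≠ 0} := by
  have hc : Continuous fun s : ℂ => (matCosh (s • Y)).det :=
    (continuous_matCosh.comp (continuous_id.smul continuous_const)).matrix_det
  exact isOpen_ne_fun hc continuous_const

lemma isOpen_starDom (M : Matrix (Idx n) (Idx n) ℂ) : IsOpen (starDom M) :=
  (isOpen_det_matCosh (stdJ n * M)).preimage continuous_fst

open scoped Matrix.Norms.Operator in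
lemma hasDerivAt_stdJ_mul_matTanh_entry {Y : Matrix (Idx n) (Idx n) ℂ} {s : ℂ}
    (hs : (matCosh (s • Y)).det ≠ 0) (i j : Idx n) :
    HasDerivAt (fun s : ℂ => (stdJ n * matTanh (s • Y)) i j)
      ((stdJ n * (Y - matTanh (s • Y) * Y * matTanh (s • Y))) i j) s :=
  hasDerivAt_entry ((hasDerivAt_matTanh hs).const_mul (stdJ n)) i j

lemma analyticOnNhd_starExp (hD : IsDetRoot (fun s => matCosh (s • (stdJ n * M))) D) :
    AnalyticOnNhd ℂ (starExp M D) (starDom M) := by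
  intro p hp
  have hfst : AnalyticAt ℂ (fun p : ℂ × (Idx n → ℂ) => p.1) p := analyticAt_fst
  have hcoord : ∀ i, AnalyticAt ℂ (fun p : ℂ × (Idx n → ℂ) => p.2 i) p := fun i =>
    ((ContinuousLinearMap.proj (R := ℂ) (φ := fun _ : Idx n => ℂ) i).comp
      (ContinuousLinearMap.snd ℂ ℂ (Idx n → ℂ))).analyticAt p
  have hDa : AnalyticAt ℂ (fun p : ℂ × (Idx n → ℂ) => D p.1) p :=
    AnalyticAt.fun_comp (hD.1.analyticAt p.1) hfst
  have hG : ∀ i j, AnalyticAt ℂ (fun p : ℂ × (Idx n → ℂ) =>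
      (stdJ n * matTanh (p.1 • (stdJ n * M))) i j) p := by
    intro i j
    have h1 : DifferentiableOn ℂ (fun s : ℂ => (stdJ n * matTanh (s • (stdJ n * M))) i j)
        {s : ℂ | (matCosh (s • (stdJ n * M))).det ≠ 0} := fun s hs =>
      (hasDerivAt_stdJ_mul_matTanh_entry hs i j).differentiableAt.differentiableWithinAt
    have h2 := h1.analyticAt ((isOpen_det_matCosh (stdJ n * M)).mem_nhds hp)
    exact AnalyticAt.fun_comp (g := fun s : ℂ => (stdJ n * matTanh (s • (stdJ n * M))) i j)
      (f := fun p : ℂ × (Idx n → ℂ) => p.1) h2 hfst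
  unfold starExp
  refine (hDa.fun_inv (detRoot_ne_zero hD hp)).fun_mul (AnalyticAt.cexp' ?_)
  refine analyticAt_const.fun_mul ?_
  simp only [dotProduct, mulVec]
  exact Finset.analyticAt_fun_sum _ fun i _ => (hcoord i).fun_mul
    (Finset.analyticAt_fun_sum _ fun j _ => (hG i j).fun_mul (hcoord j))

lemma quad_add_smul {m : Type*} [Fintype m] {A : Matrix m m ℂ} (hA : A.IsSymm) (ζ v : m → ℂ)
    (t : ℂ) :
    (ζ + t • v) ⬝ᵥ (A *ᵥ (ζ + t • v)) = ζ ⬝ᵥ (A *ᵥ ζ) + t * (2 * (v ⬝ᵥ (A *ᵥ ζ))) +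
      t ^ 2 * (v ⬝ᵥ (A *ᵥ v)) := by
  have h : ζ ⬝ᵥ (A *ᵥ v) = v ⬝ᵥ (A *ᵥ ζ) := by
    rw [dotProduct_mulVec, ← mulVec_transpose, hA.eq, dotProduct_comm]
  simp only [mulVec_add, mulVec_smul, add_dotProduct, dotProduct_add, smul_dotProduct,
    dotProduct_smul, smul_eq_mul, h]
  ring

lemma stdJ_row_dot (a : Idx n) (v : Idx n → ℂ) : stdJ n a ⬝ᵥ v = (stdJ n *ᵥ v) a := rfl

lemma hasDerivAt_starExp_line (hM : M.IsSymm) {p : ℂ × (Idx n → ℂ)} (hp : p ∈ starDom M)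
    (a : Idx n) : HasDerivAt (fun t : ℂ => starExp M D (p + t • symDir a))
      (-2 * I * (matTanh (p.1 • (stdJ n * M)) *ᵥ p.2) a * starExp M D p) 0 := by
  have hG := isSymm_stdJ_mul_matTanh (stdJ_mul_stdJ_mul_symm hM) hp
  have h0 : ∀ t : ℂ, p + t • symDir a = (p.1, p.2 + t • stdJ n a) := fun t => by
    rw [symDir]; ext <;> simp
  simp only [h0, starExp, quad_add_smul hG]
  have h1 : stdJ n a ⬝ᵥ ((stdJ n * matTanh (p.1 • (stdJ n * M))) *ᵥ p.2) =
      -(matTanh (p.1 • (stdJ n * M)) *ᵥ p.2) a := by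
    rw [stdJ_row_dot, mulVec_mulVec, ← Matrix.mul_assoc, stdJ_mul_self, neg_one_mul, neg_mulVec]
    rfl
  rw [h1]
  set q := p.2 ⬝ᵥ ((stdJ n * matTanh (p.1 • (stdJ n * M))) *ᵥ p.2)
  set r := stdJ n a ⬝ᵥ ((stdJ n * matTanh (p.1 • (stdJ n * M))) *ᵥ stdJ n a)
  set c := (matTanh (p.1 • (stdJ n * M)) *ᵥ p.2) a
  have h2 : HasDerivAt (fun t : ℂ => I * (q + t * (2 * -c) + t ^ 2 * r)) (I * (2 * -c)) 0 := by
    have h3 := (((hasDerivAt_id (0 : ℂ)).mul_const (2 * -c)).const_add q).fun_add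
      (((hasDerivAt_id (0 : ℂ)).fun_pow 2).mul_const r)
    simpa using h3.const_mul I
  refine (h2.cexp.const_mul (D p.1)⁻¹).congr_deriv ?_
  simp only [zero_mul, add_zero, zero_pow two_ne_zero]
  ring

lemma fderiv_starExp_symDir (hM : M.IsSymm)
    (hD : IsDetRoot (fun s => matCosh (s • (stdJ n * M))) D) {p : ℂ × (Idx n → ℂ)}
    (hp : p ∈ starDom M) (a : Idx n) : fderiv ℂ (starExp M D) p (symDir a) =
      -2 * I * (matTanh (p.1 • (stdJ n * M)) *ᵥ p.2) a * starExp M D p :=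
  ((analyticOnNhd_starExp hD p hp).differentiableAt.hasFDerivAt.hasLineDerivAt (symDir a)).unique
    (hasDerivAt_starExp_line hM hp a)

lemma fderiv_fderiv_starExp (hM : M.IsSymm)
    (hD : IsDetRoot (fun s => matCosh (s • (stdJ n * M))) D) {p : ℂ × (Idx n → ℂ)}
    (hp : p ∈ starDom M) (a b : Idx n) :
    fderiv ℂ (fun q => fderiv ℂ (starExp M D) q (symDir b)) p (symDir a) =
      (2 * I * (matTanh (p.1 • (stdJ n * M)) * stdJ n) b a -
        4 * (matTanh (p.1 • (stdJ n * M)) *ᵥ p.2) b * (matTanh (p.1 • (stdJ n * M)) *ᵥ p.2) a) *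
        starExp M D p := by
  have h1 := (analyticOnNhd_fderiv_apply (analyticOnNhd_starExp hD) (symDir b) p
    hp).differentiableAt.hasFDerivAt.hasLineDerivAt (symDir a)
  set Θ := matTanh (p.1 • (stdJ n * M)) with hΘ
  have hlin : HasDerivAt (fun t : ℂ => (Θ *ᵥ (p.2 + t • stdJ n a)) b) ((Θ *ᵥ stdJ n a) b) 0 := by
    have h3 := ((hasDerivAt_id (0 : ℂ)).mul_const ((Θ *ᵥ stdJ n a) b)).const_add ((Θ *ᵥ p.2) b)
    rw [one_mul] at h3
    refine h3.congr_of_eventuallyEq (Filter.Eventually.of_forall fun t => ?_)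
    simp only [mulVec_add, mulVec_smul, Pi.add_apply, Pi.smul_apply, smul_eq_mul, id]
  have h2 := (hlin.const_mul (-2 * I)).fun_mul (hasDerivAt_starExp_line (D := D) hM hp a)
  have h3 := h1.unique (h2.congr_of_eventuallyEq (Filter.Eventually.of_forall fun t => by
    have hq : p + t • symDir a = (p.1, p.2 + t • stdJ n a) := by
      rw [symDir]; ext <;> simp
    have hq' : p + t • symDir a ∈ starDom M := by rw [hq]; exact hp
    simp only
    rw [fderiv_starExp_symDir hM hD hq']
    rw [hq]))
  rw [h3, zero_smul, add_zero, zero_smul, add_zero]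
  have h4 : (Θ *ᵥ stdJ n a) b = -(Θ * stdJ n) b a := by
    rw [mulVec, dotProduct, mul_apply, ← Finset.sum_neg_distrib]
    refine Finset.sum_congr rfl fun c _ => ?_
    have := congrFun (congrFun (stdJ_transpose n) c) a
    rw [transpose_apply, neg_apply] at this
    rw [this, mul_neg]
  rw [h4]
  linear_combination (4 * (Θ *ᵥ p.2) b * (Θ *ᵥ p.2) a * starExp M D p) * I_mul_I

lemma hasDerivAt_starExp_time
    (hD : IsDetRoot (fun s => matCosh (s • (stdJ n * M))) D) {p : ℂ × (Idx n → ℂ)}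
    (hp : p ∈ starDom M) : HasDerivAt (fun s => starExp M D (s, p.2))
      ((-((matTanh (p.1 • (stdJ n * M)) * (stdJ n * M)).trace / 2) +
        I * (p.2 ⬝ᵥ ((stdJ n * (stdJ n * M - matTanh (p.1 • (stdJ n * M)) * (stdJ n * M) *
          matTanh (p.1 • (stdJ n * M)))) *ᵥ p.2))) * starExp M D p) p.1 := by
  have hne := detRoot_ne_zero hD hp
  have h1 := (hasDerivAt_detRoot hD hp).fun_inv hne
  have h2 : HasDerivAt (fun s : ℂ => p.2 ⬝ᵥ ((stdJ n * matTanh (s • (stdJ n * M))) *ᵥ p.2))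
      (p.2 ⬝ᵥ ((stdJ n * (stdJ n * M - matTanh (p.1 • (stdJ n * M)) * (stdJ n * M) *
          matTanh (p.1 • (stdJ n * M)))) *ᵥ p.2)) p.1 := by
    simp only [dotProduct, mulVec]
    exact HasDerivAt.fun_sum fun i _ => HasDerivAt.const_mul _ (HasDerivAt.fun_sum fun j _ =>
      (hasDerivAt_stdJ_mul_matTanh_entry hp i j).mul_const _)
  refine (h1.fun_mul (h2.const_mul I).cexp).congr_deriv ?_
  rw [starExp]
  field_simp

/-- Let Θ = tanh(sJM). The first-order term of the Moyal operator vanishes because MΘ is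
antisymmetric. The trace from the second derivatives matches the logarithmic derivative of D⁻¹, and
the quadratic terms match Θ' = JM - ΘJMΘ. -/
lemma fderiv_starExp_time (hM : M.IsSymm)
    (hD : IsDetRoot (fun s => matCosh (s • (stdJ n * M))) D) {p : ℂ × (Idx n → ℂ)}
    (hp : p ∈ starDom M) : fderiv ℂ (starExp M D) p (1, 0) = moyalOp M (starExp M D) p := by
  have hY := stdJ_mul_stdJ_mul_symm hM
  rw [(hasDerivAt_time (analyticOnNhd_starExp hD p hp).differentiableAt).unique
    (hasDerivAt_starExp_time hD hp), moyalOp]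
  simp only [fderiv_starExp_symDir hM hD hp, fderiv_fderiv_starExp hM hD hp]
  have hcomm := commute_matTanh hp
  have hT := matTanh_transpose_mul_stdJ hY hp
  set Θ := matTanh (p.1 • (stdJ n * M)) with hΘ
  set ζ := p.2
  have hMJ : M = -(stdJ n * (stdJ n * M)) := by
    rw [← Matrix.mul_assoc, stdJ_mul_self, neg_one_mul, neg_neg]
  have e1 : ∑ a, (M *ᵥ ζ) a * (Θ *ᵥ ζ) a = 0 := by
    have hanti : (M * Θ)ᵀ = -(M * Θ) := by
      calc (M * Θ)ᵀ = Θᵀ * -(stdJ n * (stdJ n * M)) := by rw [transpose_mul, hM.eq, ← hMJ]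
        _ = stdJ n * (Θ * (stdJ n * M)) := by
          rw [Matrix.mul_neg, ← Matrix.mul_assoc, hT, Matrix.neg_mul, neg_neg, Matrix.mul_assoc]
        _ = -(M * Θ) := by
          rw [← hcomm.eq, ← Matrix.mul_assoc, ← Matrix.mul_assoc, stdJ_mul_self, neg_one_mul,
            Matrix.neg_mul]
    have h1 : (M *ᵥ ζ) ⬝ᵥ (Θ *ᵥ ζ) = ζ ⬝ᵥ ((M * Θ) *ᵥ ζ) := by
      rw [dotProduct_comm, dotProduct_mulVec, ← mulVec_transpose, hM.eq, mulVec_mulVec,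
        dotProduct_comm]
    have h2 : ζ ⬝ᵥ ((M * Θ) *ᵥ ζ) = -(ζ ⬝ᵥ ((M * Θ) *ᵥ ζ)) := by
      conv_lhs => rw [dotProduct_mulVec, ← mulVec_transpose, hanti, neg_mulVec, neg_dotProduct,
        dotProduct_comm]
    change (M *ᵥ ζ) ⬝ᵥ (Θ *ᵥ ζ) = 0
    rw [h1]
    linear_combination (1 / 2) * h2
  have e2 : ∑ a, ∑ b, M a b * (Θ * stdJ n) b a = (Θ * (stdJ n * M)).trace := by
    rw [← Matrix.mul_assoc, trace_mul_comm, trace]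
    rfl
  have e3 : ∑ a, ∑ b, M a b * ((Θ *ᵥ ζ) b * (Θ *ᵥ ζ) a) =
      ζ ⬝ᵥ ((stdJ n * (Θ * (stdJ n * M) * Θ)) *ᵥ ζ) := by
    have h1 : ∑ a, ∑ b, M a b * ((Θ *ᵥ ζ) b * (Θ *ᵥ ζ) a) = (Θ *ᵥ ζ) ⬝ᵥ (M *ᵥ (Θ *ᵥ ζ)) := by
      rw [dotProduct]
      refine Finset.sum_congr rfl fun a _ => ?_
      rw [show (M *ᵥ (Θ *ᵥ ζ)) a = ∑ b, M a b * (Θ *ᵥ ζ) b from rfl, Finset.mul_sum]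
      exact Finset.sum_congr rfl fun b _ => by ring
    have h2 : Θᵀ * M * Θ = stdJ n * (Θ * (stdJ n * M) * Θ) := by
      rw [hMJ, Matrix.mul_neg, ← Matrix.mul_assoc Θᵀ, hT]
      simp only [Matrix.neg_mul, Matrix.mul_neg, neg_neg, Matrix.mul_assoc]
      rw [← Matrix.mul_assoc (stdJ n) (stdJ n), stdJ_mul_self]
      simp
    rw [h1, ← h2, ← mulVec_mulVec, ← mulVec_mulVec, dotProduct_mulVec ζ, vecMul_transpose]
  have e4 : ζ ⬝ᵥ ((stdJ n * (stdJ n * M)) *ᵥ ζ) = -(ζ ⬝ᵥ (M *ᵥ ζ)) := by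
    rw [← Matrix.mul_assoc, stdJ_mul_self, neg_one_mul, neg_mulVec, dotProduct_neg]
  have e5 : ∑ a, (M *ᵥ ζ) a * (-2 * I * (Θ *ᵥ ζ) a * starExp M D p) =
      -2 * I * (∑ a, (M *ᵥ ζ) a * (Θ *ᵥ ζ) a) * starExp M D p := by
    rw [Finset.mul_sum, Finset.sum_mul]
    exact Finset.sum_congr rfl fun a _ => by ring
  have e6 : ∑ a, ∑ b, M a b * ((2 * I * (Θ * stdJ n) b a - 4 * (Θ *ᵥ ζ) b * (Θ *ᵥ ζ) a) *
      starExp M D p) = (2 * I * (∑ a, ∑ b, M a b * (Θ * stdJ n) b a) -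
        4 * ∑ a, ∑ b, M a b * ((Θ *ᵥ ζ) b * (Θ *ᵥ ζ) a)) * starExp M D p := by
    simp only [Finset.mul_sum, ← Finset.sum_sub_distrib, Finset.sum_mul]
    exact Finset.sum_congr rfl fun a _ => Finset.sum_congr rfl fun b _ => by ring
  rw [e5, e6, e1, e2, e3, Matrix.mul_sub, sub_mulVec, dotProduct_sub, e4]
  linear_combination (-(Θ * (stdJ n * M)).trace / 2 * starExp M D p) * I_mul_I

end StarExp

/-! ### The star exponential -/

section StarExponential

variable {n : ℕ}

lemma matSinh_zero {m : Type*} [Fintype m] [DecidableEq m] : matSinh (0 : Matrix m m ℂ) = 0 := by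
  rw [matSinh, neg_zero, sub_self, smul_zero]

lemma zero_mem_starDom (M : Matrix (Idx n) (Idx n) ℂ) (ζ : Idx n → ℂ) : (0, ζ) ∈ starDom M := by
  change (matCosh ((0 : ℂ) • (stdJ n * M))).det ≠ 0
  rw [zero_smul, matCosh_zero, det_one]
  exact one_ne_zero

lemma starExp_zero {M : Matrix (Idx n) (Idx n) ℂ} {D : ℂ → ℂ}
    (hD : IsDetRoot (fun s => matCosh (s • (stdJ n * M))) D) (ζ : Idx n → ℂ) :
    starExp M D (0, ζ) = 1 := by
  rw [starExp, zero_smul, matTanh, matSinh_zero, Matrix.zero_mul, Matrix.mul_zero, zero_mulVec,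
    dotProduct_zero, mul_zero, Complex.exp_zero, hD.2.1, inv_one, one_mul]

lemma analyticOnNhd_starExp_time {M : Matrix (Idx n) (Idx n) ℂ} {D : ℂ → ℂ}
    (hD : IsDetRoot (fun s => matCosh (s • (stdJ n * M))) D) (ζ : Idx n → ℂ) :
    AnalyticOnNhd ℂ (fun s => starExp M D (s, ζ)) {s : ℂ | (matCosh (s • (stdJ n * M))).det ≠ 0} :=
  fun s hs => AnalyticAt.fun_comp (f := fun s : ℂ => (s, ζ)) (analyticOnNhd_starExp hD (s, ζ) hs)
    (analyticAt_id.prod analyticAt_const)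

lemma iteratedDeriv_starExp {M : Matrix (Idx n) (Idx n) ℂ} (hM : M.IsSymm) {D : ℂ → ℂ}
    (hD : IsDetRoot (fun s => matCosh (s • (stdJ n * M))) D) (l : ℕ) (ζ : Idx n → ℂ) :
    iteratedDeriv l (fun s => starExp M D (s, ζ)) 0 =
      MvPolynomial.eval ζ (starPow (MvPolynomial.C (-I) * quadPoly M) l) := by
  rw [iteratedDeriv_eq_timeIter (isOpen_starDom M) (analyticOnNhd_starExp hD) l (0, ζ)
    (zero_mem_starDom M ζ)]
  exact timeIter_eq_eval_starPow hM (isOpen_starDom M) (analyticOnNhd_starExp hD)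
    (fun p hp => fderiv_starExp_time hM hD hp) (zero_mem_starDom M) (starExp_zero hD) l ζ

/-- The set where det cosh(sJM) ≠ 0 is open and contains the compact unit disc, hence a disc of
radius greater than 1. There the function is holomorphic, and its Taylor series may be evaluated at
1. -/
lemma hasSum_starExp {M : Matrix (Idx n) (Idx n) ℂ} (hM : M.IsSymm) {D : ℂ → ℂ}
    (hD : IsDetRoot (fun s => matCosh (s • (stdJ n * M))) D)
    (hne : ∀ s : ℂ, ‖s‖ ≤ 1 → (matCosh (s • (stdJ n * M))).det ≠ 0) (ζ : Idx n → ℂ) :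
    HasSum (fun l : ℕ => ((Nat.factorial l : ℂ))⁻¹ *
      MvPolynomial.eval ζ (starPow (MvPolynomial.C (-I) * quadPoly M) l)) (starExp M D (1, ζ)) := by
  obtain ⟨δ, hδ, hsub⟩ := (isCompact_closedBall (0 : ℂ) 1).exists_thickening_subset_open
    (isOpen_det_matCosh (stdJ n * M)) fun s hs => hne s (by simpa using hs)
  rw [thickening_closedBall hδ zero_le_one] at hsub
  have h1 := Complex.hasSum_taylorSeries_on_ball (c := 0) (r := δ + 1)
    (f := fun s => starExp M D (s, ζ))
    ((analyticOnNhd_starExp_time hD ζ).differentiableOn.mono hsub) (z := 1) (by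
      rw [Metric.mem_ball, dist_zero_right, norm_one]; linarith)
  simpa only [sub_zero, one_pow, one_smul, smul_eq_mul, iteratedDeriv_starExp hM hD, one_mul] using
    h1

lemma star_det_matCosh (A : Matrix (Idx n) (Idx n) ℂ) (hA : A.map star = A) :
    star (matCosh A).det = (matCosh A).det := by
  have h1 : Aᴴ = Aᵀ := by
    rw [conjTranspose, transpose_map, hA]
  rw [← det_conjTranspose, matCosh, conjTranspose_smul, conjTranspose_add,
    ← Matrix.exp_conjTranspose, ← Matrix.exp_conjTranspose, conjTranspose_neg, h1, ← transpose_neg,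
    Matrix.exp_transpose, Matrix.exp_transpose, ← transpose_add, star_inv₀, star_ofNat,
    ← transpose_smul, det_transpose]

lemma mem_slitPlane_of_real {f : ℝ → ℂ} (hc : ContinuousOn f (Set.Icc 0 1)) (h0 : f 0 = 1)
    (hr : ∀ t, (f t).im = 0) (hne : ∀ t ∈ Set.Icc 0 1, f t ≠ 0) :
    ∀ t ∈ Set.Icc 0 1, f t ∈ slitPlane := by
  intro t ht
  refine Or.inl ?_
  by_contra hu
  obtain ⟨v, hv, hv0⟩ := (isPreconnected_Icc (a := (0 : ℝ)) (b := 1)).intermediate_value ht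
    (Set.left_mem_Icc.2 zero_le_one) (f := fun t => (f t).re)
    (Complex.continuous_re.comp_continuousOn hc) (show (0 : ℝ) ∈ Set.Icc _ _ from
      ⟨not_lt.1 hu, by rw [h0]; exact zero_le_one⟩)
  exact hne v hv (Complex.ext hv0 (hr v))

lemma stdJ_map_star (n : ℕ) : (stdJ n).map star = stdJ n := by
  ext (i | i) (j | j) <;> simp [stdJ, one_apply, apply_ite]

lemma smul_stdJ_cplx_map_star (M : Matrix (Idx n) (Idx n) ℝ) (t : ℝ) :
    ((t : ℂ) • (stdJ n * cplx M)).map star = (t : ℂ) • (stdJ n * cplx M) := by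
  have h := Matrix.map_mul (f := starRingEnd ℂ) (L := stdJ n) (M := cplx M)
  have h1 : (stdJ n * cplx M).map star = stdJ n * cplx M := by
    refine h.trans ?_
    exact congrArg₂ (· * ·) (stdJ_map_star n) (cplx_map_star M)
  ext i j
  have h2 := congrFun (congrFun h1 i) j
  rw [map_apply] at h2
  rw [map_apply, Matrix.smul_apply, smul_eq_mul, star_mul', h2, RCLike.star_def, conj_ofReal]

lemma det_matCosh_mem_slitPlane {M : Matrix (Idx n) (Idx n) ℝ}
    (hne : ∀ s : ℂ, ‖s‖ ≤ 1 → (matCosh (s • (stdJ n * cplx M))).det ≠ 0) :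
    ∀ t : ℝ, t ∈ Set.Icc 0 1 → (matCosh ((t : ℂ) • (stdJ n * cplx M))).det ∈ slitPlane := by
  refine mem_slitPlane_of_real (f := fun t : ℝ => (matCosh ((t : ℂ) • (stdJ n * cplx M))).det)
    ?_ ?_ ?_ ?_
  · exact ((continuous_matCosh.comp
      (continuous_ofReal.smul continuous_const)).matrix_det).continuousOn
  · rw [ofReal_zero, zero_smul, matCosh_zero, det_one]
  · intro t
    have := star_det_matCosh _ (smul_stdJ_cplx_map_star M t)
    exact Complex.conj_eq_iff_im.1 this
  · intro t ht
    exact hne _ (by rw [Complex.norm_real, Real.norm_eq_abs, abs_of_nonneg ht.1]; exact ht.2)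

theorem starExponential_continuation {M : Matrix (Idx n) (Idx n) ℝ} (hM : M.IsSymm) :
    ∃ D : ℂ → ℂ, IsDetRoot (fun s => matCosh (s • (stdJ n * cplx M))) D ∧
      IsConnected {s : ℂ | (matCosh (s • (stdJ n * cplx M))).det ≠ 0} ∧
      ∀ x y : Fin n → ℝ,
        AnalyticOnNhd ℂ
          (fun s : ℂ => (D s)⁻¹ * Complex.exp (Complex.I *
            qform (stdJ n * matTanh (s • (stdJ n * cplx M))) x y))
          {s : ℂ | (matCosh (s • (stdJ n * cplx M))).det ≠ 0} ∧
        ∀ l : ℕ,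
          iteratedDeriv l
            (fun s : ℂ => (D s)⁻¹ * Complex.exp (Complex.I *
              qform (stdJ n * matTanh (s • (stdJ n * cplx M))) x y)) 0 =
            MvPolynomial.eval (phaseVec x y)
              (starPow (MvPolynomial.C (-Complex.I) * quadPoly (cplx M)) l) := by
  have hMs := cplx_isSymm hM
  obtain ⟨D, hD⟩ := exists_isDetRoot (stdJ_mul_stdJ_mul_symm hMs)
  exact ⟨D, hD, (isPathConnected_det_matCosh_ne_zero _).isConnected, fun x y =>
    ⟨analyticOnNhd_starExp_time hD (phaseVec x y), fun l =>
      iteratedDeriv_starExp hMs hD l (phaseVec x y)⟩⟩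

theorem hasSum_starExponential {M : Matrix (Idx n) (Idx n) ℝ} (hM : M.IsSymm)
    (hne : ∀ s : ℂ, ‖s‖ ≤ 1 → (matCosh (s • (stdJ n * cplx M))).det ≠ 0) (x y : Fin n → ℝ) :
    HasSum
      (fun l : ℕ => ((Nat.factorial l : ℂ))⁻¹ * MvPolynomial.eval (phaseVec x y)
        (starPow (MvPolynomial.C (-Complex.I) * quadPoly (cplx M)) l))
      (powNegHalf (matCosh (stdJ n * cplx M)).det *
        Complex.exp (Complex.I * qform (stdJ n * matTanh (stdJ n * cplx M)) x y)) := by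
  have hMs := cplx_isSymm hM
  obtain ⟨D, hD⟩ := exists_isDetRoot (stdJ_mul_stdJ_mul_symm hMs)
  have h1 := hasSum_starExp hMs hD hne (phaseVec x y)
  have h2 := powNegHalf_eq_inv_detRoot hD (det_matCosh_mem_slitPlane hne)
  rw [starExp, ← h2] at h1
  simp only [one_smul] at h1
  exact h1

end StarExponential

/-! ### Signs of Gaussian integrals in two variables -/

section Sign

lemma re_cpow_nonneg {z c : ℂ} (hc : c.im = 0) (hc2 : |c.re| ≤ 1 / 2) : 0 ≤ (z ^ c).re := by
  rcases eq_or_ne z 0 with rfl | hz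
  · rcases eq_or_ne c 0 with rfl | h
    · simp
    · simp [zero_cpow h]
  · rw [cpow_def_of_ne_zero hz, Complex.exp_re]
    refine mul_nonneg (Real.exp_pos _).le (Real.cos_nonneg_of_mem_Icc ?_)
    rw [Set.mem_Icc, ← abs_le, Complex.mul_im, hc, mul_zero, zero_add, log_im, abs_mul]
    calc |z.arg| * |c.re| ≤ Real.pi * (1 / 2) :=
          mul_le_mul (abs_arg_le_pi z) hc2 (abs_nonneg _) Real.pi_pos.le
      _ = Real.pi / 2 := by ring

lemma re_powNegHalf_nonneg (z : ℂ) : 0 ≤ (powNegHalf z).re :=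
  re_cpow_nonneg (by norm_num) (by norm_num [abs_div])

lemma abs_im_cpow_half_lt {z : ℂ} (hz : 0 < z.re) :
    |(z ^ (1 / 2 : ℂ)).im| < (z ^ (1 / 2 : ℂ)).re := by
  have h1 : (z ^ (1 / 2 : ℂ)) ^ 2 = z := by
    rw [← cpow_nat_mul]; norm_num
  have h2 : 0 ≤ (z ^ (1 / 2 : ℂ)).re := re_cpow_nonneg (by norm_num) (by norm_num)
  rw [← h1, pow_two, Complex.mul_re] at hz
  exact abs_lt_of_sq_lt_sq (by nlinarith) h2

lemma re_mul_pos {a b : ℂ} (ha : |a.im| < a.re) (hb : |b.im| < b.re) : 0 < (a * b).re := by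
  rw [Complex.mul_re, sub_pos]
  calc a.im * b.im ≤ |a.im| * |b.im| := by rw [← abs_mul]; exact le_abs_self _
    _ < a.re * b.re := mul_lt_mul'' ha hb (abs_nonneg _) (abs_nonneg _)

/-- In two real dimensions the integral is a positive multiple of a product of two principal square
roots of numbers with positive real part. Each root has argument strictly between -π/4 and π/4. -/
lemma GPos.re_gint_pos {H : Matrix (Idx 1) (Idx 1) ℂ} (hH : GPos H) : 0 < (gint H).re := by
  obtain ⟨B, d, hB, hd, h⟩ := hH.exists_diagonalization
  rw [gint_eq_prod hB hd h, Fintype.prod_sum_type, Fin.prod_univ_one, Fin.prod_univ_one,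
    re_ofReal_mul]
  have h1 : ∀ i, 0 < ((Real.pi : ℂ) / (d i / 2)).re := by
    intro i
    have h2 : (Real.pi : ℂ) / (d i / 2) = ((2 * Real.pi : ℝ) : ℂ) * (d i)⁻¹ := by
      push_cast
      rw [div_div_eq_mul_div, div_eq_mul_inv]; ring
    have h3 : d i ≠ 0 := fun h0 => by have := hd i; simp [h0] at this
    rw [h2, re_ofReal_mul, inv_re]
    exact mul_pos Real.two_pi_pos (div_pos (hd i) (normSq_pos.2 h3))
  exact mul_pos (inv_pos.2 (abs_pos.2 hB)) (re_mul_pos (abs_im_cpow_half_lt (h1 _))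
    (abs_im_cpow_half_lt (h1 _)))

lemma re_nonneg_of_mul_real {u v : ℂ} (hu : 0 ≤ u.re) (hv : 0 < v.re) (h : (u * v).im = 0) :
    0 ≤ (u * v).re := by
  rw [Complex.mul_im] at h
  rw [Complex.mul_re]
  have h1 : v.re * (u.re * v.re - u.im * v.im) = u.re * (v.re ^ 2 + v.im ^ 2) := by
    linear_combination -v.im * h
  have h2 : 0 ≤ v.re * (u.re * v.re - u.im * v.im) := by rw [h1]; positivity
  exact nonneg_of_mul_nonneg_right h2 hv

lemma im_eq_zero_of_sq_mul {x : ℂ} {r : ℝ} (h : x ^ 2 * ((r ^ 2 : ℝ) : ℂ) = 1) : x.im = 0 := by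
  have h1 : (x * r) * (x * r) = 1 := by rw [← h]; push_cast; ring
  have hr : r ≠ 0 := by rintro rfl; simp at h
  have h2 : (x * r).im = 0 := by
    rcases mul_self_eq_one_iff.1 h1 with h | h <;> simp [h]
  rw [im_mul_ofReal] at h2
  exact (mul_eq_zero.1 h2).resolve_right hr

end Sign

/-! ### Exponentials of real Hamiltonian matrices -/

section RealFlow

variable {n : ℕ} {X : Matrix (Idx n) (Idx n) ℝ}

lemma cplx_exp (X : Matrix (Idx n) (Idx n) ℝ) :
    cplx (NormedSpace.exp X) = NormedSpace.exp (cplx X) := by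
  open scoped Matrix.Norms.Operator in
  exact NormedSpace.map_exp (Complex.ofRealHom.mapMatrix : Matrix (Idx n) (Idx n) ℝ →+* _)
    (continuous_id.matrix_map Complex.continuous_ofReal) X

lemma cplx_smul (t : ℝ) (X : Matrix (Idx n) (Idx n) ℝ) : cplx (t • X) = (t : ℂ) • cplx X := by
  ext i j; simp [cplx]

lemma isSymm_stdJ_mul_cplx (hX : X ∈ LieAlgebra.Symplectic.sp (Fin n) ℝ) :
    (stdJ n * cplx X).IsSymm := by
  have h1 : Xᵀ * Matrix.J (Fin n) ℝ = Matrix.J (Fin n) ℝ * -X := by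
    have := (mem_skewAdjointMatricesSubmodule _ _).1 hX
    exact this
  -- `Matrix.J` has the opposite sign convention; the Lie algebra condition is unaffected.
  have h2 : cplx (Matrix.J (Fin n) ℝ) = -stdJ n := by
    ext (i | i) (j | j) <;> simp [cplx, Matrix.J, stdJ, one_apply, apply_ite]
  have h3 := congrArg (cmat (ι := Idx n)) h1
  rw [cmat_mul, cmat_mul] at h3
  have h4 : (cplx X)ᵀ * -stdJ n = -stdJ n * -cplx X := by
    rw [← h2]
    refine h3.trans (congrArg _ ?_)
    ext i j; simp [cplx, cmat]
  rw [IsSymm, transpose_mul, stdJ_transpose, h4, neg_mul_neg]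

/-- The symbol whose complexified Hamiltonian flow is `exp (t X)`. -/
def hamSymbol (X : Matrix (Idx n) (Idx n) ℝ) : Matrix (Idx n) (Idx n) ℂ :=
  (-(I / 2)) • (stdJ n * cplx X)

lemma stdJ_mul_hamSymbol (X : Matrix (Idx n) (Idx n) ℝ) :
    stdJ n * hamSymbol X = (I / 2) • cplx X := by
  rw [hamSymbol, Matrix.mul_smul, ← Matrix.mul_assoc, stdJ_mul_self, Matrix.neg_mul,
    Matrix.one_mul, smul_neg, neg_smul, neg_neg]

/-- The matrix JX is real, so this symbol is purely imaginary on real phase space and its flow falls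
under the boundary case Re q = 0. -/
lemma dissipative_hamSymbol (hX : (stdJ n * cplx X).IsSymm) : Dissipative (hamSymbol X) := by
  refine ⟨hX.smul _, fun x y => le_of_eq ?_⟩
  have h1 : star (phaseVec x y) = phaseVec x y := by
    ext i; simp [phaseVec]
  have h2 : (stdJ n * cplx X)ᴴ = stdJ n * cplx X := by
    have h := smul_stdJ_cplx_map_star X 1
    rw [ofReal_one, one_smul] at h
    rw [conjTranspose, transpose_map, h, hX.eq]
  have h3 : star (qform (stdJ n * cplx X) x y) = qform (stdJ n * cplx X) x y := by
    have := star_quad (stdJ n * cplx X) (phaseVec x y)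
    rwa [h1, h2] at this
  have h4 : (qform (stdJ n * cplx X) x y).im = 0 := Complex.conj_eq_iff_im.1 h3
  have h5 : qform (hamSymbol X) x y = -(I / 2) * qform (stdJ n * cplx X) x y := by
    rw [qform, hamSymbol, smul_mulVec, dotProduct_smul, smul_eq_mul, qform]
  rw [h5]; simp [h4]

lemma flow_hamSymbol (X : Matrix (Idx n) (Idx n) ℝ) (t : ℝ) :
    flow (hamSymbol X) t = cplx (NormedSpace.exp (t • X)) := by
  rw [flow, stdJ_mul_hamSymbol, cplx_exp, cplx_smul, smul_smul (-(2 * I))]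
  have : -(2 * I) * (I / 2) = 1 := by linear_combination -I_mul_I
  rw [this, one_smul]

lemma kflow_hamSymbol (X : Matrix (Idx n) (Idx n) ℝ) (t : ℝ) :
    kflow (hamSymbol X) t = toS (NormedSpace.exp (t • X)) := by
  rw [kflow, flow_hamSymbol, toS]

lemma matCosh_neg {m : Type*} [Fintype m] [DecidableEq m] (A : Matrix m m ℂ) :
    matCosh (-A) = matCosh A := by
  rw [matCosh, matCosh, neg_neg, add_comm]

lemma matCos_hamSymbol (X : Matrix (Idx n) (Idx n) ℝ) (s : ℂ) :
    matCos (s • (stdJ n * hamSymbol X)) = matCosh (s • (2⁻¹ : ℂ) • cplx X) := by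
  rw [stdJ_mul_hamSymbol, matCos_smul_eq, smul_smul I, ← matCosh_neg, ← smul_neg, ← neg_smul]
  congr 3
  linear_combination -I_mul_I / 2

lemma matTan_hamSymbol (X : Matrix (Idx n) (Idx n) ℝ) :
    matTan (stdJ n * hamSymbol X) = I • matTanh ((2⁻¹ : ℂ) • cplx X) := by
  have h0 := matCos_hamSymbol X 1
  rw [one_smul, one_smul] at h0
  have h1 : I • (stdJ n * hamSymbol X) = -((2⁻¹ : ℂ) • cplx X) := by
    rw [stdJ_mul_hamSymbol, smul_smul, ← neg_smul]
    congr 1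
    linear_combination I_mul_I / 2
  rw [matTan, h0, matTanh, ← Matrix.smul_mul, matSin, matSinh, h1, neg_neg, smul_smul]
  congr 1
  rw [← neg_sub, smul_neg, ← neg_smul]
  congr 1
  rw [mul_inv, inv_I]
  ring

lemma toS_blocks (g : Matrix (Idx n) (Idx n) ℝ) :
    (toS g).toBlocks₂₁ = (toS g).toBlocks₁₂.map star := by
  obtain ⟨a, b, c, d, rfl⟩ : ∃ a b c d, g = fromBlocks a b c d :=
    ⟨_, _, _, _, (fromBlocks_toBlocks g).symm⟩
  rw [toS, cplx, fromBlocks_map, cayleyU_inv, cayleyU, Matrix.mul_smul, fromBlocks_multiply,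
    fromBlocks_multiply, fromBlocks_smul, toBlocks_fromBlocks₂₁, toBlocks_fromBlocks₁₂]
  ext i j
  simp only [Matrix.smul_apply, Matrix.map_apply, Matrix.add_apply, Matrix.mul_apply,
    Matrix.one_apply, Matrix.neg_apply]
  simp

/-! ### The Weyl symbol of metaplectic operators -/

lemma Dissipative.pathC_ne_zero {M : Matrix (Idx n) (Idx n) ℂ} (h : Dissipative M) {t : ℝ}
    (ht : 0 ≤ t) : pathC M t ≠ 0 := fun h0 => by
  have := pathC_sq h ht
  rw [h0] at this
  simp at this

lemma bargmann_smul (c : ℂ) (φ : L2 n) : bargmann (c • φ) = fun z => c * bargmann φ z := by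
  ext z
  rw [← inner_coherentS, inner_smul_right, inner_coherentS]

/-- `bargmannInv` is meaningful only on the range of the Bargmann transform. The image Gaussian lies
there, being a multiple of the transform of the coherent state evolved to time 1. -/
lemma bargmann_metaplectic_coherentS (hX : (stdJ n * cplx X).IsSymm) (w : Fin n → ℂ) :
    bargmann (metaplectic (NormedSpace.exp X)
      ((coherentS w).toLp 2 (volume : Measure (Euc n)))) = fun z =>
      powNegHalf (toS (NormedSpace.exp X)).toBlocks₁₁.det *
        Complex.exp (expK (toS (NormedSpace.exp X)).toBlocks₁₁ (toS (NormedSpace.exp X)).toBlocks₁₂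
          (toS (NormedSpace.exp X)).toBlocks₂₁ z w) := by
  have h := dissipative_hamSymbol hX
  have hk := kflow_hamSymbol X 1
  rw [one_smul] at hk
  have hsp := isExpSp_kflow h.symm h.re_nonpos (zero_le_one (α := ℝ))
  rw [hk] at hsp
  rw [metaplectic, bargmann_coherentS, metaFock_coherent hsp (toS_blocks _)]
  set c := powNegHalf (toS (NormedSpace.exp X)).toBlocks₁₁.det
  have hb : bargmann ((c / pathC (hamSymbol X) 1) •
      (gpath h w 1).toLp 2 (volume : Measure (Euc n))) = fun z => c *
        Complex.exp (expK (toS (NormedSpace.exp X)).toBlocks₁₁ (toS (NormedSpace.exp X)).toBlocks₁₂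
          (toS (NormedSpace.exp X)).toBlocks₂₁ z w) := by
    rw [bargmann_smul]
    ext z
    rw [bargmann_gpath h w z zero_le_one, hk, ← mul_assoc,
      div_mul_cancel₀ _ (h.pathC_ne_zero zero_le_one)]
  rw [← hb, bargmannInv_bargmann]

lemma isExpSp_toS_exp (hX : (stdJ n * cplx X).IsSymm) (t : ℝ) :
    IsExpSp (toS (NormedSpace.exp (t • X))) := by
  have hX' : (stdJ n * cplx (t • X)).IsSymm := by
    rw [cplx_smul, Matrix.mul_smul]; exact hX.smul _
  have h := dissipative_hamSymbol hX'
  have := isExpSp_kflow h.symm h.re_nonpos (zero_le_one (α := ℝ))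
  rwa [kflow_hamSymbol, one_smul] at this

lemma exists_metaplectic_root (hX : (stdJ n * cplx X).IsSymm) :
    ∃ δ : ℝ → ℂ, Continuous δ ∧ δ 0 = 1 ∧
      ∀ t : ℝ, δ t ^ 2 * (toS (NormedSpace.exp (t • X))).toBlocks₁₁.det = 1 := by
  have hne : ∀ t : ℝ, (toS (NormedSpace.exp (t • X))).toBlocks₁₁.det ≠ 0 := fun t =>
    (isExpSp_blocks (isExpSp_toS_exp hX t)).det_ne_zero
  have hc : Continuous fun t : ℝ => (toS (NormedSpace.exp (t • X))).toBlocks₁₁.det := by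
    simp only [← kflow_hamSymbol]
    exact (continuous_blocks₁₁.comp
      (continuous_kflow_param continuous_const continuous_id)).matrix_det
  obtain ⟨δ, h1, h2, h3⟩ := exists_continuous_sqrt (a₀ := (0 : ℝ)) (hc.inv₀ hne)
    (fun t => inv_ne_zero (hne t)) (by
      simp only [Pi.inv_apply]
      rw [← kflow_hamSymbol, kflow_zero, ← fromBlocks_one, toBlocks_fromBlocks₁₁, det_one, inv_one])
  exact ⟨δ, h1, h2, fun t => by rw [h3, Pi.inv_apply, inv_mul_cancel₀ (hne t)]⟩

lemma weylCoef_mul (a c : ℂ) (k : Matrix (Idx n) (Idx n) ℂ) :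
    weylCoef (a * c) k = a * weylCoef c k := by
  rw [weylCoef, weylCoef]; ring

/-- The coefficient is linear in c, so any amplitude is compared with the continuous choice δ(1),
for which the flow theorem gives D(1)⁻¹. -/
lemma weylCoef_metaplectic (hX : (stdJ n * cplx X).IsSymm) {D : ℂ → ℂ} {δ : ℝ → ℂ}
    (hD : IsDetRoot (fun s => matCosh (s • (2⁻¹ : ℂ) • cplx X)) D) (hδ : Continuous δ)
    (h0 : δ 0 = 1) (hs : ∀ t : ℝ, δ t ^ 2 * (toS (NormedSpace.exp (t • X))).toBlocks₁₁.det = 1)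
    (hd : (matCosh ((2⁻¹ : ℂ) • cplx X)).det ≠ 0) (c : ℂ) :
    weylCoef c (toS (NormedSpace.exp X)) = c / δ 1 * (D 1)⁻¹ := by
  have h := dissipative_hamSymbol hX
  simp only [← matCos_hamSymbol] at hD
  have hd' : (matCos (((1 : ℝ) : ℂ) • (stdJ n * hamSymbol X))).det ≠ 0 := by
    rwa [matCos_hamSymbol, ofReal_one, one_smul]
  simp only [← kflow_hamSymbol] at hs
  have h1 := weylCoef_flow h.symm h.re_nonpos hD hδ.continuousOn h0 (fun t _ => hs t)
    (zero_le_one (α := ℝ)) hd'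
  rw [kflow_hamSymbol, one_smul, ofReal_one] at h1
  have hδ1 : δ 1 ≠ 0 := fun h0 => by
    have := hs 1
    rw [h0] at this
    simp at this
  rw [← h1, ← weylCoef_mul, div_mul_cancel₀ _ hδ1]

/-- For g = exp(X/2) in SL(2, ℝ) one has g + g⁻¹ = tr(g)·1, so cosh(X/2) is the scalar tr(g)/2 and
its determinant is a square. -/
lemma det_matCosh_sq {X : Matrix (Idx 1) (Idx 1) ℝ} (hX : (stdJ 1 * cplx X).IsSymm) :
    ∃ r : ℝ, (matCosh ((2⁻¹ : ℂ) • cplx X)).det = ((r ^ 2 : ℝ) : ℂ) := by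
  have h1 := flow_symp (dissipative_hamSymbol hX).symm (2⁻¹ : ℝ)
  have h2 : NormedSpace.exp ((2⁻¹ : ℂ) • cplx X) = cplx (NormedSpace.exp ((2⁻¹ : ℝ) • X)) := by
    rw [cplx_exp, cplx_smul, ofReal_inv, ofReal_ofNat]
  rw [flow_hamSymbol] at h1
  obtain ⟨a, b, c, d, hg⟩ : ∃ a b c d, NormedSpace.exp ((2⁻¹ : ℝ) • X) = fromBlocks a b c d :=
    ⟨_, _, _, _, (fromBlocks_toBlocks _).symm⟩
  have h3 : (cplx (NormedSpace.exp ((2⁻¹ : ℝ) • X)))⁻¹ =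
      -(stdJ 1 * (cplx (NormedSpace.exp ((2⁻¹ : ℝ) • X)))ᵀ * stdJ 1) := by
    refine Matrix.inv_eq_left_inv ?_
    rw [Matrix.neg_mul, Matrix.mul_assoc, Matrix.mul_assoc, ← Matrix.mul_assoc _ (stdJ 1), h1,
      stdJ_mul_self, neg_neg]
  refine ⟨2⁻¹ * (a 0 0 + d 0 0), ?_⟩
  rw [matCosh, Matrix.exp_neg, h2, h3, hg, cplx, fromBlocks_map, stdJ, fromBlocks_transpose,
    fromBlocks_multiply, fromBlocks_multiply, fromBlocks_neg, fromBlocks_add, fromBlocks_smul]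
  have h4 : ∀ A : Matrix (Fin 1) (Fin 1) ℂ, Aᵀ = A := fun A => by
    ext i j; rw [transpose_apply, Subsingleton.elim i j]
  simp only [h4, Matrix.zero_mul, Matrix.mul_zero, Matrix.one_mul, Matrix.mul_one, zero_add,
    add_zero, Matrix.neg_mul, Matrix.mul_neg, neg_neg, add_neg_cancel, smul_zero,
    det_fromBlocks_zero₂₁, det_unique, Matrix.smul_apply, Matrix.add_apply, Matrix.map_apply]
  simp
  ring

/-- For n = 1 the coefficient is real, since det cosh(X/2) is a positive square. It is also the
product of a principal root with nonnegative real part and a Gaussian integral with positive real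
part, hence nonnegative. The principal root of det cosh(X/2) has nonnegative real part too, which
excludes ε = -1. -/
lemma sign_eq_one_of_le_one (hX : (stdJ n * cplx X).IsSymm) (hn : n ≤ 1) {ε : ℂ}
    (hd : (matCosh ((2⁻¹ : ℂ) • cplx X)).det ≠ 0)
    (hε : ε = 1 ∨ ε = -1) (h : ε * powNegHalf (matCosh ((2⁻¹ : ℂ) • cplx X)).det =
      weylCoef (powNegHalf (toS (NormedSpace.exp X)).toBlocks₁₁.det) (toS (NormedSpace.exp X))) :
    ε = 1 := by
  obtain rfl | rfl : n = 0 ∨ n = 1 := by omega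
  · rw [det_isEmpty, det_isEmpty, powNegHalf_one, Subsingleton.elim (toS _) 1, weylCoef_one,
      mul_one] at h
    exact h
  · have hm := dissipative_hamSymbol hX
    have h1 := isExpSp_toS_exp hX 1
    have hd' : (matCos (((1 : ℝ) : ℂ) • (stdJ 1 * hamSymbol X))).det ≠ 0 := by
      rwa [matCos_hamSymbol, ofReal_one, one_smul]
    have h2 := det_kflow_add_one_ne_zero hm.symm hd'
    rw [kflow_hamSymbol] at h2
    rw [one_smul] at h1 h2
    set k := toS (NormedSpace.exp X)
    have h3 := (cpos_weylMat (isExpSp_blocks h1) (by rwa [fromBlocks_toBlocks])).gpos.re_gint_pos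
    set g := gint ((cayleyU 1)ᵀ * weylMat k.toBlocks₁₁ k.toBlocks₁₂ k.toBlocks₂₁ * cayleyU 1)
    obtain ⟨r, hr⟩ := det_matCosh_sq hX
    have h4 : weylCoef (powNegHalf k.toBlocks₁₁.det) k =
        powNegHalf k.toBlocks₁₁.det * (((Real.pi⁻¹ : ℝ) : ℂ) * g) := by
      rw [weylCoef, pow_one, pow_one]
      push_cast
      have hpi : (Real.pi : ℂ) ≠ 0 := by exact_mod_cast Real.pi_ne_zero
      field_simp
      rfl
    have h5 : 0 < (((Real.pi⁻¹ : ℝ) : ℂ) * g).re := by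
      rw [re_ofReal_mul]
      exact mul_pos (inv_pos.2 Real.pi_pos) h3
    have h6 : (weylCoef (powNegHalf k.toBlocks₁₁.det) k) ^ 2 * ((r ^ 2 : ℝ) : ℂ) = 1 := by
      rw [← h, mul_pow, powNegHalf_sq, ← hr, mul_assoc, inv_mul_cancel₀ hd, mul_one]
      rcases hε with rfl | rfl <;> norm_num
    have h7 := im_eq_zero_of_sq_mul h6
    have h8 : 0 ≤ (weylCoef (powNegHalf k.toBlocks₁₁.det) k).re := by
      rw [h4] at h7 ⊢
      exact re_nonneg_of_mul_real (re_powNegHalf_nonneg _) h5 h7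
    refine hε.resolve_right fun h9 => ?_
    rw [h9, neg_one_mul] at h
    rw [← h, neg_re] at h8
    have h10 : (powNegHalf (matCosh ((2⁻¹ : ℂ) • cplx X)).det).re = 0 :=
      le_antisymm (by linarith) (re_powNegHalf_nonneg _)
    rw [← h, neg_im, neg_eq_zero] at h7
    exact powNegHalf_ne_zero hd (Complex.ext h10 h7)

/-- Along [0, 1] the continuous δ remains the principal root. The determinant of cosh is real and
nonvanishing from the value 1, hence positive, so D(1)⁻¹ is principal as well. -/
lemma sign_eq_one_of_slitPlane {D : ℂ → ℂ} {δ : ℝ → ℂ}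
    (hD : IsDetRoot (fun s => matCosh (s • (2⁻¹ : ℂ) • cplx X)) D) (hδ : Continuous δ)
    (h0 : δ 0 = 1) (hs : ∀ t : ℝ, δ t ^ 2 * (toS (NormedSpace.exp (t • X))).toBlocks₁₁.det = 1)
    (hsl : ∀ t : ℝ, 0 ≤ t → t ≤ 1 → (matCosh ((t : ℂ) • (2⁻¹ : ℂ) • cplx X)).det ≠ 0 ∧
      (toS (NormedSpace.exp (t • X))).toBlocks₁₁.det ∈ Complex.slitPlane) :
    powNegHalf (toS (NormedSpace.exp X)).toBlocks₁₁.det / δ 1 * (D 1)⁻¹ =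
      powNegHalf (matCosh ((2⁻¹ : ℂ) • cplx X)).det := by
  have hc : Continuous fun t : ℝ => (toS (NormedSpace.exp (t • X))).toBlocks₁₁.det := by
    simp only [← kflow_hamSymbol]
    exact (continuous_blocks₁₁.comp
      (continuous_kflow_param continuous_const continuous_id)).matrix_det
  have h1 := eq_powNegHalf_of_sq zero_le_one hδ.continuousOn hc.continuousOn (fun t _ => hs t) h0
    (fun t ht => (hsl t ht.1 ht.2).2)
  have h2 : ∀ t : ℝ, t ∈ Set.Icc 0 1 →
      (matCosh ((t : ℂ) • (2⁻¹ : ℂ) • cplx X)).det ∈ slitPlane := by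
    refine mem_slitPlane_of_real
      (f := fun t : ℝ => (matCosh ((t : ℂ) • (2⁻¹ : ℂ) • cplx X)).det) ?_ ?_ ?_ ?_
    · exact (continuous_matCosh.comp
        (continuous_ofReal.smul continuous_const)).matrix_det.continuousOn
    · rw [ofReal_zero, zero_smul, matCosh_zero, det_one]
    · intro t
      refine Complex.conj_eq_iff_im.1 (star_det_matCosh _ ?_)
      ext i j
      simp [cplx, Complex.conj_ofNat]
    · exact fun t ht => (hsl t ht.1 ht.2).1
  have h3 := powNegHalf_eq_inv_detRoot hD h2
  rw [one_smul] at h1 h3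
  rw [← h3, ← h1, div_self, one_mul]
  intro h
  have := hs 1
  rw [h] at this
  simp at this

theorem W1_metaplectic (hX : (stdJ n * cplx X).IsSymm) {D : ℂ → ℂ} {δ : ℝ → ℂ}
    (hD : IsDetRoot (fun s => matCosh (s • (2⁻¹ : ℂ) • cplx X)) D) (hδ : Continuous δ)
    (h0 : δ 0 = 1) (hs : ∀ t : ℝ, δ t ^ 2 * (toS (NormedSpace.exp (t • X))).toBlocks₁₁.det = 1)
    (hd : (matCosh ((2⁻¹ : ℂ) • cplx X)).det ≠ 0) (x y : Fin n → ℝ) :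
    W1 (metaplectic (NormedSpace.exp X)) x y =
      powNegHalf (toS (NormedSpace.exp X)).toBlocks₁₁.det / δ 1 * (D 1)⁻¹ *
        Complex.exp (-Complex.I * qform (stdJ n * matTanh ((2⁻¹ : ℂ) • cplx X)) x y) := by
  have h := dissipative_hamSymbol hX
  have hd' : (matCos (((1 : ℝ) : ℂ) • (stdJ n * hamSymbol X))).det ≠ 0 := by
    rwa [matCos_hamSymbol, ofReal_one, one_smul]
  have h1 := isExpSp_toS_exp hX 1
  have h2 := det_kflow_add_one_ne_zero h.symm hd'
  have h3 := weyl_phase h.symm hd' x y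
  rw [one_smul] at h1
  rw [kflow_hamSymbol, one_smul] at h2 h3
  rw [W1_gaussian h1 h2 (bargmann_metaplectic_coherentS hX),
    weylCoef_metaplectic hX hD hδ h0 hs hd, h3, ofReal_one, one_smul, matTan_hamSymbol,
    Matrix.mul_smul, qform, smul_mulVec, dotProduct_smul, smul_eq_mul, ← neg_mul, qform]

theorem metaplectic_weyl_symbol (hX : X ∈ LieAlgebra.Symplectic.sp (Fin n) ℝ) :
    ∃ (D : ℂ → ℂ) (δ : ℝ → ℂ),
      IsDetRoot (fun s => matCosh (s • (2⁻¹ : ℂ) • cplx X)) D ∧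
      (Continuous δ ∧ δ 0 = 1 ∧
        ∀ t : ℝ, δ t ^ 2 * (toS (NormedSpace.exp (t • X))).toBlocks₁₁.det = 1) ∧
      ((matCosh ((2⁻¹ : ℂ) • cplx X)).det ≠ 0 →
        ∃ ε : ℂ, (ε = 1 ∨ ε = -1) ∧
          ε * powNegHalf (matCosh ((2⁻¹ : ℂ) • cplx X)).det =
            powNegHalf (toS (NormedSpace.exp X)).toBlocks₁₁.det / δ 1 * (D 1)⁻¹ ∧
          (∀ x y : Fin n → ℝ,
            W1 (metaplectic (NormedSpace.exp X)) x y =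
              ε * powNegHalf (matCosh ((2⁻¹ : ℂ) • cplx X)).det *
                Complex.exp (-Complex.I *
                  qform (stdJ n * matTanh ((2⁻¹ : ℂ) • cplx X)) x y)) ∧
          ((n ≤ 1 ∨ ∀ t : ℝ, 0 ≤ t → t ≤ 1 →
              (matCosh ((t : ℂ) • (2⁻¹ : ℂ) • cplx X)).det ≠ 0 ∧
              (toS (NormedSpace.exp (t • X))).toBlocks₁₁.det ∈ Complex.slitPlane) →
            ε = 1)) := by
  have hs := isSymm_stdJ_mul_cplx hX
  obtain ⟨D, hD⟩ := exists_isDetRoot (Y := (2⁻¹ : ℂ) • cplx X)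
    (by rw [Matrix.mul_smul]; exact hs.smul _)
  obtain ⟨δ, hδ, h0, hδs⟩ := exists_metaplectic_root hs
  refine ⟨D, δ, hD, ⟨hδ, h0, hδs⟩, fun hd => ?_⟩
  have hp := powNegHalf_ne_zero hd
  set m := powNegHalf (toS (NormedSpace.exp X)).toBlocks₁₁.det / δ 1 * (D 1)⁻¹ with hm
  have hmul : m / powNegHalf (matCosh ((2⁻¹ : ℂ) • cplx X)).det *
      powNegHalf (matCosh ((2⁻¹ : ℂ) • cplx X)).det = m := div_mul_cancel₀ _ hp
  -- The sign ε is this quotient of two inverse square roots of the same determinant.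
  have hsq : (m / powNegHalf (matCosh ((2⁻¹ : ℂ) • cplx X)).det) ^ 2 = 1 := by
    have h1 := hδs 1
    have h2 := hD.2.2 1
    rw [one_smul] at h1
    simp only [one_smul] at h2
    have h3 := right_ne_zero_of_mul (h1.trans_ne one_ne_zero)
    rw [hm, div_pow, mul_pow, div_pow, powNegHalf_sq, powNegHalf_sq, inv_pow, h2,
      eq_inv_of_mul_eq_one_left h1, div_self (inv_ne_zero h3), one_mul, div_self (inv_ne_zero hd)]
  have hε := mul_self_eq_one_iff.1 ((pow_two _).symm.trans hsq)
  refine ⟨m / powNegHalf (matCosh ((2⁻¹ : ℂ) • cplx X)).det, hε, hmul, fun x y => ?_, ?_⟩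
  · rw [hmul, W1_metaplectic hs hD hδ h0 hδs hd]
  · rintro (hn | hsl)
    · refine sign_eq_one_of_le_one hs hn hd hε ?_
      rw [hmul, weylCoef_metaplectic hs hD hδ h0 hδs hd]
    · rw [hm, sign_eq_one_of_slitPlane hD hδ h0 hδs hsl, div_self hp]

end RealFlow

end Metaplectic

end

theorem mainTheorem7 (n : ℕ) :
    -- the Weyl symbol of `σ'(exp X)`
    (∀ X : Matrix (Idx n) (Idx n) ℝ, X ∈ LieAlgebra.Symplectic.sp (Fin n) ℝ →
      ∃ (D : ℂ → ℂ) (δ : ℝ → ℂ),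
        IsDetRoot (fun s => matCosh (s • (2⁻¹ : ℂ) • cplx X)) D ∧
        (Continuous δ ∧ δ 0 = 1 ∧
          ∀ t : ℝ, δ t ^ 2 * (toS (NormedSpace.exp (t • X))).toBlocks₁₁.det = 1) ∧
        ((matCosh ((2⁻¹ : ℂ) • cplx X)).det ≠ 0 →
          ∃ ε : ℂ, (ε = 1 ∨ ε = -1) ∧
            ε * powNegHalf (matCosh ((2⁻¹ : ℂ) • cplx X)).det =
              powNegHalf (toS (NormedSpace.exp X)).toBlocks₁₁.det / δ 1 * (D 1)⁻¹ ∧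
            (∀ x y : Fin n → ℝ,
              W1 (metaplectic (NormedSpace.exp X)) x y =
                ε * powNegHalf (matCosh ((2⁻¹ : ℂ) • cplx X)).det *
                  Complex.exp (-Complex.I *
                    qform (stdJ n * matTanh ((2⁻¹ : ℂ) • cplx X)) x y)) ∧
            ((n ≤ 1 ∨ ∀ t : ℝ, 0 ≤ t → t ≤ 1 →
                (matCosh ((t : ℂ) • (2⁻¹ : ℂ) • cplx X)).det ≠ 0 ∧
                (toS (NormedSpace.exp (t • X))).toBlocks₁₁.det ∈ Complex.slitPlane) →
              ε = 1))) ∧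
    -- the Weyl symbol of the exponential of an operator with quadratic Weyl symbol
    (∀ M : Matrix (Idx n) (Idx n) ℂ, M.IsSymm →
      (∀ x y : Fin n → ℝ, (qform M x y).re ≤ 0) →
      (∃ T, IsExpWeyl M T) ∧
      ∃ D : ℂ → ℂ, IsDetRoot (fun s => matCos (s • (stdJ n * M))) D ∧
        ∀ T, IsExpWeyl M T → ∀ t : ℝ, 0 ≤ t →
          (matCos ((t : ℂ) • (stdJ n * M))).det ≠ 0 → ∀ x y : Fin n → ℝ,
            W1 (T t) x y = (D t)⁻¹ *
              Complex.exp (-qform (stdJ n * matTan ((t : ℂ) • (stdJ n * M))) x y)) ∧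
    (∀ M : Matrix (Idx n) (Idx n) ℝ, M.IsSymm →
      (∀ x y : Fin n → ℝ, (qform (cplx M) x y).re ≤ 0) →
      (matCos (stdJ n * cplx M)).det ≠ 0 ∧
        ∀ T, IsExpWeyl (cplx M) T → ∀ x y : Fin n → ℝ,
          W1 (T 1) x y = powNegHalf (matCos (stdJ n * cplx M)).det *
            Complex.exp (-qform (stdJ n * matTan (stdJ n * cplx M)) x y)) ∧
    -- the star exponential of `-i q_M`
    (∀ M : Matrix (Idx n) (Idx n) ℝ, M.IsSymm →
      (∃ D : ℂ → ℂ, IsDetRoot (fun s => matCosh (s • (stdJ n * cplx M))) D ∧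
        IsConnected {s : ℂ | (matCosh (s • (stdJ n * cplx M))).det ≠ 0} ∧
        ∀ x y : Fin n → ℝ,
          AnalyticOnNhd ℂ
            (fun s : ℂ => (D s)⁻¹ * Complex.exp (Complex.I *
              qform (stdJ n * matTanh (s • (stdJ n * cplx M))) x y))
            {s : ℂ | (matCosh (s • (stdJ n * cplx M))).det ≠ 0} ∧
          ∀ l : ℕ,
            iteratedDeriv l
              (fun s : ℂ => (D s)⁻¹ * Complex.exp (Complex.I *
                qform (stdJ n * matTanh (s • (stdJ n * cplx M))) x y)) 0 =
              MvPolynomial.eval (phaseVec x y)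
                (starPow (MvPolynomial.C (-Complex.I) * quadPoly (cplx M)) l)) ∧
      ((∀ s : ℂ, ‖s‖ ≤ 1 → (matCosh (s • (stdJ n * cplx M))).det ≠ 0) →
        ∀ x y : Fin n → ℝ,
          HasSum
            (fun l : ℕ => ((Nat.factorial l : ℂ))⁻¹ * MvPolynomial.eval (phaseVec x y)
              (starPow (MvPolynomial.C (-Complex.I) * quadPoly (cplx M)) l))
            (powNegHalf (matCosh (stdJ n * cplx M)).det *
              Complex.exp (Complex.I *
                qform (stdJ n * matTanh (stdJ n * cplx M)) x y)))) := by
  refine ⟨fun X hX => metaplectic_weyl_symbol hX, fun M hM hq => ?_, fun M hM hq => ?_,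
    fun M hM => ⟨starExponential_continuation hM, hasSum_starExponential hM⟩⟩
  · obtain ⟨D, hD⟩ := exists_isDetRoot_matCos hM
    have h : Dissipative M := ⟨hM, hq⟩
    exact ⟨⟨weylExp h, isExpWeyl_weylExp h⟩, D, hD,
      fun T hT t ht hd x y => hT.W1_eq h hD ht hd x y⟩
  · have h : Dissipative (cplx M) := ⟨cplx_isSymm hM, hq⟩
    obtain ⟨D, hD⟩ := exists_isDetRoot_matCos h.symm
    -- For real M the determinant of cos(tJM) is positive at every real t, so it does not vanish at
    -- t = 1 and D(1)⁻¹ is the principal root.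
    have h1 := slitPlane_ne_zero (det_matCos_mem_slitPlane hM hq 1)
    have h2 := powNegHalf_eq_inv_detRoot hD fun t _ => det_matCos_mem_slitPlane hM hq t
    rw [one_smul] at h2
    refine ⟨by rwa [ofReal_one, one_smul] at h1, fun T hT x y => ?_⟩
    rw [hT.W1_eq h hD zero_le_one h1, h2, ofReal_one, one_smul]
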